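/- Let $\mathbb T^2=\mathbb R^2/\mathbb Z^2$, $T>0$, and let $G$ be the mean-zero Green function of $-\Delta$ on $\mathbb T^2$ (so $-\Delta G=\delta_0-1$) and $K=\nabla^\perp G=(\partial_2G,-\partial_1G)$ the Biot–Savart kernel. Let $\omega\in L^\infty([0,T],L^p(\mathbb T^2))$ be real-valued, with $4/3<p<\infty$, let $u=K*\omega$ (convolution in space), and suppose that $\omega,u$ are a weak solution of the 2D Euler equations in the vorticity–velocity formulation, i.e. $\partial_t\omega+\nabla\cdot(u\,\omega)=0$ in the sense of distributions on $(0,T)\times\mathbb T^2$. For real $r$ let $$\mathcal H_r=\{h\in C^1(\mathbb R):\ |h'(s)|\le C(1+|s|^{r-1})\ \text{for all } s,\ \text{for some } C>0\}.$$ A mollifier is a nonnegative, compactly supported $\varphi\in C^\infty(\mathbb R^2)$ with $\int\varphi=1$; put $\varphi_\varepsilon(x)=\varepsilon^{-2}\varphi(x/\varepsilon)$, $f_\varepsilon=\varphi_\varepsilon*f$ (in space), and $\sigma_\varepsilon=(u\,\omega)_\varepsilon-u_\varepsilon\,\omega_\varepsilon$. (1) Let $r=\tfrac32p-1$ if $4/3<p<2$,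 let $r<p$ be arbitrary if $p=2$, and let $r=p$ if $p>2$. Then for every $h\in\mathcal H_r\cap C^2(\mathbb R)$ the functions $h(\omega)$ and $u\,h(\omega)$ are integrable on $(0,T)\times\mathbb T^2$, and there is a distribution $Z_h(\omega)$ on $(0,T)\times\mathbb T^2$ such that, for every mollifier $\varphi$, $$Z_h(\omega)=\lim_{\varepsilon\to0^+}\bigl(-h''(\omega_\varepsilon)\,\nabla\omega_\varepsilon\cdot\sigma_\varepsilon\bigr)\quad\text{in the sense of distributions}$$ (so the limit exists and does not depend on $\varphi$), and $$\partial_t h(\omega)+\nabla\cdot[u\,h(\omega)]=-Z_h(\omega)$$ in the sense of distributions. (2) If $p>2$ and $h(s)=\tfrac12s^2$, then for every mollifier $\varphi$ that is moreover even, $\varphi(-x)=\varphi(x)$, one has also, in the sense of distributions, $$Z_h(\omega)=\lim_{\varepsilon\to0^+}\frac14\int_{\mathbb R^2}\nabla\varphi_\varepsilon(\ell)\cdot\Delta_\ell u\,|\Delta_\ell\omega|^2\,d\ell,$$ where $\Delta_\ell f(x,t)=f(x+\ell,t)-f(x,t)$; here, for every $\varepsilon>0$, the integral over $\ell$ converges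 absolutely for almost every $(x,t)$ and is an integrable function of $(x,t)$ on $(0,T)\times\mathbb T^2$. -/

import Mathlib

open MeasureTheory Set Filter Topology
open scoped NNReal

namespace TorusEuler

noncomputable section

/-- The Euclidean plane. Functions on the torus `𝕋² = ℝ² / ℤ²` are represented by
`ℤ²`-periodic functions on the plane. -/
abbrev Plane : Type := EuclideanSpace ℝ (Fin 2)

/-- `f` is `ℤ²`-periodic, i.e. a function on the torus. -/
def Periodic2 {F : Type*} (f : Plane → F) : Prop :=
  ∀ (i : Fin 2) (x : Plane), f (x + EuclideanSpace.single i (1 : ℝ)) = f x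

/-- The fundamental cell `[0,1)²`. Integration over the torus is integration over the cell. -/
def cell : Set Plane := {x | ∀ i, x i ∈ Ico (0 : ℝ) 1}

/-- Lebesgue measure on the torus. -/
def torusMeasure : Measure Plane := volume.restrict cell

/-- Lebesgue measure on the space-time domain `(0,T) × 𝕋²`. -/
def spaceTime (T : ℝ) : Measure (ℝ × Plane) := volume.restrict (Ioo 0 T ×ˢ cell)

/-! ### The Biot–Savart law -/

/-- The heat kernel of the torus at time `s > 0`:
`∑_{k ∈ ℤ²} exp (-4 π² |k|² s) cos (2 π k ⬝ x)`. -/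
def heatKernel (s : ℝ) (x : Plane) : ℝ :=
  ∑' k : ℤ × ℤ, Real.exp (-(4 * Real.pi ^ 2 * ((k.1 : ℝ) ^ 2 + (k.2 : ℝ) ^ 2) * s)) *
    Real.cos (2 * Real.pi * ((k.1 : ℝ) * x 0 + (k.2 : ℝ) * x 1))

/-- The Green function of `-Δ` on the torus, with mean zero: the time integral of the heat kernel
minus its mean, so that `-ΔG = δ₀ - 1` and the Fourier coefficients of `G` are
`1 / (4 π² |k|²)` for `k ≠ 0`. It is smooth away from the lattice `ℤ²`. -/
def green (x : Plane) : ℝ := ∫ s in Ioi (0 : ℝ), (heatKernel s x - 1)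

/-- The Biot–Savart kernel `K = ∇^⊥ G = (∂₂ G, -∂₁ G)`. -/
def biotSavartKernel (x : Plane) : Plane := !₂[gradient green x 1, -(gradient green x 0)]

/-- The velocity `K * f`, a convolution on the torus. -/
def velocity (f : Plane → ℝ) (x : Plane) : Plane :=
  ∫ y, f (x - y) • biotSavartKernel y ∂torusMeasure

/-! ### Function spaces -/

/-- `ω ∈ L^∞([0,T], L^p(𝕋²))`. -/
structure MemLinftyLp (T p : ℝ) (ω : ℝ → Plane → ℝ) : Prop where
  periodic : ∀ t, Periodic2 (ω t)
  measurable : AEStronglyMeasurable (fun z : ℝ × Plane => ω z.1 z.2) (spaceTime T)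
  bounded : ∃ M : ℝ≥0, ∀ᵐ t ∂(volume.restrict (Ioo 0 T)),
    eLpNorm (ω t) (ENNReal.ofReal p) torusMeasure ≤ M

/-- The class `𝓗_r` of `C¹` functions `h` with `|h'(s)| ≤ C (1 + |s|^(r-1))`. -/
def GrowthClass (r : ℝ) : Set (ℝ → ℝ) :=
  {h | ContDiff ℝ 1 h ∧ ∃ C > 0, ∀ s, |deriv h s| ≤ C * (1 + |s| ^ (r - 1))}

/-- The relation between the integrability exponent `p` and the growth exponent `r`. -/
def AdmissibleGrowth (p r : ℝ) : Prop :=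
  (4 / 3 < p ∧ p < 2 ∧ r = 3 / 2 * p - 1) ∨ (p = 2 ∧ r < p) ∨ (2 < p ∧ r = p)

/-! ### Distributions on `(0,T) × 𝕋²` -/

/-- Smooth test functions on `(0,T) × 𝕋²`, with compact support in `(0,T)` in time. -/
structure IsTest (T : ℝ) (ψ : ℝ × Plane → ℝ) : Prop where
  smooth : ContDiff ℝ (⊤ : ℕ∞) ψ
  periodic : ∀ t, Periodic2 (fun x => ψ (t, x))
  support : ∃ a b, 0 < a ∧ b < T ∧ ∀ t x, t ∉ Icc a b → ψ (t, x) = 0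

/-- `Z` is a distribution on `(0,T) × 𝕋²`: a linear functional on test functions which, on test
functions supported in a fixed compact subinterval of `(0,T)`, is bounded by finitely many
derivatives. (Values of `Z` outside the space of test functions are irrelevant.) -/
structure IsDistribution (T : ℝ) (Z : (ℝ × Plane → ℝ) → ℝ) : Prop where
  linear : ∀ ψ₁ ψ₂, IsTest T ψ₁ → IsTest T ψ₂ → ∀ c₁ c₂ : ℝ,
    Z (fun z => c₁ * ψ₁ z + c₂ * ψ₂ z) = c₁ * Z ψ₁ + c₂ * Z ψ₂
  continuous : ∀ a b, 0 < a → b < T → ∃ (N : ℕ) (C : ℝ), ∀ ψ, IsTest T ψ →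
    (∀ t x, t ∉ Icc a b → ψ (t, x) = 0) →
    ∀ M : ℝ, (∀ n ≤ N, ∀ z, ‖iteratedFDeriv ℝ n ψ z‖ ≤ M) → |Z ψ| ≤ C * M

/-- The integrable functions `F ε` on `(0,T) × 𝕋²` converge to `Z` in the sense of distributions
as `ε → 0+`. -/
def DistribTendsto (T : ℝ) (F : ℝ → ℝ × Plane → ℝ) (Z : (ℝ × Plane → ℝ) → ℝ) : Prop :=
  (∀ ε > 0, Integrable (F ε) (spaceTime T)) ∧
    ∀ ψ, IsTest T ψ →
      Tendsto (fun ε => ∫ z, F ε z * ψ z ∂(spaceTime T)) (𝓝[>] 0) (𝓝 (Z ψ))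

/-- The pairing `⟨∂_t g + ∇ ⬝ w, ψ⟩` of the distribution `∂_t g + ∇ ⬝ w` with the test
function `ψ`, all derivatives being moved onto `ψ`. -/
def balancePairing (T : ℝ) (g : ℝ → Plane → ℝ) (w : ℝ → Plane → Plane) (ψ : ℝ × Plane → ℝ) : ℝ :=
  -∫ z, (g z.1 z.2 * deriv (fun s => ψ (s, z.2)) z.1 +
      inner ℝ (w z.1 z.2) (gradient (fun y => ψ (z.1, y)) z.2)) ∂(spaceTime T)

/-- `ω`, with the velocity `u = K * ω`, is a weak solution of the 2D Euler equations in the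
vorticity-velocity formulation: `∂_t ω + ∇ ⬝ (u ω) = 0` in the sense of distributions. -/
def IsWeakEuler (T : ℝ) (ω : ℝ → Plane → ℝ) : Prop :=
  ∀ ψ, IsTest T ψ → balancePairing T ω (fun t x => ω t x • velocity (ω t) x) ψ = 0

/-- `∂_t h(ω) + ∇ ⬝ [u h(ω)] = -Z` in the sense of distributions, where `u = K * ω` and where
`h(ω)` and `u h(ω)` are integrable, so that they are distributions. -/
def LocalBalance (T : ℝ) (ω : ℝ → Plane → ℝ) (h : ℝ → ℝ) (Z : (ℝ × Plane → ℝ) → ℝ) : Prop :=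
  Integrable (fun z : ℝ × Plane => h (ω z.1 z.2)) (spaceTime T) ∧
  Integrable (fun z : ℝ × Plane => h (ω z.1 z.2) • velocity (ω z.1) z.2) (spaceTime T) ∧
  ∀ ψ, IsTest T ψ →
    balancePairing T (fun t x => h (ω t x)) (fun t x => h (ω t x) • velocity (ω t) x) ψ = -Z ψ

/-! ### Mollification and the defect -/

/-- A mollifier: smooth, nonnegative, compactly supported in the plane, with unit integral. -/
structure IsMollifier (φ : Plane → ℝ) : Prop where
  smooth : ContDiff ℝ (⊤ : ℕ∞) φ
  nonneg : ∀ x, 0 ≤ φ x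
  compact : HasCompactSupport φ
  integral_eq_one : ∫ x, φ x = 1

/-- `φ_ε(x) = ε⁻² φ(x / ε)`. -/
def rescale (φ : Plane → ℝ) (ε : ℝ) (x : Plane) : ℝ := ε⁻¹ ^ 2 * φ (ε⁻¹ • x)

/-- `f_ε = φ_ε * f`, for a function `f` on the torus. -/
def mollify {F : Type*} [NormedAddCommGroup F] [NormedSpace ℝ F]
    (φ : Plane → ℝ) (ε : ℝ) (f : Plane → F) (x : Plane) : F :=
  ∫ y, rescale φ ε y • f (x - y)

/-- The turbulent transport `σ_ε = (u f)_ε - u_ε f_ε`, where `u = K * f`. -/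
def turbulentTransport (φ : Plane → ℝ) (ε : ℝ) (f : Plane → ℝ) (x : Plane) : Plane :=
  mollify φ ε (fun y => f y • velocity f y) x - mollify φ ε f x • mollify φ ε (velocity f) x

/-- The flux `-h''(ω_ε) ∇ω_ε ⬝ σ_ε` at the point `z = (t, x)`. -/
def flux (h : ℝ → ℝ) (ω : ℝ → Plane → ℝ) (φ : Plane → ℝ) (ε : ℝ) (z : ℝ × Plane) : ℝ :=
  -(deriv (deriv h) (mollify φ ε (ω z.1) z.2) *
    inner ℝ (gradient (mollify φ ε (ω z.1)) z.2) (turbulentTransport φ ε (ω z.1) z.2))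

/-- `Z` is the defect `Z_h(ω)`: for every choice of the mollifier `φ`, the distributional limit of
`-h''(ω_ε) ∇ω_ε ⬝ σ_ε` as `ε → 0+` is `Z`. -/
def IsDefect (T : ℝ) (ω : ℝ → Plane → ℝ) (h : ℝ → ℝ) (Z : (ℝ × Plane → ℝ) → ℝ) : Prop :=
  IsDistribution T Z ∧ ∀ φ, IsMollifier φ → DistribTendsto T (flux h ω φ) Z

/-- The integrand `∇φ_ε(ℓ) ⬝ Δ_ℓ u |Δ_ℓ ω|²` at the point `z = (t, x)`, where `u = K * ω` and
`Δ_ℓ f(x) = f(x + ℓ) - f(x)`. -/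
def incrementIntegrand (ω : ℝ → Plane → ℝ) (φ : Plane → ℝ) (ε : ℝ) (z : ℝ × Plane) (l : Plane) :
    ℝ :=
  inner ℝ (gradient (rescale φ ε) l) (velocity (ω z.1) (z.2 + l) - velocity (ω z.1) z.2) *
    |ω z.1 (z.2 + l) - ω z.1 z.2| ^ 2

/-- `(1/4) ∫ ∇φ_ε(ℓ) ⬝ Δ_ℓ u |Δ_ℓ ω|² dℓ` at the point `z = (t, x)`. -/
def incrementFlux (ω : ℝ → Plane → ℝ) (φ : Plane → ℝ) (ε : ℝ) (z : ℝ × Plane) : ℝ :=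
  1 / 4 * ∫ l, incrementIntegrand ω φ ε z l

end

end TorusEuler

open scoped Pointwise

namespace TorusEuler

/-! Mollification in space produces a vorticity ω_ε which, at each point, agrees at almost every
time with a Lipschitz function of time, and ∂_t ω_ε + ∇·(uω)_ε = 0. Since u_ε is divergence free,
the chain rule gives ∂_t h(ω_ε) + ∇·(u_ε h(ω_ε)) + ∇·(h'(ω_ε) σ_ε) = h''(ω_ε) ∇ω_ε·σ_ε. After all
derivatives are moved onto the test function, the flux is controlled by three quantities without
derivatives. It suffices that, in L¹ of space-time, h(ω_ε) → h(ω), h(ω_ε) u_ε → h(ω) u and h'(ω_ε)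
σ_ε → 0. The limit does not see the mollifier, so `defect` is defined outright as -(∂_t h(ω) + ∇·(u
h(ω))). The balance then holds by definition, and the content is the convergence, in
`BoundedVorticity.integral_kernelFlux_mul` and `BoundedVorticity.tendsto_integral_smoothPairing`.

All L¹ bounds come from one trilinear estimate, `VelocityBound`: (1 + |F|)^m |A| (|K| * |g|) is
integrable when F, A, g are in L^p. For p < 2 the Hardy-Littlewood-Sobolev inequality puts |K| * |g|
in L^q with 1/q = 1/p - 1/2, and Hölder's inequality closes exactly for m = 3p/2 - 2 = r - 1, which
is nonnegative since p > 4/3. For p > 2 the velocity is bounded, and m = p - 1 is allowed. For p = 2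
one descends to an exponent slightly below 2. Linearity of K * in its argument turns the estimate
into a Lipschitz bound, so every error is at most a constant times the L^p modulus of translations
of ω(t), which tends to 0 for each t and is bounded in t.

The kernel enters through two facts: |K(x)| ≤ C/|x| near the origin, which places K in weak L², and
∇·K = 0. Both are proved at the level of the heat kernel, which factors into two theta functions.
Fourier series control large times, and the functional equation of the Hurwitz kernels (Poisson
summation) controls small ones. The resulting majorant 1/(√s (s + |x|²)) integrates over s to π/|x|.

For the increment formula with p > 2, write Φ for the periodized even mollifier. Expanding the cubic
increment leaves -∇·(Φ * (ω²u)) + u·∇(Φ * ω²) + 2ω (∇·(Φ * (uω)) - u·∇(Φ * ω)). Tested against ψ,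
the first two terms cancel in the limit. The commutator is computed by point splitting: the equation
is tested with ψ times Φ * ω, first with both factors mollified and then with one mollification
removed (`integral_mul_commutator`). It equals the integral of (∂_tψ + u·∇ψ) ω (Φ * ω), whose limit,
with the factor 2/4 = 1/2, is the defect of s²/2.

The hypotheses bound ω only for almost every time and up to null sets;
`MemLinftyLp.exists_boundedVorticity` supplies a Borel representative that is bounded in L^p at
every time. -/

noncomputable section

/-! ### Periodic functions and integration over the fundamental cell. -/

/-- The standard basis of the plane. -/
noncomputable def stdBasis : Module.Basis (Fin 2) ℝ Plane := (EuclideanSpace.basisFun (Fin 2) ℝ).toBasis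

/-- The lattice of periods `ℤ²`. -/
abbrev lattice : AddSubgroup Plane := (Submodule.span ℤ (Set.range stdBasis)).toAddSubgroup

instance : Countable lattice :=
  inferInstanceAs (Countable (Submodule.span ℤ (Set.range stdBasis)))

theorem stdBasis_apply (i : Fin 2) : stdBasis i = EuclideanSpace.single i (1 : ℝ) := by
  simp [stdBasis]

theorem cell_eq_fundamentalDomain : cell = ZSpan.fundamentalDomain stdBasis := by
  ext x
  simp [cell, ZSpan.mem_fundamentalDomain, stdBasis]

theorem isAddFundamentalDomain_cell : IsAddFundamentalDomain lattice cell (volume : Measure Plane) := by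
  rw [cell_eq_fundamentalDomain]
  exact ZSpan.isAddFundamentalDomain' stdBasis volume

theorem measurableSet_cell : MeasurableSet cell := by
  rw [cell_eq_fundamentalDomain]
  exact ZSpan.fundamentalDomain_measurableSet stdBasis

theorem volume_cell : volume cell = 1 := by
  have h : cell = (MeasurableEquiv.toLp 2 (Fin 2 → ℝ)).symm ⁻¹' (Set.univ.pi fun _ => Ico (0 : ℝ) 1) := by
    ext x
    simp [cell]
  rw [h, (EuclideanSpace.volume_preserving_symm_measurableEquiv_toLp (Fin 2)).measure_preimage_equiv]
  simp [Real.volume_pi_Ico]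

instance : IsProbabilityMeasure torusMeasure :=
  ⟨by simp [torusMeasure, volume_cell]⟩

namespace Periodic2

variable {F : Type*} {f : Plane → F}

theorem add_mem (hf : Periodic2 f) {v : Plane} (hv : v ∈ lattice) (x : Plane) : f (x + v) = f x := by
  rw [Submodule.mem_toAddSubgroup] at hv
  induction hv using Submodule.span_induction generalizing x with
  | mem v hv =>
    obtain ⟨i, rfl⟩ := hv
    rw [stdBasis_apply]
    exact hf i x
  | zero => simp
  | add a b _ _ ha hb => rw [← add_assoc, hb, ha]
  | smul n a _ ha =>
    induction n using Int.induction_on with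
    | zero => simp
    | succ n ih => rw [add_smul, one_smul, ← add_assoc, ha, ih]
    | pred n ih => rw [← ih, ← ha (x + (-(n : ℤ) - 1) • a), add_assoc, sub_smul, one_smul]; simp

theorem vadd (hf : Periodic2 f) (v : lattice) (x : Plane) : f (v +ᵥ x) = f x := by
  rw [AddSubgroup.vadd_def, vadd_eq_add, add_comm]
  exact hf.add_mem v.2 x

theorem comp_add (hf : Periodic2 f) (a : Plane) : Periodic2 fun x => f (x + a) := fun i x => by
  simp only [add_right_comm x, hf i]

theorem comp_sub (hf : Periodic2 f) (a : Plane) : Periodic2 fun x => f (x - a) := by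
  simpa [sub_eq_add_neg] using hf.comp_add (-a)

theorem comp_neg (hf : Periodic2 f) : Periodic2 fun x => f (-x) := fun i x => by
  simp only
  rw [← hf i, neg_add]; simp

theorem comp_sub_left (hf : Periodic2 f) (a : Plane) : Periodic2 fun x => f (a - x) := by
  have := (hf.comp_add a).comp_neg
  simpa [neg_add_eq_sub] using this

theorem comp {G : Type*} (hf : Periodic2 f) (g : F → G) : Periodic2 fun x => g (f x) :=
  fun i x => by simp only [hf i x]

theorem comp₂ {G H : Type*} {g : Plane → G} (hf : Periodic2 f) (hg : Periodic2 g) (k : F → G → H) :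
    Periodic2 fun x => k (f x) (g x) := fun i x => by simp only [hf i x, hg i x]

end Periodic2

/-- A change of variables moves the cell, and a periodic function has the same integral over any two
fundamental domains. This and the reflected cell below give the invariance of torus integrals under
translation and reflection. -/
theorem isAddFundamentalDomain_vadd_cell (a : Plane) :
    IsAddFundamentalDomain lattice (a +ᵥ cell) (volume : Measure Plane) :=
  isAddFundamentalDomain_cell.vadd_of_comm a

theorem image_add_right_cell (a : Plane) : (fun x => x + a) '' cell = a +ᵥ cell := by
  simp only [add_comm, Set.image_vadd.symm, vadd_eq_add]

theorem isAddFundamentalDomain_neg_cell :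
    IsAddFundamentalDomain lattice (-cell) (volume : Measure Plane) := by
  refine isAddFundamentalDomain_cell.preimage_of_equiv (f := fun x => -x)
    (Measure.measurePreserving_neg volume).quasiMeasurePreserving (e := fun v => -v)
    (Equiv.neg _).bijective fun v x => ?_
  simp [AddSubgroup.vadd_def, add_comm]

theorem lintegral_torus_add {f : Plane → ENNReal} (hf : Periodic2 f) (a : Plane) :
    ∫⁻ x, f (x + a) ∂torusMeasure = ∫⁻ x, f x ∂torusMeasure := by
  rw [torusMeasure, isAddFundamentalDomain_cell.setLIntegral_eq (isAddFundamentalDomain_vadd_cell a) f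
    hf.vadd]
  have h := (measurePreserving_add_right volume a).setLIntegral_comp_emb
    (measurableEmbedding_addRight a) f cell
  rw [h]
  rw [image_add_right_cell]

theorem lintegral_torus_neg {f : Plane → ENNReal} (hf : Periodic2 f) :
    ∫⁻ x, f (-x) ∂torusMeasure = ∫⁻ x, f x ∂torusMeasure := by
  rw [torusMeasure, isAddFundamentalDomain_cell.setLIntegral_eq isAddFundamentalDomain_neg_cell f
    hf.vadd]
  have h := (Measure.measurePreserving_neg (volume : Measure Plane)).setLIntegral_comp_emb
    (MeasurableEquiv.neg Plane).measurableEmbedding f cell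
  rw [h]
  congr 2
  ext x
  simp

theorem lintegral_torus_sub_left {f : Plane → ENNReal} (hf : Periodic2 f) (a : Plane) :
    ∫⁻ x, f (a - x) ∂torusMeasure = ∫⁻ x, f x ∂torusMeasure := by
  rw [← lintegral_torus_add hf a, ← lintegral_torus_neg (hf.comp_add a)]
  simp only [neg_add_eq_sub]

theorem lintegral_torus_sub {f : Plane → ENNReal} (hf : Periodic2 f) (a : Plane) :
    ∫⁻ x, f (x - a) ∂torusMeasure = ∫⁻ x, f x ∂torusMeasure := by
  simpa [sub_eq_add_neg] using lintegral_torus_add hf (-a)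

section integral

variable {E : Type*} [NormedAddCommGroup E]

theorem integrable_torus_add_iff {f : Plane → E} (hf : Periodic2 f) (a : Plane) :
    Integrable (fun x => f (x + a)) torusMeasure ↔ Integrable f torusMeasure := by
  have h1 := isAddFundamentalDomain_cell.integrableOn_iff (isAddFundamentalDomain_vadd_cell a)
    hf.vadd
  have h := (measurePreserving_add_right volume a).integrableOn_image
    (measurableEmbedding_addRight a) (f := f) (s := cell)
  rw [← image_add_right_cell, h] at h1
  exact h1.symm

theorem integrable_torus_neg_iff {f : Plane → E} (hf : Periodic2 f) :
    Integrable (fun x => f (-x)) torusMeasure ↔ Integrable f torusMeasure := by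
  have h1 := isAddFundamentalDomain_cell.integrableOn_iff isAddFundamentalDomain_neg_cell
    hf.vadd
  have h := (Measure.measurePreserving_neg (volume : Measure Plane)).integrableOn_image
    (MeasurableEquiv.neg Plane).measurableEmbedding (f := f) (s := cell)
  have h2 : -cell = (fun x => -x) '' cell := by
    ext x
    simp
  rw [h2, h] at h1
  exact h1.symm

theorem integrable_torus_sub_left_iff {f : Plane → E} (hf : Periodic2 f) (a : Plane) :
    Integrable (fun x => f (a - x)) torusMeasure ↔ Integrable f torusMeasure := by
  rw [← integrable_torus_add_iff hf a, ← integrable_torus_neg_iff (hf.comp_add a)]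
  simp only [neg_add_eq_sub]

theorem integrable_torus_sub_iff {f : Plane → E} (hf : Periodic2 f) (a : Plane) :
    Integrable (fun x => f (x - a)) torusMeasure ↔ Integrable f torusMeasure := by
  simpa [sub_eq_add_neg] using integrable_torus_add_iff hf (-a)

variable [NormedSpace ℝ E]

theorem integral_torus_add {f : Plane → E} (hf : Periodic2 f) (a : Plane) :
    ∫ x, f (x + a) ∂torusMeasure = ∫ x, f x ∂torusMeasure := by
  rw [torusMeasure, isAddFundamentalDomain_cell.setIntegral_eq (isAddFundamentalDomain_vadd_cell a)
    hf.vadd]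
  have h := (measurePreserving_add_right volume a).setIntegral_image_emb
    (measurableEmbedding_addRight a) f cell
  rw [← h]
  rw [image_add_right_cell]

theorem integral_torus_neg {f : Plane → E} (hf : Periodic2 f) :
    ∫ x, f (-x) ∂torusMeasure = ∫ x, f x ∂torusMeasure := by
  rw [torusMeasure, isAddFundamentalDomain_cell.setIntegral_eq isAddFundamentalDomain_neg_cell
    hf.vadd]
  have h := (Measure.measurePreserving_neg (volume : Measure Plane)).setIntegral_image_emb
    (MeasurableEquiv.neg Plane).measurableEmbedding f cell
  rw [← h]
  congr 2
  ext x
  simp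

theorem integral_torus_sub_left {f : Plane → E} (hf : Periodic2 f) (a : Plane) :
    ∫ x, f (a - x) ∂torusMeasure = ∫ x, f x ∂torusMeasure := by
  rw [← integral_torus_add hf a, ← integral_torus_neg (hf.comp_add a)]
  simp only [neg_add_eq_sub]

theorem integral_torus_sub {f : Plane → E} (hf : Periodic2 f) (a : Plane) :
    ∫ x, f (x - a) ∂torusMeasure = ∫ x, f x ∂torusMeasure := by
  simpa [sub_eq_add_neg] using integral_torus_add hf (-a)

end integral

/-- A property of periodic nature that holds almost everywhere on the torus holds almost everywhere
on the plane. -/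
theorem ae_plane_of_ae_torus {P : Plane → Prop} (hP : Periodic2 P)
    (h : ∀ᵐ x ∂torusMeasure, P x) : ∀ᵐ x, P x := by
  have h0 : volume ({x | ¬ P x} ∩ cell) = 0 := by
    have := h
    rw [ae_iff, torusMeasure, Measure.restrict_apply' measurableSet_cell] at this
    exact this
  rw [ae_iff]
  refine isAddFundamentalDomain_cell.measure_zero_of_invariant _ (fun g => ?_) h0
  ext x
  rw [Set.mem_vadd_set_iff_neg_vadd_mem]
  have := hP.vadd (-g) x
  simp only [mem_ofPred_eq, this]

theorem ae_torus_of_ae_plane {P : Plane → Prop} (h : ∀ᵐ x, P x) : ∀ᵐ x ∂torusMeasure, P x :=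
  ae_restrict_of_ae h

/-! ### Weak derivatives in time and their Lipschitz representatives. -/

/-- Smooth functions of time with compact support in `(0,T)`. -/
structure IsTimeTest (T : ℝ) (χ : ℝ → ℝ) : Prop where
  smooth : ContDiff ℝ (⊤ : ℕ∞) χ
  support : ∃ a b, 0 < a ∧ b < T ∧ ∀ t, t ∉ Icc a b → χ t = 0

/-- The derivative of `a` on `(0,T)` is `-b` in the sense of distributions. -/
def HasNegWeakDeriv (T : ℝ) (a b : ℝ → ℝ) : Prop :=
  ∀ χ, IsTimeTest T χ → ∫ t in Ioo 0 T, deriv χ t * a t = ∫ t in Ioo 0 T, χ t * b t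

theorem IsTimeTest.hasCompactSupport {T : ℝ} {χ : ℝ → ℝ} (hχ : IsTimeTest T χ) :
    HasCompactSupport χ := by
  obtain ⟨a, b, -, -, h⟩ := hχ.support
  exact HasCompactSupport.intro isCompact_Icc (fun t ht => h t ht)

theorem IsTimeTest.apply_zero {T : ℝ} {χ : ℝ → ℝ} (hχ : IsTimeTest T χ) : χ 0 = 0 := by
  obtain ⟨a, b, ha, -, h⟩ := hχ.support
  exact h 0 fun h => by linarith [h.1]

theorem IsTimeTest.apply_right {T : ℝ} {χ : ℝ → ℝ} (hχ : IsTimeTest T χ) : χ T = 0 := by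
  obtain ⟨a, b, -, hb, h⟩ := hχ.support
  exact h T fun h => by linarith [h.2]

/-- The fundamental theorem of calculus for an absolutely continuous function that vanishes at the
end points. -/
theorem setIntegral_eq_zero_of_absolutelyContinuous {T : ℝ} (hT : 0 < T) {G g : ℝ → ℝ}
    (hG : AbsolutelyContinuousOnInterval G 0 T) (h0 : G 0 = 0) (h1 : G T = 0)
    (hg : ∀ᵐ t, t ∈ Ioo 0 T → HasDerivAt G (g t) t) : ∫ t in Ioo 0 T, g t = 0 := by
  have h := hG.integral_deriv_eq_sub
  rw [intervalIntegral.integral_of_le hT.le, integral_Ioc_eq_integral_Ioo, h0, h1, sub_zero] at h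
  refine Eq.trans ?_ h
  refine setIntegral_congr_ae (measurableSet_Ioo : MeasurableSet (Ioo 0 T)) ?_
  filter_upwards [hg] with t ht htm
  exact (ht htm).deriv.symm

theorem locallyIntegrable_of_abs_le {b : ℝ → ℝ} {B : ℝ} (hbm : Measurable b) (hb : ∀ t, |b t| ≤ B) :
    LocallyIntegrable b volume :=
  (memLp_top_of_bound hbm.aestronglyMeasurable B (ae_of_all _ hb)).locallyIntegrable le_top

theorem lipschitzWith_primitive {b : ℝ → ℝ} {B : ℝ≥0} (hbm : Measurable b) (hb : ∀ t, |b t| ≤ B) :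
    LipschitzWith B fun t => ∫ s in (0 : ℝ)..t, b s := by
  have hi := fun x y => (intervalIntegrable_iff.2 (((locallyIntegrable_of_abs_le hbm hb).integrableOn_isCompact
      (isCompact_uIcc (a := x) (b := y))).mono_set uIoc_subset_uIcc))
  refine LipschitzWith.of_dist_le_mul fun x y => ?_
  rw [Real.dist_eq, Real.dist_eq, intervalIntegral.integral_interval_sub_left (hi _ _) (hi _ _)]
  exact intervalIntegral.norm_integral_le_of_norm_le_const (f := b) fun s _ => hb s

theorem IsTimeTest.exists_integral_one {T : ℝ} (hT : 0 < T) :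
    ∃ χ, IsTimeTest T χ ∧ ∫ t in Ioo 0 T, χ t = 1 := by
  let f : ContDiffBump (T / 2) := ⟨T / 8, T / 4, by positivity, by linarith⟩
  refine ⟨f.normed volume, ⟨f.contDiff_normed, T / 4, 3 / 4 * T, by positivity, by linarith,
    fun t ht => ?_⟩, ?_⟩
  · rw [← Function.notMem_support, f.support_normed_eq]
    contrapose! ht
    have : f.rOut = T / 4 := rfl
    rw [this, Real.ball_eq_Ioo] at ht
    exact ⟨by linarith [ht.1], by linarith [ht.2]⟩
  · rw [setIntegral_eq_integral_of_forall_compl_eq_zero, f.integral_normed]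
    intro t ht
    rw [← Function.notMem_support, f.support_normed_eq]
    contrapose! ht
    have : f.rOut = T / 4 := rfl
    rw [this, Real.ball_eq_Ioo] at ht
    exact ⟨by linarith [ht.1], by linarith [ht.2]⟩

theorem IsTimeTest.of_tsupport_subset {T : ℝ} (hT : 0 < T) {χ : ℝ → ℝ}
    (hχ : ContDiff ℝ (⊤ : ℕ∞) χ) (hc : HasCompactSupport χ) (hs : tsupport χ ⊆ Ioo 0 T) :
    IsTimeTest T χ := by
  refine ⟨hχ, ?_⟩
  rcases (tsupport χ).eq_empty_or_nonempty with h | h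
  · exact ⟨T / 2, T / 2, by positivity, by linarith, fun t _ => image_eq_zero_of_notMem_tsupport
      (by simp [h])⟩
  · have hm := hs (hc.isCompact.sInf_mem h)
    have hM := hs (hc.isCompact.sSup_mem h)
    refine ⟨_, _, hm.1, hM.2, fun t ht => image_eq_zero_of_notMem_tsupport fun h => ht ⟨?_, ?_⟩⟩
    · exact csInf_le hc.isCompact.bddBelow h
    · exact le_csSup hc.isCompact.bddAbove h

/-- A smooth function with compact support in `(0,T)` and vanishing integral has a primitive of the
same kind. -/
theorem IsTimeTest.primitive {T : ℝ} (hT : 0 < T) {χ : ℝ → ℝ} (hχ : IsTimeTest T χ)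
    (h0 : ∫ t in Ioo 0 T, χ t = 0) : IsTimeTest T (fun t => ∫ s in (0 : ℝ)..t, χ s) := by
  have hc := hχ.smooth.continuous
  obtain ⟨a, b, ha, hb, h⟩ := hχ.support
  refine ⟨?_, a, b, ha, hb, fun t ht => ?_⟩
  · have hd : deriv (fun t => ∫ s in (0 : ℝ)..t, χ s) = χ :=
      funext fun t => (hc.integral_hasStrictDerivAt 0 t).hasDerivAt.deriv
    have : ContDiff ℝ ((⊤ : ℕ∞) + 1) (fun t => ∫ s in (0 : ℝ)..t, χ s) := by
      rw [contDiff_succ_iff_deriv]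
      refine ⟨fun t => (hc.integral_hasStrictDerivAt 0 t).hasDerivAt.differentiableAt, by simp, ?_⟩
      rw [hd]
      exact hχ.smooth
    exact this
  · rcases not_and_or.1 ht with ht | ht
    · rw [intervalIntegral.integral_congr (g := fun _ => 0)]
      · simp
      · intro s hs
        refine h s fun hs' => ?_
        have := hs.2
        rcases le_total 0 t with h1 | h1
        · rw [max_eq_right h1] at this; linarith [hs'.1]
        · rw [max_eq_left h1] at this; linarith [hs'.1]
    · have h1 : ∫ s in (0 : ℝ)..T, χ s = 0 := by
        rw [intervalIntegral.integral_of_le hT.le, integral_Ioc_eq_integral_Ioo, h0]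
      rw [← intervalIntegral.integral_add_adjacent_intervals (hc.intervalIntegrable 0 T)
        (hc.intervalIntegrable T t), h1, zero_add, intervalIntegral.integral_congr (g := fun _ => 0)]
      · simp
      · intro s hs
        refine h s fun hs' => ?_
        have := hs.1
        rcases le_total T t with h1 | h1
        · rw [min_eq_left h1] at this; linarith [hs'.2]
        · rw [min_eq_right h1] at this; linarith [hs'.2]

/-- The du Bois-Reymond argument: subtracting a multiple of a fixed test function of integral one
makes any test function mean-free, hence the derivative of another test function, against which `w`
integrates to zero. The constant is the integral of `w` against the fixed test function. -/
theorem ae_eq_const_of_hasNegWeakDeriv_zero {T : ℝ} (hT : 0 < T) {w : ℝ → ℝ}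
    (hw : IntegrableOn w (Ioo 0 T)) (h : HasNegWeakDeriv T w 0) :
    ∃ c, ∀ᵐ t, t ∈ Ioo 0 T → w t = c := by
  obtain ⟨χ₀, hχ₀, h₀⟩ := IsTimeTest.exists_integral_one hT
  have hint : ∀ {χ}, IsTimeTest T χ → IntegrableOn (fun t => χ t * w t) (Ioo 0 T) := fun {χ} hχ => by
    obtain ⟨C, hC⟩ := hχ.hasCompactSupport.exists_bound_of_continuous hχ.smooth.continuous
    exact hw.bdd_mul hχ.smooth.continuous.aestronglyMeasurable (ae_of_all _ hC)
  refine ⟨∫ t in Ioo 0 T, χ₀ t * w t, ?_⟩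
  set c := ∫ t in Ioo 0 T, χ₀ t * w t
  have key := isOpen_Ioo.ae_eq_zero_of_integral_contDiff_smul_eq_zero (μ := volume) (U := Ioo 0 T)
    (f := fun t => w t - c) (show IntegrableOn (fun t => w t - c) (Ioo 0 T) from
      hw.sub (integrable_const c)).locallyIntegrableOn ?_
  · filter_upwards [key] with t ht h
    linarith [ht h]
  intro χ hχs hχc hχt
  have hχ := IsTimeTest.of_tsupport_subset hT hχs hχc hχt
  have hχi : IntegrableOn χ (Ioo 0 T) := (hχs.continuous.integrable_of_hasCompactSupport hχc).integrableOn
  have hχ₀i : IntegrableOn χ₀ (Ioo 0 T) :=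
    (hχ₀.smooth.continuous.integrable_of_hasCompactSupport hχ₀.hasCompactSupport).integrableOn
  set m := ∫ t in Ioo 0 T, χ t with hm
  have hη : IsTimeTest T fun t => χ t - m * χ₀ t := by
    obtain ⟨a, b, ha, hb, hab⟩ := hχ.support
    obtain ⟨a', b', ha', hb', hab'⟩ := hχ₀.support
    refine ⟨hχs.sub (contDiff_const.mul hχ₀.smooth), min a a', max b b', lt_min ha ha',
      max_lt hb hb', fun t ht => ?_⟩
    rw [hab t fun h => ht ⟨min_le_of_left_le h.1, le_max_of_le_left h.2⟩,
      hab' t fun h => ht ⟨min_le_of_right_le h.1, le_max_of_le_right h.2⟩]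
    simp
  have hη0 : ∫ t in Ioo 0 T, (χ t - m * χ₀ t) = 0 := by
    rw [integral_sub hχi (hχ₀i.const_mul m), integral_const_mul, h₀]
    simp [hm]
  have h1 := h _ (hη.primitive hT hη0)
  have hd : ∀ t, deriv (fun t => ∫ s in (0 : ℝ)..t, (χ s - m * χ₀ s)) t = χ t - m * χ₀ t :=
    fun t => (hη.smooth.continuous.integral_hasStrictDerivAt 0 t).hasDerivAt.deriv
  simp only [hd, Pi.zero_apply, mul_zero, integral_zero] at h1
  have h2 : ∫ t in Ioo 0 T, (χ t - m * χ₀ t) * w t = (∫ t in Ioo 0 T, χ t * w t) - m * c := by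
    rw [← integral_const_mul, ← integral_sub (hint hχ) ((hint hχ₀).const_mul m)]
    simp only [sub_mul, mul_assoc]
  have h3 : ∫ t in Ioo 0 T, χ t * (w t - c) = (∫ t in Ioo 0 T, χ t * w t) - m * c := by
    rw [hm, ← integral_mul_const, ← integral_sub (hint hχ) (hχi.mul_const c)]
    simp only [mul_sub]
  rw [← setIntegral_eq_integral_of_forall_compl_eq_zero (s := Ioo 0 T)]
  · simp only [smul_eq_mul]
    rw [h3, ← h2, h1]
  · intro t ht
    rw [image_eq_zero_of_notMem_tsupport fun h => ht (hχt h), zero_smul]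

/-- A function with a bounded weak derivative has a Lipschitz representative. -/
theorem HasNegWeakDeriv.exists_lipschitz {T : ℝ} (hT : 0 < T) {a b : ℝ → ℝ} {B : ℝ≥0}
    (h : HasNegWeakDeriv T a b) (ha : IntegrableOn a (Ioo 0 T)) (hbm : Measurable b)
    (hb : ∀ t, |b t| ≤ B) :
    ∃ A : ℝ → ℝ, LipschitzWith B A ∧ (∀ᵐ t, t ∈ Ioo 0 T → a t = A t) ∧
      ∀ᵐ t, HasDerivAt A (-b t) t := by
  have hL := lipschitzWith_primitive hbm hb
  have hD := LocallyIntegrable.ae_hasDerivAt_integral (locallyIntegrable_of_abs_le hbm hb)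
  set P : ℝ → ℝ := fun t => ∫ s in (0 : ℝ)..t, b s with hP
  have hPi : IntegrableOn P (Ioo 0 T) :=
    (hL.continuous.integrableOn_Icc (a := 0) (b := T)).mono_set Ioo_subset_Icc_self
  -- Adding the primitive of `b` removes the weak derivative, so the sum is a constant `c` almost
  -- everywhere and `c - P` is the representative.
  have hw : HasNegWeakDeriv T (fun t => a t + P t) 0 := by
    intro χ hχ
    obtain ⟨C, hC⟩ := (hχ.hasCompactSupport.deriv).exists_bound_of_continuous
      (hχ.smooth.continuous_deriv (by simp))
    obtain ⟨C', hC'⟩ := hχ.hasCompactSupport.exists_bound_of_continuous hχ.smooth.continuous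
    have hm : AEStronglyMeasurable (deriv χ) (volume.restrict (Ioo 0 T)) :=
      (hχ.smooth.continuous_deriv (by simp)).aestronglyMeasurable
    have h1 : ∫ t in Ioo 0 T, (deriv χ t * P t + χ t * b t) = 0 := by
      refine setIntegral_eq_zero_of_absolutelyContinuous hT (G := fun t => χ t * P t) ?_
        (by simp [hχ.apply_zero]) (by simp [hχ.apply_right]) ?_
      · exact ((hχ.smooth.of_le (by simp)).contDiffOn.absolutelyContinuousOnInterval).fun_mul
          hL.lipschitzOnWith.absolutelyContinuousOnInterval
      · filter_upwards [hD] with t ht _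
        exact ((hχ.smooth.differentiable (by simp)) t).hasDerivAt.mul (ht 0)
    have hi1 : IntegrableOn (fun t => deriv χ t * a t) (Ioo 0 T) :=
      ha.bdd_mul hm (ae_of_all _ hC)
    have hi2 : IntegrableOn (fun t => deriv χ t * P t) (Ioo 0 T) :=
      hPi.bdd_mul hm (ae_of_all _ hC)
    have hi3 : IntegrableOn (fun t => χ t * b t) (Ioo 0 T) := by
      refine Integrable.bdd_mul (Measure.integrableOn_of_bounded (M := B) (by simp)
        hbm.aestronglyMeasurable (ae_of_all _ hb)) hχ.smooth.continuous.aestronglyMeasurable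
        (ae_of_all _ hC')
    rw [integral_add hi2 hi3] at h1
    simp only [mul_add, Pi.zero_apply, mul_zero, integral_zero]
    rw [integral_add hi1 hi2, h χ hχ]
    linarith
  obtain ⟨c, hc⟩ := ae_eq_const_of_hasNegWeakDeriv_zero hT (ha.add hPi) hw
  refine ⟨fun t => c - P t, ?_, ?_, ?_⟩
  · refine LipschitzWith.of_dist_le_mul fun x y => ?_
    rw [dist_sub_left]
    exact hL.dist_le_mul x y
  · filter_upwards [hc] with t ht h
    have := ht h
    simp only [Pi.add_apply] at this
    linarith
  · filter_upwards [hD] with t ht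
    exact (ht 0).const_sub c

/-- The weak chain rule. On the Lipschitz representative `A` the product of `χ` and `f ∘ A` is
absolutely continuous and vanishes at both ends, so its almost everywhere derivative has integral
zero. -/
theorem HasNegWeakDeriv.integral_deriv_mul_comp {T : ℝ} (hT : 0 < T) {a b : ℝ → ℝ} {B : ℝ≥0}
    (h : HasNegWeakDeriv T a b) (ha : IntegrableOn a (Ioo 0 T)) (hbm : Measurable b)
    (hb : ∀ t, |b t| ≤ B) {f : ℝ → ℝ} (hf : ContDiff ℝ 1 f) {χ : ℝ → ℝ} (hχ : IsTimeTest T χ) :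
    ∫ t in Ioo 0 T, (deriv χ t * f (a t) - χ t * (deriv f (a t) * b t)) = 0 := by
  obtain ⟨A, hL, hA, hD⟩ := h.exists_lipschitz hT ha hbm hb
  have : ∫ t in Ioo 0 T, (deriv χ t * f (A t) - χ t * (deriv f (A t) * b t)) = 0 := by
    refine setIntegral_eq_zero_of_absolutelyContinuous hT (G := fun t => χ t * f (A t)) ?_
      (by simp [hχ.apply_zero]) (by simp [hχ.apply_right]) ?_
    · refine ((hχ.smooth.of_le (by simp)).contDiffOn.absolutelyContinuousOnInterval).fun_mul ?_
      -- A `C¹` function is only locally Lipschitz; the compact range of `A` on the interval makes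
      -- this enough.
      have hcomp : IsCompact (A '' uIcc 0 T) := isCompact_uIcc.image hL.continuous
      obtain ⟨R, hR⟩ := hcomp.isBounded.subset_closedBall 0
      obtain ⟨K, hK⟩ := hf.contDiffOn.exists_lipschitzOnWith (s := Metric.closedBall 0 R)
        (by simp) (convex_closedBall _ _) (isCompact_closedBall _ _)
      exact (hK.comp hL.lipschitzOnWith fun t ht => hR ⟨t, ht, rfl⟩).absolutelyContinuousOnInterval
    · filter_upwards [hD] with t ht _
      have h1 := ((hf.differentiable (by simp)) (A t)).hasDerivAt.comp t ht
      refine (((hχ.smooth.differentiable (by simp)) t).hasDerivAt.mul h1).congr_deriv ?_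
      simp only [Function.comp_apply]
      ring
  refine Eq.trans ?_ this
  refine setIntegral_congr_ae (measurableSet_Ioo : MeasurableSet (Ioo 0 T)) ?_
  filter_upwards [hA] with t ht htm
  rw [ht htm]

/-- The weak product rule, needed for products of two different mollifications of the vorticity in
the increment formula. -/
theorem HasNegWeakDeriv.integral_deriv_mul_mul {T : ℝ} (hT : 0 < T) {a₁ b₁ a₂ b₂ : ℝ → ℝ}
    {B₁ B₂ : ℝ≥0} (h₁ : HasNegWeakDeriv T a₁ b₁) (ha₁ : IntegrableOn a₁ (Ioo 0 T))
    (hbm₁ : Measurable b₁) (hb₁ : ∀ t, |b₁ t| ≤ B₁)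
    (h₂ : HasNegWeakDeriv T a₂ b₂) (ha₂ : IntegrableOn a₂ (Ioo 0 T))
    (hbm₂ : Measurable b₂) (hb₂ : ∀ t, |b₂ t| ≤ B₂) {χ : ℝ → ℝ} (hχ : IsTimeTest T χ) :
    ∫ t in Ioo 0 T, (deriv χ t * (a₁ t * a₂ t) - χ t * (b₁ t * a₂ t + a₁ t * b₂ t)) = 0 := by
  obtain ⟨A₁, hL₁, hA₁, hD₁⟩ := h₁.exists_lipschitz hT ha₁ hbm₁ hb₁
  obtain ⟨A₂, hL₂, hA₂, hD₂⟩ := h₂.exists_lipschitz hT ha₂ hbm₂ hb₂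
  have : ∫ t in Ioo 0 T, (deriv χ t * (A₁ t * A₂ t) - χ t * (b₁ t * A₂ t + A₁ t * b₂ t)) = 0 := by
    refine setIntegral_eq_zero_of_absolutelyContinuous hT (G := fun t => χ t * (A₁ t * A₂ t)) ?_
      (by simp [hχ.apply_zero]) (by simp [hχ.apply_right]) ?_
    · exact ((hχ.smooth.of_le (by simp)).contDiffOn.absolutelyContinuousOnInterval).fun_mul
        (hL₁.lipschitzOnWith.absolutelyContinuousOnInterval.fun_mul
          hL₂.lipschitzOnWith.absolutelyContinuousOnInterval)
    · filter_upwards [hD₁, hD₂] with t ht₁ ht₂ _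
      refine (((hχ.smooth.differentiable (by simp)) t).hasDerivAt.mul (ht₁.mul ht₂)).congr_deriv ?_
      simp only [Pi.mul_apply]
      ring
  refine Eq.trans ?_ this
  refine setIntegral_congr_ae (measurableSet_Ioo : MeasurableSet (Ioo 0 T)) ?_
  filter_upwards [hA₁, hA₂] with t ht₁ ht₂ htm
  rw [ht₁ htm, ht₂ htm]

/-! ### Bounds for the heat kernel of the circle. -/

/-- The heat kernel of the circle `ℝ / ℤ`. -/
def theta (s a : ℝ) : ℝ :=
  ∑' n : ℤ, Real.exp (-(4 * Real.pi ^ 2 * (n : ℝ) ^ 2 * s)) * Real.cos (2 * Real.pi * (n * a))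

/-- The space derivative of the heat kernel of the circle. -/
def thetaDeriv (s a : ℝ) : ℝ :=
  ∑' n : ℤ, -(Real.exp (-(4 * Real.pi ^ 2 * (n : ℝ) ^ 2 * s)) *
    (2 * Real.pi * n * Real.sin (2 * Real.pi * (n * a))))

/-- A summable majorant on `ℤ`. -/
def inverseSquareBound (c₀ c₁ : ℝ) (n : ℤ) : ℝ := Pi.single (M := fun _ : ℤ => ℝ) 0 c₀ n + c₁ * (1 / (n : ℝ) ^ 2)

def inverseSquareSum : ℝ := ∑' n : ℤ, 1 / (n : ℝ) ^ 2

theorem hasSum_inverseSquareBound (c₀ c₁ : ℝ) :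
    HasSum (inverseSquareBound c₀ c₁) (c₀ + c₁ * inverseSquareSum) :=
  (hasSum_pi_single (0 : ℤ) c₀).add
    ((Real.summable_one_div_int_pow.2 one_lt_two).hasSum.mul_left c₁)

theorem inverseSquareBound_zero (c₀ c₁ : ℝ) : inverseSquareBound c₀ c₁ 0 = c₀ := by
  simp [inverseSquareBound]

theorem inverseSquareBound_of_ne (c₀ c₁ : ℝ) {n : ℤ} (hn : n ≠ 0) :
    inverseSquareBound c₀ c₁ n = c₁ * (1 / (n : ℝ) ^ 2) := by
  simp [inverseSquareBound, hn]

theorem le_inverseSquareBound {f : ℤ → ℝ} {c₀ c₁ : ℝ} (h0 : |f 0| ≤ c₀)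
    (h : ∀ n : ℤ, n ≠ 0 → |f n| ≤ c₁ * (1 / (n : ℝ) ^ 2)) (n : ℤ) :
    ‖f n‖ ≤ inverseSquareBound c₀ c₁ n := by
  rcases eq_or_ne n 0 with rfl | hn
  · rw [inverseSquareBound_zero]; exact h0
  · rw [inverseSquareBound_of_ne _ _ hn]; exact h n hn

theorem abs_tsum_le_of_inverseSquare {f : ℤ → ℝ} {c₀ c₁ : ℝ} (h0 : |f 0| ≤ c₀)
    (h : ∀ n : ℤ, n ≠ 0 → |f n| ≤ c₁ * (1 / (n : ℝ) ^ 2)) :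
    |∑' n, f n| ≤ c₀ + c₁ * inverseSquareSum :=
  tsum_of_norm_bounded (hasSum_inverseSquareBound c₀ c₁) (le_inverseSquareBound h0 h)

theorem summable_of_inverseSquare {f : ℤ → ℝ} {c₁ : ℝ}
    (h : ∀ n : ℤ, n ≠ 0 → |f n| ≤ c₁ * (1 / (n : ℝ) ^ 2)) : Summable f :=
  Summable.of_norm_bounded (hasSum_inverseSquareBound _ c₁).summable (le_inverseSquareBound le_rfl h)

/-- The quadratic Taylor term is all the decay that is used: with `v` proportional to `n² s` it
gives summability in `n`, even after differentiation, and a factor `s⁻²` that is integrable at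
infinity. -/
theorem exp_neg_le_two_div_sq {v : ℝ} (hv : 0 < v) : Real.exp (-v) ≤ 2 / v ^ 2 := by
  rw [Real.exp_neg, inv_eq_one_div, div_le_div_iff₀ (Real.exp_pos v) (by positivity)]
  nlinarith [Real.quadratic_le_exp_of_nonneg hv.le]

theorem two_pi_mul_exp_le {s : ℝ} (hs : 0 < s) {n : ℤ} (hn : n ≠ 0) :
    Real.exp (-(4 * Real.pi ^ 2 * (n : ℝ) ^ 2 * s)) * (2 * Real.pi * |(n : ℝ)|) ≤
      s⁻¹ ^ 2 * (1 / (n : ℝ) ^ 2) := by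
  have hn1 : (1 : ℝ) ≤ |(n : ℝ)| := by exact_mod_cast Int.one_le_abs hn
  have hpi := Real.pi_gt_three
  rw [← sq_abs (n : ℝ)]
  set m := |(n : ℝ)|
  have hm : 0 < m := by linarith
  refine (mul_le_mul_of_nonneg_right (exp_neg_le_two_div_sq (by positivity))
    (by positivity)).trans ?_
  have h1 : 2 / (4 * Real.pi ^ 2 * m ^ 2 * s) ^ 2 * (2 * Real.pi * m) =
      s⁻¹ ^ 2 * (1 / m ^ 2) * (1 / (4 * Real.pi ^ 3 * m)) := by
    field_simp
    ring
  rw [h1]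
  refine mul_le_of_le_one_right (by positivity) ?_
  rw [div_le_one (by positivity)]
  have : (1 : ℝ) ≤ Real.pi ^ 3 := one_le_pow₀ (by linarith)
  nlinarith

theorem exp_le_inverseSquare {s : ℝ} (hs : 0 < s) {n : ℤ} (hn : n ≠ 0) :
    Real.exp (-(4 * Real.pi ^ 2 * (n : ℝ) ^ 2 * s)) ≤ s⁻¹ ^ 2 * (1 / (n : ℝ) ^ 2) := by
  refine le_trans ?_ (two_pi_mul_exp_le hs hn)
  have hn1 : (1 : ℝ) ≤ |(n : ℝ)| := by exact_mod_cast Int.one_le_abs hn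
  refine le_mul_of_one_le_right (Real.exp_pos _).le ?_
  nlinarith [Real.pi_gt_three]

theorem abs_theta_term_le {s : ℝ} (hs : 0 < s) (a : ℝ) {n : ℤ} (hn : n ≠ 0) :
    |Real.exp (-(4 * Real.pi ^ 2 * (n : ℝ) ^ 2 * s)) * Real.cos (2 * Real.pi * (n * a))| ≤
      s⁻¹ ^ 2 * (1 / (n : ℝ) ^ 2) := by
  rw [abs_mul, abs_of_pos (Real.exp_pos _)]
  exact (mul_le_of_le_one_right (Real.exp_pos _).le (Real.abs_cos_le_one _)).trans
    (exp_le_inverseSquare hs hn)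

theorem abs_thetaDeriv_term_le {s : ℝ} (hs : 0 < s) (a : ℝ) {n : ℤ} (hn : n ≠ 0) :
    |-(Real.exp (-(4 * Real.pi ^ 2 * (n : ℝ) ^ 2 * s)) *
      (2 * Real.pi * n * Real.sin (2 * Real.pi * (n * a))))| ≤ s⁻¹ ^ 2 * (1 / (n : ℝ) ^ 2) := by
  rw [abs_neg, abs_mul, abs_of_pos (Real.exp_pos _), abs_mul, abs_mul,
    abs_of_pos (show 0 < 2 * Real.pi by positivity)]
  refine le_trans (mul_le_mul_of_nonneg_left ?_ (Real.exp_pos _).le) (two_pi_mul_exp_le hs hn)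
  exact mul_le_of_le_one_right (by positivity) (Real.abs_sin_le_one _)

theorem hasSum_theta {s : ℝ} (hs : 0 < s) (a : ℝ) :
    HasSum (fun n : ℤ => Real.exp (-(4 * Real.pi ^ 2 * (n : ℝ) ^ 2 * s)) *
      Real.cos (2 * Real.pi * (n * a))) (theta s a) :=
  (summable_of_inverseSquare fun _ hn => abs_theta_term_le hs a hn).hasSum

theorem hasSum_thetaDeriv {s : ℝ} (hs : 0 < s) (a : ℝ) :
    HasSum (fun n : ℤ => -(Real.exp (-(4 * Real.pi ^ 2 * (n : ℝ) ^ 2 * s)) *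
      (2 * Real.pi * n * Real.sin (2 * Real.pi * (n * a))))) (thetaDeriv s a) :=
  (summable_of_inverseSquare fun _ hn => abs_thetaDeriv_term_le hs a hn).hasSum

theorem hasDerivAt_theta {s : ℝ} (hs : 0 < s) (a : ℝ) :
    HasDerivAt (theta s) (thetaDeriv s a) a := by
  refine hasDerivAt_tsum (u := inverseSquareBound 0 (s⁻¹ ^ 2)) (y₀ := 0)
    (hasSum_inverseSquareBound _ _).summable (fun n y => ?_)
    (fun n y => le_inverseSquareBound
      (f := fun n : ℤ => -(Real.exp (-(4 * Real.pi ^ 2 * (n : ℝ) ^ 2 * s)) *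
      (2 * Real.pi * n * Real.sin (2 * Real.pi * (n * y))))) (by simp)
      (fun n hn => abs_thetaDeriv_term_le hs y hn) n)
    (hasSum_theta hs 0).summable a
  have h1 : HasDerivAt (fun z : ℝ => 2 * Real.pi * (n * z)) (2 * Real.pi * n) y := by
    simpa using ((hasDerivAt_id y).const_mul (n : ℝ)).const_mul (2 * Real.pi)
  refine (h1.cos.const_mul _).congr_deriv ?_
  ring

/-- The majorant degenerates as `s → 0` but is uniform on `s > s₀` for each positive `s₀`. Joint
continuity supplies the measurability needed for Fubini in time and space. -/
theorem continuousOn_theta :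
    ContinuousOn (fun z : ℝ × ℝ => theta z.1 z.2) (Ioi 0 ×ˢ univ) := by
  have key : ∀ s₀ > (0 : ℝ), ContinuousOn (fun z : ℝ × ℝ => theta z.1 z.2) (Ioi s₀ ×ˢ univ) := by
    intro s₀ hs₀
    refine continuousOn_tsum (u := inverseSquareBound 1 (s₀⁻¹ ^ 2)) (fun n => by fun_prop)
      (hasSum_inverseSquareBound _ _).summable fun n z hz => ?_
    refine le_inverseSquareBound (f := fun n : ℤ => Real.exp (-(4 * Real.pi ^ 2 * (n : ℝ) ^ 2 * z.1)) *
      Real.cos (2 * Real.pi * (n * z.2))) (by simp) (fun n hn => ?_) n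
    have hz1 : s₀ < z.1 := hz.1
    refine (abs_theta_term_le (hs₀.trans hz1) z.2 hn).trans ?_
    have hz2 : z.1⁻¹ ≤ s₀⁻¹ := inv_anti₀ hs₀ hz1.le
    have : 0 ≤ z.1⁻¹ := inv_nonneg.2 (hs₀.trans hz1).le
    gcongr
  intro z hz
  have hz1 : 0 < z.1 := hz.1
  refine ((key (z.1 / 2) (by linarith)).continuousAt ?_).continuousWithinAt
  exact prod_mem_nhds (Ioi_mem_nhds (by linarith)) univ_mem

theorem continuousOn_thetaDeriv :
    ContinuousOn (fun z : ℝ × ℝ => thetaDeriv z.1 z.2) (Ioi 0 ×ˢ univ) := by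
  have key : ∀ s₀ > (0 : ℝ),
      ContinuousOn (fun z : ℝ × ℝ => thetaDeriv z.1 z.2) (Ioi s₀ ×ˢ univ) := by
    intro s₀ hs₀
    refine continuousOn_tsum (u := inverseSquareBound 0 (s₀⁻¹ ^ 2)) (fun n => by fun_prop)
      (hasSum_inverseSquareBound _ _).summable fun n z hz => ?_
    refine le_inverseSquareBound (f := fun n : ℤ => -(Real.exp (-(4 * Real.pi ^ 2 * (n : ℝ) ^ 2 * z.1)) *
      (2 * Real.pi * n * Real.sin (2 * Real.pi * (n * z.2))))) (by simp) (fun n hn => ?_) n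
    have hz1 : s₀ < z.1 := hz.1
    refine (abs_thetaDeriv_term_le (hs₀.trans hz1) z.2 hn).trans ?_
    have hz2 : z.1⁻¹ ≤ s₀⁻¹ := inv_anti₀ hs₀ hz1.le
    have : 0 ≤ z.1⁻¹ := inv_nonneg.2 (hs₀.trans hz1).le
    gcongr
  intro z hz
  have hz1 : 0 < z.1 := hz.1
  refine ((key (z.1 / 2) (by linarith)).continuousAt ?_).continuousWithinAt
  exact prod_mem_nhds (Ioi_mem_nhds (by linarith)) univ_mem

/-- Removing the mode `n = 0` leaves only decaying modes. -/
theorem abs_theta_sub_one_le {s : ℝ} (hs : 0 < s) (a : ℝ) :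
    |theta s a - 1| ≤ s⁻¹ ^ 2 * inverseSquareSum := by
  have h := (hasSum_theta hs a).sub (hasSum_pi_single (0 : ℤ) (1 : ℝ))
  rw [← h.tsum_eq, ← zero_add (s⁻¹ ^ 2 * inverseSquareSum)]
  refine abs_tsum_le_of_inverseSquare (by simp) fun n hn => ?_
  simpa [Pi.single_eq_of_ne hn] using abs_theta_term_le hs a hn

theorem abs_thetaDeriv_le_of_large {s : ℝ} (hs : 0 < s) (a : ℝ) :
    |thetaDeriv s a| ≤ s⁻¹ ^ 2 * inverseSquareSum := by
  rw [← zero_add (s⁻¹ ^ 2 * inverseSquareSum)]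
  exact abs_tsum_le_of_inverseSquare (by simp) fun n hn => abs_thetaDeriv_term_le hs a hn

/-- The time change `4πs` identifies the Fourier series with a Hurwitz kernel, whose functional
equation is Poisson summation: it trades the series for Gaussians centred at the integers, which are
good for small `s`. -/
theorem theta_eq_cosKernel {s : ℝ} (hs : 0 < s) (a : ℝ) :
    theta s a = HurwitzZeta.cosKernel a (4 * Real.pi * s) := by
  have h := Complex.hasSum_re (HurwitzZeta.hasSum_int_cosKernel a (t := 4 * Real.pi * s) (by positivity))
  rw [Complex.ofReal_re] at h
  refine (hasSum_theta hs a).unique (h.congr_fun fun n => ?_)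
  have h1 : (2 * Real.pi * Complex.I * a * n : ℂ) = ((2 * Real.pi * (n * a) : ℝ) : ℂ) * Complex.I := by
    push_cast; ring
  rw [h1, Complex.re_mul_ofReal, Complex.exp_ofReal_mul_I_re, mul_comm]
  congr 2
  ring

theorem thetaDeriv_eq_sinKernel {s : ℝ} (hs : 0 < s) (a : ℝ) :
    thetaDeriv s a = -(2 * Real.pi) * HurwitzZeta.sinKernel a (4 * Real.pi * s) := by
  have h := (Complex.hasSum_re
    (HurwitzZeta.hasSum_int_sinKernel a (t := 4 * Real.pi * s) (by positivity))).mul_left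
    (-(2 * Real.pi))
  rw [Complex.ofReal_re] at h
  refine (hasSum_thetaDeriv hs a).unique (h.congr_fun fun n => ?_)
  have h1 : (2 * Real.pi * Complex.I * a * n : ℂ) = ((2 * Real.pi * (n * a) : ℝ) : ℂ) * Complex.I := by
    push_cast; ring
  have h2 : (-Complex.I * n * Complex.exp ((2 * Real.pi * (n * a) : ℝ) * Complex.I)).re =
      n * Real.sin (2 * Real.pi * (n * a)) := by
    have : ((n : ℤ) : ℂ) = ((n : ℝ) : ℂ) := by simp
    rw [mul_comm (-Complex.I), mul_assoc, this, Complex.re_ofReal_mul, neg_mul, Complex.neg_re,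
      Complex.I_mul_re, Complex.exp_ofReal_mul_I_im, neg_neg]
  rw [h1, Complex.re_mul_ofReal, h2]
  have h3 : -Real.pi * (n : ℝ) ^ 2 * (4 * Real.pi * s) = -(4 * Real.pi ^ 2 * (n : ℝ) ^ 2 * s) := by ring
  rw [h3]
  ring

theorem exp_neg_pi_le {a x : ℝ} (hx : 0 < x) :
    Real.exp (-Real.pi * a ^ 2 * x) ≤ 1 / (1 + a ^ 2 * x) := by
  have h : -Real.pi * a ^ 2 * x = -(Real.pi * (a ^ 2 * x)) := by ring
  rw [h, Real.exp_neg, inv_eq_one_div]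
  refine one_div_le_one_div_of_le (by positivity) ?_
  have h1 := Real.add_one_le_exp (Real.pi * (a ^ 2 * x))
  have : a ^ 2 * x ≤ Real.pi * (a ^ 2 * x) :=
    le_mul_of_one_le_left (by positivity) (by linarith [Real.pi_gt_three])
  linarith

/-- With `w = √x |a|` the claim is `w (1 + w²) ≤ exp (π w²)`, which follows from the quadratic lower
bound of `exp (w²)`. The rational majorant is chosen to be the same as for the undifferentiated
Gaussian, so that one estimate serves both kernels. -/
theorem mul_exp_neg_pi_le {a x : ℝ} (hx : 0 < x) :
    √x * |a| * Real.exp (-Real.pi * a ^ 2 * x) ≤ 1 / (1 + a ^ 2 * x) := by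
  have h : -Real.pi * a ^ 2 * x = -(Real.pi * (a ^ 2 * x)) := by ring
  set w := √x * |a| with hw
  have hw0 : 0 ≤ w := by positivity
  have hw2 : a ^ 2 * x = w ^ 2 := by rw [hw, mul_pow, Real.sq_sqrt hx.le, sq_abs]; ring
  rw [h, Real.exp_neg, ← div_eq_mul_inv, div_le_div_iff₀ (Real.exp_pos _) (by positivity), hw2]
  have h1 := Real.quadratic_le_exp_of_nonneg (x := w ^ 2) (by positivity)
  have h2 : Real.exp (w ^ 2) ≤ Real.exp (Real.pi * w ^ 2) :=
    Real.exp_le_exp.2 (le_mul_of_one_le_left (by positivity) (by linarith [Real.pi_gt_three]))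
  nlinarith [sq_nonneg (w - 1), sq_nonneg (w ^ 2 - w), mul_nonneg hw0 hw0]

/-- When `|a| ≤ 1/2` every nonzero image satisfies `|n + a| ≥ |n| / 2`. Only the image at the origin
is singular, and the others sum to a multiple of `1 / x`. -/
theorem one_div_le_of_abs_le_half {a x : ℝ} (hx : 0 < x) (ha : |a| ≤ 1 / 2) {n : ℤ} (hn : n ≠ 0) :
    1 / (1 + ((n : ℝ) + a) ^ 2 * x) ≤ 4 / x * (1 / (n : ℝ) ^ 2) := by
  have hn1 : (1 : ℝ) ≤ |(n : ℝ)| := by exact_mod_cast Int.one_le_abs hn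
  have h1 : |(n : ℝ)| / 2 ≤ |(n : ℝ) + a| := by
    have h2 : |(n : ℝ)| ≤ |(n : ℝ) + a| + |a| := by
      have := abs_sub ((n : ℝ) + a) a
      simpa using this
    linarith
  have h2 : (n : ℝ) ^ 2 / 4 ≤ ((n : ℝ) + a) ^ 2 := by
    rw [← sq_abs ((n : ℝ) + a), ← sq_abs (n : ℝ)]
    nlinarith [abs_nonneg (n : ℝ)]
  have hn2 : 0 < (n : ℝ) ^ 2 := by positivity
  rw [div_mul_div_comm, div_le_div_iff₀ (by positivity) (by positivity)]
  nlinarith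

theorem abs_evenKernel_le {a x : ℝ} (hx : 0 < x) (ha : |a| ≤ 1 / 2) :
    |HurwitzZeta.evenKernel a x| ≤ 1 / (1 + a ^ 2 * x) + 4 / x * inverseSquareSum := by
  rw [← (HurwitzZeta.hasSum_int_evenKernel a hx).tsum_eq]
  refine abs_tsum_le_of_inverseSquare ?_ fun n hn => ?_
  · rw [abs_of_pos (Real.exp_pos _)]
    simpa using exp_neg_pi_le (a := a) hx
  · rw [abs_of_pos (Real.exp_pos _)]
    exact (exp_neg_pi_le hx).trans (one_div_le_of_abs_le_half hx ha hn)

theorem abs_oddKernel_le {a x : ℝ} (hx : 0 < x) (ha : |a| ≤ 1 / 2) :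
    √x * |HurwitzZeta.oddKernel a x| ≤ 1 / (1 + a ^ 2 * x) + 4 / x * inverseSquareSum := by
  have h := (HurwitzZeta.hasSum_int_oddKernel a hx).mul_left (√x)
  have h0 : √x * |HurwitzZeta.oddKernel a x| = |√x * HurwitzZeta.oddKernel a x| := by
    rw [abs_mul, abs_of_nonneg (Real.sqrt_nonneg x)]
  rw [h0, ← h.tsum_eq]
  have h1 : ∀ n : ℤ, |√x * (((n : ℝ) + a) * Real.exp (-Real.pi * ((n : ℝ) + a) ^ 2 * x))| ≤
      1 / (1 + ((n : ℝ) + a) ^ 2 * x) := fun n => by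
    rw [abs_mul, abs_mul, abs_of_nonneg (Real.sqrt_nonneg x), abs_of_pos (Real.exp_pos _), ← mul_assoc]
    exact mul_exp_neg_pi_le hx
  refine abs_tsum_le_of_inverseSquare ?_ fun n hn => ?_
  · simpa using h1 0
  · exact (h1 n).trans (one_div_le_of_abs_le_half hx ha hn)

theorem inverseSquareSum_nonneg : 0 ≤ inverseSquareSum := tsum_nonneg fun n => by positivity

/-- Here `x = 1 / (4πs)`. The images away from the origin contribute a multiple of `s`, which is
absorbed by `s / (s + a²)` because `s + a² ≤ 2`. -/
theorem poisson_majorant_le {a s : ℝ} (hs : 0 < s) (hs1 : s ≤ 1) (ha : |a| ≤ 1 / 2) :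
    1 / (1 + a ^ 2 * (1 / (4 * Real.pi * s))) + 4 / (1 / (4 * Real.pi * s)) * inverseSquareSum ≤
      4 * Real.pi * (1 + 8 * inverseSquareSum) * (s / (s + a ^ 2)) := by
  have hpi := Real.pi_gt_three
  have hS := inverseSquareSum_nonneg
  have ha2 : a ^ 2 ≤ 1 / 4 := by rw [← sq_abs]; nlinarith [abs_nonneg a]
  have hd : 0 < s + a ^ 2 := by positivity
  have h1 : 1 / (1 + a ^ 2 * (1 / (4 * Real.pi * s))) ≤ 4 * Real.pi * (s / (s + a ^ 2)) := by
    have : 1 / (1 + a ^ 2 * (1 / (4 * Real.pi * s))) = 4 * Real.pi * s / (4 * Real.pi * s + a ^ 2) := by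
      field_simp
    rw [this, ← mul_div_assoc]
    gcongr
    nlinarith
  have h2 : s ≤ 2 * (s / (s + a ^ 2)) := by
    rw [← mul_div_assoc, le_div_iff₀ hd]
    nlinarith
  have h3 : 4 / (1 / (4 * Real.pi * s)) * inverseSquareSum = 16 * Real.pi * inverseSquareSum * s := by
    field_simp; ring
  rw [h3]
  have h4 := mul_le_mul_of_nonneg_left h2
    (show 0 ≤ 16 * Real.pi * inverseSquareSum by positivity)
  linarith

def thetaConst : ℝ := 4 * Real.pi * (1 + 8 * inverseSquareSum)

theorem one_le_thetaConst : 1 ≤ thetaConst := by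
  have := inverseSquareSum_nonneg
  unfold thetaConst
  nlinarith [Real.pi_gt_three]

/-- A polynomial substitute for the Gaussian bound by `s^(-1/2) exp (-a² / 4s)`: the functional
equation contributes the factor `1 / √(4πs)` to the majorant `s / (s + a²)`. -/
theorem abs_theta_le_of_small {s a : ℝ} (hs : 0 < s) (hs1 : s ≤ 1) (ha : |a| ≤ 1 / 2) :
    |theta s a| ≤ thetaConst * (√s / (s + a ^ 2)) := by
  have hpi := Real.pi_gt_three
  have hx : 0 < 1 / (4 * Real.pi * s) := by positivity
  have h1 := (abs_evenKernel_le hx ha).trans (poisson_majorant_le hs hs1 ha)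
  rw [HurwitzZeta.evenKernel_functional_equation, one_div_one_div, ← theta_eq_cosKernel hs,
    ← Real.sqrt_eq_rpow, abs_mul, Real.sqrt_div zero_le_one, Real.sqrt_one, one_div_one_div,
    abs_of_nonneg (Real.sqrt_nonneg _)] at h1
  have h2 : √s ≤ √(4 * Real.pi * s) := Real.sqrt_le_sqrt (by nlinarith)
  have h3 : √s * |theta s a| ≤ √s * (thetaConst * (√s / (s + a ^ 2))) := by
    calc _ ≤ √(4 * Real.pi * s) * |theta s a| := by gcongr
      _ ≤ _ := h1
      _ = _ := by
        have : √s * (thetaConst * (√s / (s + a ^ 2))) = thetaConst * ((√s * √s) / (s + a ^ 2)) := by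
          ring
        rw [this, Real.mul_self_sqrt hs.le, thetaConst]
  exact le_of_mul_le_mul_left h3 (Real.sqrt_pos.2 hs)

theorem abs_thetaDeriv_le_of_small {s a : ℝ} (hs : 0 < s) (hs1 : s ≤ 1) (ha : |a| ≤ 1 / 2) :
    |thetaDeriv s a| ≤ thetaConst / (s + a ^ 2) := by
  have hpi := Real.pi_gt_three
  have hx : 0 < 1 / (4 * Real.pi * s) := by positivity
  have h1 := (abs_oddKernel_le hx ha).trans (poisson_majorant_le hs hs1 ha)
  have hr : (1 / (4 * Real.pi * s)) ^ (3 / 2 : ℝ) =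
      1 / (4 * Real.pi * s) * √(1 / (4 * Real.pi * s)) := by
    rw [Real.sqrt_eq_rpow, ← Real.rpow_one_add' hx.le (by norm_num)]
    norm_num
  rw [HurwitzZeta.oddKernel_functional_equation, one_div_one_div, hr, abs_mul,
    abs_of_pos (by positivity), ← mul_assoc] at h1
  have hsq := Real.sqrt_pos.2 hx
  have h2 : √(1 / (4 * Real.pi * s)) * (1 / (1 / (4 * Real.pi * s) * √(1 / (4 * Real.pi * s)))) =
      4 * Real.pi * s := by
    generalize √(1 / (4 * Real.pi * s)) = q at hsq
    field_simp
  rw [h2] at h1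
  rw [thetaDeriv_eq_sinKernel hs, abs_mul, abs_neg, abs_of_pos (show 0 < 2 * Real.pi by positivity)]
  refine le_of_mul_le_mul_left (a := 2 * s) ?_ (by positivity)
  calc 2 * s * (2 * Real.pi * |HurwitzZeta.sinKernel a (4 * Real.pi * s)|)
      = 4 * Real.pi * s * |HurwitzZeta.sinKernel a (4 * Real.pi * s)| := by ring
    _ ≤ _ := h1
    _ = s * (thetaConst / (s + a ^ 2)) := by unfold thetaConst; ring
    _ ≤ _ := by
      have := one_le_thetaConst
      have : 0 ≤ thetaConst / (s + a ^ 2) := by positivity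
      nlinarith

/-- The terms are odd in `n`. The vanishing sum removes the product of sines from the addition
formula, so that the heat kernel of the torus factors into two theta functions. -/
theorem hasSum_theta_sin {s : ℝ} (hs : 0 < s) (a : ℝ) :
    HasSum (fun n : ℤ => Real.exp (-(4 * Real.pi ^ 2 * (n : ℝ) ^ 2 * s)) *
      Real.sin (2 * Real.pi * (n * a))) 0 := by
  have hS : Summable (fun n : ℤ => Real.exp (-(4 * Real.pi ^ 2 * (n : ℝ) ^ 2 * s)) *
      Real.sin (2 * Real.pi * (n * a))) := by
    refine summable_of_inverseSquare (c₁ := s⁻¹ ^ 2) fun n hn => ?_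
    rw [abs_mul, abs_of_pos (Real.exp_pos _)]
    exact (mul_le_of_le_one_right (Real.exp_pos _).le (Real.abs_sin_le_one _)).trans
      (exp_le_inverseSquare hs hn)
  have h := hS.hasSum
  have h' := (Equiv.neg ℤ).hasSum_iff.2 h
  have h2 : HasSum (fun n : ℤ => Real.exp (-(4 * Real.pi ^ 2 * (n : ℝ) ^ 2 * s)) *
      Real.sin (2 * Real.pi * (n * a))) (-∑' n : ℤ, Real.exp (-(4 * Real.pi ^ 2 * (n : ℝ) ^ 2 * s)) *
      Real.sin (2 * Real.pi * (n * a))) := by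
    refine h'.neg.congr_fun fun n => ?_
    simp
  have := h.unique h2
  have h0 : (∑' n : ℤ, Real.exp (-(4 * Real.pi ^ 2 * (n : ℝ) ^ 2 * s)) *
      Real.sin (2 * Real.pi * (n * a))) = 0 := by linarith
  rwa [h0] at h

theorem hasSum_mul_sub_mul {c₁ c₂ s₁ s₂ : ℤ → ℝ} {A B : ℝ} (h₁ : HasSum c₁ A) (h₂ : HasSum c₂ B)
    (h₃ : HasSum s₁ 0) (h₄ : HasSum s₂ 0) :
    HasSum (fun k : ℤ × ℤ => c₁ k.1 * c₂ k.2 - s₁ k.1 * s₂ k.2) (A * B) := by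
  have h := (h₁.mul h₂ (summable_mul_of_summable_norm h₁.summable.norm h₂.summable.norm)).sub
    (h₃.mul h₄ (summable_mul_of_summable_norm h₃.summable.norm h₄.summable.norm))
  rwa [mul_zero, sub_zero] at h

theorem heatKernel_eq {s : ℝ} (hs : 0 < s) (x : Plane) :
    heatKernel s x = theta s (x 0) * theta s (x 1) := by
  have h := hasSum_mul_sub_mul (hasSum_theta hs (x 0)) (hasSum_theta hs (x 1))
    (hasSum_theta_sin hs (x 0)) (hasSum_theta_sin hs (x 1))
  rw [← h.tsum_eq, heatKernel]
  refine tsum_congr fun k => ?_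
  have e1 : -(4 * Real.pi ^ 2 * ((k.1 : ℝ) ^ 2 + (k.2 : ℝ) ^ 2) * s) =
    -(4 * Real.pi ^ 2 * (k.1 : ℝ) ^ 2 * s) + -(4 * Real.pi ^ 2 * (k.2 : ℝ) ^ 2 * s) := by ring
  rw [e1, Real.exp_add, mul_add (2 * Real.pi), Real.cos_add]
  ring

/-! ### The gradient of the Green function. -/

/-- The differential in space of the heat kernel of the torus. -/
def heatFDeriv (s : ℝ) (x : Plane) : Plane →L[ℝ] ℝ :=
  (thetaDeriv s (x 0) * theta s (x 1)) • EuclideanSpace.proj (𝕜 := ℝ) 0 +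
    (theta s (x 0) * thetaDeriv s (x 1)) • EuclideanSpace.proj (𝕜 := ℝ) 1

theorem hasFDerivAt_heatKernel {s : ℝ} (hs : 0 < s) (x : Plane) :
    HasFDerivAt (heatKernel s) (heatFDeriv s x) x := by
  have he : heatKernel s = fun x => theta s (x 0) * theta s (x 1) :=
    funext fun x => heatKernel_eq hs x
  rw [he]
  have h0 := (hasDerivAt_theta hs (x 0)).comp_hasFDerivAt x
    (EuclideanSpace.proj (𝕜 := ℝ) (0 : Fin 2)).hasFDerivAt
  have h1 := (hasDerivAt_theta hs (x 1)).comp_hasFDerivAt x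
    (EuclideanSpace.proj (𝕜 := ℝ) (1 : Fin 2)).hasFDerivAt
  refine (h0.mul h1).congr_fderiv ?_
  ext v
  simp [heatFDeriv]
  ring

theorem plane_norm_sq (x : Plane) : ‖x‖ ^ 2 = x 0 ^ 2 + x 1 ^ 2 := by
  rw [EuclideanSpace.norm_sq_eq, Fin.sum_univ_two]
  simp

def gradConst : ℝ := thetaConst ^ 2 + 2 * inverseSquareSum * (1 + inverseSquareSum)

theorem gradConst_pos : 0 < gradConst := by
  have := one_le_thetaConst
  have := inverseSquareSum_nonneg
  unfold gradConst
  positivity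

/-- One majorant for all times, with an explicit integral in `s`. For `s ≤ 1` it uses `(s + a²)(s +
b²) ≥ s (s + a² + b²)`. For `s > 1` the decay `s⁻²` suffices, because then `√s (s + a² + b²) ≤ 2
s²`. -/
theorem abs_thetaDeriv_mul_theta_le {s a b : ℝ} (hs : 0 < s) (ha : |a| ≤ 1 / 2) (hb : |b| ≤ 1 / 2) :
    |thetaDeriv s a * theta s b| ≤ gradConst * (1 / (√s * (s + (a ^ 2 + b ^ 2)))) := by
  have hS := inverseSquareSum_nonneg
  have hC := one_le_thetaConst
  have hq := Real.sqrt_pos.2 hs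
  have hq2 := Real.mul_self_sqrt hs.le
  rw [abs_mul]
  rcases le_or_gt s 1 with h1 | h1
  · calc |thetaDeriv s a| * |theta s b|
        ≤ (thetaConst / (s + a ^ 2)) * (thetaConst * (√s / (s + b ^ 2))) :=
          mul_le_mul (abs_thetaDeriv_le_of_small hs h1 ha) (abs_theta_le_of_small hs h1 hb)
            (abs_nonneg _) (by positivity)
      _ = thetaConst ^ 2 * (√s / ((s + a ^ 2) * (s + b ^ 2))) := by field_simp
      _ ≤ thetaConst ^ 2 * (1 / (√s * (s + (a ^ 2 + b ^ 2)))) := by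
          gcongr ?_ * ?_
          rw [div_le_div_iff₀ (by positivity) (by positivity), ← mul_assoc, hq2]
          nlinarith [mul_nonneg (sq_nonneg a) (sq_nonneg b)]
      _ ≤ _ := by
          gcongr ?_ * ?_
          unfold gradConst
          nlinarith
  · have ha2 : a ^ 2 ≤ 1 / 4 := by rw [← sq_abs]; nlinarith [abs_nonneg a]
    have hb2 : b ^ 2 ≤ 1 / 4 := by rw [← sq_abs]; nlinarith [abs_nonneg b]
    have hθ : |theta s b| ≤ 1 + inverseSquareSum := by
      have h2 := abs_theta_sub_one_le hs b
      have h3 : |theta s b| ≤ |theta s b - 1| + |(1 : ℝ)| := by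
        simpa using abs_add_le (theta s b - 1) 1
      have h4 : s⁻¹ ^ 2 ≤ 1 := pow_le_one₀ (by positivity) (inv_le_one_of_one_le₀ h1.le)
      rw [abs_one] at h3
      nlinarith
    calc |thetaDeriv s a| * |theta s b|
        ≤ (s⁻¹ ^ 2 * inverseSquareSum) * (1 + inverseSquareSum) :=
          mul_le_mul (abs_thetaDeriv_le_of_large hs a) hθ (abs_nonneg _) (by positivity)
      _ = (2 * inverseSquareSum * (1 + inverseSquareSum)) * (1 / (2 * s ^ 2)) := by field_simp
      _ ≤ (2 * inverseSquareSum * (1 + inverseSquareSum)) *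
          (1 / (√s * (s + (a ^ 2 + b ^ 2)))) := by
          gcongr ?_ * (1 / ?_)
          have hqs : √s ≤ s := by
            have : 1 ≤ √s := by rw [Real.one_le_sqrt]; exact h1.le
            nlinarith
          nlinarith
      _ ≤ _ := by
          gcongr ?_ * ?_
          unfold gradConst
          nlinarith

theorem norm_proj_le (i : Fin 2) : ‖(EuclideanSpace.proj i : Plane →L[ℝ] ℝ)‖ ≤ 1 := by
  refine ContinuousLinearMap.opNorm_le_bound _ zero_le_one fun x => ?_
  rw [one_mul]
  exact PiLp.norm_apply_le x i

theorem norm_heatFDeriv_le {s : ℝ} (hs : 0 < s) {x : Plane} (hx : ∀ i, |x i| ≤ 1 / 2) :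
    ‖heatFDeriv s x‖ ≤ 2 * gradConst * (1 / (√s * (s + ‖x‖ ^ 2))) := by
  have h0 := abs_thetaDeriv_mul_theta_le hs (hx 0) (hx 1)
  have h1 := abs_thetaDeriv_mul_theta_le hs (hx 1) (hx 0)
  rw [plane_norm_sq]
  rw [add_comm (x 1 ^ 2), mul_comm (thetaDeriv s (x 1))] at h1
  refine (norm_add_le _ _).trans ?_
  rw [norm_smul, norm_smul, Real.norm_eq_abs, Real.norm_eq_abs]
  have h2 := mul_le_mul h0 (norm_proj_le 0) (norm_nonneg _) ((abs_nonneg _).trans h0)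
  have h3 := mul_le_mul h1 (norm_proj_le 1) (norm_nonneg _) ((abs_nonneg _).trans h1)
  linarith

/-- A crude bound, uniform in small `s` but singular at the origin: it serves only to make the time
integral defining the Green function converge. -/
theorem abs_heatKernel_sub_one_le_of_small {s : ℝ} (hs : 0 < s) (hs1 : s ≤ 1) {x : Plane}
    (hx : ∀ i, |x i| ≤ 1 / 2) (h0 : x ≠ 0) :
    |heatKernel s x - 1| ≤ thetaConst ^ 2 / ‖x‖ ^ 2 + 1 := by
  have hC := one_le_thetaConst
  have hr : 0 < ‖x‖ ^ 2 := by positivity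
  rw [plane_norm_sq] at hr ⊢
  rw [heatKernel_eq hs]
  refine (abs_sub _ _).trans ?_
  rw [abs_one, abs_mul]
  gcongr
  calc |theta s (x 0)| * |theta s (x 1)|
      ≤ (thetaConst * (√s / (s + x 0 ^ 2))) * (thetaConst * (√s / (s + x 1 ^ 2))) :=
        mul_le_mul (abs_theta_le_of_small hs hs1 (hx 0)) (abs_theta_le_of_small hs hs1 (hx 1))
          (abs_nonneg _) (by positivity)
    _ = thetaConst ^ 2 * ((√s * √s) / ((s + x 0 ^ 2) * (s + x 1 ^ 2))) := by
        field_simp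
    _ ≤ thetaConst ^ 2 * (1 / (x 0 ^ 2 + x 1 ^ 2)) := by
        rw [Real.mul_self_sqrt hs.le]
        gcongr ?_ * ?_
        rw [div_le_div_iff₀ (by positivity) hr]
        nlinarith [mul_nonneg (sq_nonneg (x 0)) (sq_nonneg (x 1)), sq_nonneg s]
    _ = _ := by ring

theorem abs_heatKernel_sub_one_le_of_large {s : ℝ} (hs : 1 ≤ s) (x : Plane) :
    |heatKernel s x - 1| ≤ inverseSquareSum * (inverseSquareSum + 2) * s ^ (-2 : ℝ) := by
  have hs0 : 0 < s := by linarith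
  have hS := inverseSquareSum_nonneg
  have h0 := abs_theta_sub_one_le hs0 (x 0)
  have h1 := abs_theta_sub_one_le hs0 (x 1)
  have h4 : s⁻¹ ^ 2 ≤ 1 := pow_le_one₀ (by positivity) (inv_le_one_of_one_le₀ hs)
  have h5 : s ^ (-2 : ℝ) = s⁻¹ ^ 2 := by
    rw [Real.rpow_neg hs0.le, inv_pow]; norm_num
  rw [heatKernel_eq hs0, h5]
  have h6 : theta s (x 0) * theta s (x 1) - 1 =
    (theta s (x 0) - 1) * (theta s (x 1) - 1) + (theta s (x 0) - 1) + (theta s (x 1) - 1) := by ring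
  rw [h6]
  refine (abs_add_three _ _ _).trans ?_
  rw [abs_mul]
  have h7 := mul_le_mul h0 h1 (abs_nonneg _) (by positivity)
  have h8 : s⁻¹ ^ 2 * inverseSquareSum * (s⁻¹ ^ 2 * inverseSquareSum) ≤
      inverseSquareSum * (s⁻¹ ^ 2 * inverseSquareSum) := by
    gcongr
    exact mul_le_of_le_one_left hS h4
  nlinarith

theorem continuousOn_theta_left (a : ℝ) : ContinuousOn (fun s => theta s a) (Ioi 0) :=
  continuousOn_theta.comp (f := fun s => (s, a)) (by fun_prop) fun _ hs => ⟨hs, mem_univ _⟩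

theorem continuousOn_thetaDeriv_left (a : ℝ) : ContinuousOn (fun s => thetaDeriv s a) (Ioi 0) :=
  continuousOn_thetaDeriv.comp (f := fun s => (s, a)) (by fun_prop) fun _ hs => ⟨hs, mem_univ _⟩

theorem continuousOn_heatKernel_left (x : Plane) :
    ContinuousOn (fun s => heatKernel s x) (Ioi 0) :=
  ((continuousOn_theta_left (x 0)).mul (continuousOn_theta_left (x 1))).congr
    fun _ hs => heatKernel_eq hs x

theorem continuousOn_heatFDeriv_left (x : Plane) :
    ContinuousOn (fun s => heatFDeriv s x) (Ioi 0) := by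
  have h1 := continuousOn_theta_left
  have h2 := continuousOn_thetaDeriv_left
  exact (((h2 _).mul (h1 _)).smul continuousOn_const).add
    (((h1 _).mul (h2 _)).smul continuousOn_const)

theorem integrableOn_heatKernel_sub_one {x : Plane} (hx : ∀ i, |x i| ≤ 1 / 2) (h0 : x ≠ 0) :
    IntegrableOn (fun s => heatKernel s x - 1) (Ioi 0) := by
  have hm := (continuousOn_heatKernel_left x).sub (continuousOn_const (c := (1 : ℝ)))
  rw [← Ioc_union_Ioi_eq_Ioi zero_le_one]
  refine IntegrableOn.union ?_ ?_
  · refine Integrable.of_bound ((hm.mono Ioc_subset_Ioi_self).aestronglyMeasurable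
      measurableSet_Ioc) (thetaConst ^ 2 / ‖x‖ ^ 2 + 1) ?_
    filter_upwards [ae_restrict_mem measurableSet_Ioc] with s hs
    exact abs_heatKernel_sub_one_le_of_small hs.1 hs.2 hx h0
  · refine Integrable.mono' ((integrableOn_Ioi_rpow_of_lt (a := -2) (by norm_num) one_pos).const_mul
      (inverseSquareSum * (inverseSquareSum + 2)))
      ((hm.mono (Ioi_subset_Ioi zero_le_one)).aestronglyMeasurable measurableSet_Ioi) ?_
    filter_upwards [ae_restrict_mem measurableSet_Ioi] with s hs
    exact abs_heatKernel_sub_one_le_of_large (le_of_lt hs) x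

/-- The function `2 / r * arctan (√s / r)` is the antiderivative of the majorant `1 / (√s (s +
r²))`; its total increase `π / r` is the source of the singularity `1 / |x|` of the kernel. -/
theorem tendsto_arctan_sqrt {r : ℝ} (hr : 0 < r) :
    Tendsto (fun s => 2 / r * Real.arctan (√s / r)) atTop (𝓝 (Real.pi / r)) := by
  have h1 : Tendsto (fun s => √s / r) atTop atTop :=
    Real.tendsto_sqrt_atTop.atTop_div_const hr
  have h2 := ((Real.tendsto_arctan_atTop.mono_right nhdsWithin_le_nhds).comp h1).const_mul (2 / r)
  have h3 : Real.pi / r = 2 / r * (Real.pi / 2) := by ring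
  rw [h3]
  exact h2

theorem hasDerivAt_arctan_sqrt {r s : ℝ} (hr : 0 < r) (hs : 0 < s) :
    HasDerivAt (fun s => 2 / r * Real.arctan (√s / r)) (1 / (√s * (s + r ^ 2))) s := by
  have h := (((Real.hasDerivAt_sqrt hs.ne').div_const r).arctan).const_mul (2 / r)
  refine h.congr_deriv ?_
  rw [div_pow, Real.sq_sqrt hs.le]
  have := Real.sqrt_pos.2 hs
  field_simp
  ring

theorem continuousWithinAt_arctan_sqrt (r : ℝ) :
    ContinuousWithinAt (fun s => 2 / r * Real.arctan (√s / r)) (Ici 0) 0 := by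
  refine Continuous.continuousWithinAt ?_
  exact continuous_const.mul (Real.continuous_arctan.comp (Real.continuous_sqrt.div_const r))

theorem integrableOn_inv_sqrt_mul {r : ℝ} (hr : 0 < r) :
    IntegrableOn (fun s => 1 / (√s * (s + r ^ 2))) (Ioi 0) :=
  integrableOn_Ioi_deriv_of_nonneg (continuousWithinAt_arctan_sqrt r)
    (fun _ hs => hasDerivAt_arctan_sqrt hr hs)
    (fun s hs => by have : 0 < s := hs; positivity) (tendsto_arctan_sqrt hr)

theorem integral_inv_sqrt_mul {r : ℝ} (hr : 0 < r) :
    ∫ s in Ioi (0 : ℝ), 1 / (√s * (s + r ^ 2)) = Real.pi / r := by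
  rw [integral_Ioi_of_hasDerivAt_of_nonneg (continuousWithinAt_arctan_sqrt r)
    (fun _ hs => hasDerivAt_arctan_sqrt hr hs)
    (fun s hs => by have : 0 < s := hs; positivity) (tendsto_arctan_sqrt hr)]
  simp

theorem integrableOn_heatFDeriv {x : Plane} (hx : ∀ i, |x i| ≤ 1 / 2) (h0 : x ≠ 0) :
    IntegrableOn (fun s => heatFDeriv s x) (Ioi 0) := by
  refine Integrable.mono' ((integrableOn_inv_sqrt_mul (norm_pos_iff.2 h0)).const_mul
    (2 * gradConst)) ((continuousOn_heatFDeriv_left x).aestronglyMeasurable measurableSet_Ioi) ?_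
  filter_upwards [ae_restrict_mem measurableSet_Ioi] with s hs
  exact norm_heatFDeriv_le hs hx

theorem hasFDerivAt_green {x : Plane} (hx : ∀ i, |x i| < 1 / 2) (h0 : x ≠ 0) :
    HasFDerivAt green (∫ s in Ioi (0 : ℝ), heatFDeriv s x) x := by
  have hr : 0 < ‖x‖ := norm_pos_iff.2 h0
  have hopen : IsOpen {y : Plane | ∀ i, |y i| < 1 / 2} := by
    simp only [ofPred_forall]
    exact isOpen_iInter_of_finite fun i => isOpen_lt (by fun_prop) continuous_const
  -- On this neighbourhood `‖y‖` is bounded below by `‖x‖ / 2`, so one integrable function of `s`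
  -- dominates all the derivatives.
  have hs : {y : Plane | (∀ i, |y i| < 1 / 2) ∧ ‖x‖ / 2 < ‖y‖} ∈ 𝓝 x :=
    (hopen.inter (isOpen_lt continuous_const continuous_norm)).mem_nhds ⟨hx, by
      simp only [mem_ofPred_eq]; linarith⟩
  refine hasFDerivAt_integral_of_dominated_of_fderiv_le (F := fun y s => heatKernel s y - 1)
    (F' := fun y s => heatFDeriv s y)
    (bound := fun s => 2 * gradConst * (1 / (√s * (s + (‖x‖ / 2) ^ 2)))) hs ?_ ?_ ?_ ?_ ?_ ?_
  · exact Eventually.of_forall fun y => ((continuousOn_heatKernel_left y).sub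
      continuousOn_const).aestronglyMeasurable measurableSet_Ioi
  · exact integrableOn_heatKernel_sub_one (fun i => (hx i).le) h0
  · exact (continuousOn_heatFDeriv_left x).aestronglyMeasurable measurableSet_Ioi
  · filter_upwards [ae_restrict_mem measurableSet_Ioi] with s hs y hy
    have hs0 : 0 < s := hs
    refine (norm_heatFDeriv_le hs fun i => (hy.1 i).le).trans ?_
    have := gradConst_pos
    have := Real.sqrt_pos.2 hs0
    have := hy.2
    gcongr
  · exact (integrableOn_inv_sqrt_mul (half_pos hr)).const_mul _
  · filter_upwards [ae_restrict_mem measurableSet_Ioi] with s hs y _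
    exact (hasFDerivAt_heatKernel hs y).sub_const 1

theorem norm_fderiv_green_le {x : Plane} (hx : ∀ i, |x i| < 1 / 2) (h0 : x ≠ 0) :
    ‖fderiv ℝ green x‖ ≤ 2 * gradConst * Real.pi / ‖x‖ := by
  rw [(hasFDerivAt_green hx h0).fderiv]
  refine (norm_integral_le_of_norm_le ((integrableOn_inv_sqrt_mul (norm_pos_iff.2 h0)).const_mul
    (2 * gradConst)) ?_).trans_eq ?_
  · filter_upwards [ae_restrict_mem measurableSet_Ioi] with s hs
    exact norm_heatFDeriv_le hs fun i => (hx i).le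
  · rw [integral_const_mul, integral_inv_sqrt_mul (norm_pos_iff.2 h0), mul_div_assoc]

theorem gradient_apply (f : Plane → ℝ) (x : Plane) (i : Fin 2) :
    gradient f x i = fderiv ℝ f x (EuclideanSpace.single i 1) := by
  rw [← toDual_gradient, InnerProductSpace.toDual_apply_apply, EuclideanSpace.inner_single_right]
  simp

theorem norm_gradient (f : Plane → ℝ) (x : Plane) : ‖gradient f x‖ = ‖fderiv ℝ f x‖ := by
  rw [← toDual_gradient, LinearIsometryEquiv.norm_map]

theorem norm_biotSavartKernel (x : Plane) : ‖biotSavartKernel x‖ = ‖fderiv ℝ green x‖ := by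
  rw [← norm_gradient, ← sq_eq_sq₀ (norm_nonneg _) (norm_nonneg _), plane_norm_sq, plane_norm_sq]
  simp [biotSavartKernel]
  ring

theorem fderiv_apply_eq (g : Plane →L[ℝ] ℝ) (v : Plane) :
    g v = g (EuclideanSpace.single 0 1) * v 0 + g (EuclideanSpace.single 1 1) * v 1 := by
  have : v = v 0 • EuclideanSpace.single (0 : Fin 2) (1 : ℝ) +
      v 1 • EuclideanSpace.single (1 : Fin 2) (1 : ℝ) := by
    ext i
    fin_cases i <;> simp
  conv_lhs => rw [this]
  simp [mul_comm]

/-- The rotation is transposed from the kernel onto the covector, so that only the gradient of the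
Green function remains, and with it a time integral of heat kernels. -/
theorem fderiv_biotSavartKernel (g : Plane →L[ℝ] ℝ) (x : Plane) :
    g (biotSavartKernel x) =
      fderiv ℝ green x (!₂[-(g (EuclideanSpace.single 1 1)), g (EuclideanSpace.single 0 1)]) := by
  rw [fderiv_apply_eq g, fderiv_apply_eq (fderiv ℝ green x)]
  simp [biotSavartKernel, gradient_apply]
  ring

theorem measurable_biotSavartKernel : Measurable biotSavartKernel := by
  have h : ∀ i, Measurable fun x => gradient green x i := fun i => by
    simp only [gradient_apply]
    exact measurable_fderiv_apply_const ℝ green _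
  unfold biotSavartKernel
  refine (MeasurableEquiv.toLp 2 (Fin 2 → ℝ)).measurable.comp ?_
  rw [measurable_pi_iff]
  intro i
  fin_cases i
  · exact h 1
  · exact (h 0).neg

theorem periodic2_heatKernel (s : ℝ) : Periodic2 (heatKernel s) := by
  intro i x
  unfold heatKernel
  refine tsum_congr fun k => ?_
  congr 1
  fin_cases i
  · simp only [Fin.zero_eta, PiLp.add_apply, PiLp.single_apply]
    have : 2 * Real.pi * ((k.1 : ℝ) * (x 0 + 1) + (k.2 : ℝ) * x 1) =
      2 * Real.pi * ((k.1 : ℝ) * x 0 + (k.2 : ℝ) * x 1) + k.1 * (2 * Real.pi) := by ring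
    simp [this, Real.cos_add_int_mul_two_pi]
  · simp only [Fin.mk_one, PiLp.add_apply, PiLp.single_apply]
    have : 2 * Real.pi * ((k.1 : ℝ) * x 0 + (k.2 : ℝ) * (x 1 + 1)) =
      2 * Real.pi * ((k.1 : ℝ) * x 0 + (k.2 : ℝ) * x 1) + k.2 * (2 * Real.pi) := by ring
    simp [this, Real.cos_add_int_mul_two_pi]

theorem periodic2_green : Periodic2 green := fun i x => by
  unfold green
  simp only [periodic2_heatKernel _ i x]

theorem Periodic2.fderiv {f : Plane → ℝ} (hf : Periodic2 f) : Periodic2 (_root_.fderiv ℝ f) := by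
  intro i x
  rw [← fderiv_comp_add_right]
  congr 1
  exact funext fun y => hf i y

theorem periodic2_biotSavartKernel : Periodic2 biotSavartKernel := fun i x => by
  unfold biotSavartKernel
  simp only [gradient_apply, periodic2_green.fderiv i x]

theorem norm_le_two_of_mem_cell {x : Plane} (hx : x ∈ cell) : ‖x‖ ≤ 2 := by
  have h := plane_norm_sq x
  have h0 := hx 0
  have h1 := hx 1
  nlinarith [h0.1, h0.2, h1.1, h1.2, norm_nonneg x]

/-! ### The Biot-Savart kernel: weak integrability and vanishing divergence. -/

/-- On the torus, the integral of a directional derivative vanishes. -/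
theorem integral_torus_lineDeriv_eq_zero {f f' : Plane → ℝ} (v : Plane) (hf : Periodic2 f)
    (hc : Continuous f) (hc' : Continuous f')
    (hd : ∀ x, HasDerivAt (fun a : ℝ => f (x + a • v)) (f' x) 0) :
    ∫ x, f' x ∂torusMeasure = 0 := by
  obtain ⟨C, hC⟩ := (isCompact_closedBall (0 : Plane) (2 + ‖v‖)).exists_bound_of_continuousOn
    hc'.continuousOn
  have hd' : ∀ x a, HasDerivAt (fun a : ℝ => f (x + a • v)) (f' (x + a • v)) a := by
    intro x a
    have h := hd (x + a • v)
    rw [← sub_self a] at h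
    refine (h.comp_sub_const a a).congr_of_eventuallyEq (Eventually.of_forall fun b => ?_)
    simp only [sub_smul]
    congr 1
    abel
  obtain ⟨C₀, hC₀⟩ := (isCompact_closedBall (0 : Plane) 2).exists_bound_of_continuousOn
    hc.continuousOn
  have h := hasDerivAt_integral_of_dominated_loc_of_deriv_le (μ := torusMeasure)
    (F := fun (a : ℝ) x => f (x + a • v)) (F' := fun a x => f' (x + a • v)) (x₀ := 0)
    (s := Metric.ball 0 1) (bound := fun _ => C) (Metric.ball_mem_nhds 0 one_pos)
    (Eventually.of_forall fun a => by
      exact (hc.comp (by fun_prop : Continuous fun x : Plane => x + a • v)).aestronglyMeasurable)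
    (Integrable.of_bound (by
      exact (hc.comp (by fun_prop : Continuous fun x : Plane => x + (0 : ℝ) • v)).aestronglyMeasurable)
      C₀ (by
        filter_upwards [ae_restrict_mem measurableSet_cell] with x hx
        refine hC₀ _ ?_
        simpa using norm_le_two_of_mem_cell hx))
    (by exact (hc'.comp (by fun_prop : Continuous fun x : Plane => x + (0 : ℝ) • v)).aestronglyMeasurable)
    (by
      filter_upwards [ae_restrict_mem measurableSet_cell] with x hx a ha
      refine hC _ ?_
      rw [mem_closedBall_zero_iff]
      rw [mem_ball_zero_iff, Real.norm_eq_abs] at ha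
      refine (norm_add_le _ _).trans (add_le_add (norm_le_two_of_mem_cell hx) ?_)
      rw [norm_smul]
      exact mul_le_of_le_one_left (norm_nonneg _) ha.le)
    (integrable_const C)
    (ae_of_all _ fun x a _ => hd' x a)
  have h2 := h.2
  -- By translation invariance the integral of `f (x + a • v)` does not depend on `a`, while its
  -- derivative at `a = 0` is the integral of `f'`.
  simp only [integral_torus_add hf] at h2
  have h3 := h2.unique (hasDerivAt_const 0 _)
  simpa using h3

theorem theta_add_one (s a : ℝ) : theta s (a + 1) = theta s a := by
  refine tsum_congr fun n => ?_
  have : 2 * Real.pi * ((n : ℝ) * (a + 1)) = 2 * Real.pi * (n * a) + n * (2 * Real.pi) := by ring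
  rw [this, Real.cos_add_int_mul_two_pi]

theorem thetaDeriv_add_one (s a : ℝ) : thetaDeriv s (a + 1) = thetaDeriv s a := by
  refine tsum_congr fun n => ?_
  have : 2 * Real.pi * ((n : ℝ) * (a + 1)) = 2 * Real.pi * (n * a) + n * (2 * Real.pi) := by ring
  rw [this, Real.sin_add_int_mul_two_pi]

theorem continuous_theta {s : ℝ} (hs : 0 < s) : Continuous (theta s) :=
  continuous_iff_continuousAt.2 fun a => (hasDerivAt_theta hs a).continuousAt

theorem continuous_thetaDeriv {s : ℝ} (hs : 0 < s) : Continuous (thetaDeriv s) := by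
  rw [← continuousOn_univ]
  exact continuousOn_thetaDeriv.comp (f := fun a => (s, a)) (by fun_prop) fun _ _ => ⟨hs, mem_univ _⟩

/-- The rotated gradient. -/
def rotGrad (g : Plane → ℝ) (x : Plane) : Plane :=
  !₂[-(fderiv ℝ g x (EuclideanSpace.single 1 1)), fderiv ℝ g x (EuclideanSpace.single 0 1)]

theorem continuous_rotGrad {g : Plane → ℝ} (hg : ContDiff ℝ 1 g) : Continuous (rotGrad g) := by
  have h := hg.continuous_fderiv (by simp)
  unfold rotGrad
  refine (PiLp.continuous_toLp 2 _).comp ?_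
  rw [continuous_pi_iff]
  intro i
  fin_cases i
  · exact (h.clm_apply continuous_const).neg
  · exact h.clm_apply continuous_const

/-- The integrand is the difference of two exact derivatives, of `θ(x₀) g θ'(x₁)` in direction 0 and
of `θ(x₁) g θ'(x₀)` in direction 1: the terms `θ'(x₀) θ'(x₁) g` cancel. In this arrangement neither
`g` nor the theta function is differentiated twice. -/
theorem integral_heatFDeriv_rotGrad {s : ℝ} (hs : 0 < s) {g : Plane → ℝ} (hg : ContDiff ℝ 1 g)
    (hp : Periodic2 g) : ∫ x, heatFDeriv s x (rotGrad g x) ∂torusMeasure = 0 := by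
  have hθ := continuous_theta hs
  have hθ' := continuous_thetaDeriv hs
  have hgc := hg.continuous
  have hgd := hg.continuous_fderiv (by simp)
  have hx : ∀ i : Fin 2, Continuous fun x : Plane => x i := fun i => by fun_prop
  have hg1 : ∀ (x v : Plane), HasDerivAt (fun a : ℝ => g (x + a • v)) (fderiv ℝ g x v) 0 := by
    intro x v
    have h1 : HasFDerivAt g (fderiv ℝ g x) (x + (0 : ℝ) • v) := by
      simpa using ((hg.differentiable (by simp)) x).hasFDerivAt
    have h2 : HasDerivAt (fun a : ℝ => x + a • v) v 0 := by
      simpa using ((hasDerivAt_id (0 : ℝ)).smul_const v).const_add x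
    exact h1.comp_hasDerivAt 0 h2
  have hθ1 : ∀ x : Plane, ∀ i : Fin 2, HasDerivAt
      (fun a : ℝ => theta s ((x + a • EuclideanSpace.single i (1 : ℝ) : Plane) i))
      (thetaDeriv s (x i)) 0 := by
    intro x i
    have h2 : HasDerivAt (fun a : ℝ => (x + a • EuclideanSpace.single i (1 : ℝ) : Plane) i) 1 0 := by
      simpa using (hasDerivAt_id (0 : ℝ)).const_add (x i)
    have h1 : HasDerivAt (theta s) (thetaDeriv s (x i))
        ((x + (0 : ℝ) • EuclideanSpace.single i (1 : ℝ) : Plane) i) := by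
      simpa using hasDerivAt_theta hs (x i)
    simpa [Function.comp_def] using h1.comp 0 h2
  have e0 : ∫ x : Plane, (thetaDeriv s (x 0) * g x + theta s (x 0) *
      fderiv ℝ g x (EuclideanSpace.single 0 1)) * thetaDeriv s (x 1) ∂torusMeasure = 0 := by
    refine integral_torus_lineDeriv_eq_zero (f := fun x => theta s (x 0) * g x * thetaDeriv s (x 1))
      (EuclideanSpace.single 0 1) ?_ (by fun_prop) (by fun_prop) fun x => ?_
    · intro i x
      simp only [hp i x]
      fin_cases i <;> simp [theta_add_one, thetaDeriv_add_one]
    · have := ((hθ1 x 0).mul (hg1 x (EuclideanSpace.single 0 1))).mul_const (thetaDeriv s (x 1))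
      simpa using this
  have e1 : ∫ x : Plane, (thetaDeriv s (x 1) * g x + theta s (x 1) *
      fderiv ℝ g x (EuclideanSpace.single 1 1)) * thetaDeriv s (x 0) ∂torusMeasure = 0 := by
    refine integral_torus_lineDeriv_eq_zero (f := fun x => theta s (x 1) * g x * thetaDeriv s (x 0))
      (EuclideanSpace.single 1 1) ?_ (by fun_prop) (by fun_prop) fun x => ?_
    · intro i x
      simp only [hp i x]
      fin_cases i <;> simp [theta_add_one, thetaDeriv_add_one]
    · have := ((hθ1 x 1).mul (hg1 x (EuclideanSpace.single 1 1))).mul_const (thetaDeriv s (x 0))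
      simpa using this
  have hint : ∀ F : Plane → ℝ, Continuous F → Integrable F torusMeasure := by
    intro F hF
    obtain ⟨C, hC⟩ := (isCompact_closedBall (0 : Plane) 2).exists_bound_of_continuousOn hF.continuousOn
    refine Integrable.of_bound hF.aestronglyMeasurable C ?_
    filter_upwards [ae_restrict_mem measurableSet_cell] with x hx
    exact hC x (by simpa using norm_le_two_of_mem_cell hx)
  have e2 := integral_sub (hint _ (by fun_prop : Continuous fun x : Plane =>
    (thetaDeriv s (x 0) * g x + theta s (x 0) *
      fderiv ℝ g x (EuclideanSpace.single 0 1)) * thetaDeriv s (x 1)))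
    (hint _ (by fun_prop : Continuous fun x : Plane => (thetaDeriv s (x 1) * g x + theta s (x 1) *
      fderiv ℝ g x (EuclideanSpace.single 1 1)) * thetaDeriv s (x 0)))
  rw [e0, e1, sub_zero] at e2
  rw [← e2]
  congr 1
  funext x
  simp [heatFDeriv, rotGrad]
  ring

/-- The centre of the cell. -/
def centre : Plane := !₂[1 / 2, 1 / 2]

theorem volume_coord_eq_zero (i : Fin 2) : volume {x : Plane | x i = 0} = 0 := by
  have h : {x : Plane | x i = 0} =
      (LinearMap.ker (EuclideanSpace.proj (𝕜 := ℝ) i : Plane →L[ℝ] ℝ).toLinearMap : Set Plane) := by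
    ext x; simp
  rw [h]
  refine Measure.addHaar_submodule _ _ fun htop => ?_
  have : EuclideanSpace.single i (1 : ℝ) ∈
      LinearMap.ker (EuclideanSpace.proj (𝕜 := ℝ) i : Plane →L[ℝ] ℝ).toLinearMap := by
    rw [htop]; trivial
  simp at this

/-- The cell has the singularity of the kernel at a corner. Shifting by its centre brings almost
every point into the punctured open square where the local bounds hold. -/
theorem ae_torus_centred : ∀ᵐ x ∂torusMeasure,
    (∀ i, |(x - centre) i| < 1 / 2) ∧ x - centre ≠ 0 := by
  have h1 : ∀ i : Fin 2, ∀ᵐ x : Plane ∂torusMeasure, x i ≠ 0 := fun i => by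
    refine ae_torus_of_ae_plane ?_
    rw [ae_iff]
    simpa using volume_coord_eq_zero i
  have h2 : ∀ᵐ x : Plane ∂torusMeasure, x ≠ centre :=
    ae_torus_of_ae_plane (Measure.ae_ne volume centre)
  filter_upwards [h1 0, h1 1, h2, ae_restrict_mem measurableSet_cell] with x hx0 hx1 hx2 hx
  refine ⟨fun i => ?_, sub_ne_zero.2 hx2⟩
  have h3 := hx i
  have h4 : x i ≠ 0 := by fin_cases i <;> assumption
  have h5 : 0 < x i := lt_of_le_of_ne h3.1 h4.symm
  have h6 : centre i = 1 / 2 := by fin_cases i <;> simp [centre]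
  rw [PiLp.sub_apply, h6, abs_lt]
  constructor <;> linarith [h3.2]

/-- The Biot-Savart kernel is in weak `L²`. -/
theorem measure_lt_norm_biotSavartKernel_le : ∃ D : ℝ, 0 < D ∧ ∀ τ : ℝ, 0 < τ →
    torusMeasure {x | τ < ‖biotSavartKernel x‖} ≤ ENNReal.ofReal (D / τ ^ 2) := by
  set C := 2 * gradConst * Real.pi with hC
  have hC0 : 0 < C := by have := gradConst_pos; positivity
  refine ⟨C ^ 2 * Real.pi, by positivity, fun τ hτ => ?_⟩
  have hp : Periodic2 fun x => {x | τ < ‖biotSavartKernel x‖}.indicator (fun _ => (1 : ENNReal)) x := by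
    intro i x
    simp only [indicator_apply, mem_ofPred_eq, periodic2_biotSavartKernel i x]
  -- After the shift, the superlevel set is contained, up to a null set, in the disc of radius `C /
  -- τ`, of area `π C² / τ²`.
  have hm : MeasurableSet {x | τ < ‖biotSavartKernel x‖} :=
    measurableSet_lt measurable_const measurable_biotSavartKernel.norm
  have h1 := lintegral_torus_sub hp centre
  rw [lintegral_indicator_const hm, one_mul] at h1
  rw [← h1]
  calc ∫⁻ x, {x | τ < ‖biotSavartKernel x‖}.indicator (fun _ => (1 : ENNReal)) (x - centre) ∂torusMeasure
      ≤ ∫⁻ x, (Metric.ball centre (C / τ)).indicator (fun _ => (1 : ENNReal)) x ∂torusMeasure := by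
        refine lintegral_mono_ae ?_
        filter_upwards [ae_torus_centred] with x hx
        by_cases h3 : τ < ‖biotSavartKernel (x - centre)‖
        · rw [indicator_of_mem (s := Metric.ball centre (C / τ))]
          · exact indicator_le_self' (fun _ _ => zero_le_one) _
          · rw [mem_ball_iff_norm]
            have h5 := norm_fderiv_green_le hx.1 hx.2
            rw [← norm_biotSavartKernel, ← hC] at h5
            have h6 := h3.trans_le h5
            have h7 := norm_pos_iff.2 hx.2
            rw [lt_div_iff₀ h7] at h6
            rw [lt_div_iff₀ hτ]
            linarith
        · rw [indicator_of_notMem (s := {x | τ < ‖biotSavartKernel x‖}) h3]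
          exact zero_le
    _ = torusMeasure (Metric.ball centre (C / τ)) := by
        rw [lintegral_indicator_const Metric.isOpen_ball.measurableSet, one_mul]
    _ ≤ volume (Metric.ball centre (C / τ)) := Measure.restrict_apply_le _ _
    _ = _ := by
        rw [EuclideanSpace.volume_ball_fin_two, ← ENNReal.ofReal_pow (by positivity),
          ← ENNReal.ofReal_mul (by positivity)]
        congr 1
        field_simp

theorem integrable_inv_norm_sub_centre :
    Integrable (fun x : Plane => ‖x - centre‖⁻¹) torusMeasure := by
  have h : LocallyIntegrable (fun x : Plane => ‖x‖⁻¹) volume := by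
    refine locallyIntegrable_of_norm_le_rpow (C := 1) (α := 1) (by simp) (by simp) ?_
      (by fun_prop : Measurable fun x : Plane => ‖x‖⁻¹).aestronglyMeasurable
    filter_upwards with x
    rw [Real.rpow_neg_one, one_mul, norm_inv, norm_norm]
  have h2 : IntegrableOn (fun x : Plane => ‖x‖⁻¹) (Metric.closedBall 0 (2 + ‖centre‖)) :=
    h.integrableOn_isCompact (isCompact_closedBall _ _)
  have h3 := (measurePreserving_sub_right (volume : Measure Plane) centre).integrableOn_comp_preimage
    (measurableEmbedding_subRight centre) (f := fun x : Plane => ‖x‖⁻¹)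
    (s := Metric.closedBall 0 (2 + ‖centre‖))
  refine (h3.2 h2).mono_set fun x hx => ?_
  simp only [mem_preimage, mem_closedBall_zero_iff]
  exact (norm_sub_le _ _).trans (add_le_add (norm_le_two_of_mem_cell hx) le_rfl)

theorem fderiv_biotSavartKernel_eq (g : Plane → ℝ) (x : Plane) :
    fderiv ℝ g x (biotSavartKernel x) = fderiv ℝ green x (rotGrad g x) :=
  fderiv_biotSavartKernel (fderiv ℝ g x) x

theorem periodic2_rotGrad {g : Plane → ℝ} (hp : Periodic2 g) : Periodic2 (rotGrad g) := fun i x => by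
  unfold rotGrad
  simp only [hp.fderiv i x]

theorem periodic2_heatFDeriv (s : ℝ) : Periodic2 (heatFDeriv s) := fun i x => by
  unfold heatFDeriv
  fin_cases i <;> simp [theta_add_one, thetaDeriv_add_one]

/-- The Biot-Savart kernel is divergence free in the sense of distributions. -/
theorem integral_fderiv_biotSavartKernel {g : Plane → ℝ} (hg : ContDiff ℝ 1 g)
    (hp : Periodic2 g) : ∫ x, fderiv ℝ g x (biotSavartKernel x) ∂torusMeasure = 0 := by
  simp only [fderiv_biotSavartKernel_eq]
  have hper : Periodic2 fun x => fderiv ℝ green x (rotGrad g x) :=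
    (periodic2_green.fderiv).comp₂ (periodic2_rotGrad hp) fun a b => a b
  have hJ := continuous_rotGrad hg
  obtain ⟨B, hB⟩ := (isCompact_closedBall (0 : Plane) (2 + ‖centre‖)).exists_bound_of_continuousOn
    hJ.continuousOn
  have hB' : ∀ x ∈ cell, ‖rotGrad g (x - centre)‖ ≤ B := fun x hx => hB _ (by
    rw [mem_closedBall_zero_iff]
    exact (norm_sub_le _ _).trans (add_le_add (norm_le_two_of_mem_cell hx) le_rfl))
  rw [← integral_torus_sub hper centre]
  have h1 : ∫ x, fderiv ℝ green (x - centre) (rotGrad g (x - centre)) ∂torusMeasure =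
      ∫ x, (∫ s in Ioi (0 : ℝ), heatFDeriv s (x - centre) (rotGrad g (x - centre)))
        ∂torusMeasure := by
    refine integral_congr_ae ?_
    filter_upwards [ae_torus_centred] with x hx
    rw [(hasFDerivAt_green hx.1 hx.2).fderiv,
      ContinuousLinearMap.integral_apply (integrableOn_heatFDeriv (fun i => (hx.1 i).le) hx.2)]
  -- After Fubini each time slice vanishes. Absolute integrability holds because the time integral
  -- of the majorant is a multiple of `1 / ‖x - centre‖`, which is integrable in the plane.
  rw [h1, integral_integral_swap]
  · rw [setIntegral_congr_fun (g := fun _ => 0) measurableSet_Ioi]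
    · simp
    · intro s hs
      simp only
      rw [integral_torus_sub (f := fun x => heatFDeriv s x (rotGrad g x))
        ((periodic2_heatFDeriv s).comp₂ (periodic2_rotGrad hp) fun a b => a b) centre]
      exact integral_heatFDeriv_rotGrad hs hg hp
  · have hmeas : AEStronglyMeasurable (fun z : Plane × ℝ =>
        heatFDeriv z.2 (z.1 - centre) (rotGrad g (z.1 - centre)))
        (torusMeasure.prod (volume.restrict (Ioi 0))) := by
      have hμ : torusMeasure.prod (volume.restrict (Ioi (0 : ℝ))) =
          ((volume : Measure Plane).prod volume).restrict (cell ×ˢ Ioi 0) := by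
        rw [torusMeasure, Measure.prod_restrict]
      rw [hμ]
      have hθ : ∀ i : Fin 2, ContinuousOn (fun z : Plane × ℝ => theta z.2 ((z.1 - centre) i))
          (cell ×ˢ Ioi 0) := fun i =>
        continuousOn_theta.comp (f := fun z : Plane × ℝ => (z.2, (z.1 - centre) i)) (by fun_prop)
          fun z hz => ⟨hz.2, mem_univ _⟩
      have hθ' : ∀ i : Fin 2, ContinuousOn (fun z : Plane × ℝ => thetaDeriv z.2 ((z.1 - centre) i))
          (cell ×ˢ Ioi 0) := fun i =>
        continuousOn_thetaDeriv.comp (f := fun z : Plane × ℝ => (z.2, (z.1 - centre) i))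
          (by fun_prop) fun z hz => ⟨hz.2, mem_univ _⟩
      refine ContinuousOn.aestronglyMeasurable ?_ (measurableSet_cell.prod measurableSet_Ioi)
      refine ContinuousOn.clm_apply (((hθ' 0).mul (hθ 1)).smul continuousOn_const |>.add
        (((hθ 0).mul (hθ' 1)).smul continuousOn_const)) ?_
      exact (hJ.comp (by fun_prop)).continuousOn
    have hbound : ∀ᵐ x ∂torusMeasure, ∀ s > (0 : ℝ),
        ‖heatFDeriv s (x - centre) (rotGrad g (x - centre))‖ ≤
          2 * gradConst * B * (1 / (√s * (s + ‖x - centre‖ ^ 2))) := by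
      filter_upwards [ae_torus_centred, ae_restrict_mem measurableSet_cell] with x hx hxc s hs
      refine (ContinuousLinearMap.le_opNorm _ _).trans ?_
      refine (mul_le_mul (norm_heatFDeriv_le hs fun i => (hx.1 i).le) (hB' x hxc) (norm_nonneg _)
        ?_).trans_eq (by ring)
      have := gradConst_pos
      positivity
    refine (integrable_prod_iff hmeas).2 ⟨?_, ?_⟩
    · filter_upwards [ae_torus_centred] with x hx
      exact (integrableOn_heatFDeriv (fun i => (hx.1 i).le) hx.2).apply_continuousLinearMap _
    · refine Integrable.mono' (integrable_inv_norm_sub_centre.const_mul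
        (2 * gradConst * B * Real.pi)) hmeas.norm.integral_prod_right' ?_
      filter_upwards [ae_torus_centred, hbound] with x hx hb
      have hr := norm_pos_iff.2 hx.2
      have h3 : ‖∫ s in Ioi (0 : ℝ), ‖heatFDeriv s (x - centre) (rotGrad g (x - centre))‖‖ ≤
          ∫ s in Ioi (0 : ℝ), 2 * gradConst * B * (1 / (√s * (s + ‖x - centre‖ ^ 2))) := by
        refine norm_integral_le_of_norm_le ((integrableOn_inv_sqrt_mul hr).const_mul _) ?_
        filter_upwards [ae_restrict_mem measurableSet_Ioi] with s hs
        rw [norm_norm]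
        exact hb s hs
      refine h3.trans_eq ?_
      rw [integral_const_mul, integral_inv_sqrt_mul hr]
      ring

/-! ### The Hardy-Littlewood-Sobolev inequality for kernels in weak `L²`. -/

theorem lintegral_Ioc_rpow {a τ : ℝ} (ha : -1 < a) (hτ : 0 ≤ τ) :
    ∫⁻ t in Ioc 0 τ, ENNReal.ofReal (t ^ a) = ENNReal.ofReal (τ ^ (a + 1) / (a + 1)) := by
  have hi : IntegrableOn (fun t : ℝ => t ^ a) (Ioc 0 τ) := by
    rw [← intervalIntegrable_iff_integrableOn_Ioc_of_le hτ]
    exact intervalIntegral.intervalIntegrable_rpow' ha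
  rw [← ofReal_integral_eq_lintegral_ofReal hi]
  · rw [← intervalIntegral.integral_of_le hτ, integral_rpow (Or.inl ha),
      Real.zero_rpow (by linarith), sub_zero]
  · filter_upwards [ae_restrict_mem measurableSet_Ioc] with t ht
    exact Real.rpow_nonneg ht.1.le a

theorem lintegral_Ioi_rpow {a τ : ℝ} (ha : a < -1) (hτ : 0 < τ) :
    ∫⁻ t in Ioi τ, ENNReal.ofReal (t ^ a) = ENNReal.ofReal (-τ ^ (a + 1) / (a + 1)) := by
  rw [← ofReal_integral_eq_lintegral_ofReal (integrableOn_Ioi_rpow_of_lt ha hτ)]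
  · rw [integral_Ioi_rpow_of_lt ha hτ]
  · filter_upwards [ae_restrict_mem measurableSet_Ioi] with t ht
    exact Real.rpow_nonneg (hτ.trans ht).le a

section weak

variable {α : Type*} [MeasurableSpace α] {μ : Measure α} {κ : α → ℝ} {D : ℝ}

/-- Layer cake: levels below `τ` see the set where `κ > τ`, of measure at most `D / τ²`, and levels
above see the tail of `D / t²`. Each part contributes `D / τ`. -/
theorem lintegral_indicator_lt_le (hκ : Measurable κ) (hκ0 : ∀ x, 0 ≤ κ x) (hD : 0 < D)
    (hw : ∀ τ : ℝ, 0 < τ → μ {x | τ < κ x} ≤ ENNReal.ofReal (D / τ ^ 2)) {τ : ℝ} (hτ : 0 < τ) :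
    ∫⁻ x, ENNReal.ofReal ({x | τ < κ x}.indicator κ x) ∂μ ≤ ENNReal.ofReal (2 * D / τ) := by
  have hS : MeasurableSet {x | τ < κ x} := measurableSet_lt measurable_const hκ
  rw [lintegral_eq_lintegral_meas_lt μ (ae_of_all _ fun x => indicator_nonneg (fun x _ => hκ0 x) x)
    (hκ.indicator hS).aemeasurable, ← Ioc_union_Ioi_eq_Ioi hτ.le,
    lintegral_union measurableSet_Ioi (by
      rw [Set.disjoint_left]; intro x hx hx'; exact absurd hx.2 (not_le.2 hx'))]
  have hsub : ∀ t > (0 : ℝ), {x | t < {x | τ < κ x}.indicator κ x} ⊆ {x | τ < κ x} ∩ {x | t < κ x} := by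
    intro t ht x hx
    by_cases h : x ∈ {x | τ < κ x}
    · refine ⟨h, ?_⟩
      simpa [indicator_of_mem h] using hx
    · rw [mem_ofPred_eq, indicator_of_notMem h] at hx
      exact absurd hx (not_lt.2 ht.le)
  have h1 : ∫⁻ t in Ioc 0 τ, μ {x | t < {x | τ < κ x}.indicator κ x} ≤ ENNReal.ofReal (D / τ) := by
    calc _ ≤ ∫⁻ t in Ioc 0 τ, ENNReal.ofReal (D / τ ^ 2) := by
          refine setLIntegral_mono measurable_const fun t ht => ?_
          exact (measure_mono ((hsub t ht.1).trans inter_subset_left)).trans (hw τ hτ)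
      _ = _ := by
          rw [setLIntegral_const, Real.volume_Ioc, ← ENNReal.ofReal_mul (by positivity)]
          congr 1
          field_simp
          ring
  have h2 : ∫⁻ t in Ioi τ, μ {x | t < {x | τ < κ x}.indicator κ x} ≤ ENNReal.ofReal (D / τ) := by
    calc _ ≤ ∫⁻ t in Ioi τ, ENNReal.ofReal D * ENNReal.ofReal (t ^ (-2 : ℝ)) := by
          refine setLIntegral_mono (by fun_prop) fun t ht => ?_
          have ht0 : 0 < t := hτ.trans ht
          refine (measure_mono ((hsub t ht0).trans inter_subset_right)).trans ((hw t ht0).trans_eq ?_)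
          rw [← ENNReal.ofReal_mul hD.le, Real.rpow_neg ht0.le, div_eq_mul_inv]
          norm_num
      _ = _ := by
          rw [lintegral_const_mul _ (by fun_prop), lintegral_Ioi_rpow (by norm_num) hτ,
            ← ENNReal.ofReal_mul hD.le]
          congr 1
          norm_num
          rw [Real.rpow_neg_one, div_eq_mul_inv]
  refine (add_le_add h1 h2).trans_eq ?_
  rw [← ENNReal.ofReal_add (by positivity) (by positivity)]
  congr 1
  ring

/-- Only levels up to `τ` occur, and there `D t^(r-3)` is integrable at zero since `r > 2`. -/
theorem lintegral_indicator_le_rpow_le (hκ : Measurable κ) (hκ0 : ∀ x, 0 ≤ κ x) (hD : 0 < D)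
    (hw : ∀ τ : ℝ, 0 < τ → μ {x | τ < κ x} ≤ ENNReal.ofReal (D / τ ^ 2)) {τ : ℝ} (hτ : 0 < τ)
    {r : ℝ} (hr : 2 < r) :
    ∫⁻ x, ENNReal.ofReal ({x | κ x ≤ τ}.indicator κ x ^ r) ∂μ ≤
      ENNReal.ofReal (r * D / (r - 2) * τ ^ (r - 2)) := by
  have hS : MeasurableSet {x | κ x ≤ τ} := measurableSet_le hκ measurable_const
  rw [lintegral_rpow_eq_lintegral_meas_lt_mul μ
    (ae_of_all _ fun x => indicator_nonneg (fun x _ => hκ0 x) x)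
    (hκ.indicator hS).aemeasurable (by linarith), ← Ioc_union_Ioi_eq_Ioi hτ.le,
    lintegral_union measurableSet_Ioi (by
      rw [Set.disjoint_left]; intro x hx hx'; exact absurd hx.2 (not_le.2 hx'))]
  have h2 : ∫⁻ t in Ioi τ, μ {x | t < {x | κ x ≤ τ}.indicator κ x} * ENNReal.ofReal (t ^ (r - 1)) =
      0 := by
    rw [setLIntegral_congr_fun (g := fun _ => 0) measurableSet_Ioi]
    · simp
    · intro t ht
      have : {x | t < {x | κ x ≤ τ}.indicator κ x} = ∅ := by
        rw [eq_empty_iff_forall_notMem]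
        intro x hx
        rw [mem_ofPred_eq] at hx
        have ht0 : τ < t := ht
        by_cases h : x ∈ {x | κ x ≤ τ}
        · rw [indicator_of_mem h] at hx
          have : κ x ≤ τ := h
          linarith
        · rw [indicator_of_notMem h] at hx
          linarith
      simp [this]
  have h1 : ∫⁻ t in Ioc 0 τ, μ {x | t < {x | κ x ≤ τ}.indicator κ x} * ENNReal.ofReal (t ^ (r - 1)) ≤
      ENNReal.ofReal (D * (τ ^ (r - 2) / (r - 2))) := by
    calc _ ≤ ∫⁻ t in Ioc 0 τ, ENNReal.ofReal D * ENNReal.ofReal (t ^ (r - 3)) := by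
          refine setLIntegral_mono (by fun_prop) fun t ht => ?_
          have hsub : {x | t < {x | κ x ≤ τ}.indicator κ x} ⊆ {x | t < κ x} := fun x hx =>
            lt_of_lt_of_le hx (indicator_le_self' (fun x _ => hκ0 x) x)
          refine (mul_le_mul_left ((measure_mono hsub).trans (hw t ht.1)) _).trans_eq ?_
          have ht0 : 0 < t := ht.1
          have ht2 : 0 < t ^ 2 := pow_pos ht.1 2
          rw [← ENNReal.ofReal_mul (by positivity), ← ENNReal.ofReal_mul hD.le]
          congr 1
          have : t ^ (r - 1) = t ^ (r - 3) * t ^ 2 := by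
            rw [← Real.rpow_natCast, ← Real.rpow_add ht.1]
            congr 1
            push_cast
            ring
          rw [this]
          field_simp
      _ = _ := by
          rw [lintegral_const_mul _ (by fun_prop), lintegral_Ioc_rpow (by linarith) hτ.le,
            ← ENNReal.ofReal_mul hD.le]
          congr 3 <;> ring_nf
  rw [h2, add_zero]
  refine (mul_le_mul_right h1 _).trans_eq ?_
  rw [← ENNReal.ofReal_mul (by linarith)]
  congr 1
  ring

/-- Small levels cost only the total mass, and large levels are controlled by the weak bound because
`r < 2`. -/
theorem lintegral_rpow_lt_top_of_weak [IsFiniteMeasure μ] (hκ : Measurable κ) (hκ0 : ∀ x, 0 ≤ κ x)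
    (hD : 0 < D) (hw : ∀ τ : ℝ, 0 < τ → μ {x | τ < κ x} ≤ ENNReal.ofReal (D / τ ^ 2))
    {r : ℝ} (hr1 : 0 < r) (hr : r < 2) :
    ∫⁻ x, ENNReal.ofReal (κ x ^ r) ∂μ < ⊤ := by
  rw [lintegral_rpow_eq_lintegral_meas_lt_mul μ (ae_of_all _ hκ0) hκ.aemeasurable hr1,
    ← Ioc_union_Ioi_eq_Ioi zero_le_one,
    lintegral_union measurableSet_Ioi (by
      rw [Set.disjoint_left]; intro x hx hx'; exact absurd hx.2 (not_le.2 hx'))]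
  refine ENNReal.mul_lt_top ENNReal.ofReal_lt_top (ENNReal.add_lt_top.2 ⟨?_, ?_⟩)
  · calc _ ≤ ∫⁻ t in Ioc (0 : ℝ) 1, μ univ * ENNReal.ofReal (t ^ (r - 1)) := by
          refine setLIntegral_mono (by fun_prop) fun t ht => ?_
          gcongr
          exact subset_univ _
      _ < _ := by
          rw [lintegral_const_mul _ (by fun_prop), lintegral_Ioc_rpow (by linarith) zero_le_one]
          exact ENNReal.mul_lt_top (measure_lt_top μ _) ENNReal.ofReal_lt_top
  · calc _ ≤ ∫⁻ t in Ioi (1 : ℝ), ENNReal.ofReal D * ENNReal.ofReal (t ^ (r - 3)) := by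
          refine setLIntegral_mono (by fun_prop) fun t ht => ?_
          have ht0 : 0 < t := one_pos.trans ht
          refine (mul_le_mul_left (hw t ht0) _).trans_eq ?_
          rw [← ENNReal.ofReal_mul (by positivity), ← ENNReal.ofReal_mul hD.le]
          congr 1
          have : t ^ (r - 1) = t ^ (r - 3) * t ^ 2 := by
            rw [← Real.rpow_natCast, ← Real.rpow_add ht0]
            congr 1
            push_cast
            ring
          rw [this]
          field_simp
      _ < _ := by
          rw [lintegral_const_mul _ (by fun_prop), lintegral_Ioi_rpow (by linarith) one_pos]
          exact ENNReal.mul_lt_top ENNReal.ofReal_lt_top ENNReal.ofReal_lt_top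

end weak

/-- Convolution on the torus of nonnegative functions. -/
def torusConv (g k : Plane → ENNReal) (x : Plane) : ENNReal := ∫⁻ y, g (x - y) * k y ∂torusMeasure

theorem measurable_torusConv {g k : Plane → ENNReal} (hg : Measurable g) (hk : Measurable k) :
    Measurable (torusConv g k) :=
  Measurable.lintegral_prod_right' (f := fun z : Plane × Plane => g (z.1 - z.2) * k z.2)
    ((hg.comp (measurable_fst.sub measurable_snd)).mul (hk.comp measurable_snd))

theorem lintegral_torusConv {g k : Plane → ENNReal} (hg : Measurable g) (hp : Periodic2 g)
    (hk : Measurable k) :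
    ∫⁻ x, torusConv g k x ∂torusMeasure = (∫⁻ x, g x ∂torusMeasure) * ∫⁻ x, k x ∂torusMeasure := by
  unfold torusConv
  rw [lintegral_lintegral_swap ((hg.comp (measurable_fst.sub measurable_snd)).mul
    (hk.comp measurable_snd)).aemeasurable, ← lintegral_const_mul _ hk]
  refine lintegral_congr fun y => ?_
  rw [lintegral_mul_const _ (by fun_prop : Measurable fun x => g (x - y)), lintegral_torus_sub hp]

theorem torusConv_le_of_holder {g k : Plane → ENNReal} (hg : Measurable g) (hp : Periodic2 g)
    (hk : Measurable k) {p q : ℝ} (hpq : p.HolderConjugate q) (x : Plane) :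
    torusConv g k x ≤
      (∫⁻ x, g x ^ p ∂torusMeasure) ^ (1 / p) * (∫⁻ x, k x ^ q ∂torusMeasure) ^ (1 / q) := by
  have h := ENNReal.lintegral_mul_le_Lp_mul_Lq torusMeasure hpq
    (by fun_prop : Measurable fun y => g (x - y)).aemeasurable
    hk.aemeasurable
  rwa [lintegral_torus_sub_left (f := fun y => g y ^ p) (hp.comp fun t => t ^ p) x] at h

theorem torusConv_add_right {g k₁ k₂ : Plane → ENNReal} (hg : Measurable g) (hk₁ : Measurable k₁)
    (x : Plane) :
    torusConv g (k₁ + k₂) x = torusConv g k₁ x + torusConv g k₂ x := by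
  unfold torusConv
  rw [← lintegral_add_left (by fun_prop : Measurable fun y => g (x - y) * k₁ y)]
  simp only [Pi.add_apply, mul_add]

theorem torusConv_add_left {g₁ g₂ k : Plane → ENNReal} (hg : Measurable g₁) (hk : Measurable k)
    (x : Plane) :
    torusConv (g₁ + g₂) k x = torusConv g₁ k x + torusConv g₂ k x := by
  unfold torusConv
  rw [← lintegral_add_left (by fun_prop : Measurable fun y => g₁ (x - y) * k y)]
  simp only [Pi.add_apply, add_mul]

theorem torusConv_le_of_le {g k : Plane → ENNReal} (hk : Measurable k) {c : ENNReal}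
    (hc : ∀ x, g x ≤ c) (x : Plane) : torusConv g k x ≤ c * ∫⁻ x, k x ∂torusMeasure := by
  rw [← lintegral_const_mul _ hk]
  exact lintegral_mono fun y => mul_le_mul_left (hc _) _

section HardyLittlewoodSobolev

variable {κ : Plane → ℝ} {D p q : ℝ}

/-- Both factors are truncated at heights adapted to `t`: `κ` at `τ` and `g` at `ν`. The low part of
`κ` is handled by Hölder, the low part of `g` against the high part of `κ` by the sup bound, each
contributing at most `t / 3`; only high against high is left for Chebyshev. Keeping the truncated
integral of `g` on the right leads directly to the strong inequality, without an interpolation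
theorem. -/
theorem measure_lt_torusConv_le (hκ : Measurable κ) (hκ0 : ∀ x, 0 ≤ κ x) (hD : 0 < D)
    (hw : ∀ τ : ℝ, 0 < τ → torusMeasure {x | τ < κ x} ≤ ENNReal.ofReal (D / τ ^ 2))
    (hp1 : 1 < p) (hp2 : p < 2) (hq : q = 2 * p / (2 - p)) :
    ∃ E > 0, ∀ g : Plane → ℝ, Measurable g → Periodic2 g → (∀ x, 0 ≤ g x) →
      ∫⁻ x, ENNReal.ofReal (g x ^ p) ∂torusMeasure ≤ 1 → ∀ t : ℝ, 0 < t →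
      torusMeasure {x | ENNReal.ofReal t <
        torusConv (fun x => ENNReal.ofReal (g x)) (fun x => ENNReal.ofReal (κ x)) x} ≤
      ENNReal.ofReal (1 / (E * t ^ (1 + q / 2))) * ∫⁻ x,
        ENNReal.ofReal ({x | E * t ^ (1 + q / 2) < g x}.indicator g x) ∂torusMeasure := by
  have h2p : 0 < 2 - p := by linarith
  have hq0 : 0 < q := by rw [hq]; positivity
  set p' := p / (p - 1) with hp'
  have hpp : p.HolderConjugate p' := Real.HolderConjugate.conjExponent hp1
  have hp'2 : 2 < p' := by rw [hp', lt_div_iff₀ (by linarith)]; linarith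
  have hexp : (p' - 2) * (1 / p') = 2 / q := by
    rw [hq, hp']
    have : p - 1 ≠ 0 := by linarith
    field_simp
    ring
  -- The Hölder bound on the low part of the kernel is `c₁ τ^(2/q)`, and `c₂` is chosen so that this
  -- equals `t / 3`. The truncation height `ν = t τ / (6 D)` makes `ν * (2 D / τ)` equal to `t / 3`
  -- as well.
  set c₁ := (p' * D / (p' - 2)) ^ (1 / p') with hc₁
  have hc₁0 : 0 < c₁ := Real.rpow_pos_of_pos (div_pos (by positivity) (by linarith)) _
  set c₂ := (1 / (3 * c₁)) ^ (q / 2) with hc₂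
  have hc₂0 : 0 < c₂ := Real.rpow_pos_of_pos (by positivity) _
  refine ⟨c₂ / (6 * D), by positivity, fun g hg hgp hg0 hg1 t ht => ?_⟩
  set τ := c₂ * t ^ (q / 2) with hτ
  have hτ0 : 0 < τ := mul_pos hc₂0 (Real.rpow_pos_of_pos ht _)
  have hν : c₂ / (6 * D) * t ^ (1 + q / 2) = t * τ / (6 * D) := by
    rw [Real.rpow_add ht, Real.rpow_one, hτ]; ring
  have hc1τ : c₁ * τ ^ (2 / q) = t / 3 := by
    rw [hτ, hc₂, ← Real.mul_rpow (by positivity) ht.le, ← Real.rpow_mul (by positivity)]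
    have : q / 2 * (2 / q) = 1 := by field_simp
    rw [this, Real.rpow_one]
    field_simp
  rw [hν]
  set ν := t * τ / (6 * D) with hνdef
  have hν0 : 0 < ν := by positivity
  have hS1 : MeasurableSet {x | κ x ≤ τ} := measurableSet_le hκ measurable_const
  have hS2 : MeasurableSet {x | τ < κ x} := measurableSet_lt measurable_const hκ
  have hR1 : MeasurableSet {x | g x ≤ ν} := measurableSet_le hg measurable_const
  have hR2 : MeasurableSet {x | ν < g x} := measurableSet_lt measurable_const hg
  set k₁ : Plane → ENNReal := fun x => ENNReal.ofReal ({x | κ x ≤ τ}.indicator κ x) with hk₁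
  set k₂ : Plane → ENNReal := fun x => ENNReal.ofReal ({x | τ < κ x}.indicator κ x) with hk₂
  set g₁ : Plane → ENNReal := fun x => ENNReal.ofReal ({x | g x ≤ ν}.indicator g x) with hg₁
  set g₂ : Plane → ENNReal := fun x => ENNReal.ofReal ({x | ν < g x}.indicator g x) with hg₂
  have mk₁ : Measurable k₁ := (hκ.indicator hS1).ennreal_ofReal
  have mk₂ : Measurable k₂ := (hκ.indicator hS2).ennreal_ofReal
  have mg₁ : Measurable g₁ := (hg.indicator hR1).ennreal_ofReal
  have mg₂ : Measurable g₂ := (hg.indicator hR2).ennreal_ofReal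
  have ek : (fun x => ENNReal.ofReal (κ x)) = k₁ + k₂ := by
    funext x
    simp only [hk₁, hk₂, Pi.add_apply, indicator_apply, mem_ofPred_eq]
    by_cases h : κ x ≤ τ
    · simp [h, not_lt.2 h]
    · simp [h, not_le.1 h]
  have eg : (fun x => ENNReal.ofReal (g x)) = g₁ + g₂ := by
    funext x
    simp only [hg₁, hg₂, Pi.add_apply, indicator_apply, mem_ofPred_eq]
    by_cases h : g x ≤ ν
    · simp [h, not_lt.2 h]
    · simp [h, not_le.1 h]
  have hpg₂ : Periodic2 g₂ := hgp.comp fun s => ENNReal.ofReal ({s : ℝ | ν < s}.indicator id s)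
  have b1 : ∀ x, torusConv (fun x => ENNReal.ofReal (g x)) k₁ x ≤ ENNReal.ofReal (t / 3) := by
    intro x
    refine (torusConv_le_of_holder hg.ennreal_ofReal (hgp.comp ENNReal.ofReal) mk₁ hpp x).trans ?_
    have h1 : (∫⁻ x, ENNReal.ofReal (g x) ^ p ∂torusMeasure) ^ (1 / p) ≤ 1 := by
      refine ENNReal.rpow_le_one ?_ (by positivity)
      simpa only [ENNReal.ofReal_rpow_of_nonneg (hg0 _) (by linarith : 0 ≤ p)] using hg1
    have h2 : (∫⁻ x, k₁ x ^ p' ∂torusMeasure) ^ (1 / p') ≤ ENNReal.ofReal (t / 3) := by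
      have h3 : ∫⁻ x, k₁ x ^ p' ∂torusMeasure ≤
          ENNReal.ofReal (p' * D / (p' - 2) * τ ^ (p' - 2)) := by
        refine le_trans (le_of_eq ?_) (lintegral_indicator_le_rpow_le hκ hκ0 hD hw hτ0 hp'2)
        refine lintegral_congr fun x => ?_
        rw [hk₁, ENNReal.ofReal_rpow_of_nonneg (indicator_nonneg (fun x _ => hκ0 x) x) (by linarith)]
      refine (ENNReal.rpow_le_rpow h3 (by positivity)).trans_eq ?_
      have h4 : 0 ≤ p' * D / (p' - 2) := div_nonneg (by positivity) (by linarith)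
      rw [ENNReal.ofReal_rpow_of_nonneg (by positivity) (by positivity),
        Real.mul_rpow h4 (by positivity), ← Real.rpow_mul hτ0.le, hexp, ← hc₁, hc1τ]
    calc _ ≤ 1 * ENNReal.ofReal (t / 3) := mul_le_mul' h1 h2
      _ = _ := one_mul _
  have b2 : ∀ x, torusConv g₁ k₂ x ≤ ENNReal.ofReal (t / 3) := by
    intro x
    refine (torusConv_le_of_le mk₂ (c := ENNReal.ofReal ν) (fun x => ?_) x).trans ?_
    · refine ENNReal.ofReal_le_ofReal ?_
      by_cases h : g x ≤ ν
      · rw [indicator_of_mem (s := {x | g x ≤ ν}) h]; exact h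
      · rw [indicator_of_notMem (s := {x | g x ≤ ν}) h]; exact hν0.le
    · refine (mul_le_mul_right (lintegral_indicator_lt_le hκ hκ0 hD hw hτ0) _).trans_eq ?_
      rw [← ENNReal.ofReal_mul hν0.le]
      congr 1
      rw [hνdef]
      field_simp
      norm_num
  have hsub : {x | ENNReal.ofReal t <
        torusConv (fun x => ENNReal.ofReal (g x)) (fun x => ENNReal.ofReal (κ x)) x} ⊆
      {x | ENNReal.ofReal (t / 3) ≤ torusConv g₂ k₂ x} := by
    intro x hx
    simp only [mem_ofPred_eq] at hx ⊢
    by_contra! hcon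
    rw [ek, torusConv_add_right hg.ennreal_ofReal mk₁] at hx
    have h1 : torusConv (fun x => ENNReal.ofReal (g x)) k₂ x =
        torusConv g₁ k₂ x + torusConv g₂ k₂ x := by rw [eg, torusConv_add_left mg₁ mk₂]
    rw [h1] at hx
    refine absurd hx (not_lt.2 ?_)
    calc _ ≤ ENNReal.ofReal (t / 3) + (ENNReal.ofReal (t / 3) + ENNReal.ofReal (t / 3)) :=
          add_le_add (b1 x) (add_le_add (b2 x) hcon.le)
      _ = ENNReal.ofReal t := by
          rw [← ENNReal.ofReal_add (by positivity) (by positivity),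
            ← ENNReal.ofReal_add (by positivity) (by positivity)]
          congr 1
          ring
  have hmark := mul_meas_ge_le_lintegral (μ := torusMeasure) (measurable_torusConv mg₂ mk₂)
    (ENNReal.ofReal (t / 3))
  rw [lintegral_torusConv mg₂ hpg₂ mk₂] at hmark
  have h3 : torusMeasure {x | ENNReal.ofReal (t / 3) ≤ torusConv g₂ k₂ x} =
      ENNReal.ofReal (3 / t) * (ENNReal.ofReal (t / 3) *
        torusMeasure {x | ENNReal.ofReal (t / 3) ≤ torusConv g₂ k₂ x}) := by
    rw [← mul_assoc, ← ENNReal.ofReal_mul (by positivity)]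
    have : 3 / t * (t / 3) = 1 := by field_simp
    rw [this, ENNReal.ofReal_one, one_mul]
  calc _ ≤ torusMeasure {x | ENNReal.ofReal (t / 3) ≤ torusConv g₂ k₂ x} := measure_mono hsub
    _ ≤ ENNReal.ofReal (3 / t) * ((∫⁻ x, g₂ x ∂torusMeasure) * ENNReal.ofReal (2 * D / τ)) := by
        rw [h3]
        exact mul_le_mul_right (hmark.trans (mul_le_mul_right
          (lintegral_indicator_lt_le hκ hκ0 hD hw hτ0) _)) _
    _ = _ := by
        rw [mul_comm (∫⁻ x, g₂ x ∂torusMeasure), ← mul_assoc, ← ENNReal.ofReal_mul (by positivity)]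
        congr 2
        rw [hνdef]
        field_simp
        norm_num

/-- Tonelli: for fixed `x` the truncation restricts `t` to the interval up to `(g x / E)^(1/a)`, on
which the remaining power `t^(q-1-a)` integrates to `g x` to the power `p` after multiplication by
`g x`. -/
theorem lintegral_weak_bound {E a q p : ℝ} (hE : 0 < E) (ha : 0 < a) (haq : a < q)
    (hp : p = q / a) {g : Plane → ℝ} (hg : Measurable g) (hg0 : ∀ x, 0 ≤ g x) :
    ∫⁻ t in Ioi (0 : ℝ), (ENNReal.ofReal (1 / (E * t ^ a)) * ∫⁻ x,
        ENNReal.ofReal ({x | E * t ^ a < g x}.indicator g x) ∂torusMeasure) *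
        ENNReal.ofReal (t ^ (q - 1)) ≤
      ENNReal.ofReal (E⁻¹ ^ p / (q - a)) * ∫⁻ x, ENNReal.ofReal (g x ^ p) ∂torusMeasure := by
  have hm : Measurable fun z : ℝ × Plane => {z : ℝ × Plane | E * z.1 ^ a < g z.2}.indicator
      (fun z => g z.2) z := by
    refine Measurable.indicator (hg.comp measurable_snd) (measurableSet_lt (by fun_prop) (by fun_prop))
  have hm' : Measurable fun z : ℝ × Plane => ENNReal.ofReal (1 / (E * z.1 ^ a)) *
      ENNReal.ofReal (z.1 ^ (q - 1)) * ENNReal.ofReal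
        ({z : ℝ × Plane | E * z.1 ^ a < g z.2}.indicator (fun z => g z.2) z) :=
    Measurable.mul (by fun_prop) hm.ennreal_ofReal
  calc _ = ∫⁻ t in Ioi (0 : ℝ), ∫⁻ x, ENNReal.ofReal (1 / (E * t ^ a)) *
      ENNReal.ofReal (t ^ (q - 1)) * ENNReal.ofReal
        ({z : ℝ × Plane | E * z.1 ^ a < g z.2}.indicator (fun z => g z.2) (t, x)) ∂torusMeasure := by
        refine lintegral_congr fun t => ?_
        have hmt : Measurable fun x => ENNReal.ofReal
            ({z : ℝ × Plane | E * z.1 ^ a < g z.2}.indicator (fun z => g z.2) (t, x)) :=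
          (hm.comp measurable_prodMk_left).ennreal_ofReal
        rw [lintegral_const_mul _ hmt, mul_right_comm]
        rfl
    _ = ∫⁻ x, (∫⁻ t in Ioi (0 : ℝ), ENNReal.ofReal (1 / (E * t ^ a)) *
      ENNReal.ofReal (t ^ (q - 1)) * ENNReal.ofReal
        ({z : ℝ × Plane | E * z.1 ^ a < g z.2}.indicator (fun z => g z.2) (t, x))) ∂torusMeasure :=
        lintegral_lintegral_swap hm'.aemeasurable
    _ ≤ ∫⁻ x, ENNReal.ofReal (E⁻¹ ^ p / (q - a)) * ENNReal.ofReal (g x ^ p) ∂torusMeasure := by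
        refine lintegral_mono fun x => ?_
        set R := (g x / E) ^ (1 / a) with hR
        have hgE : 0 ≤ g x / E := div_nonneg (hg0 x) hE.le
        have hR0 : 0 ≤ R := Real.rpow_nonneg hgE _
        calc _ ≤ ∫⁻ t in Ioi (0 : ℝ), (Ioc 0 R).indicator (fun t => ENNReal.ofReal (g x / E) *
              ENNReal.ofReal (t ^ (q - 1 - a))) t := by
              refine setLIntegral_mono (by
                refine Measurable.indicator (by fun_prop) measurableSet_Ioc) fun t ht => ?_
              have ht0 : 0 < t := ht
              by_cases h : E * t ^ a < g x
              · have htR : t ∈ Ioc 0 R := by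
                  refine ⟨ht0, ?_⟩
                  rw [hR, one_div, Real.le_rpow_inv_iff_of_pos ht0.le hgE ha, le_div_iff₀ hE, mul_comm]
                  exact h.le
                rw [indicator_of_mem htR, indicator_of_mem (by exact h)]
                have hta := Real.rpow_pos_of_pos ht0 a
                rw [← ENNReal.ofReal_mul (by positivity), ← ENNReal.ofReal_mul (by positivity),
                  ← ENNReal.ofReal_mul hgE]
                refine ENNReal.ofReal_le_ofReal (le_of_eq ?_)
                rw [Real.rpow_sub ht0 (q - 1) a]
                field_simp
              · rw [indicator_of_notMem (by exact h)]
                simp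
          _ = ∫⁻ t in Ioc 0 R, ENNReal.ofReal (g x / E) * ENNReal.ofReal (t ^ (q - 1 - a)) := by
              rw [lintegral_indicator measurableSet_Ioc, Measure.restrict_restrict measurableSet_Ioc,
                inter_eq_left.2 Ioc_subset_Ioi_self]
          _ = _ := by
              rw [lintegral_const_mul _ (by fun_prop), lintegral_Ioc_rpow (by linarith) hR0,
                ← ENNReal.ofReal_mul hgE, ← ENNReal.ofReal_mul (by
                  have : 0 < q - a := by linarith
                  positivity)]
              congr 1
              have e1 : q - 1 - a + 1 = q - a := by ring
              have e2 : 1 + 1 / a * (q - a) = p := by rw [hp]; field_simp; ring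
              have hp0 : p ≠ 0 := by rw [hp]; exact (div_pos (ha.trans haq) ha).ne'
              rw [e1, hR, ← Real.rpow_mul hgE, ← mul_div_assoc,
                ← Real.rpow_one_add' hgE (by rw [e2]; exact hp0), e2, div_eq_mul_inv (g x) E,
                Real.mul_rpow (hg0 x) (by positivity)]
              ring
    _ = _ := lintegral_const_mul _ (by fun_prop)

/-- The Hardy-Littlewood-Sobolev inequality on the torus, for functions of norm at most `1`. -/
theorem lintegral_torusConv_rpow_le_of_le_one (hκ : Measurable κ) (hκ0 : ∀ x, 0 ≤ κ x) (hD : 0 < D)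
    (hw : ∀ τ : ℝ, 0 < τ → torusMeasure {x | τ < κ x} ≤ ENNReal.ofReal (D / τ ^ 2))
    (hp1 : 1 < p) (hp2 : p < 2) (hq : q = 2 * p / (2 - p)) :
    ∃ C : ℝ≥0, ∀ g : Plane → ℝ, Measurable g → Periodic2 g → (∀ x, 0 ≤ g x) →
      ∫⁻ x, ENNReal.ofReal (g x ^ p) ∂torusMeasure ≤ 1 →
      ∫⁻ x, torusConv (fun x => ENNReal.ofReal (g x)) (fun x => ENNReal.ofReal (κ x)) x ^ q
        ∂torusMeasure ≤ C := by
  obtain ⟨E, hE, h⟩ := measure_lt_torusConv_le hκ hκ0 hD hw hp1 hp2 hq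
  have h2p : 0 < 2 - p := by linarith
  have hq2 : 2 < q := by rw [hq, lt_div_iff₀ h2p]; linarith
  refine ⟨(q * (E⁻¹ ^ p / (q - (1 + q / 2)))).toNNReal, fun g hg hgp hg0 hg1 => ?_⟩
  set F := torusConv (fun x => ENNReal.ofReal (g x)) (fun x => ENNReal.ofReal (κ x)) with hF
  have hFm : Measurable F := measurable_torusConv hg.ennreal_ofReal hκ.ennreal_ofReal
  have hF1 : ∫⁻ x, F x ∂torusMeasure < ⊤ := by
    rw [hF, lintegral_torusConv hg.ennreal_ofReal (hgp.comp ENNReal.ofReal) hκ.ennreal_ofReal]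
    refine ENNReal.mul_lt_top ?_ ?_
    · calc ∫⁻ x, ENNReal.ofReal (g x) ∂torusMeasure
          ≤ ∫⁻ x, (1 + ENNReal.ofReal (g x ^ p)) ∂torusMeasure := by
            refine lintegral_mono fun x => ?_
            rw [← ENNReal.ofReal_one, ← ENNReal.ofReal_add zero_le_one (Real.rpow_nonneg (hg0 x) _)]
            refine ENNReal.ofReal_le_ofReal ?_
            rcases le_total (g x) 1 with h | h
            · have := Real.rpow_nonneg (hg0 x) p; linarith
            · have := Real.self_le_rpow_of_one_le h hp1.le; linarith
        _ < ⊤ := by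
            rw [lintegral_add_left measurable_const]
            refine ENNReal.add_lt_top.2 ⟨by simp, hg1.trans_lt ENNReal.one_lt_top⟩
    · have := lintegral_rpow_lt_top_of_weak hκ hκ0 hD hw one_pos one_lt_two
      simpa using this
  have hFtop : ∀ᵐ x ∂torusMeasure, F x < ⊤ := ae_lt_top hFm hF1.ne
  have e1 : ∫⁻ x, F x ^ q ∂torusMeasure =
      ∫⁻ x, ENNReal.ofReal ((F x).toReal ^ q) ∂torusMeasure := by
    refine lintegral_congr_ae ?_
    filter_upwards [hFtop] with x hx
    rw [← ENNReal.ofReal_rpow_of_nonneg ENNReal.toReal_nonneg (by linarith),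
      ENNReal.ofReal_toReal hx.ne]
  rw [e1, lintegral_rpow_eq_lintegral_meas_lt_mul _ (ae_of_all _ fun x => ENNReal.toReal_nonneg)
    hFm.ennreal_toReal.aemeasurable (by linarith)]
  -- This is `1/q = 1/p - 1/2` rewritten: the truncation exponent `1 + q/2` brings back exactly the
  -- power `p`.
  have hpa : p = q / (1 + q / 2) := by
    rw [hq]
    field_simp
    ring
  calc _ ≤ ENNReal.ofReal q * ∫⁻ t in Ioi (0 : ℝ),
        (ENNReal.ofReal (1 / (E * t ^ (1 + q / 2))) * ∫⁻ x,
        ENNReal.ofReal ({x | E * t ^ (1 + q / 2) < g x}.indicator g x) ∂torusMeasure) *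
        ENNReal.ofReal (t ^ (q - 1)) := by
        refine mul_le_mul_right (lintegral_mono_ae ?_) _
        filter_upwards [ae_restrict_mem measurableSet_Ioi] with t ht
        have ht0 : 0 < t := ht
        refine mul_le_mul_left ((measure_mono fun x hx => ?_).trans (h g hg hgp hg0 hg1 t ht0)) _
        simp only [mem_ofPred_eq] at hx ⊢
        rw [ENNReal.ofReal_lt_iff_lt_toReal ht0.le]
        · exact hx
        · rintro htop
          change F x = ⊤ at htop
          rw [htop] at hx
          simp at hx
          linarith
    _ ≤ ENNReal.ofReal q * (ENNReal.ofReal (E⁻¹ ^ p / (q - (1 + q / 2))) * 1) := by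
        refine mul_le_mul_right ((lintegral_weak_bound hE (by linarith) (by linarith) hpa hg
          hg0).trans (mul_le_mul_right hg1 _)) _
    _ = _ := by
        rw [mul_one, ← ENNReal.ofReal_mul (by linarith)]
        rfl

/-- The Hardy-Littlewood-Sobolev inequality on the torus. -/
theorem lintegral_torusConv_rpow_le (hκ : Measurable κ) (hκ0 : ∀ x, 0 ≤ κ x) (hD : 0 < D)
    (hw : ∀ τ : ℝ, 0 < τ → torusMeasure {x | τ < κ x} ≤ ENNReal.ofReal (D / τ ^ 2))
    (hp1 : 1 < p) (hp2 : p < 2) (hq : q = 2 * p / (2 - p)) :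
    ∃ C : ℝ≥0, ∀ g : Plane → ℝ, Measurable g → Periodic2 g → (∀ x, 0 ≤ g x) →
      (∫⁻ x, torusConv (fun x => ENNReal.ofReal (g x)) (fun x => ENNReal.ofReal (κ x)) x ^ q
        ∂torusMeasure) ^ (1 / q) ≤ C * (∫⁻ x, ENNReal.ofReal (g x ^ p) ∂torusMeasure) ^ (1 / p) := by
  obtain ⟨C, hC⟩ := lintegral_torusConv_rpow_le_of_le_one hκ hκ0 hD hw hp1 hp2 hq
  have h2p : 0 < 2 - p := by linarith
  have hq0 : 0 < q := by rw [hq]; positivity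
  have hp0 : 0 < p := by linarith
  refine ⟨(C + 1) ^ (1 / q), fun g hg hgp hg0 => ?_⟩
  set A := ∫⁻ x, ENNReal.ofReal (g x ^ p) ∂torusMeasure with hA
  have hC1 : ((C + 1) ^ (1 / q) : ℝ≥0) ≠ 0 := by positivity
  rcases eq_or_ne A ⊤ with hAt | hAt
  · rw [hAt, ENNReal.top_rpow_of_pos (by positivity), ENNReal.mul_top (by exact_mod_cast hC1)]
    exact le_top
  -- Normalization by an arbitrary constant above the norm, so that functions of norm zero need no case.
  have key : ∀ b : ℝ, 0 < b → A ≤ ENNReal.ofReal (b ^ p) →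
      (∫⁻ x, torusConv (fun x => ENNReal.ofReal (g x)) (fun x => ENNReal.ofReal (κ x)) x ^ q
        ∂torusMeasure) ^ (1 / q) ≤ ((C + 1) ^ (1 / q) : ℝ≥0) * ENNReal.ofReal b := by
    intro b hb hAb
    have hn : ∫⁻ x, ENNReal.ofReal ((b⁻¹ * g x) ^ p) ∂torusMeasure ≤ 1 := by
      calc _ = ∫⁻ x, ENNReal.ofReal (b⁻¹ ^ p) * ENNReal.ofReal (g x ^ p) ∂torusMeasure := by
            refine lintegral_congr fun x => ?_
            rw [Real.mul_rpow (by positivity) (hg0 x), ENNReal.ofReal_mul (by positivity)]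
        _ = ENNReal.ofReal (b⁻¹ ^ p) * A := lintegral_const_mul _ (by fun_prop)
        _ ≤ ENNReal.ofReal (b⁻¹ ^ p) * ENNReal.ofReal (b ^ p) := mul_le_mul_right hAb _
        _ = 1 := by
            rw [← ENNReal.ofReal_mul (by positivity), ← Real.mul_rpow (by positivity) hb.le,
              inv_mul_cancel₀ hb.ne', Real.one_rpow, ENNReal.ofReal_one]
    have h1 := hC (fun x => b⁻¹ * g x) (by fun_prop) (hgp.comp fun s => b⁻¹ * s)
      (fun x => mul_nonneg (by positivity) (hg0 x)) hn
    have e1 : ∀ x, torusConv (fun x => ENNReal.ofReal (g x)) (fun x => ENNReal.ofReal (κ x)) x =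
        ENNReal.ofReal b *
          torusConv (fun x => ENNReal.ofReal (b⁻¹ * g x)) (fun x => ENNReal.ofReal (κ x)) x := by
      intro x
      unfold torusConv
      rw [← lintegral_const_mul _ (by fun_prop)]
      refine lintegral_congr fun y => ?_
      rw [← mul_assoc, ← ENNReal.ofReal_mul hb.le, mul_inv_cancel_left₀ hb.ne']
    have mT : Measurable (torusConv (fun x => ENNReal.ofReal (b⁻¹ * g x))
        (fun x => ENNReal.ofReal (κ x))) := measurable_torusConv (by fun_prop) (by fun_prop)
    simp only [e1, ENNReal.mul_rpow_of_nonneg _ _ hq0.le]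
    rw [lintegral_const_mul _ (mT.pow_const q), ENNReal.mul_rpow_of_nonneg _ _ (by positivity),
      ← ENNReal.rpow_mul, mul_one_div_cancel hq0.ne', ENNReal.rpow_one, mul_comm,
      ENNReal.coe_rpow_of_nonneg _ (by positivity)]
    gcongr
    exact h1.trans (by exact_mod_cast (le_add_of_nonneg_right zero_le_one))
  have hlim : Tendsto (fun n : ℕ => ((C + 1) ^ (1 / q) : ℝ≥0) *
      ENNReal.ofReal (A.toReal ^ (1 / p) + 1 / ((n : ℝ) + 1))) atTop
      (𝓝 (((C + 1) ^ (1 / q) : ℝ≥0) * A ^ (1 / p))) := by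
    have e2 : A ^ (1 / p) = ENNReal.ofReal (A.toReal ^ (1 / p) + 0) := by
      rw [add_zero, ← ENNReal.ofReal_rpow_of_nonneg ENNReal.toReal_nonneg (by positivity),
        ENNReal.ofReal_toReal hAt]
    rw [e2]
    refine ENNReal.Tendsto.const_mul ?_ (Or.inr ENNReal.coe_ne_top)
    exact ENNReal.tendsto_ofReal (tendsto_const_nhds.add tendsto_one_div_add_atTop_nhds_zero_nat)
  refine ge_of_tendsto' hlim fun n => key _ (by positivity) ?_
  have h5 : A.toReal ≤ (A.toReal ^ (1 / p) + 1 / ((n : ℝ) + 1)) ^ p := by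
    have e3 : A.toReal = (A.toReal ^ (1 / p)) ^ p := by
      rw [← Real.rpow_mul ENNReal.toReal_nonneg, one_div_mul_cancel hp0.ne', Real.rpow_one]
    conv_lhs => rw [e3]
    refine Real.rpow_le_rpow (by positivity) ?_ hp0.le
    have : 0 < 1 / ((n : ℝ) + 1) := by positivity
    linarith
  exact (ENNReal.ofReal_toReal hAt).symm.trans_le (ENNReal.ofReal_le_ofReal h5)

end HardyLittlewoodSobolev

/-! ### Norms on the torus and the trilinear velocity estimate. -/

/-- The `L^p` norm on the torus. -/
def torusNorm {E : Type*} [NormedAddCommGroup E] (p : ℝ) (f : Plane → E) : ENNReal :=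
  eLpNorm f (ENNReal.ofReal p) torusMeasure

theorem torusNorm_eq {E : Type*} [NormedAddCommGroup E] {p : ℝ} (hp : 0 < p) (f : Plane → E) :
    torusNorm p f = (∫⁻ x, ‖f x‖ₑ ^ p ∂torusMeasure) ^ (1 / p) := by
  rw [torusNorm, eLpNorm_eq_lintegral_rpow_enorm_toReal (by simpa using hp) ENNReal.ofReal_ne_top,
    ENNReal.toReal_ofReal hp.le]

theorem torusNorm_rpow {E : Type*} [NormedAddCommGroup E] {p : ℝ} (hp : 0 < p) (f : Plane → E)
    (m : ℝ) : (∫⁻ x, ‖f x‖ₑ ^ p ∂torusMeasure) ^ (m / p) = torusNorm p f ^ m := by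
  rw [torusNorm_eq hp, ← ENNReal.rpow_mul]
  congr 1
  ring

theorem torusNorm_add_le {E : Type*} [NormedAddCommGroup E] {p : ℝ} (hp : 1 ≤ p) {f g : Plane → E}
    (hf : AEStronglyMeasurable f torusMeasure) (hg : AEStronglyMeasurable g torusMeasure) :
    torusNorm p (fun x => f x + g x) ≤ torusNorm p f + torusNorm p g :=
  eLpNorm_add_le hf hg (by simpa using hp)

theorem torusNorm_sub_le {E : Type*} [NormedAddCommGroup E] {p : ℝ} (hp : 1 ≤ p) {f g : Plane → E}
    (hf : AEStronglyMeasurable f torusMeasure) (hg : AEStronglyMeasurable g torusMeasure) :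
    torusNorm p (fun x => f x - g x) ≤ torusNorm p f + torusNorm p g :=
  eLpNorm_sub_le hf hg (by simpa using hp)

theorem torusNorm_const_one {p : ℝ} (hp : 0 < p) : torusNorm p (fun _ => (1 : ℝ)) = 1 := by
  rw [torusNorm_eq hp]
  simp

theorem torusNorm_abs {p : ℝ} (f : Plane → ℝ) : torusNorm p (fun x => |f x|) = torusNorm p f :=
  eLpNorm_congr_norm_ae (ae_of_all _ fun x => by simp)

theorem torusNorm_one_add_le {p : ℝ} (hp : 1 ≤ p) {f : Plane → ℝ} (hf : Measurable f) :
    torusNorm p (fun x => 1 + |f x|) ≤ 1 + torusNorm p f := by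
  refine (torusNorm_add_le hp aestronglyMeasurable_const
    (by fun_prop : Measurable fun x => |f x|).aestronglyMeasurable).trans_eq ?_
  rw [torusNorm_const_one (by linarith), torusNorm_abs]

theorem enorm_one_add_abs (a : ℝ) : ‖1 + |a|‖ₑ = 1 + ‖a‖ₑ := by
  rw [Real.enorm_of_nonneg (by positivity), ENNReal.ofReal_add zero_le_one (abs_nonneg a),
    ENNReal.ofReal_one, ← Real.enorm_eq_ofReal_abs]

/-- Hölder's inequality for a power of one function and two further functions. -/
theorem lintegral_rpow_mul_mul_le {p m q : ℝ} (hp : 0 < p) (hm : 0 ≤ m) (hq : 0 < q)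
    (h : m / p + 1 / p + 1 / q = 1) {F A B : Plane → ENNReal} (hF : Measurable F)
    (hA : Measurable A) (hB : Measurable B) :
    ∫⁻ x, F x ^ m * A x * B x ∂torusMeasure ≤ (∫⁻ x, F x ^ p ∂torusMeasure) ^ (m / p) *
      (∫⁻ x, A x ^ p ∂torusMeasure) ^ (1 / p) * (∫⁻ x, B x ^ q ∂torusMeasure) ^ (1 / q) := by
  have h1 := ENNReal.lintegral_prod_norm_pow_le (μ := torusMeasure) (Finset.univ : Finset (Fin 3))
    (f := ![fun x => F x ^ p, fun x => A x ^ p, fun x => B x ^ q])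
    (fun i _ => by
      fin_cases i
      · exact (hF.pow_const p).aemeasurable
      · exact (hA.pow_const p).aemeasurable
      · exact (hB.pow_const q).aemeasurable)
    (p := ![m / p, 1 / p, 1 / q]) (by simpa [Fin.sum_univ_three] using h) (fun i _ => by
      fin_cases i
      · simpa using by positivity
      · simpa using by positivity
      · simpa using by positivity)
  simp only [Fin.prod_univ_three, Matrix.cons_val_zero, Matrix.cons_val_one, Matrix.cons_val,
    ← ENNReal.rpow_mul] at h1
  simpa [mul_div_cancel₀ _ hp.ne', mul_inv_cancel₀ hp.ne', mul_inv_cancel₀ hq.ne'] using h1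

theorem lintegral_rpow_mul_le {p m : ℝ} (hp : 0 < p) (hm : 0 ≤ m) (h : m + 1 ≤ p)
    {F A : Plane → ENNReal} (hF : Measurable F) (hA : Measurable A) :
    ∫⁻ x, F x ^ m * A x ∂torusMeasure ≤ (∫⁻ x, F x ^ p ∂torusMeasure) ^ (m / p) *
      (∫⁻ x, A x ^ p ∂torusMeasure) ^ (1 / p) := by
  have h1 := ENNReal.lintegral_prod_norm_pow_le (μ := torusMeasure) (Finset.univ : Finset (Fin 3))
    (f := ![fun x => F x ^ p, fun x => A x ^ p, fun x => 1])
    (fun i _ => by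
      fin_cases i
      · exact (hF.pow_const p).aemeasurable
      · exact (hA.pow_const p).aemeasurable
      · exact aemeasurable_const)
    -- The constant function 1 absorbs the unused exponent, since the torus has measure one.
    (p := ![m / p, 1 / p, 1 - (m / p + 1 / p)]) (by simp [Fin.sum_univ_three]) (fun i _ => by
      fin_cases i
      · simpa using by positivity
      · simpa using by positivity
      · have : m / p + 1 / p ≤ 1 := by rw [← add_div, div_le_one hp]; exact h
        simpa using this)
  simp only [Fin.prod_univ_three, Matrix.cons_val_zero, Matrix.cons_val_one, Matrix.cons_val,
    ← ENNReal.rpow_mul] at h1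
  simpa [mul_div_cancel₀ _ hp.ne', mul_inv_cancel₀ hp.ne'] using h1

theorem lintegral_one_add_rpow_mul_le {p m : ℝ} (hp : 1 ≤ p) (hm : 0 ≤ m) (h : m + 1 ≤ p)
    {F A : Plane → ℝ} (hF : Measurable F) (hA : Measurable A) :
    ∫⁻ x, (1 + ‖F x‖ₑ) ^ m * ‖A x‖ₑ ∂torusMeasure ≤
      (1 + torusNorm p F) ^ m * torusNorm p A := by
  have hp0 : 0 < p := by linarith
  refine (lintegral_rpow_mul_le hp0 hm h (by fun_prop) hA.enorm).trans ?_
  simp only [← enorm_one_add_abs]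
  rw [torusNorm_rpow hp0, ← torusNorm_eq hp0]
  exact mul_le_mul_left (ENNReal.rpow_le_rpow (torusNorm_one_add_le hp hF) hm) _

/-- The convolution of `|g|` with the modulus of the Biot-Savart kernel. -/
def potential (g : Plane → ℝ) (x : Plane) : ENNReal :=
  torusConv (fun x => ‖g x‖ₑ) (fun x => ‖biotSavartKernel x‖ₑ) x

theorem measurable_potential {g : Plane → ℝ} (hg : Measurable g) : Measurable (potential g) :=
  measurable_torusConv hg.enorm measurable_biotSavartKernel.enorm

theorem enorm_velocity_le (g : Plane → ℝ) (x : Plane) : ‖velocity g x‖ₑ ≤ potential g x := by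
  refine (enorm_integral_le_lintegral_enorm _).trans_eq ?_
  simp only [enorm_smul]
  rfl

/-- The bound on the velocity that is behind all estimates: `(1 + |F|)^m |A| |K * g|` is integrable
when `F`, `A` and `g` are in `L^p`. -/
structure VelocityBound (p m : ℝ) (C : ℝ≥0) : Prop where
  one_lt : 1 < p
  nonneg : 0 ≤ m
  add_one_le : m + 1 ≤ p
  bound : ∀ F A g : Plane → ℝ, Measurable F → Measurable A → Measurable g → Periodic2 g →
    ∫⁻ x, (1 + ‖F x‖ₑ) ^ m * ‖A x‖ₑ * potential g x ∂torusMeasure ≤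
      C * (1 + torusNorm p F) ^ m * torusNorm p A * torusNorm p g

/-- The potential is in `L^q` with `1/q = 1/p - 1/2`, so the Hölder condition `m/p + 1/p + 1/q = 1`
forces `m = 3p/2 - 2`. The lower bound `4/3` on `p` keeps this exponent nonnegative. -/
theorem velocityBound_of_lt_two {p : ℝ} (hp1 : 4 / 3 < p) (hp2 : p < 2) :
    ∃ C, VelocityBound p (3 / 2 * p - 2) C := by
  obtain ⟨D, hD, hw⟩ := measure_lt_norm_biotSavartKernel_le
  have h2p : 0 < 2 - p := by linarith
  have hp0 : 0 < p := by linarith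
  obtain ⟨C, hC⟩ := lintegral_torusConv_rpow_le (p := p) (q := 2 * p / (2 - p))
    measurable_biotSavartKernel.norm (fun _ => norm_nonneg _) hD hw (by linarith) hp2 rfl
  have hq0 : 0 < 2 * p / (2 - p) := by positivity
  have hm : 0 ≤ 3 / 2 * p - 2 := by linarith
  refine ⟨C, by linarith, hm, by linarith, fun F A g hF hA hg hgp => ?_⟩
  refine (lintegral_rpow_mul_mul_le (q := 2 * p / (2 - p)) hp0 hm hq0 (by field_simp; ring)
    (by fun_prop) hA.enorm (measurable_potential hg)).trans ?_
  simp only [← enorm_one_add_abs]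
  rw [torusNorm_rpow hp0, ← torusNorm_eq hp0]
  have h1 := hC (fun x => ‖g x‖) hg.norm (hgp.comp _) (fun _ => norm_nonneg _)
  simp only [ofReal_norm] at h1
  have h2 : (∫⁻ x, ENNReal.ofReal (‖g x‖ ^ p) ∂torusMeasure) ^ (1 / p) = torusNorm p g := by
    rw [torusNorm_eq hp0]
    simp only [← ENNReal.ofReal_rpow_of_nonneg (norm_nonneg _) hp0.le, ofReal_norm]
  rw [h2] at h1
  calc _ ≤ (1 + torusNorm p F) ^ (3 / 2 * p - 2) * torusNorm p A * (C * torusNorm p g) := by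
        refine mul_le_mul' (mul_le_mul' ?_ le_rfl) h1
        exact ENNReal.rpow_le_rpow (torusNorm_one_add_le (by linarith) hF) hm
    _ = _ := by ring

/-- The exponent conjugate to `p` is below 2, so a kernel in weak `L²` belongs to the dual space and
Hölder bounds the potential at every point. -/
theorem exists_potential_le {p : ℝ} (hp : 2 < p) : ∃ C : ℝ≥0, ∀ g : Plane → ℝ, Measurable g →
    Periodic2 g → ∀ x, potential g x ≤ C * torusNorm p g := by
  obtain ⟨D, hD, hw⟩ := measure_lt_norm_biotSavartKernel_le
  have hp0 : 0 < p := by linarith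
  set q := p / (p - 1) with hq
  have hpq : p.HolderConjugate q := Real.HolderConjugate.conjExponent (by linarith)
  have hq0 : 0 < q := hpq.symm.pos
  have hq2 : q < 2 := by rw [hq, div_lt_iff₀ (by linarith)]; linarith
  have h := lintegral_rpow_lt_top_of_weak measurable_biotSavartKernel.norm
    (fun _ => norm_nonneg _) hD hw hq0 hq2
  have h2 : (∫⁻ x, ‖biotSavartKernel x‖ₑ ^ q ∂torusMeasure) ^ (1 / q) < ⊤ := by
    refine ENNReal.rpow_lt_top_of_nonneg (by positivity) ?_
    simpa only [← ENNReal.ofReal_rpow_of_nonneg (norm_nonneg _) hq0.le, ofReal_norm]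
      using h.ne
  refine ⟨((∫⁻ x, ‖biotSavartKernel x‖ₑ ^ q ∂torusMeasure) ^ (1 / q)).toNNReal,
    fun g hg hgp x => ?_⟩
  have h3 := torusConv_le_of_holder (g := fun x => ‖g x‖ₑ)
    (k := fun x => ‖biotSavartKernel x‖ₑ) hg.enorm (hgp.comp _)
    measurable_biotSavartKernel.enorm hpq x
  rw [← torusNorm_eq hp0, mul_comm, ← ENNReal.coe_toNNReal h2.ne] at h3
  exact h3

theorem velocityBound_of_two_lt {p : ℝ} (hp : 2 < p) : ∃ C, VelocityBound p (p - 1) C := by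
  obtain ⟨C, hC⟩ := exists_potential_le hp
  refine ⟨C, by linarith, by linarith, by linarith, fun F A g hF hA hg hgp => ?_⟩
  calc _ ≤ ∫⁻ x, (1 + ‖F x‖ₑ) ^ (p - 1) * ‖A x‖ₑ * (C * torusNorm p g) ∂torusMeasure :=
        lintegral_mono fun x => mul_le_mul_right (hC g hg hgp x) _
    _ = (∫⁻ x, (1 + ‖F x‖ₑ) ^ (p - 1) * ‖A x‖ₑ ∂torusMeasure) * (C * torusNorm p g) :=
        lintegral_mul_const _ (by fun_prop)
    _ ≤ ((1 + torusNorm p F) ^ (p - 1) * torusNorm p A) * (C * torusNorm p g) :=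
        mul_le_mul_left (lintegral_one_add_rpow_mul_le (by linarith) (by linarith) (by linarith)
          hF hA) _
    _ = _ := by ring

/-! ### Periodization: from integrals over the plane to integrals over the torus. -/

section periodize

variable {E : Type*} [NormedAddCommGroup E]

/-- The sum of the translates of `κ` by the lattice of periods. -/
def periodize (κ : Plane → E) (x : Plane) : E := ∑ᶠ v : lattice, κ (x + v)

/-- The lattice is discrete and the support bounded, so over a bounded set every sum of translates
is finite. This removes all questions of convergence from the periodization. -/
theorem exists_finset_translate_eq_zero {κ : Plane → E} (hκ : HasCompactSupport κ) (R : ℝ) :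
    ∃ S : Finset lattice, ∀ x : Plane, ‖x‖ ≤ R → ∀ v ∉ S, κ (x + v) = 0 := by
  obtain ⟨R', hR'⟩ := hκ.isBounded.subset_closedBall 0
  have hf : {v : lattice | ‖(v : Plane)‖ ≤ R + R'}.Finite := by
    have h := ZSpan.setFinite_inter stdBasis (Metric.isBounded_closedBall (x := (0 : Plane))
      (r := R + R'))
    refine (h.preimage (f := ((↑) : lattice → Plane)) Subtype.val_injective.injOn).subset
      fun v hv => ⟨?_, v.2⟩
    simpa using hv
  refine ⟨hf.toFinset, fun x hx v hv => image_eq_zero_of_notMem_tsupport fun h => hv ?_⟩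
  have h1 := hR' h
  rw [mem_closedBall_zero_iff] at h1
  simp only [Set.Finite.mem_toFinset, mem_ofPred_eq]
  have := norm_sub_le (x + (v : Plane)) x
  rw [add_sub_cancel_left] at this
  linarith

theorem periodize_eq_sum {κ : Plane → E} {S : Finset lattice} {x : Plane}
    (hS : ∀ v ∉ S, κ (x + v) = 0) : periodize κ x = ∑ v ∈ S, κ (x + v) := by
  refine finsum_eq_sum_of_support_subset _ fun v hv => ?_
  by_contra h
  exact hv (hS v h)

theorem single_mem_lattice (i : Fin 2) : EuclideanSpace.single i (1 : ℝ) ∈ lattice := by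
  rw [Submodule.mem_toAddSubgroup, ← stdBasis_apply]
  exact Submodule.subset_span ⟨i, rfl⟩

theorem periodic2_periodize (κ : Plane → E) : Periodic2 (periodize κ) := fun i x => by
  unfold periodize
  refine Eq.trans ?_ (finsum_comp_equiv (Equiv.addLeft (⟨_, single_mem_lattice i⟩ : lattice)))
  simp only [Equiv.coe_addLeft, AddSubgroup.coe_add, add_assoc]

theorem exists_finset_eventually_periodize {κ : Plane → E} (hκ : HasCompactSupport κ) (x : Plane) :
    ∃ S : Finset lattice, ∀ᶠ y in 𝓝 x, ∀ v ∉ S, κ (y + v) = 0 := by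
  obtain ⟨S, hS⟩ := exists_finset_translate_eq_zero hκ (‖x‖ + 1)
  refine ⟨S, ?_⟩
  filter_upwards [Metric.ball_mem_nhds x one_pos] with y hy
  refine hS y ?_
  have := norm_sub_norm_le y x
  rw [mem_ball_iff_norm] at hy
  linarith

theorem exists_norm_le_of_hasCompactSupport {κ : Plane → E} (hκ : HasCompactSupport κ)
    (hc : Continuous κ) : ∃ C : ℝ≥0, ∀ x, ‖κ x‖ ≤ C := by
  obtain ⟨C, hC⟩ := hc.bounded_above_of_compact_support hκ
  exact ⟨C.toNNReal, fun x => (hC x).trans (Real.le_coe_toNNReal C)⟩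

variable {F G : Type*} [NormedSpace ℝ E] [NormedAddCommGroup F] [NormedSpace ℝ F]
  [NormedAddCommGroup G] [NormedSpace ℝ G]

theorem contDiff_periodize {κ : Plane → E} (hκ : HasCompactSupport κ) {n : WithTop ℕ∞}
    (hc : ContDiff ℝ n κ) : ContDiff ℝ n (periodize κ) := by
  rw [contDiff_iff_contDiffAt]
  intro x
  obtain ⟨S, hS⟩ := exists_finset_eventually_periodize hκ x
  have h1 : ContDiff ℝ n fun y : Plane => ∑ v ∈ S, κ (y + v) :=
    ContDiff.sum fun v _ => hc.comp (contDiff_id.add contDiff_const)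
  exact h1.contDiffAt.congr_of_eventuallyEq (hS.mono fun y hy => periodize_eq_sum hy)

theorem fderiv_periodize {κ : Plane → E} (hκ : HasCompactSupport κ) (hc : ContDiff ℝ 1 κ)
    (x : Plane) : fderiv ℝ (periodize κ) x = periodize (fderiv ℝ κ) x := by
  obtain ⟨S, hS⟩ := exists_finset_eventually_periodize hκ x
  have h1 : periodize κ =ᶠ[𝓝 x] fun y => ∑ v ∈ S, κ (y + v) :=
    hS.mono fun y hy => periodize_eq_sum hy
  have h2 : ∀ v ∉ S, fderiv ℝ κ (x + v) = 0 := fun v hv => by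
    rw [← fderiv_comp_add_right]
    have : (fun y => κ (y + v)) =ᶠ[𝓝 x] fun _ => 0 := hS.mono fun y hy => hy v hv
    rw [this.fderiv_eq]
    simp
  have hd := hc.differentiable one_ne_zero
  rw [h1.fderiv_eq, periodize_eq_sum h2, fderiv_fun_sum fun v _ => by fun_prop]
  simp only [fderiv_comp_add_right]

/-- The plane is tiled by translates of the cell, of which finitely many meet the support. A general
bilinear map covers both scalar kernels and differentials of kernels applied to vector fields. -/
theorem integrable_of_periodic (L : E →L[ℝ] F →L[ℝ] G) {κ : Plane → E} (hκ : HasCompactSupport κ)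
    (hc : Continuous κ) {f : Plane → F} (hf : Periodic2 f) (hfm : StronglyMeasurable f)
    (hfi : Integrable f torusMeasure) : Integrable fun y => L (κ y) (f y) := by
  have hm : StronglyMeasurable fun y => L (κ y) (f y) :=
    L.continuous₂.comp_stronglyMeasurable (hc.stronglyMeasurable.prodMk hfm)
  refine ⟨hm.aestronglyMeasurable, ?_⟩
  obtain ⟨C, hC⟩ := exists_norm_le_of_hasCompactSupport hκ hc
  obtain ⟨S, hS⟩ := exists_finset_translate_eq_zero hκ 2
  rw [HasFiniteIntegral, isAddFundamentalDomain_cell.lintegral_eq_tsum'', tsum_eq_sum (s := S)]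
  · refine ENNReal.sum_lt_top.2 fun v _ => ?_
    refine lt_of_le_of_lt (lintegral_mono (g := fun x => ENNReal.ofReal (‖L‖ * C) * ‖f x‖ₑ)
      fun x => ?_) ?_
    · simp only
      rw [hf.vadd, ← ofReal_norm, ← ofReal_norm, ← ENNReal.ofReal_mul (by positivity)]
      refine ENNReal.ofReal_le_ofReal ((L.le_opNorm₂ _ _).trans ?_)
      gcongr
      exact hC _
    · rw [lintegral_const_mul _ hfm.enorm]
      exact ENNReal.mul_lt_top ENNReal.ofReal_lt_top hfi.2
  · intro v hv
    rw [setLIntegral_congr_fun (g := fun _ => 0) measurableSet_cell fun x hx => ?_]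
    · simp
    · simp only [AddSubgroup.vadd_def, vadd_eq_add]
      rw [add_comm, hS x (norm_le_two_of_mem_cell hx) v hv]
      simp

/-- Unfolding: an integral over the plane against a periodic function is an integral over the
torus. -/
theorem integral_periodize [CompleteSpace G] (L : E →L[ℝ] F →L[ℝ] G) {κ : Plane → E}
    (hκ : HasCompactSupport κ) (hc : Continuous κ) {f : Plane → F} (hf : Periodic2 f)
    (hfm : StronglyMeasurable f) (hfi : Integrable f torusMeasure) :
    ∫ y, L (κ y) (f y) = ∫ y, L (periodize κ y) (f y) ∂torusMeasure := by
  obtain ⟨S, hS⟩ := exists_finset_translate_eq_zero hκ 2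
  have hi := integrable_of_periodic L hκ hc hf hfm hfi
  rw [isAddFundamentalDomain_cell.integral_eq_tsum'' _ hi, tsum_eq_sum (s := S)]
  · have h1 : ∀ v : lattice, (fun x => L (κ (v +ᵥ x)) (f (v +ᵥ x))) =
        fun x => L (κ (x + v)) (f x) := fun v => by
      ext x
      rw [hf.vadd, AddSubgroup.vadd_def, vadd_eq_add, add_comm]
    have h2 : ∀ v : lattice, IntegrableOn (fun x => L (κ (x + v)) (f x)) cell := fun v => by
      rw [← h1]
      exact ((measurePreserving_vadd v volume).integrable_comp_of_integrable hi).integrableOn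
    simp only [h1]
    rw [← integral_finsetSum _ fun v _ => h2 v, torusMeasure]
    refine setIntegral_congr_fun measurableSet_cell fun x hx => ?_
    rw [periodize_eq_sum (hS x (norm_le_two_of_mem_cell hx)), map_sum, sum_apply]
  · intro v hv
    rw [setIntegral_congr_fun (g := fun _ => 0) measurableSet_cell fun x hx => ?_]
    · simp
    · simp only [AddSubgroup.vadd_def, vadd_eq_add]
      rw [add_comm, hS x (norm_le_two_of_mem_cell hx) v hv]
      simp

end periodize

theorem Periodic2.exists_norm_le {E : Type*} [NormedAddCommGroup E] {f : Plane → E}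
    (hf : Periodic2 f) (hc : Continuous f) : ∃ C : ℝ≥0, ∀ x, ‖f x‖ ≤ C := by
  obtain ⟨C, hC⟩ := (isCompact_closedBall (0 : Plane) 2).exists_bound_of_continuousOn
    hc.continuousOn
  refine ⟨C.toNNReal, fun x => ?_⟩
  obtain ⟨v, hv, -⟩ := ZSpan.exist_unique_vadd_mem_fundamentalDomain stdBasis x
  rw [← cell_eq_fundamentalDomain] at hv
  have h : f x = f ((v : Plane) + x) := by
    rw [add_comm]; exact (hf.add_mem (v := v) v.2 x).symm
  rw [h]
  exact (hC _ (by rw [mem_closedBall_zero_iff]; exact norm_le_two_of_mem_cell hv)).trans (Real.le_coe_toNNReal C)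

section bilinear

variable {E F G : Type*} [NormedAddCommGroup E] [NormedSpace ℝ E] [NormedAddCommGroup F]
  [NormedSpace ℝ F] [NormedAddCommGroup G] [NormedSpace ℝ G]

theorem norm_bilinear_le (L : E →L[ℝ] F →L[ℝ] G) {C : ℝ≥0} {a : E} (ha : ‖a‖ ≤ C) (b : F) :
    ‖L a b‖ ≤ ‖L‖ * C * ‖b‖ := by
  refine (L.le_opNorm₂ _ _).trans ?_
  gcongr

/-- A bounded continuous kernel applied to an integrable function is integrable. -/
theorem integrable_prod_bilinear (L : E →L[ℝ] F →L[ℝ] G) {c : Plane × Plane → E}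
    (hc : Continuous c) {C : ℝ≥0} (hC : ∀ z, ‖c z‖ ≤ C) {f : Plane → F}
    (hf : Integrable f torusMeasure) :
    Integrable (fun z : Plane × Plane => L (c z) (f z.2)) (torusMeasure.prod torusMeasure) := by
  refine ((hf.norm.comp_snd torusMeasure).const_mul (‖L‖ * C)).mono' ?_
    (ae_of_all _ fun z => norm_bilinear_le L (hC z) _)
  exact L.aestronglyMeasurable_comp₂ hc.aestronglyMeasurable (hf.1.comp_snd)

theorem integrable_bilinear (L : E →L[ℝ] F →L[ℝ] G) {c : Plane → E}
    (hc : Continuous c) {C : ℝ≥0} (hC : ∀ z, ‖c z‖ ≤ C) {f : Plane → F}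
    (hf : Integrable f torusMeasure) :
    Integrable (fun y => L (c y) (f y)) torusMeasure :=
  (hf.norm.const_mul (‖L‖ * C)).mono' (L.aestronglyMeasurable_comp₂ hc.aestronglyMeasurable hf.1)
    (ae_of_all _ fun z => norm_bilinear_le L (hC z) _)

theorem norm_integral_bilinear_le (L : E →L[ℝ] F →L[ℝ] G) {c : Plane → E} {C : ℝ≥0}
    (hC : ∀ z, ‖c z‖ ≤ C) {f : Plane → F} (hf : Integrable f torusMeasure) :
    ‖∫ y, L (c y) (f y) ∂torusMeasure‖ ≤ ‖L‖ * C * ∫ y, ‖f y‖ ∂torusMeasure := by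
  rw [← integral_const_mul]
  exact norm_integral_le_of_norm_le (hf.norm.const_mul _)
    (ae_of_all _ fun z => norm_bilinear_le L (hC z) _)

theorem continuous_integral_bilinear (L : E →L[ℝ] F →L[ℝ] G) {k : Plane → E}
    (hk : Continuous k) {C : ℝ≥0} (hC : ∀ z, ‖k z‖ ≤ C) {f : Plane → F}
    (hf : Integrable f torusMeasure) :
    Continuous fun x => ∫ y, L (k (x - y)) (f y) ∂torusMeasure := by
  refine continuous_of_dominated (bound := fun y => ‖L‖ * C * ‖f y‖) (fun x => ?_)
    (fun x => ae_of_all _ fun y => norm_bilinear_le L (hC _) _) (hf.norm.const_mul _)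
    (ae_of_all _ fun y => by fun_prop)
  exact L.aestronglyMeasurable_comp₂
    (by fun_prop : Continuous fun y => k (x - y)).aestronglyMeasurable hf.1

end bilinear

/-! ### Convolution with smooth periodic kernels. -/

/-- A smooth function on the torus. -/
structure SmoothKernel (Φ : Plane → ℝ) : Prop where
  contDiff : ContDiff ℝ (⊤ : ℕ∞) Φ
  periodic : Periodic2 Φ

/-- The convolution `Φ * f` on the torus. -/
def smooth {F : Type*} [NormedAddCommGroup F] [NormedSpace ℝ F] (Φ : Plane → ℝ) (f : Plane → F)
    (x : Plane) : F := ∫ y, Φ (x - y) • f y ∂torusMeasure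

/-- The divergence `∇ ⬝ (Φ * W)` of the convolution of a vector field on the torus. -/
def smoothDiv (Φ : Plane → ℝ) (W : Plane → Plane) (x : Plane) : ℝ :=
  ∫ y, fderiv ℝ Φ (x - y) (W y) ∂torusMeasure

theorem smooth_eq {F : Type*} [NormedAddCommGroup F] [NormedSpace ℝ F] {Φ : Plane → ℝ}
    (hp : Periodic2 Φ) {f : Plane → F} (hf : Periodic2 f) (x : Plane) :
    smooth Φ f x = ∫ y, Φ y • f (x - y) ∂torusMeasure := by
  have h := integral_torus_sub_left
    ((hp.comp_sub_left x).comp₂ hf fun a b => a • b) x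
  simp only [sub_sub_cancel] at h
  exact h.symm

theorem periodic2_smooth {F : Type*} [NormedAddCommGroup F] [NormedSpace ℝ F] {Φ : Plane → ℝ}
    (hp : Periodic2 Φ) (f : Plane → F) : Periodic2 (smooth Φ f) := fun i x => by
  unfold smooth
  congr 1 with y
  rw [add_sub_right_comm, hp]

namespace SmoothKernel

variable {Φ : Plane → ℝ} (hΦ : SmoothKernel Φ)
include hΦ

theorem continuous : Continuous Φ := hΦ.contDiff.continuous

theorem differentiable : Differentiable ℝ Φ := hΦ.contDiff.differentiable (by simp)

theorem continuous_fderiv : Continuous (fderiv ℝ Φ) := hΦ.contDiff.continuous_fderiv (by simp)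

theorem fderiv_comp_sub_left (x y : Plane) :
    fderiv ℝ (fun y => Φ (x - y)) y = -fderiv ℝ Φ (x - y) := by
  have h := (hΦ.differentiable (x - y)).hasFDerivAt.comp y ((hasFDerivAt_id y).const_sub x)
  refine h.fderiv.trans ?_
  ext v
  simp

theorem exists_norm_le : ∃ C : ℝ≥0, (∀ x, ‖Φ x‖ ≤ C) ∧ ∀ x, ‖fderiv ℝ Φ x‖ ≤ C := by
  obtain ⟨C₁, h₁⟩ := hΦ.periodic.exists_norm_le hΦ.continuous
  obtain ⟨C₂, h₂⟩ := hΦ.periodic.fderiv.exists_norm_le hΦ.continuous_fderiv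
  exact ⟨max C₁ C₂, fun x => (h₁ x).trans (by simp), fun x => (h₂ x).trans (by simp)⟩

section

variable {F : Type*} [NormedAddCommGroup F] [NormedSpace ℝ F] {f : Plane → F}
  (hf : Integrable f torusMeasure)
include hf

theorem integrable_smooth_integrand (x : Plane) :
    Integrable (fun y => Φ (x - y) • f y) torusMeasure := by
  obtain ⟨C, hC, -⟩ := hΦ.exists_norm_le
  have := hΦ.continuous
  exact integrable_bilinear (ContinuousLinearMap.lsmul ℝ ℝ) (c := fun y => Φ (x - y))
    (by fun_prop) (fun _ => hC _) hf

theorem continuous_smooth : Continuous (smooth Φ f) := by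
  obtain ⟨C, hC, -⟩ := hΦ.exists_norm_le
  exact continuous_integral_bilinear (ContinuousLinearMap.lsmul ℝ ℝ) hΦ.continuous hC hf

end

theorem continuous_smoothDiv {W : Plane → Plane} (hW : Integrable W torusMeasure) :
    Continuous (smoothDiv Φ W) := by
  obtain ⟨C, -, hC⟩ := hΦ.exists_norm_le
  exact continuous_integral_bilinear (ContinuousLinearMap.id ℝ (Plane →L[ℝ] ℝ))
    hΦ.continuous_fderiv hC hW

theorem integrable_smoothDiv_integrand {W : Plane → Plane} (hW : Integrable W torusMeasure)
    (x : Plane) : Integrable (fun y => fderiv ℝ Φ (x - y) (W y)) torusMeasure := by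
  obtain ⟨C, -, hC⟩ := hΦ.exists_norm_le
  have := hΦ.continuous_fderiv
  exact integrable_bilinear (ContinuousLinearMap.id ℝ (Plane →L[ℝ] ℝ))
    (c := fun y => fderiv ℝ Φ (x - y)) (by fun_prop) (fun _ => hC _) hW

variable (F : Type*) [NormedAddCommGroup F] [NormedSpace ℝ F] in
theorem exists_norm_smooth_le : ∃ C : ℝ≥0, ∀ f : Plane → F, Integrable f torusMeasure → ∀ x,
    ‖smooth Φ f x‖ ≤ C * ∫ y, ‖f y‖ ∂torusMeasure := by
  obtain ⟨C, hC, -⟩ := hΦ.exists_norm_le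
  refine ⟨‖(ContinuousLinearMap.lsmul ℝ ℝ : ℝ →L[ℝ] F →L[ℝ] F)‖₊ * C, fun f hf x => ?_⟩
  exact norm_integral_bilinear_le (ContinuousLinearMap.lsmul ℝ ℝ) (c := fun y => Φ (x - y))
    (fun _ => hC _) hf

theorem exists_norm_smoothDiv_le : ∃ C : ℝ≥0, ∀ W : Plane → Plane, Integrable W torusMeasure →
    ∀ x, ‖smoothDiv Φ W x‖ ≤ C * ∫ y, ‖W y‖ ∂torusMeasure := by
  obtain ⟨C, -, hC⟩ := hΦ.exists_norm_le
  refine ⟨‖(ContinuousLinearMap.id ℝ (Plane →L[ℝ] ℝ) :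
    (Plane →L[ℝ] ℝ) →L[ℝ] Plane →L[ℝ] ℝ)‖₊ * C, fun f hf x => ?_⟩
  exact norm_integral_bilinear_le (ContinuousLinearMap.id ℝ (Plane →L[ℝ] ℝ))
    (c := fun y => fderiv ℝ Φ (x - y)) (fun _ => hC _) hf

theorem hasFDerivAt_smooth {f : Plane → ℝ} (hf : Integrable f torusMeasure) (x : Plane) :
    HasFDerivAt (smooth Φ f) (∫ y, f y • fderiv ℝ Φ (x - y) ∂torusMeasure) x := by
  obtain ⟨C, hC, hC'⟩ := hΦ.exists_norm_le
  have h1 := hΦ.continuous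
  have h2 := hΦ.continuous_fderiv
  refine hasFDerivAt_integral_of_dominated_of_fderiv_le (𝕜 := ℝ)
    (F' := fun x y => f y • fderiv ℝ Φ (x - y)) (s := univ) (F := fun x y => Φ (x - y) • f y)
    (bound := fun y => ‖f y‖ * C) univ_mem ?_ (hΦ.integrable_smooth_integrand hf x) ?_ ?_
    (hf.norm.mul_const _) ?_
  · exact Eventually.of_forall fun z => (hΦ.integrable_smooth_integrand hf z).1
  · exact hf.1.smul (by fun_prop : Continuous fun y => fderiv ℝ Φ (x - y)).aestronglyMeasurable
  · refine ae_of_all _ fun y z _ => ?_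
    rw [norm_smul]
    gcongr
    exact hC' _
  · refine ae_of_all _ fun y z _ => ?_
    have h3 := ((hΦ.differentiable (z - y)).hasFDerivAt.comp z (hasFDerivAt_sub_const y)).mul_const
      (f y)
    simpa using h3

theorem integrable_fderiv_integrand {f : Plane → ℝ} (hf : Integrable f torusMeasure) (x : Plane) :
    Integrable (fun y => f y • fderiv ℝ Φ (x - y)) torusMeasure := by
  obtain ⟨C, -, hC⟩ := hΦ.exists_norm_le
  have := hΦ.continuous_fderiv
  exact integrable_bilinear (ContinuousLinearMap.lsmul ℝ ℝ).flip
    (c := fun y => fderiv ℝ Φ (x - y)) (by fun_prop) (fun _ => hC _) hf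

/-- Directional derivatives of a mollified function are divergences of mollified fields with a
frozen direction; in the increment formula that direction is the velocity at `x`. -/
theorem fderiv_smooth {f : Plane → ℝ} (hf : Integrable f torusMeasure) (x v : Plane) :
    fderiv ℝ (smooth Φ f) x v = smoothDiv Φ (fun y => f y • v) x := by
  rw [(hΦ.hasFDerivAt_smooth hf x).fderiv,
    ContinuousLinearMap.integral_apply (hΦ.integrable_fderiv_integrand hf x)]
  simp [smoothDiv]

theorem exists_norm_fderiv_smooth_le : ∃ C : ℝ≥0, ∀ f : Plane → ℝ, Integrable f torusMeasure →
    ∀ x, ‖fderiv ℝ (smooth Φ f) x‖ ≤ C * ∫ y, ‖f y‖ ∂torusMeasure := by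
  obtain ⟨C, -, hC⟩ := hΦ.exists_norm_le
  refine ⟨‖(ContinuousLinearMap.lsmul ℝ ℝ : ℝ →L[ℝ] (Plane →L[ℝ] ℝ) →L[ℝ] (Plane →L[ℝ] ℝ)).flip‖₊ * C, fun f hf x => ?_⟩
  rw [(hΦ.hasFDerivAt_smooth hf x).fderiv]
  exact norm_integral_bilinear_le (ContinuousLinearMap.lsmul ℝ ℝ).flip
    (c := fun y => fderiv ℝ Φ (x - y)) (fun _ => hC _) hf

theorem contDiff_smooth {f : Plane → ℝ} (hf : Integrable f torusMeasure) :
    ContDiff ℝ 1 (smooth Φ f) := by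
  obtain ⟨C, hC, hC'⟩ := hΦ.exists_norm_le
  refine contDiff_one_iff_hasFDerivAt.2 ⟨_, ?_, hΦ.hasFDerivAt_smooth hf⟩
  exact continuous_integral_bilinear (ContinuousLinearMap.lsmul ℝ ℝ).flip hΦ.continuous_fderiv hC' hf

/-- Integration by parts for the divergence of a mollified vector field. -/
theorem integral_mul_smoothDiv {g : Plane → ℝ} (hg : ContDiff ℝ 1 g) (hgp : Periodic2 g)
    {W : Plane → Plane} (hW : Integrable W torusMeasure) :
    ∫ x, g x * smoothDiv Φ W x ∂torusMeasure =
      -∫ x, fderiv ℝ g x (smooth Φ W x) ∂torusMeasure := by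
  obtain ⟨C, hC, hC'⟩ := hΦ.exists_norm_le
  have hg0 := hg.continuous
  have hg1 := hg.continuous_fderiv one_ne_zero
  obtain ⟨B, hB⟩ := hgp.exists_norm_le hg0
  obtain ⟨B', hB'⟩ := hgp.fderiv.exists_norm_le hg1
  have h1 := hΦ.continuous
  have h2 := hΦ.continuous_fderiv
  have hs := hΦ.continuous_smooth hW
  have hd := hΦ.continuous_smoothDiv hW
  have hi1 : Integrable (fun x => g x * smoothDiv Φ W x) torusMeasure := by
    obtain ⟨A, hA⟩ := hΦ.exists_norm_smoothDiv_le
    refine Integrable.of_bound (by fun_prop : Continuous _).aestronglyMeasurable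
      (B * (A * ∫ y, ‖W y‖ ∂torusMeasure)) (ae_of_all _ fun x => ?_)
    rw [norm_mul]
    gcongr
    exacts [hB x, hA W hW x]
  have hi2 : Integrable (fun x => fderiv ℝ g x (smooth Φ W x)) torusMeasure := by
    obtain ⟨A, hA⟩ := hΦ.exists_norm_smooth_le Plane
    refine Integrable.of_bound (by fun_prop : Continuous _).aestronglyMeasurable
      (B' * (A * ∫ y, ‖W y‖ ∂torusMeasure)) (ae_of_all _ fun x => ?_)
    refine (ContinuousLinearMap.le_opNorm _ _).trans ?_
    gcongr
    exacts [hB' x, hA W hW x]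
  rw [eq_neg_iff_add_eq_zero, ← integral_add hi1 hi2]
  have key : ∀ x, g x * smoothDiv Φ W x + fderiv ℝ g x (smooth Φ W x) =
      ∫ y, (g x • fderiv ℝ Φ (x - y) + Φ (x - y) • fderiv ℝ g x) (W y) ∂torusMeasure := fun x => by
    unfold smoothDiv smooth
    rw [← integral_const_mul,
      ← ContinuousLinearMap.integral_comp_comm _ (hΦ.integrable_smooth_integrand hW x),
      ← integral_add ((hΦ.integrable_smoothDiv_integrand hW x).const_mul _)
        ((fderiv ℝ g x).integrable_comp (hΦ.integrable_smooth_integrand hW x))]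
    simp
  simp only [key]
  -- For fixed `y` the inner integrand is the derivative of `g · Φ(· - y)` in the constant direction
  -- `W y`. Hence no regularity of `W` is used.
  rw [integral_integral_swap]
  · refine Eq.trans (integral_congr_ae (ae_of_all _ fun y => ?_)) (integral_zero _ _)
    refine integral_torus_lineDeriv_eq_zero (f := fun x => g x * Φ (x - y)) (W y)
      (hgp.comp₂ (hΦ.periodic.comp_sub y) fun a b => a * b) (by fun_prop) ?_ fun x => ?_
    · simp only [_root_.add_apply, _root_.smul_apply]
      fun_prop
    · have hl : HasDerivAt (fun a : ℝ => x + a • W y) (W y) 0 := by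
        simpa using ((hasDerivAt_id (0 : ℝ)).smul_const (W y)).const_add x
      have h3 := (((hg.differentiable one_ne_zero (x + (0 : ℝ) • W y)).hasFDerivAt.comp_hasDerivAt
        (0 : ℝ) hl)).mul (((hΦ.differentiable (x + (0 : ℝ) • W y - y)).hasFDerivAt.comp_hasDerivAt
        (0 : ℝ) (hl.sub_const y)))
      simp only [Function.comp_apply, Function.comp_def, zero_smul, add_zero] at h3
      refine HasDerivAt.congr_deriv h3 ?_
      simp only [_root_.add_apply, _root_.smul_apply, smul_eq_mul]
      ring
  · refine integrable_prod_bilinear (ContinuousLinearMap.id ℝ (Plane →L[ℝ] ℝ))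
      (c := fun z : Plane × Plane => g z.1 • fderiv ℝ Φ (z.1 - z.2) + Φ (z.1 - z.2) • fderiv ℝ g z.1)
      (by fun_prop) (C := B * C + C * B') (fun z => ?_) hW
    refine (norm_add_le _ _).trans ?_
    rw [norm_smul, norm_smul]
    push_cast
    gcongr
    exacts [hB _, hC' _, hC _, hB' _]

end SmoothKernel

/-! ### The velocity of an integrable vorticity. -/

theorem integrable_biotSavartKernel : Integrable biotSavartKernel torusMeasure := by
  obtain ⟨D, hD, hw⟩ := measure_lt_norm_biotSavartKernel_le
  have h := lintegral_rpow_lt_top_of_weak measurable_biotSavartKernel.norm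
    (fun _ => norm_nonneg _) hD hw one_pos one_lt_two
  simp only [Real.rpow_one, ofReal_norm] at h
  exact ⟨measurable_biotSavartKernel.aestronglyMeasurable, h⟩

/-- Integrable functions on the torus. -/
structure TorusL1 (f : Plane → ℝ) : Prop where
  measurable : Measurable f
  periodic : Periodic2 f
  integrable : Integrable f torusMeasure

theorem velocity_eq {f : Plane → ℝ} (hf : Periodic2 f) (x : Plane) :
    velocity f x = ∫ y, f y • biotSavartKernel (x - y) ∂torusMeasure := by
  have h := integral_torus_sub_left (hf.comp₂ (periodic2_biotSavartKernel.comp_sub_left x)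
    fun a b => a • b) x
  simp only [sub_sub_cancel] at h
  exact h

theorem velocity_comp_sub (f : Plane → ℝ) (a x : Plane) :
    velocity (fun y => f (y - a)) x = velocity f (x - a) := by
  simp only [velocity, sub_right_comm]

/-- Equality holds at every point, even where the integral diverges, because the integrands agree
almost everywhere. A change of representative therefore never alters the velocity. -/
theorem velocity_congr {f g : Plane → ℝ} (hf : Periodic2 f) (hg : Periodic2 g)
    (h : f =ᵐ[torusMeasure] g) : velocity f = velocity g := by
  ext1 x
  rw [velocity_eq hf, velocity_eq hg]
  exact integral_congr_ae (h.mono fun y hy => by simp only [hy])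

theorem periodic2_velocity {f : Plane → ℝ} (hf : Periodic2 f) : Periodic2 (velocity f) :=
  fun i x => by
  unfold velocity
  simp only [add_sub_right_comm x, hf i]

namespace TorusL1

variable {f g : Plane → ℝ}

theorem sub (hf : TorusL1 f) (hg : TorusL1 g) : TorusL1 fun x => f x - g x :=
  ⟨hf.measurable.sub hg.measurable, hf.periodic.comp₂ hg.periodic fun a b => a - b,
    hf.integrable.sub hg.integrable⟩

theorem comp_sub (hf : TorusL1 f) (a : Plane) : TorusL1 fun x => f (x - a) :=
  ⟨hf.measurable.comp (by fun_prop), hf.periodic.comp_sub a,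
    (integrable_torus_sub_iff hf.periodic a).2 hf.integrable⟩

theorem smooth (hf : TorusL1 f) {Φ : Plane → ℝ} (hΦ : SmoothKernel Φ) : TorusL1 (smooth Φ f) := by
  have hc := hΦ.continuous_smooth hf.integrable
  obtain ⟨C, hC⟩ := (periodic2_smooth hΦ.periodic f).exists_norm_le hc
  exact ⟨hc.measurable, periodic2_smooth hΦ.periodic f,
    Integrable.of_bound hc.aestronglyMeasurable C (ae_of_all _ hC)⟩

variable (hf : TorusL1 f)
include hf

theorem integrable_prod_kernel :
    Integrable (fun z : Plane × Plane => f z.2 • biotSavartKernel (z.1 - z.2))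
      (torusMeasure.prod torusMeasure) := by
  have hm : Measurable fun z : Plane × Plane => f z.2 • biotSavartKernel (z.1 - z.2) :=
    (hf.measurable.comp measurable_snd).smul
      (measurable_biotSavartKernel.comp (measurable_fst.sub measurable_snd))
  rw [integrable_prod_iff' hm.aestronglyMeasurable]
  refine ⟨ae_of_all _ fun y => ?_, ?_⟩
  · exact ((integrable_torus_sub_iff periodic2_biotSavartKernel y).2
      integrable_biotSavartKernel).smul (f y)
  · simp only [norm_smul, integral_const_mul,
      integral_torus_sub (periodic2_biotSavartKernel.comp fun a => ‖a‖)]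
    exact hf.integrable.norm.mul_const _

theorem ae_integrable_kernel :
    ∀ᵐ x ∂torusMeasure, Integrable (fun y => f y • biotSavartKernel (x - y)) torusMeasure :=
  hf.integrable_prod_kernel.prod_right_ae

theorem stronglyMeasurable_velocity : StronglyMeasurable (velocity f) := by
  have hm : Measurable fun z : Plane × Plane => f (z.1 - z.2) • biotSavartKernel z.2 :=
    (hf.measurable.comp (by fun_prop)).smul (measurable_biotSavartKernel.comp measurable_snd)
  exact hm.stronglyMeasurable.integral_prod_right'

theorem integrable_velocity : Integrable (velocity f) torusMeasure := by
  have h := hf.integrable_prod_kernel.integral_prod_left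
  simpa only [← velocity_eq hf.periodic] using h

/-- Additivity can fail on the null set where one of the integrals diverges and takes the default
value zero. -/
theorem velocity_sub_ae (hg : TorusL1 g) :
    ∀ᵐ x ∂torusMeasure, velocity (fun x => f x - g x) x = velocity f x - velocity g x := by
  filter_upwards [hf.ae_integrable_kernel, hg.ae_integrable_kernel] with x h1 h2
  rw [velocity_eq hf.periodic, velocity_eq hg.periodic, velocity_eq (hf.sub hg).periodic,
    ← integral_sub h1 h2]
  simp only [sub_smul]

/-- Convolutions commute: after Fubini, the reflection `y ↦ x + z - y` exchanges the two kernels. It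
is what makes the mollified velocity the velocity of the mollified vorticity. -/
theorem velocity_smooth {Φ : Plane → ℝ} (hΦ : SmoothKernel Φ) (x : Plane) :
    velocity (TorusEuler.smooth Φ f) x = TorusEuler.smooth Φ (velocity f) x := by
  obtain ⟨C, hC, -⟩ := hΦ.exists_norm_le
  have hc := hΦ.continuous
  have hK := measurable_biotSavartKernel
  have hKx := (integrable_torus_sub_left_iff periodic2_biotSavartKernel x).2
    integrable_biotSavartKernel
  rw [velocity_eq (periodic2_smooth hΦ.periodic f)]
  unfold TorusEuler.smooth
  simp only [velocity_eq hf.periodic]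
  have e1 : ∀ y, (∫ z, Φ (y - z) • f z ∂torusMeasure) • biotSavartKernel (x - y) =
      ∫ z, (Φ (y - z) • f z) • biotSavartKernel (x - y) ∂torusMeasure := fun y =>
    (integral_smul_const _ _).symm
  have e2 : ∀ y, Φ (x - y) • ∫ z, f z • biotSavartKernel (y - z) ∂torusMeasure =
      ∫ z, Φ (x - y) • f z • biotSavartKernel (y - z) ∂torusMeasure := fun y =>
    (integral_smul _ _).symm
  simp only [e1, e2]
  have hA : Integrable (Function.uncurry fun y z => (Φ (y - z) • f z) • biotSavartKernel (x - y))
      (torusMeasure.prod torusMeasure) := by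
    have h1 : Integrable (fun z : Plane × Plane => f z.2 • biotSavartKernel (x - z.1))
        (torusMeasure.prod torusMeasure) := by
      have := (hKx.norm.mul_prod hf.integrable.norm)
      refine this.mono' (((hf.measurable.comp measurable_snd).smul
        (hK.comp (by fun_prop : Measurable fun z : Plane × Plane => x - z.1))).aestronglyMeasurable)
        (ae_of_all _ fun z => ?_)
      rw [norm_smul, mul_comm]
    have h2 := h1.bdd_smul (φ := fun z : Plane × Plane => Φ (z.1 - z.2)) C
      (by fun_prop : Continuous fun z : Plane × Plane => Φ (z.1 - z.2)).aestronglyMeasurable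
      (ae_of_all _ fun z => hC _)
    simp only [smul_assoc]
    exact h2
  have hB : Integrable (Function.uncurry fun y z => Φ (x - y) • f z • biotSavartKernel (y - z))
      (torusMeasure.prod torusMeasure) :=
    hf.integrable_prod_kernel.bdd_smul C
      (by fun_prop : Continuous fun z : Plane × Plane => Φ (x - z.1)).aestronglyMeasurable
      (ae_of_all _ fun z => hC _)
  rw [integral_integral_swap hA, integral_integral_swap hB]
  refine integral_congr_ae (ae_of_all _ fun z => ?_)
  have h := integral_torus_sub_left ((hΦ.periodic.comp_sub_left x).comp₂
    (periodic2_biotSavartKernel.comp_sub z) fun a b => a • f z • b) (x + z)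
  refine Eq.trans (integral_congr_ae (ae_of_all _ fun y => ?_)) h
  simp only
  rw [smul_assoc, show x - (x + z - y) = y - z by abel, show x + z - y - z = x - y by abel]

/-- The velocity is divergence free. -/
theorem integral_fderiv_velocity (hg : ContDiff ℝ 1 g) (hgp : Periodic2 g) :
    ∫ x, fderiv ℝ g x (velocity f x) ∂torusMeasure = 0 := by
  have hg1 := hg.continuous_fderiv one_ne_zero
  obtain ⟨B, hB⟩ := hgp.fderiv.exists_norm_le hg1
  have e : ∀ᵐ x ∂torusMeasure, fderiv ℝ g x (velocity f x) =
      ∫ y, fderiv ℝ g x (f y • biotSavartKernel (x - y)) ∂torusMeasure := by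
    filter_upwards [hf.ae_integrable_kernel] with x hx
    rw [velocity_eq hf.periodic, ContinuousLinearMap.integral_comp_comm _ hx]
  rw [integral_congr_ae e, integral_integral_swap]
  · refine Eq.trans (integral_congr_ae (ae_of_all _ fun y => ?_)) (integral_zero _ _)
    simp only [map_smul, integral_smul]
    have h := integral_fderiv_biotSavartKernel (g := fun x => g (x + y))
      (hg.comp (contDiff_id.add contDiff_const)) (hgp.comp_add y)
    have h2 := integral_torus_sub (hgp.fderiv.comp_add y |>.comp₂ periodic2_biotSavartKernel
      fun a b => a b) y
    simp only [sub_add_cancel] at h2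
    simp only [fderiv_comp_add_right] at h
    rw [h2, h, smul_zero]
  · refine (hf.integrable_prod_kernel.norm.const_mul (B : ℝ)).mono' ?_ (ae_of_all _ fun z => ?_)
    · exact (ContinuousLinearMap.id ℝ (Plane →L[ℝ] ℝ)).aestronglyMeasurable_comp₂
        (f := fun z : Plane × Plane => fderiv ℝ g z.1)
        (by fun_prop : Continuous fun z : Plane × Plane => fderiv ℝ g z.1).aestronglyMeasurable
        hf.integrable_prod_kernel.1
    · exact (ContinuousLinearMap.le_opNorm _ _).trans (by gcongr; exact hB _)

/-- The weak divergence condition tested with `Φ(x - ·)`. -/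
theorem smoothDiv_velocity {Φ : Plane → ℝ} (hΦ : SmoothKernel Φ) (x : Plane) :
    smoothDiv Φ (velocity f) x = 0 := by
  have h := hf.integral_fderiv_velocity (g := fun y => Φ (x - y))
    ((hΦ.contDiff.of_le (by simp)).comp (contDiff_const.sub contDiff_id))
    (hΦ.periodic.comp_sub_left x)
  simp only [hΦ.fderiv_comp_sub_left, _root_.neg_apply, integral_neg, neg_eq_zero] at h
  exact h

end TorusL1

/-! ### Averages against probability densities. -/

theorem rpow_lintegral_le {α : Type*} [MeasurableSpace α] (ν : Measure α) [IsProbabilityMeasure ν]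
    {p : ℝ} (hp : 1 ≤ p) {g : α → ENNReal} (hg : Measurable g) :
    (∫⁻ x, g x ∂ν) ^ p ≤ ∫⁻ x, g x ^ p ∂ν := by
  rcases hp.eq_or_lt with rfl | hp
  · simp
  have hpq := Real.HolderConjugate.conjExponent hp
  have h := ENNReal.lintegral_mul_le_Lp_mul_Lq ν hpq hg.aemeasurable
    (aemeasurable_const (b := (1 : ENNReal)))
  simp only [Pi.mul_apply, mul_one, ENNReal.one_rpow, lintegral_const, measure_univ] at h
  calc _ ≤ ((∫⁻ x, g x ^ p ∂ν) ^ (1 / p)) ^ p := ENNReal.rpow_le_rpow h (by linarith)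
    _ = _ := by
      rw [← ENNReal.rpow_mul, one_div_mul_cancel (by linarith), ENNReal.rpow_one]

theorem rpow_one_div_le_iff {p : ℝ} (hp : 0 < p) {a b : ENNReal} :
    a ^ (1 / p) ≤ b ↔ a ≤ b ^ p := by
  rw [one_div, ENNReal.rpow_inv_le_iff hp]

/-- A probability density on the torus. -/
structure UnitKernel (Φ : Plane → ℝ) : Prop extends SmoothKernel Φ where
  nonneg : ∀ x, 0 ≤ Φ x
  integral_eq_one : ∫ x, Φ x ∂torusMeasure = 1

namespace UnitKernel

variable {Φ : Plane → ℝ} (hΦ : UnitKernel Φ)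
include hΦ

theorem toSmooth : SmoothKernel Φ := hΦ.toSmoothKernel

theorem integrable : Integrable Φ torusMeasure := by
  obtain ⟨C, hC, -⟩ := hΦ.toSmooth.exists_norm_le
  exact Integrable.of_bound hΦ.toSmooth.continuous.aestronglyMeasurable C (ae_of_all _ hC)

theorem lintegral_eq_one : ∫⁻ x, ENNReal.ofReal (Φ x) ∂torusMeasure = 1 := by
  rw [← ofReal_integral_eq_lintegral_ofReal hΦ.integrable (ae_of_all _ hΦ.nonneg),
    hΦ.integral_eq_one, ENNReal.ofReal_one]

/-- Averages of functions that are small in `L^p` are small in `L^p`. -/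
theorem lintegral_average_rpow_le {p : ℝ} (hp : 1 ≤ p) {G : Plane × Plane → ENNReal}
    (hG : Measurable G) {δ : ENNReal}
    (hδ : ∀ y, Φ y ≠ 0 → ∫⁻ x, G (x, y) ^ p ∂torusMeasure ≤ δ) :
    ∫⁻ x, (∫⁻ y, ENNReal.ofReal (Φ y) * G (x, y) ∂torusMeasure) ^ p ∂torusMeasure ≤ δ := by
  have hm : Measurable fun y => ENNReal.ofReal (Φ y) := hΦ.toSmooth.continuous.measurable.ennreal_ofReal
  have hν : IsProbabilityMeasure (torusMeasure.withDensity fun y => ENNReal.ofReal (Φ y)) :=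
    ⟨by rw [withDensity_apply _ .univ, setLIntegral_univ, hΦ.lintegral_eq_one]⟩
  have hd : ∀ g : Plane → ENNReal, Measurable g → ∫⁻ y, ENNReal.ofReal (Φ y) * g y ∂torusMeasure =
      ∫⁻ y, g y ∂(torusMeasure.withDensity fun y => ENNReal.ofReal (Φ y)) := fun g hg =>
    (lintegral_withDensity_eq_lintegral_mul _ hm hg).symm
  calc _ ≤ ∫⁻ x, ∫⁻ y, ENNReal.ofReal (Φ y) * G (x, y) ^ p ∂torusMeasure ∂torusMeasure := by
        refine lintegral_mono fun x => ?_
        simp only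
        rw [hd _ (by fun_prop), hd _ (by fun_prop)]
        exact rpow_lintegral_le _ hp (by fun_prop)
    _ = ∫⁻ y, ENNReal.ofReal (Φ y) * ∫⁻ x, G (x, y) ^ p ∂torusMeasure ∂torusMeasure := by
        rw [lintegral_lintegral_swap (by
          exact ((hm.comp measurable_snd).mul (hG.pow_const p)).aemeasurable)]
        refine lintegral_congr fun y => lintegral_const_mul _ (by fun_prop)
    _ ≤ ∫⁻ y, ENNReal.ofReal (Φ y) * δ ∂torusMeasure := by
        refine lintegral_mono fun y => ?_
        by_cases h : Φ y = 0
        · simp [h]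
        · exact mul_le_mul_right (hδ y h) _
    _ = δ := by rw [lintegral_mul_const _ hm, hΦ.lintegral_eq_one, one_mul]

/-- Since `Φ` has integral one, a constant can be moved under the average. The choice `c = f x`
yields approximation, `c = 0` yields contraction, and a third value serves the turbulent transport.
-/
theorem enorm_smooth_sub_le {F : Type*} [NormedAddCommGroup F] [NormedSpace ℝ F]
    [CompleteSpace F] {V : Plane → F}
    (hV : Integrable V torusMeasure) (hp : Periodic2 V) (x : Plane) (c : F) :
    ‖smooth Φ V x - c‖ₑ ≤ ∫⁻ y, ENNReal.ofReal (Φ y) * ‖V (x - y) - c‖ₑ ∂torusMeasure := by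
  have hi : Integrable (fun y => Φ y • V (x - y)) torusMeasure := by
    have h := (integrable_torus_sub_left_iff ((hΦ.periodic.comp_sub_left x).comp₂ hp
      fun a b => a • b) x).2 (hΦ.toSmooth.integrable_smooth_integrand hV x)
    simpa only [sub_sub_cancel] using h
  have h1 : smooth Φ V x - c = ∫ y, Φ y • (V (x - y) - c) ∂torusMeasure := by
    simp only [smul_sub]
    rw [integral_sub hi (hΦ.integrable.smul_const c), integral_smul_const, hΦ.integral_eq_one,
      one_smul, smooth_eq hΦ.periodic hp]
  rw [h1]
  refine (enorm_integral_le_lintegral_enorm _).trans_eq ?_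
  simp only [enorm_smul, Real.enorm_of_nonneg (hΦ.nonneg _)]

theorem torusNorm_smooth_sub_le {p : ℝ} (hp : 1 ≤ p) {f : Plane → ℝ} (hf : TorusL1 f)
    {δ : ENNReal} (hδ : ∀ y, Φ y ≠ 0 → torusNorm p (fun x => f (x - y) - f x) ≤ δ) :
    torusNorm p (fun x => smooth Φ f x - f x) ≤ δ := by
  have hp0 : 0 < p := by linarith
  have hm := hf.measurable
  rw [torusNorm_eq hp0, rpow_one_div_le_iff hp0]
  refine le_trans (lintegral_mono fun x => ENNReal.rpow_le_rpow
    (hΦ.enorm_smooth_sub_le hf.integrable hf.periodic x (f x)) hp0.le) ?_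
  refine hΦ.lintegral_average_rpow_le hp (G := fun z => ‖f (z.1 - z.2) - f z.1‖ₑ) (by fun_prop)
    fun y hy => ?_
  rw [← rpow_one_div_le_iff hp0, ← torusNorm_eq hp0]
  exact hδ y hy

theorem torusNorm_smooth_le {p : ℝ} (hp : 1 ≤ p) {f : Plane → ℝ} (hf : TorusL1 f) :
    torusNorm p (smooth Φ f) ≤ torusNorm p f := by
  have hp0 : 0 < p := by linarith
  have hm := hf.measurable
  rw [torusNorm_eq hp0, rpow_one_div_le_iff hp0]
  have h := fun x => hΦ.enorm_smooth_sub_le hf.integrable hf.periodic x 0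
  simp only [sub_zero] at h
  refine le_trans (lintegral_mono fun x => ENNReal.rpow_le_rpow (h x) hp0.le) ?_
  refine hΦ.lintegral_average_rpow_le hp (G := fun z => ‖f (z.1 - z.2)‖ₑ) (by fun_prop)
    fun y hy => ?_
  rw [← rpow_one_div_le_iff hp0, lintegral_torus_sub (hf.periodic.comp fun a => ‖a‖ₑ ^ p),
    ← torusNorm_eq hp0]

theorem lintegral_mul_smooth_sub_le {w : Plane → ENNReal} (hw : Measurable w) {V c : Plane → Plane}
    (hVm : Measurable V) (hV : Integrable V torusMeasure) (hp : Periodic2 V) (hc : Measurable c)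
    {δ : ENNReal}
    (hδ : ∀ y, Φ y ≠ 0 → ∫⁻ x, w x * ‖V (x - y) - c x‖ₑ ∂torusMeasure ≤ δ) :
    ∫⁻ x, w x * ‖smooth Φ V x - c x‖ₑ ∂torusMeasure ≤ δ := by
  have h := hΦ.lintegral_average_rpow_le le_rfl
    (G := fun z => w z.1 * ‖V (z.1 - z.2) - c z.1‖ₑ) (by fun_prop) (δ := δ) (by simpa using hδ)
  simp only [ENNReal.rpow_one] at h
  refine le_trans (lintegral_mono fun x => ?_) h
  refine (mul_le_mul_right (hΦ.enorm_smooth_sub_le hV hp x (c x)) _).trans_eq ?_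
  rw [← lintegral_const_mul _ (by
    have := hΦ.toSmooth.continuous.measurable
    fun_prop)]
  exact lintegral_congr fun y => mul_left_comm _ _ _

end UnitKernel

/-! ### Translations in `L^p`. -/

theorem torusNorm_comp_sub {p : ℝ} (hp : 0 < p) {f : Plane → ℝ} (hf : Periodic2 f) (a : Plane) :
    torusNorm p (fun x => f (x - a)) = torusNorm p f := by
  rw [torusNorm_eq hp, torusNorm_eq hp, lintegral_torus_sub (hf.comp fun a => ‖a‖ₑ ^ p)]

theorem integrable_of_torusNorm_lt_top {p : ℝ} (hp : 1 ≤ p) {f : Plane → ℝ} (hf : Measurable f)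
    (h : torusNorm p f < ⊤) : Integrable f torusMeasure :=
  MemLp.integrable (q := ENNReal.ofReal p) (by simpa using hp) ⟨hf.aestronglyMeasurable, h⟩

/-- Translation is continuous in `L^p`. -/
theorem tendsto_torusNorm_translate {p : ℝ} (hp : 1 ≤ p) {f : Plane → ℝ} (hf : Measurable f)
    (hfp : Periodic2 f) (hN : torusNorm p f < ⊤) :
    Tendsto (fun y => torusNorm p fun x => f (x - y) - f x) (𝓝 0) (𝓝 0) := by
  have hp0 : 0 < p := by linarith
  have hpE : (1 : ENNReal) ≤ ENNReal.ofReal p := by simpa using hp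
  -- The cell lies in the ball of radius 2 and translations are at most 1 long, so a cutoff equal to
  -- 1 on the ball of radius 3 does not change the difference on the cell. The question moves to the
  -- plane, where continuous functions of compact support are dense.
  let κ : ContDiffBump (0 : Plane) := ⟨3, 4, by norm_num, by norm_num⟩
  have hκc : Continuous κ := κ.continuous
  set F : Plane → ℝ := fun x => κ x * f x with hF
  have hFm : Measurable F := hκc.measurable.mul hf
  have hFp : MemLp F (ENNReal.ofReal p) volume := by
    refine ⟨hFm.aestronglyMeasurable, ?_⟩
    rw [eLpNorm_lt_top_iff_lintegral_rpow_enorm_lt_top (by simpa using hp0) ENNReal.ofReal_ne_top,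
      ENNReal.toReal_ofReal hp0.le]
    have hi : Integrable (fun x => ‖f x‖ ^ p) torusMeasure := by
      refine ⟨(hf.norm.pow_const p).aestronglyMeasurable, ?_⟩
      rw [torusNorm_eq hp0] at hN
      have := (ENNReal.rpow_lt_top_iff_of_pos (by positivity)).1 hN
      rw [HasFiniteIntegral]
      refine lt_of_eq_of_lt (lintegral_congr fun x => ?_) this
      rw [Real.enorm_rpow_of_nonneg (norm_nonneg _) hp0.le, enorm_norm]
    have h1 := integrable_of_periodic (ContinuousLinearMap.lsmul ℝ ℝ) (κ := fun x => |κ x| ^ p)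
      (κ.hasCompactSupport.comp_left (g := fun s : ℝ => |s| ^ p) (by simp [hp0.ne']))
      (hκc.abs.rpow_const fun x => Or.inr hp0.le) (hfp.comp fun a => ‖a‖ ^ p)
      (hf.norm.pow_const p).stronglyMeasurable hi
    refine lt_of_eq_of_lt (lintegral_congr fun x => ?_) h1.2
    simp only [hF, ContinuousLinearMap.lsmul_apply, smul_eq_mul, enorm_mul]
    rw [Real.enorm_rpow_of_nonneg (norm_nonneg _) hp0.le, enorm_norm,
      Real.enorm_rpow_of_nonneg (abs_nonneg _) hp0.le, ← Real.norm_eq_abs, enorm_norm,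
      ENNReal.mul_rpow_of_nonneg _ _ hp0.le]
  have hFf : ∀ x, ‖x‖ ≤ 3 → F x = f x := fun x hx => by
    rw [hF]
    simp only
    rw [κ.one_of_mem_closedBall (by simpa using hx), one_mul]
  rw [ENNReal.tendsto_nhds_zero]
  intro η hη
  obtain ⟨η', hη', hηη⟩ : ∃ η' : ℝ≥0, 0 < η' ∧ (η' : ENNReal) + η' + η' ≤ η := by
    obtain ⟨a, ha, hlt⟩ := ENNReal.lt_iff_exists_nnreal_btwn.1 hη
    refine ⟨a / 3, by
      have : (0 : ENNReal) < a := ha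
      have := ENNReal.coe_pos.1 this
      positivity, ?_⟩
    rw [← ENNReal.coe_add, ← ENNReal.coe_add, add_thirds]
    exact hlt.le
  obtain ⟨g, hgc, hgF, hg, -⟩ := hFp.exists_hasCompactSupport_eLpNorm_sub_le
    ENNReal.ofReal_ne_top (ε := η') (by simpa using hη'.ne')
  obtain ⟨ρ, hρ, hu⟩ := Metric.uniformContinuous_iff.1 (hgc.uniformContinuous_of_continuous hg)
    η' hη'
  filter_upwards [Metric.ball_mem_nhds (0 : Plane) (lt_min hρ one_pos)] with y hy
  rw [mem_ball_zero_iff, lt_min_iff] at hy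
  have hgm := hg.measurable
  have e1 : torusNorm p (fun x => f (x - y) - f x) =
      torusNorm p (fun x => (F (x - y) - g (x - y)) + (g (x - y) - g x) + (g x - F x)) := by
    refine eLpNorm_congr_ae ((ae_restrict_iff' measurableSet_cell).2 (ae_of_all _ fun x hx => ?_))
    have := norm_le_two_of_mem_cell hx
    simp only
    rw [hFf x (by linarith), hFf (x - y) ((norm_sub_le _ _).trans (by linarith))]
    ring
  rw [e1]
  refine (torusNorm_add_le hp (by fun_prop : Measurable _).aestronglyMeasurable
    (by fun_prop : Measurable _).aestronglyMeasurable).trans (le_trans ?_ hηη)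
  refine add_le_add ((torusNorm_add_le hp (by fun_prop : Measurable _).aestronglyMeasurable
    (by fun_prop : Measurable _).aestronglyMeasurable).trans (add_le_add ?_ ?_)) ?_
  · refine (eLpNorm_mono_measure _ Measure.restrict_le_self).trans (le_trans (le_of_eq ?_) hgF)
    exact eLpNorm_comp_measurePreserving (g := F - g) (f := fun x => x - y)
      (hFm.sub hgm).aestronglyMeasurable (measurePreserving_sub_right volume y)
  · refine (eLpNorm_le_of_ae_bound (C := η') (ae_of_all _ fun x => ?_)).trans_eq ?_
    · have := @hu (x - y) x (by simpa [dist_eq_norm] using hy.1)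
      rw [dist_eq_norm] at this
      exact this.le
    · simp
  · refine (eLpNorm_mono_measure _ Measure.restrict_le_self).trans (le_trans (le_of_eq ?_) hgF)
    exact eLpNorm_sub_comm _ _ _ _

/-! ### Nonlinear estimates from the velocity bound. -/

theorem enorm_le_of_abs_le {C : ℝ≥0} {m x s y : ℝ} (h : |x| ≤ C * (1 + |s|) ^ m * |y|) :
    ‖x‖ₑ ≤ C * ((1 + ‖s‖ₑ) ^ m * ‖y‖ₑ) := by
  have h0 : (0 : ℝ) < 1 + |s| := by positivity
  have h1 : ‖x‖ₑ ≤ ‖(C : ℝ) * (1 + |s|) ^ m * y‖ₑ := by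
    rw [enorm_le_iff_norm_le, Real.norm_eq_abs, Real.norm_eq_abs, abs_mul,
      abs_of_nonneg (by positivity : (0 : ℝ) ≤ C * (1 + |s|) ^ m)]
    exact h
  refine h1.trans_eq ?_
  rw [enorm_mul, enorm_mul, Real.enorm_of_nonneg (by positivity : 0 ≤ (1 + |s|) ^ m),
    ← ENNReal.ofReal_rpow_of_pos h0, ← Real.enorm_of_nonneg h0.le, enorm_one_add_abs, mul_assoc]
  simp

/-- A function with a derivative of growth of order `m`. -/
structure PowerGrowth (h : ℝ → ℝ) (m : ℝ) (C : ℝ≥0) : Prop where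
  contDiff : ContDiff ℝ 1 h
  abs_deriv_le : ∀ s, |deriv h s| ≤ C * (1 + |s|) ^ m
  abs_le : ∀ s, |h s| ≤ C * (1 + |s|) ^ m * (1 + |s|)

namespace PowerGrowth

variable {h : ℝ → ℝ} {m : ℝ} {C : ℝ≥0} (H : PowerGrowth h m C)
include H

theorem continuous : Continuous h := H.contDiff.continuous

theorem continuous_deriv : Continuous (deriv h) := H.contDiff.continuous_deriv le_rfl

/-- The mean value inequality on the symmetric interval of radius `|a| + |b|`. The redundant outer
modulus gives the weight the form `1 + |F|` of `VelocityBound`. -/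
theorem abs_sub_le (hm : 0 ≤ m) (a b : ℝ) :
    |h a - h b| ≤ C * (1 + |(|a| + |b|)|) ^ m * |a - b| := by
  rw [abs_of_nonneg (by positivity : 0 ≤ |a| + |b|)]
  refine (convex_Icc (-(|a| + |b|)) (|a| + |b|)).norm_image_sub_le_of_norm_deriv_le (𝕜 := ℝ)
    (fun x _ => H.contDiff.differentiable one_ne_zero x) (fun x hx => ?_) ?_ ?_
  · refine (H.abs_deriv_le x).trans ?_
    have : |x| ≤ |a| + |b| := _root_.abs_le.2 hx
    gcongr
  · exact _root_.abs_le.1 (by linarith [abs_nonneg a])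
  · exact _root_.abs_le.1 (by linarith [abs_nonneg b])

theorem enorm_sub_le (hm : 0 ≤ m) (a b : ℝ) :
    ‖h a - h b‖ₑ ≤ C * ((1 + ‖(|a| + |b|)‖ₑ) ^ m * ‖a - b‖ₑ) :=
  enorm_le_of_abs_le (H.abs_sub_le hm a b)

theorem enorm_le (a : ℝ) : ‖h a‖ₑ ≤ C * ((1 + ‖a‖ₑ) ^ m * ‖1 + |a|‖ₑ) := by
  refine enorm_le_of_abs_le ?_
  rw [abs_of_nonneg (by positivity : 0 ≤ 1 + |a|)]
  exact H.abs_le a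

theorem enorm_deriv_le (a : ℝ) : ‖deriv h a‖ₑ ≤ C * (1 + ‖a‖ₑ) ^ m := by
  have := enorm_le_of_abs_le (x := deriv h a) (y := 1) (s := a) (m := m) (C := C)
    (by simpa using H.abs_deriv_le a)
  simpa using this

end PowerGrowth

theorem TorusL1.enorm_velocity_sub_le {f g : Plane → ℝ} (hf : TorusL1 f) (hg : TorusL1 g) :
    ∀ᵐ x ∂torusMeasure, ‖velocity f x - velocity g x‖ₑ ≤ potential (fun x => f x - g x) x := by
  filter_upwards [hf.velocity_sub_ae hg] with x hx
  rw [← hx]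
  exact enorm_velocity_le _ _

namespace VelocityBound

variable {p m : ℝ} {B : ℝ≥0} (V : VelocityBound p m B)
include V

theorem torusNorm_abs_add_abs_le {f g : Plane → ℝ} (hf : Measurable f) (hg : Measurable g)
    {M : ENNReal} (hfM : torusNorm p f ≤ M) (hgM : torusNorm p g ≤ M) :
    torusNorm p (fun x => |f x| + |g x|) ≤ 2 * M := by
  refine (torusNorm_add_le V.one_lt.le (by fun_prop : Measurable fun x => |f x|).aestronglyMeasurable
    (by fun_prop : Measurable fun x => |g x|).aestronglyMeasurable).trans ?_
  rw [torusNorm_abs, torusNorm_abs, two_mul]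
  exact add_le_add hfM hgM

variable {h : ℝ → ℝ} {C : ℝ≥0} (H : PowerGrowth h m C)

theorem torusL1 {f : Plane → ℝ} (hf : Measurable f) (hfp : Periodic2 f) (hN : torusNorm p f < ⊤) :
    TorusL1 f :=
  ⟨hf, hfp, integrable_of_torusNorm_lt_top V.one_lt.le hf hN⟩

include H in
theorem lintegral_comp_sub_le {f g : Plane → ℝ} (hf : Measurable f) (hg : Measurable g)
    {M δ : ENNReal} (hfM : torusNorm p f ≤ M) (hgM : torusNorm p g ≤ M)
    (hδ : torusNorm p (fun x => f x - g x) ≤ δ) :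
    ∫⁻ x, ‖h (f x) - h (g x)‖ₑ ∂torusMeasure ≤ C * ((1 + 2 * M) ^ m * δ) := by
  have hm := V.nonneg
  refine (lintegral_mono fun x => H.enorm_sub_le hm (f x) (g x)).trans ?_
  rw [lintegral_const_mul _ (by fun_prop)]
  refine mul_le_mul_right ((lintegral_one_add_rpow_mul_le V.one_lt.le hm V.add_one_le
    (by fun_prop) (hf.sub hg)).trans ?_) _
  exact mul_le_mul' (ENNReal.rpow_le_rpow (add_le_add le_rfl (V.torusNorm_abs_add_abs_le hf hg hfM hgM)) hm) hδ

include H in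
theorem lintegral_comp_le {f : Plane → ℝ} (hf : Measurable f) {M : ENNReal}
    (hfM : torusNorm p f ≤ M) :
    ∫⁻ x, ‖h (f x)‖ₑ ∂torusMeasure ≤ C * ((1 + M) ^ m * (1 + M)) := by
  have hm := V.nonneg
  refine (lintegral_mono fun x => H.enorm_le (f x)).trans ?_
  rw [lintegral_const_mul _ (by fun_prop)]
  refine mul_le_mul_right ((lintegral_one_add_rpow_mul_le V.one_lt.le hm V.add_one_le
    hf (by fun_prop)).trans ?_) _
  have h1 : 1 + torusNorm p f ≤ 1 + M := add_le_add le_rfl hfM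
  exact mul_le_mul' (ENNReal.rpow_le_rpow h1 hm) ((torusNorm_one_add_le V.one_lt.le hf).trans h1)

include H in
theorem lintegral_comp_mul_potential_le {f g : Plane → ℝ} (hf : Measurable f)
    (hg : Measurable g) (hgp : Periodic2 g) {M : ENNReal} (hfM : torusNorm p f ≤ M) :
    ∫⁻ x, ‖h (f x)‖ₑ * potential g x ∂torusMeasure ≤
      C * (B * (1 + M) ^ m * (1 + M) * torusNorm p g) := by
  have hm := V.nonneg
  have hpg := measurable_potential hg
  refine (lintegral_mono fun x => mul_le_mul_left (H.enorm_le (f x)) (potential g x)).trans ?_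
  simp only [mul_assoc (C : ENNReal)]
  rw [lintegral_const_mul _ (by fun_prop)]
  refine mul_le_mul_right ((V.bound f _ g hf (by fun_prop) hg hgp).trans ?_) _
  have h1 : 1 + torusNorm p f ≤ 1 + M := add_le_add le_rfl hfM
  exact mul_le_mul' (mul_le_mul' (mul_le_mul' le_rfl (ENNReal.rpow_le_rpow h1 hm))
    ((torusNorm_one_add_le V.one_lt.le hf).trans h1)) le_rfl

include H in
theorem lintegral_comp_smul_velocity_le {f : Plane → ℝ} (hf : Measurable f)
    (hfp : Periodic2 f) {M : ENNReal} (hfM : torusNorm p f ≤ M) :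
    ∫⁻ x, ‖h (f x) • velocity f x‖ₑ ∂torusMeasure ≤ C * (B * (1 + M) ^ m * (1 + M) * M) := by
  refine (lintegral_mono fun x => ?_).trans
    ((V.lintegral_comp_mul_potential_le H hf hf hfp hfM).trans ?_)
  · rw [enorm_smul]
    exact mul_le_mul_right (enorm_velocity_le _ _) _
  · gcongr

include H in
-- The difference splits as `(h(f) - h(g)) u_f + h(g) (u_f - u_g)`. Each term has one factor
-- controlled by the distance of `f` and `g` in `L^p`: in the second the velocity of the difference
-- is again given by the kernel.
theorem lintegral_comp_smul_velocity_sub_le {f g : Plane → ℝ} (hf : Measurable f)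
    (hg : Measurable g) (hfp : Periodic2 f) (hgp : Periodic2 g)
    {M : ℝ≥0} {δ : ENNReal} (hfM : torusNorm p f ≤ M) (hgM : torusNorm p g ≤ M)
    (hδ : torusNorm p (fun x => f x - g x) ≤ δ) :
    ∫⁻ x, ‖h (f x) • velocity f x - h (g x) • velocity g x‖ₑ ∂torusMeasure ≤
      C * (B * (1 + 2 * M) ^ m * δ * M) + C * (B * (1 + M) ^ m * (1 + M) * δ) := by
  have hm := V.nonneg
  have hf1 := V.torusL1 hf hfp (hfM.trans_lt ENNReal.coe_lt_top)
  have hg1 := V.torusL1 hg hgp (hgM.trans_lt ENNReal.coe_lt_top)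
  have hpf := measurable_potential hf
  have hpfg := measurable_potential (hf.sub hg)
  have hhm := H.continuous.measurable
  calc _ ≤ ∫⁻ x, (C * ((1 + ‖(|f x| + |g x|)‖ₑ) ^ m * ‖f x - g x‖ₑ * potential f x) +
        ‖h (g x)‖ₑ * potential (fun x => f x - g x) x) ∂torusMeasure := by
        refine lintegral_mono_ae ?_
        filter_upwards [hf1.enorm_velocity_sub_le hg1] with x hx
        rw [show h (f x) • velocity f x - h (g x) • velocity g x = (h (f x) - h (g x)) • velocity f x
          + h (g x) • (velocity f x - velocity g x) by rw [sub_smul, smul_sub]; abel]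
        refine (enorm_add_le _ _).trans (add_le_add ?_ ?_)
        · rw [enorm_smul, ← mul_assoc]
          exact mul_le_mul' (H.enorm_sub_le hm _ _) (enorm_velocity_le _ _)
        · rw [enorm_smul]
          exact mul_le_mul_right hx _
    _ = C * (∫⁻ x, (1 + ‖(|f x| + |g x|)‖ₑ) ^ m * ‖f x - g x‖ₑ * potential f x ∂torusMeasure) +
        ∫⁻ x, ‖h (g x)‖ₑ * potential (fun x => f x - g x) x ∂torusMeasure := by
        rw [lintegral_add_left (by fun_prop), lintegral_const_mul _ (by fun_prop)]
    _ ≤ _ := by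
        refine add_le_add (mul_le_mul_right ((V.bound (fun x => |f x| + |g x|)
          (fun x => f x - g x) f (by fun_prop) (by fun_prop) hf hfp).trans ?_) _)
          ((V.lintegral_comp_mul_potential_le H hg (hf.sub hg) (hf1.sub hg1).periodic hgM).trans ?_)
        · have := V.torusNorm_abs_add_abs_le hf hg hfM hgM
          gcongr
        · gcongr
          exact hδ

theorem lintegral_weight_smul_velocity_sub_le {F f g : Plane → ℝ} (hF : Measurable F)
    (hf : Measurable f) (hg : Measurable g) (hfp : Periodic2 f) (hgp : Periodic2 g)
    {M : ℝ≥0} {δ : ENNReal} (hFM : torusNorm p F ≤ M) (hfM : torusNorm p f ≤ M)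
    (hgM : torusNorm p g ≤ M) (hδ : torusNorm p (fun x => f x - g x) ≤ δ) :
    ∫⁻ x, (1 + ‖F x‖ₑ) ^ m * ‖f x • velocity f x - g x • velocity g x‖ₑ ∂torusMeasure ≤
      B * (1 + M) ^ m * δ * M + B * (1 + M) ^ m * M * δ := by
  have hm := V.nonneg
  have hf1 := V.torusL1 hf hfp (hfM.trans_lt ENNReal.coe_lt_top)
  have hg1 := V.torusL1 hg hgp (hgM.trans_lt ENNReal.coe_lt_top)
  have hpf := measurable_potential hf
  calc _ ≤ ∫⁻ x, ((1 + ‖F x‖ₑ) ^ m * ‖f x - g x‖ₑ * potential f x +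
        (1 + ‖F x‖ₑ) ^ m * ‖g x‖ₑ * potential (fun x => f x - g x) x) ∂torusMeasure := by
        refine lintegral_mono_ae ?_
        filter_upwards [hf1.enorm_velocity_sub_le hg1] with x hx
        rw [show f x • velocity f x - g x • velocity g x = (f x - g x) • velocity f x
          + g x • (velocity f x - velocity g x) by rw [sub_smul, smul_sub]; abel, mul_assoc, mul_assoc,
          ← mul_add]
        refine mul_le_mul_right ((enorm_add_le _ _).trans (add_le_add ?_ ?_)) _
        · rw [enorm_smul]
          exact mul_le_mul_right (enorm_velocity_le _ _) _
        · rw [enorm_smul]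
          exact mul_le_mul_right hx _
    _ ≤ _ := by
        rw [lintegral_add_left (by fun_prop)]
        refine add_le_add ((V.bound F _ f hF (hf.sub hg) hf hfp).trans ?_)
          ((V.bound F g _ hF hg (hf.sub hg) (hf1.sub hg1).periodic).trans ?_)
        · gcongr
          exact hδ
        · gcongr
          exact hδ

/-- The turbulent transport, weighted with `h'`, is small when the translates of `f` by vectors in
the support of the kernel are close to `f`. -/
theorem lintegral_weight_smooth_sub_le {Φ : Plane → ℝ} (hΦ : UnitKernel Φ) {F f : Plane → ℝ}
    (hF : Measurable F) (hf : Measurable f) (hfp : Periodic2 f) {M : ℝ≥0} {δ : ENNReal}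
    (hFM : torusNorm p F ≤ M) (hfM : torusNorm p f ≤ M)
    (hi : Integrable (fun x => f x • velocity f x) torusMeasure)
    (hδ : ∀ y, Φ y ≠ 0 → torusNorm p (fun x => f (x - y) - f x) ≤ δ) :
    ∫⁻ x, (1 + ‖F x‖ₑ) ^ m * ‖smooth Φ (fun x => f x • velocity f x) x -
        smooth Φ f x • velocity (smooth Φ f) x‖ₑ ∂torusMeasure ≤
      B * (1 + M) ^ m * (2 * δ) * M + B * (1 + M) ^ m * M * (2 * δ) := by
  have hp := V.one_lt.le
  have hf1 := V.torusL1 hf hfp (hfM.trans_lt ENNReal.coe_lt_top)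
  have hs := hf1.smooth hΦ.toSmooth
  have hsm := hs.measurable
  have hv := hf1.stronglyMeasurable_velocity.measurable
  have hvs := hs.stronglyMeasurable_velocity.measurable
  refine hΦ.lintegral_mul_smooth_sub_le (by fun_prop)
    (V := fun x => f x • velocity f x) (c := fun x => smooth Φ f x • velocity (smooth Φ f) x)
    (hf.smul hv) hi
    (hfp.comp₂ (periodic2_velocity hfp) fun a b => a • b) (hsm.smul hvs) fun y hy => ?_
  -- The transport is an average over `y` of differences between the vorticity flux translated by
  -- `y` and the flux of `Φ * f`. Both `f(· - y)` and `Φ * f` are within `δ` of `f`, hence within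
  -- `2δ` of each other.
  have h1 := V.lintegral_weight_smul_velocity_sub_le (M := M) (δ := 2 * δ) hF
    (hf1.comp_sub y).measurable hsm (hf1.comp_sub y).periodic hs.periodic hFM
    (by rwa [torusNorm_comp_sub (by linarith) hfp])
    ((hΦ.torusNorm_smooth_le hp hf1).trans hfM) ?_
  · simpa only [velocity_comp_sub] using h1
  · have h2 := hΦ.torusNorm_smooth_sub_le hp hf1 hδ
    calc torusNorm p (fun x => f (x - y) - smooth Φ f x)
        = torusNorm p (fun x => (f (x - y) - f x) - (smooth Φ f x - f x)) := by
          simp only [sub_sub_sub_cancel_right]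
      _ ≤ δ + δ := (torusNorm_sub_le hp (by fun_prop : Measurable _).aestronglyMeasurable
          (by fun_prop : Measurable _).aestronglyMeasurable).trans (add_le_add (hδ y hy) h2)
      _ = 2 * δ := (two_mul δ).symm

end VelocityBound

/-! ### The translation modulus and the mollifiers. -/

/-- The modulus of continuity of the translations of `f` in `L^p`. -/
def translationModulus (p : ℝ) (f : Plane → ℝ) (ρ : ℝ) : ENNReal :=
  ⨆ y : Plane, ⨆ _ : ‖y‖ ≤ ρ, torusNorm p fun x => f (x - y) - f x

/-- The triangle inequality and translation invariance. The bound does not depend on `ρ` and later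
dominates the modulus in time. -/
theorem translationModulus_le {p : ℝ} (hp : 1 ≤ p) {f : Plane → ℝ} (hf : Measurable f)
    (hfp : Periodic2 f) (ρ : ℝ) : translationModulus p f ρ ≤ 2 * torusNorm p f := by
  refine iSup₂_le fun y _ => ?_
  refine (torusNorm_sub_le hp (by fun_prop : Measurable fun x => f (x - y)).aestronglyMeasurable
    hf.aestronglyMeasurable).trans_eq ?_
  rw [torusNorm_comp_sub (by linarith) hfp, two_mul]

theorem tendsto_translationModulus {p : ℝ} (hp : 1 ≤ p) {f : Plane → ℝ} (hf : Measurable f)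
    (hfp : Periodic2 f) (hN : torusNorm p f < ⊤) (R : ℝ) :
    Tendsto (fun ε => translationModulus p f (R * ε)) (𝓝[>] 0) (𝓝 0) := by
  rw [ENNReal.tendsto_nhds_zero]
  intro η hη
  have h := ENNReal.tendsto_nhds_zero.1 (tendsto_torusNorm_translate hp hf hfp hN) η hη
  obtain ⟨ρ, hρ, hb⟩ := Metric.eventually_nhds_iff.1 h
  have h2 : Tendsto (fun ε : ℝ => R * ε) (𝓝[>] 0) (𝓝 0) := by
    have : Tendsto (fun ε : ℝ => R * ε) (𝓝 0) (𝓝 (R * 0)) :=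
      (continuous_const.mul continuous_id).tendsto 0
    rw [mul_zero] at this
    exact this.mono_left nhdsWithin_le_nhds
  filter_upwards [h2.eventually (gt_mem_nhds hρ)] with ε hε
  exact iSup₂_le fun y hy => hb (by rw [dist_zero_right]; exact hy.trans_lt hε)

/-- The periodization of the rescaled mollifier. -/
def mollKernel (φ : Plane → ℝ) (ε : ℝ) : Plane → ℝ := periodize (rescale φ ε)

namespace IsMollifier

variable {φ : Plane → ℝ} (hφ : IsMollifier φ)
include hφ

theorem contDiff_rescale (ε : ℝ) : ContDiff ℝ (⊤ : ℕ∞) (rescale φ ε) :=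
  contDiff_const.mul (hφ.smooth.comp (contDiff_const_smul ε⁻¹))

theorem hasCompactSupport_rescale {ε : ℝ} (hε : 0 < ε) : HasCompactSupport (rescale φ ε) :=
  (hφ.compact.comp_smul (inv_ne_zero hε.ne')).mul_left

theorem integral_rescale {ε : ℝ} (hε : 0 < ε) : ∫ x, rescale φ ε x = 1 := by
  unfold rescale
  rw [integral_const_mul, Measure.integral_comp_smul, hφ.integral_eq_one]
  simp [hε.ne']

theorem exists_radius : ∃ R : ℝ, ∀ x, φ x ≠ 0 → ‖x‖ ≤ R := by
  obtain ⟨R, hR⟩ := hφ.compact.isBounded.subset_closedBall 0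
  exact ⟨R, fun x hx => by simpa using hR (subset_tsupport φ hx)⟩

theorem unitKernel {ε : ℝ} (hε : 0 < ε) : UnitKernel (mollKernel φ ε) := by
  have hc := hφ.contDiff_rescale ε
  have hs := hφ.hasCompactSupport_rescale hε
  refine ⟨⟨contDiff_periodize hs hc, periodic2_periodize _⟩, fun x => ?_, ?_⟩
  · exact finsum_nonneg fun v => mul_nonneg (by positivity) (hφ.nonneg _)
  · have h := integral_periodize (ContinuousLinearMap.lsmul ℝ ℝ) hs hc.continuous
      (f := fun _ => (1 : ℝ)) (fun _ _ => rfl) stronglyMeasurable_const (integrable_const _)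
    simp only [ContinuousLinearMap.lsmul_apply, smul_eq_mul, mul_one, hφ.integral_rescale hε] at h
    exact h.symm

theorem smoothKernel {ε : ℝ} (hε : 0 < ε) : SmoothKernel (mollKernel φ ε) :=
  (hφ.unitKernel hε).toSmooth

theorem mollify_eq {F : Type*} [NormedAddCommGroup F] [NormedSpace ℝ F] [CompleteSpace F] {ε : ℝ}
    (hε : 0 < ε) {f : Plane → F} (hm : StronglyMeasurable f) (hp : Periodic2 f)
    (hi : Integrable f torusMeasure) (x : Plane) :
    mollify φ ε f x = TorusEuler.smooth (mollKernel φ ε) f x := by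
  rw [smooth_eq (hφ.unitKernel hε).periodic hp]
  exact integral_periodize (ContinuousLinearMap.lsmul ℝ ℝ) (hφ.hasCompactSupport_rescale hε)
    (hφ.contDiff_rescale ε).continuous (hp.comp_sub_left x)
    (hm.comp_measurable (by fun_prop)) ((integrable_torus_sub_left_iff hp x).2 hi)

omit hφ in
-- A point where the periodized kernel is nonzero need not be short, but it differs by a period from
-- a vector of length at most `R ε`, and a periodic function does not feel the period.
theorem torusNorm_translate_le {R : ℝ} (hR : ∀ x, φ x ≠ 0 → ‖x‖ ≤ R) {ε : ℝ} (hε : 0 < ε)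
    {f : Plane → ℝ} (hf : Periodic2 f) (p : ℝ) {y : Plane} (hy : mollKernel φ ε y ≠ 0) :
    torusNorm p (fun x => f (x - y) - f x) ≤ translationModulus p f (R * ε) := by
  obtain ⟨v, hv⟩ : ∃ v : lattice, rescale φ ε (y + v) ≠ 0 := by
    by_contra! h
    exact hy ((finsum_congr h).trans finsum_zero)
  have h1 := hR _ (right_ne_zero_of_mul hv)
  rw [norm_smul, norm_inv, Real.norm_of_nonneg hε.le, inv_mul_le_iff₀ hε, mul_comm] at h1
  have h2 : (fun x => f (x - y) - f x) = fun x => f (x - (y + v)) - f x := by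
    ext x
    rw [← hf.add_mem v.2 (x - (y + v))]
    congr 2
    abel
  rw [h2]
  exact le_iSup₂_of_le (y + (v : Plane)) h1 le_rfl

end IsMollifier

theorem mollify_congr {F : Type*} [NormedAddCommGroup F] [NormedSpace ℝ F] (φ : Plane → ℝ) (ε : ℝ)
    {f g : Plane → F} (hf : Periodic2 f) (hg : Periodic2 g) (h : f =ᵐ[torusMeasure] g) :
    mollify φ ε f = mollify φ ε g := by
  ext1 x
  have h1 : ∀ᵐ y, f y = g y := ae_plane_of_ae_torus (hf.comp₂ hg fun a b => a = b) h
  have h2 : ∀ᵐ y, f (x - y) = g (x - y) :=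
    (quasiMeasurePreserving_sub_left_of_right_invariant volume x).ae h1
  exact integral_congr_ae (h2.mono fun y hy => by simp only [hy])

/-! ### The flux integrated by parts in space. -/

/-- The space integral of the flux, with all derivatives moved to the test function. -/
theorem integral_flux_mul {Φ : Plane → ℝ} (hΦ : SmoothKernel Φ) {h : ℝ → ℝ} (hh : ContDiff ℝ 2 h)
    {f : Plane → ℝ} (hf : TorusL1 f) (hi : Integrable (fun x => f x • velocity f x) torusMeasure)
    {η : Plane → ℝ} (hη : ContDiff ℝ 1 η) (hηp : Periodic2 η) :
    ∫ x, -(deriv (deriv h) (smooth Φ f x) * fderiv ℝ (smooth Φ f) x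
        (smooth Φ (fun x => f x • velocity f x) x - smooth Φ f x • velocity (smooth Φ f) x)) * η x
        ∂torusMeasure =
      ∫ x, (deriv h (smooth Φ f x) * η x * smoothDiv Φ (fun x => f x • velocity f x) x +
        deriv h (smooth Φ f x) * fderiv ℝ η x
          (smooth Φ (fun x => f x • velocity f x) x - smooth Φ f x • velocity (smooth Φ f) x) +
        h (smooth Φ f x) * fderiv ℝ η x (velocity (smooth Φ f) x)) ∂torusMeasure := by
  set F := smooth Φ f with hF
  set W : Plane → Plane := fun x => f x • velocity f x with hW
  have hFc : ContDiff ℝ 1 F := hΦ.contDiff_smooth hf.integrable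
  have hFL := hf.smooth hΦ
  have hFp : Periodic2 F := hFL.periodic
  have hh1 : ContDiff ℝ 1 h := hh.of_le (by norm_num)
  have hd : ContDiff ℝ 1 (deriv h) := ContDiff.deriv' hh
  have hg : ContDiff ℝ 1 fun x => deriv h (F x) * η x := (hd.comp hFc).mul hη
  have hgp : Periodic2 fun x => deriv h (F x) * η x := hFp.comp₂ hηp fun a b => deriv h a * b
  -- In the gradient of this function the terms `h'(F) η ∇F` cancel, leaving `F ∇(h'(F) η) - h(F)
  -- ∇η`. Pairing it with the divergence-free mollified velocity removes the part of the flux that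
  -- contains `F u_ε`.
  have hk : ContDiff ℝ 1 fun x => deriv h (F x) * η x * F x - h (F x) * η x :=
    (hg.mul hFc).sub ((hh1.comp hFc).mul hη)
  have hkp : Periodic2 fun x => deriv h (F x) * η x * F x - h (F x) * η x :=
    hFp.comp₂ hηp fun a b => deriv h a * b * a - h a * b
  have e1 := hΦ.integral_mul_smoothDiv hg hgp hi
  have e2 := hFL.integral_fderiv_velocity hk hkp
  have hdF : ∀ x, HasFDerivAt F (fderiv ℝ F x) x := fun x =>
    (hFc.differentiable one_ne_zero x).hasFDerivAt
  have hdη : ∀ x, HasFDerivAt η (fderiv ℝ η x) x := fun x =>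
    (hη.differentiable one_ne_zero x).hasFDerivAt
  have hdd : ∀ x, HasFDerivAt (fun x => deriv h (F x)) (deriv (deriv h) (F x) • fderiv ℝ F x) x :=
    fun x => (hd.differentiable one_ne_zero (F x)).hasDerivAt.comp_hasFDerivAt x (hdF x)
  have hdh : ∀ x, HasFDerivAt (fun x => h (F x)) (deriv h (F x) • fderiv ℝ F x) x :=
    fun x => (hh1.differentiable one_ne_zero (F x)).hasDerivAt.comp_hasFDerivAt x (hdF x)
  have d1 : ∀ x v, fderiv ℝ (fun x => deriv h (F x) * η x) x v =
      deriv h (F x) * fderiv ℝ η x v + deriv (deriv h) (F x) * fderiv ℝ F x v * η x := fun x v => by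
    have e : HasFDerivAt (fun x => deriv h (F x) * η x) _ x := (hdd x).mul (hdη x)
    rw [e.fderiv]
    simp only [_root_.add_apply, _root_.smul_apply, smul_eq_mul]
    ring
  have d2 : ∀ x v, fderiv ℝ (fun x => deriv h (F x) * η x * F x - h (F x) * η x) x v =
      fderiv ℝ (fun x => deriv h (F x) * η x) x v * F x - h (F x) * fderiv ℝ η x v := fun x v => by
    have e : HasFDerivAt (fun x => deriv h (F x) * η x * F x - h (F x) * η x) _ x :=
      (((hdd x).mul (hdη x)).mul (hdF x)).sub ((hdh x).mul (hdη x))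
    rw [e.fderiv, d1]
    simp only [_root_.add_apply, _root_.smul_apply, _root_.sub_apply, smul_eq_mul, Pi.mul_apply]
    ring
  have hFcc := hFc.continuous
  have hF1 := hFc.continuous_fderiv one_ne_zero
  have hη1 := hη.continuous_fderiv one_ne_zero
  have hηc := hη.continuous
  have hhc := hh1.continuous
  have hdc := hd.continuous
  have hddc : Continuous (deriv (deriv h)) := hd.continuous_deriv le_rfl
  have hWc := hΦ.continuous_smooth hi
  have hDc := hΦ.continuous_smoothDiv hi
  have hvc : Continuous (velocity F) := by
    have : velocity F = smooth Φ (velocity f) := funext (hf.velocity_smooth hΦ)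
    rw [this]
    exact hΦ.continuous_smooth hf.integrable_velocity
  have hint : ∀ {g : Plane → ℝ}, Continuous g → Integrable g torusMeasure := fun {g} hg =>
    (hg.continuousOn.integrableOn_compact (isCompact_closedBall (0 : Plane) 2)).mono_set
      fun x hx => by simpa using norm_le_two_of_mem_cell hx
  have hgc := hg.continuous_fderiv one_ne_zero
  have hkc := hk.continuous_fderiv one_ne_zero
  rw [← sub_eq_zero, ← integral_sub (hint (by fun_prop)) (hint (by fun_prop))]
  have e3 : ∫ x, (-(fderiv ℝ (fun x => deriv h (F x) * η x) x (smooth Φ W x)) -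
      deriv h (F x) * η x * smoothDiv Φ W x +
      fderiv ℝ (fun x => deriv h (F x) * η x * F x - h (F x) * η x) x (velocity F x))
      ∂torusMeasure = 0 := by
    rw [integral_add (hint (by fun_prop)) (hint (by fun_prop)),
      integral_sub (hint (by fun_prop)) (hint (by fun_prop)), integral_neg, e1, e2]
    ring
  refine Eq.trans (integral_congr_ae (ae_of_all _ fun x => ?_)) e3
  simp only [d2, d1, map_sub, map_smul, smul_eq_mul]
  ring

/-! ### Space-time measure, test functions and bounded vorticities. -/

theorem spaceTime_eq_prod (T : ℝ) :
    spaceTime T = (volume.restrict (Ioo 0 T)).prod torusMeasure := by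
  rw [spaceTime, torusMeasure, Measure.prod_restrict, Measure.volume_eq_prod]

instance (T : ℝ) : IsFiniteMeasure (volume.restrict (Ioo 0 T)) :=
  ⟨by simp⟩

instance (T : ℝ) : IsFiniteMeasure (spaceTime T) := by
  rw [spaceTime_eq_prod]
  infer_instance

/-- The time derivative. -/
def timeDeriv (ψ : ℝ × Plane → ℝ) (z : ℝ × Plane) : ℝ := deriv (fun s => ψ (s, z.2)) z.1

/-- The derivative in space. -/
def spaceDeriv (ψ : ℝ × Plane → ℝ) (z : ℝ × Plane) : Plane →L[ℝ] ℝ :=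
  fderiv ℝ (fun y => ψ (z.1, y)) z.2

theorem inner_gradient (f : Plane → ℝ) (x v : Plane) :
    inner ℝ (gradient f x) v = fderiv ℝ f x v := by
  rw [gradient, InnerProductSpace.toDual_symm_apply]

theorem inner_gradient_right (f : Plane → ℝ) (x v : Plane) :
    inner ℝ v (gradient f x) = fderiv ℝ f x v := by
  rw [real_inner_comm, inner_gradient]

theorem balancePairing_eq (T : ℝ) (g : ℝ → Plane → ℝ) (w : ℝ → Plane → Plane)
    (ψ : ℝ × Plane → ℝ) : balancePairing T g w ψ =
      -∫ z, (g z.1 z.2 * timeDeriv ψ z + spaceDeriv ψ z (w z.1 z.2)) ∂(spaceTime T) := by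
  simp only [balancePairing, inner_gradient_right]
  rfl

section test

variable {T : ℝ} {ψ : ℝ × Plane → ℝ}

theorem timeDeriv_eq (hψ : ContDiff ℝ 1 ψ) (z : ℝ × Plane) :
    timeDeriv ψ z = fderiv ℝ ψ z (1, 0) := by
  have h := (hψ.differentiable one_ne_zero z).hasFDerivAt.comp_hasDerivAt z.1
    ((hasDerivAt_id z.1).prodMk (hasDerivAt_const z.1 z.2))
  exact h.deriv

theorem spaceDeriv_eq (hψ : ContDiff ℝ 1 ψ) (z : ℝ × Plane) :
    spaceDeriv ψ z = (fderiv ℝ ψ z).comp (ContinuousLinearMap.inr ℝ ℝ Plane) := by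
  have h := HasFDerivAt.comp (g := ψ) (f := fun y => (z.1, y)) z.2
    (hψ.differentiable one_ne_zero z).hasFDerivAt (hasFDerivAt_prodMk_right z.1 z.2)
  exact h.fderiv

theorem continuous_timeDeriv (hψ : ContDiff ℝ 1 ψ) : Continuous (timeDeriv ψ) := by
  rw [show timeDeriv ψ = _ from funext (timeDeriv_eq hψ)]
  have := hψ.continuous_fderiv one_ne_zero
  fun_prop

theorem continuous_spaceDeriv (hψ : ContDiff ℝ 1 ψ) : Continuous (spaceDeriv ψ) := by
  rw [show spaceDeriv ψ = _ from funext (spaceDeriv_eq hψ)]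
  have := hψ.continuous_fderiv one_ne_zero
  fun_prop

theorem exists_norm_le_spaceTime (T : ℝ) {E : Type*} [NormedAddCommGroup E] {G : ℝ × Plane → E}
    (hG : Continuous G) : ∃ C : ℝ≥0, ∀ᵐ z ∂(spaceTime T), ‖G z‖ ≤ C := by
  obtain ⟨C, hC⟩ := ((isCompact_Icc (a := 0) (b := T)).prod
    (isCompact_closedBall (0 : Plane) 2)).exists_bound_of_continuousOn hG.continuousOn
  refine ⟨C.toNNReal, ?_⟩
  rw [spaceTime]
  refine (ae_restrict_iff' (measurableSet_Ioo.prod measurableSet_cell)).2 (ae_of_all _ fun z hz => ?_)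
  exact (hC z ⟨Ioo_subset_Icc_self hz.1, by simpa using norm_le_two_of_mem_cell hz.2⟩).trans
    (Real.le_coe_toNNReal C)

namespace IsTest

variable (hψ : IsTest T ψ)
include hψ

theorem contDiff_one : ContDiff ℝ 1 ψ := hψ.smooth.of_le (by simp)

theorem isTimeTest (x : Plane) : IsTimeTest T fun t => ψ (t, x) := by
  obtain ⟨a, b, ha, hb, h⟩ := hψ.support
  exact ⟨hψ.smooth.comp (contDiff_id.prodMk contDiff_const), a, b, ha, hb, fun t ht => h t x ht⟩

theorem contDiff_space (t : ℝ) : ContDiff ℝ 1 fun x => ψ (t, x) :=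
  hψ.contDiff_one.comp (contDiff_const.prodMk contDiff_id)

end IsTest

theorem IsTimeTest.isTest_mul {χ : ℝ → ℝ} (hχ : IsTimeTest T χ) {Φ : Plane → ℝ}
    (hΦ : SmoothKernel Φ) (x : Plane) : IsTest T fun z => χ z.1 * Φ (x - z.2) := by
  obtain ⟨a, b, ha, hb, h⟩ := hχ.support
  refine ⟨(hχ.smooth.comp contDiff_fst).mul (hΦ.contDiff.comp (contDiff_const.sub contDiff_snd)),
    fun t => (hΦ.periodic.comp_sub_left x).comp fun a => χ t * a, a, b, ha, hb, fun t y ht => ?_⟩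
  simp [h t ht]

end test

/-- A function that is integrable in space, uniformly in time. -/
theorem integrable_spaceTime_of_lintegral_le (T : ℝ) {E : Type*} [NormedAddCommGroup E]
    {G : ℝ × Plane → E} (hG : StronglyMeasurable G) {A : ENNReal} (hA : A < ⊤)
    (h : ∀ t, ∫⁻ x, ‖G (t, x)‖ₑ ∂torusMeasure ≤ A) : Integrable G (spaceTime T) := by
  refine ⟨hG.aestronglyMeasurable, ?_⟩
  rw [HasFiniteIntegral, spaceTime_eq_prod, lintegral_prod _ hG.enorm.aemeasurable]
  refine (lintegral_mono h).trans_lt ?_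
  rw [lintegral_const]
  exact ENNReal.mul_lt_top hA (measure_lt_top _ _)

theorem stronglyMeasurable_integral_bilinear {E F G : Type*} [NormedAddCommGroup E]
    [NormedSpace ℝ E] [NormedAddCommGroup F] [NormedSpace ℝ F] [NormedAddCommGroup G]
    [NormedSpace ℝ G] (L : E →L[ℝ] F →L[ℝ] G) {k : Plane → E} (hk : Continuous k)
    {f : ℝ → Plane → F} (hf : StronglyMeasurable fun z : ℝ × Plane => f z.1 z.2) :
    StronglyMeasurable fun z : ℝ × Plane => ∫ y, L (k (z.2 - y)) (f z.1 y) ∂torusMeasure := by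
  have h1 : StronglyMeasurable fun q : (ℝ × Plane) × Plane => L (k (q.1.2 - q.2)) (f q.1.1 q.2) := by
    refine L.continuous₂.comp_stronglyMeasurable (StronglyMeasurable.prodMk ?_ ?_)
    · exact hk.comp_stronglyMeasurable
        (by fun_prop : Continuous fun q : (ℝ × Plane) × Plane => q.1.2 - q.2).stronglyMeasurable
    · exact hf.comp_measurable
        (by fun_prop : Measurable fun q : (ℝ × Plane) × Plane => (q.1.1, q.2))
  exact h1.integral_prod_right'

/-- A vorticity that is bounded in `L^p` at all times. -/
structure BoundedVorticity (p : ℝ) (M : ℝ≥0) (ω : ℝ → Plane → ℝ) : Prop where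
  measurable : Measurable fun z : ℝ × Plane => ω z.1 z.2
  periodic : ∀ t, Periodic2 (ω t)
  norm_le : ∀ t, torusNorm p (ω t) ≤ M

theorem powerGrowth_id {m : ℝ} (hm : 0 ≤ m) : PowerGrowth (fun s => s) m 1 := by
  have h1 : ∀ s : ℝ, 1 ≤ (1 + |s|) ^ m := fun s => Real.one_le_rpow (by linarith [abs_nonneg s]) hm
  refine ⟨contDiff_id, fun s => ?_, fun s => ?_⟩
  · simpa using h1 s
  · have := h1 s
    have := abs_nonneg s
    simp only [NNReal.coe_one, one_mul]
    nlinarith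

/-- The flux of the vorticity. -/
def vorticityFlux (f : Plane → ℝ) (x : Plane) : Plane := f x • velocity f x

theorem periodic2_vorticityFlux {f : Plane → ℝ} (hf : Periodic2 f) : Periodic2 (vorticityFlux f) :=
  hf.comp₂ (periodic2_velocity hf) fun a b => a • b

theorem integral_norm_le_of_lintegral_le {E : Type*} [NormedAddCommGroup E] {f : Plane → E}
    (hf : AEStronglyMeasurable f torusMeasure) {A : ℝ≥0}
    (h : ∫⁻ x, ‖f x‖ₑ ∂torusMeasure ≤ A) :
    Integrable f torusMeasure ∧ ∫ x, ‖f x‖ ∂torusMeasure ≤ A := by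
  refine ⟨⟨hf, h.trans_lt ENNReal.coe_lt_top⟩, ?_⟩
  rw [integral_norm_eq_lintegral_enorm hf]
  exact ENNReal.toReal_le_coe_of_le_coe h

namespace BoundedVorticity

variable {p m : ℝ} {B M : ℝ≥0} {ω : ℝ → Plane → ℝ} (N : BoundedVorticity p M ω)
  (V : VelocityBound p m B)
include N

theorem measurable_at (t : ℝ) : Measurable (ω t) := N.measurable.comp (by fun_prop : Measurable fun x : Plane => (t, x))

theorem measurable_velocity : Measurable fun z : ℝ × Plane => velocity (ω z.1) z.2 := by
  have hm : Measurable fun q : (ℝ × Plane) × Plane => ω q.1.1 (q.1.2 - q.2) • biotSavartKernel q.2 :=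
    (N.measurable.comp (by fun_prop : Measurable fun q : (ℝ × Plane) × Plane =>
      (q.1.1, q.1.2 - q.2))).smul (measurable_biotSavartKernel.comp measurable_snd)
  exact hm.stronglyMeasurable.integral_prod_right'.measurable

theorem measurable_vorticityFlux : Measurable fun z : ℝ × Plane => vorticityFlux (ω z.1) z.2 :=
  N.measurable.smul N.measurable_velocity

include V

theorem torusL1 (t : ℝ) : TorusL1 (ω t) :=
  V.torusL1 (N.measurable_at t) (N.periodic t) ((N.norm_le t).trans_lt ENNReal.coe_lt_top)

theorem exists_lintegral_le : ∃ A : ℝ≥0, ∀ t, ∫⁻ x, ‖ω t x‖ₑ ∂torusMeasure ≤ A ∧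
    ∫⁻ x, ‖velocity (ω t) x‖ₑ ∂torusMeasure ≤ A ∧
    ∫⁻ x, ‖vorticityFlux (ω t) x‖ₑ ∂torusMeasure ≤ A := by
  have hm := V.nonneg
  have f1 : ((1 + M : ENNReal)) ^ m < ⊤ :=
    ENNReal.rpow_lt_top_of_nonneg hm (by simp)
  obtain ⟨A₁, h₁⟩ : ∃ A : ℝ≥0, (A : ENNReal) = (1 : ℝ≥0) * ((1 + M : ENNReal) ^ m * (1 + M)) :=
    ⟨_, ENNReal.coe_toNNReal (by finiteness)⟩
  obtain ⟨A₂, h₂⟩ : ∃ A : ℝ≥0, (A : ENNReal) = B * M := ⟨_, ENNReal.coe_toNNReal (by finiteness)⟩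
  obtain ⟨A₃, h₃⟩ : ∃ A : ℝ≥0, (A : ENNReal) =
      (1 : ℝ≥0) * (B * (1 + M : ENNReal) ^ m * (1 + M) * M) :=
    ⟨_, ENNReal.coe_toNNReal (by finiteness)⟩
  refine ⟨max A₁ (max A₂ A₃), fun t => ⟨?_, ?_, ?_⟩⟩
  · refine (V.lintegral_comp_le (powerGrowth_id hm) (N.measurable_at t) (N.norm_le t)).trans ?_
    rw [← h₁]
    exact_mod_cast le_max_left _ _
  · have h := V.bound (fun _ => 0) (fun _ => 1) (ω t) measurable_const measurable_const
      (N.measurable_at t) (N.periodic t)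
    have h0 : torusNorm p (fun _ => (0 : ℝ)) = 0 := eLpNorm_zero
    rw [torusNorm_const_one (by linarith [V.one_lt]), h0] at h
    simp only [enorm_zero, add_zero, ENNReal.one_rpow, enorm_one, one_mul, mul_one] at h
    refine (lintegral_mono fun x => enorm_velocity_le (ω t) x).trans (h.trans ?_)
    refine (mul_le_mul_right (N.norm_le t) _).trans ?_
    rw [← h₂]
    exact_mod_cast (le_max_left _ _).trans (le_max_right _ _)
  · refine (V.lintegral_comp_smul_velocity_le (powerGrowth_id hm) (N.measurable_at t)
      (N.periodic t) (N.norm_le t)).trans ?_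
    rw [← h₃]
    exact_mod_cast (le_max_right _ _).trans (le_max_right _ _)

theorem integrable_vorticityFlux (t : ℝ) : Integrable (vorticityFlux (ω t)) torusMeasure := by
  obtain ⟨A, hA⟩ := N.exists_lintegral_le V
  exact ⟨(N.measurable_vorticityFlux.comp (by fun_prop :
    Measurable fun x : Plane => (t, x))).aestronglyMeasurable,
    (hA t).2.2.trans_lt ENNReal.coe_lt_top⟩

/-- All mollified quantities are bounded, uniformly in time. -/
theorem exists_norm_le {Φ : Plane → ℝ} (hΦ : SmoothKernel Φ) : ∃ A : ℝ≥0, ∀ t x,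
    ‖smooth Φ (ω t) x‖ ≤ A ∧ ‖fderiv ℝ (smooth Φ (ω t)) x‖ ≤ A ∧
    ‖velocity (smooth Φ (ω t)) x‖ ≤ A ∧ ‖smooth Φ (vorticityFlux (ω t)) x‖ ≤ A ∧
    ‖smoothDiv Φ (vorticityFlux (ω t)) x‖ ≤ A := by
  obtain ⟨A, hA⟩ := N.exists_lintegral_le V
  obtain ⟨C₁, h₁⟩ := hΦ.exists_norm_smooth_le ℝ
  obtain ⟨C₂, h₂⟩ := hΦ.exists_norm_smooth_le Plane
  obtain ⟨C₃, h₃⟩ := hΦ.exists_norm_smoothDiv_le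
  obtain ⟨C₄, h₄⟩ := hΦ.exists_norm_fderiv_smooth_le
  refine ⟨(C₁ + C₂ + C₃ + C₄) * A, fun t x => ?_⟩
  have hL := N.torusL1 V t
  obtain ⟨i₁, a₁⟩ := integral_norm_le_of_lintegral_le hL.integrable.1 (hA t).1
  obtain ⟨i₂, a₂⟩ := integral_norm_le_of_lintegral_le hL.integrable_velocity.1 (hA t).2.1
  obtain ⟨i₃, a₃⟩ := integral_norm_le_of_lintegral_le (N.integrable_vorticityFlux V t).1 (hA t).2.2
  have key : ∀ {C : ℝ≥0} {a I : ℝ}, C ≤ C₁ + C₂ + C₃ + C₄ → a ≤ C * I → I ≤ A →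
      a ≤ ((C₁ + C₂ + C₃ + C₄) * A : ℝ≥0) := fun {C a I} hC h hI => by
    refine h.trans ((mul_le_mul_of_nonneg_left hI C.2).trans ?_)
    exact_mod_cast mul_le_mul_left hC A
  refine ⟨key ?_ (h₁ _ i₁ x) a₁, key ?_ (h₄ _ i₁ x) a₁, ?_, key ?_ (h₂ _ i₃ x) a₃,
    key ?_ (h₃ _ i₃ x) a₃⟩
  · simp only [add_assoc]; exact le_self_add
  · exact le_add_self
  · rw [hL.velocity_smooth hΦ]
    exact key (by simp only [add_assoc]; exact le_add_left le_self_add) (h₂ _ i₂ x) a₂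
  · simp only [add_assoc]; exact le_add_left le_self_add
  · simp only [add_assoc]; exact le_add_left (le_add_left le_self_add)

end BoundedVorticity

/-! ### The mollified equation and the chain rule. -/

/-- The turbulent transport of the mollification with the kernel `Φ`. -/
def stress (Φ : Plane → ℝ) (f : Plane → ℝ) (x : Plane) : Plane :=
  smooth Φ (vorticityFlux f) x - smooth Φ f x • velocity (smooth Φ f) x

/-- The flux of the mollification with the kernel `Φ`. -/
def kernelFlux (Φ : Plane → ℝ) (h : ℝ → ℝ) (ω : ℝ → Plane → ℝ) (z : ℝ × Plane) : ℝ :=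
  -(deriv (deriv h) (smooth Φ (ω z.1) z.2) *
    fderiv ℝ (smooth Φ (ω z.1)) z.2 (stress Φ (ω z.1) z.2))

/-- The integrand of the pairing of the flux with a test function, after integration by parts. -/
def smoothPairing (Φ : Plane → ℝ) (h : ℝ → ℝ) (ω : ℝ → Plane → ℝ) (ψ : ℝ × Plane → ℝ)
    (z : ℝ × Plane) : ℝ :=
  h (smooth Φ (ω z.1) z.2) * timeDeriv ψ z +
    spaceDeriv ψ z (h (smooth Φ (ω z.1) z.2) • velocity (smooth Φ (ω z.1)) z.2) +
    spaceDeriv ψ z (deriv h (smooth Φ (ω z.1) z.2) • stress Φ (ω z.1) z.2)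

theorem exists_norm_comp_le {g : ℝ → ℝ} (hg : Continuous g) (A : ℝ≥0) :
    ∃ C : ℝ≥0, ∀ s, ‖s‖ ≤ A → ‖g s‖ ≤ C := by
  obtain ⟨C, hC⟩ := (isCompact_closedBall (0 : ℝ) A).exists_bound_of_continuousOn hg.continuousOn
  exact ⟨C.toNNReal, fun s hs => (hC s (by simpa using hs)).trans (Real.le_coe_toNNReal C)⟩

theorem stronglyMeasurable_fderiv_smooth {ω : ℝ → Plane → ℝ}
    (hω : Measurable fun z : ℝ × Plane => ω z.1 z.2) (hi : ∀ t, Integrable (ω t) torusMeasure)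
    {Φ : Plane → ℝ} (hΦ : SmoothKernel Φ) :
    StronglyMeasurable fun z : ℝ × Plane => fderiv ℝ (smooth Φ (ω z.1)) z.2 := by
  have h := stronglyMeasurable_integral_bilinear
    (ContinuousLinearMap.lsmul ℝ ℝ : ℝ →L[ℝ] (Plane →L[ℝ] ℝ) →L[ℝ] Plane →L[ℝ] ℝ).flip
    hΦ.continuous_fderiv hω.stronglyMeasurable
  rw [show (fun z : ℝ × Plane => fderiv ℝ (smooth Φ (ω z.1)) z.2) = _ from funext fun z =>
    (hΦ.hasFDerivAt_smooth (hi z.1) z.2).fderiv]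
  exact h

namespace BoundedVorticity

variable {p m : ℝ} {B M : ℝ≥0} {ω : ℝ → Plane → ℝ} (N : BoundedVorticity p M ω)
  (V : VelocityBound p m B) {Φ : Plane → ℝ} (hΦ : SmoothKernel Φ)
include N hΦ

theorem measurable_smooth : Measurable fun z : ℝ × Plane => smooth Φ (ω z.1) z.2 :=
  (stronglyMeasurable_integral_bilinear (ContinuousLinearMap.lsmul ℝ ℝ) hΦ.continuous
    N.measurable.stronglyMeasurable).measurable

theorem measurable_smooth_vorticityFlux :
    Measurable fun z : ℝ × Plane => smooth Φ (vorticityFlux (ω z.1)) z.2 :=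
  (stronglyMeasurable_integral_bilinear (ContinuousLinearMap.lsmul ℝ ℝ) hΦ.continuous
    (f := fun t => vorticityFlux (ω t)) N.measurable_vorticityFlux.stronglyMeasurable).measurable

theorem measurable_smoothDiv_vorticityFlux :
    Measurable fun z : ℝ × Plane => smoothDiv Φ (vorticityFlux (ω z.1)) z.2 :=
  (stronglyMeasurable_integral_bilinear (ContinuousLinearMap.id ℝ (Plane →L[ℝ] ℝ))
    hΦ.continuous_fderiv (f := fun t => vorticityFlux (ω t)) N.measurable_vorticityFlux.stronglyMeasurable).measurable

include V

theorem measurable_velocity_smooth :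
    Measurable fun z : ℝ × Plane => velocity (smooth Φ (ω z.1)) z.2 := by
  simp only [fun z : ℝ × Plane => (N.torusL1 V z.1).velocity_smooth hΦ z.2]
  exact (stronglyMeasurable_integral_bilinear (ContinuousLinearMap.lsmul ℝ ℝ) hΦ.continuous
    (f := fun t => velocity (ω t)) N.measurable_velocity.stronglyMeasurable).measurable

theorem measurable_stress : Measurable fun z : ℝ × Plane => stress Φ (ω z.1) z.2 :=
  (N.measurable_smooth_vorticityFlux hΦ).sub
    ((N.measurable_smooth hΦ).smul (N.measurable_velocity_smooth V hΦ))

theorem exists_norm_stress_le : ∃ A : ℝ≥0, ∀ t x, ‖stress Φ (ω t) x‖ ≤ A := by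
  obtain ⟨A, hA⟩ := N.exists_norm_le V hΦ
  refine ⟨A + A * A, fun t x => ?_⟩
  obtain ⟨h₁, -, h₂, h₃, -⟩ := hA t x
  refine (norm_sub_le _ _).trans ?_
  rw [norm_smul]
  push_cast
  gcongr

variable {h : ℝ → ℝ} (hh : ContDiff ℝ 2 h)
include hh

theorem measurable_kernelFlux : Measurable (kernelFlux Φ h ω) := by
  have hd : ContDiff ℝ 1 (deriv h) := ContDiff.deriv' hh
  have hdd : Continuous (deriv (deriv h)) := hd.continuous_deriv le_rfl
  refine Measurable.neg (Measurable.mul (hdd.measurable.comp (N.measurable_smooth hΦ)) ?_)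
  exact ((ContinuousLinearMap.id ℝ (Plane →L[ℝ] ℝ)).continuous₂.comp_stronglyMeasurable
    ((stronglyMeasurable_fderiv_smooth N.measurable (fun t => (N.torusL1 V t).integrable) hΦ).prodMk
      (N.measurable_stress V hΦ).stronglyMeasurable)).measurable

theorem exists_norm_kernelFlux_le : ∃ A : ℝ≥0, ∀ z, ‖kernelFlux Φ h ω z‖ ≤ A := by
  have hd : ContDiff ℝ 1 (deriv h) := ContDiff.deriv' hh
  have hdd : Continuous (deriv (deriv h)) := hd.continuous_deriv le_rfl
  obtain ⟨A, hA⟩ := N.exists_norm_le V hΦ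
  obtain ⟨S, hS⟩ := N.exists_norm_stress_le V hΦ
  obtain ⟨C, hC⟩ := exists_norm_comp_le hdd A
  refine ⟨C * (A * S), fun z => ?_⟩
  rw [kernelFlux, norm_neg, norm_mul]
  push_cast
  gcongr
  · exact hC _ (hA _ _).1
  · refine (ContinuousLinearMap.le_opNorm _ _).trans ?_
    gcongr
    exacts [(hA _ _).2.1, hS _ _]

theorem integrable_kernelFlux (T : ℝ) : Integrable (kernelFlux Φ h ω) (spaceTime T) := by
  obtain ⟨A, hA⟩ := N.exists_norm_kernelFlux_le V hΦ hh
  exact Integrable.of_bound (N.measurable_kernelFlux V hΦ hh).aestronglyMeasurable A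
    (ae_of_all _ hA)

omit hh

/-- The mollified vorticity equation. -/
theorem hasNegWeakDeriv {T : ℝ} (hsol : IsWeakEuler T ω) (x : Plane) :
    HasNegWeakDeriv T (fun t => smooth Φ (ω t) x)
      (fun t => smoothDiv Φ (vorticityFlux (ω t)) x) := by
  intro χ hχ
  -- Testing with `χ(t) Φ(x - y)` turns the weak equation into an identity for the mollification at
  -- the fixed point `x`.
  have hψ := hχ.isTest_mul hΦ x
  obtain ⟨A, hA⟩ := N.exists_lintegral_le V
  have h := hsol _ hψ
  rw [balancePairing_eq, neg_eq_zero] at h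
  have hc1 := continuous_timeDeriv hψ.contDiff_one
  have hc2 := continuous_spaceDeriv hψ.contDiff_one
  obtain ⟨C₁, hC₁⟩ := exists_norm_le_spaceTime T hc1
  obtain ⟨C₂, hC₂⟩ := exists_norm_le_spaceTime T hc2
  have e1 : ∀ z : ℝ × Plane, timeDeriv (fun z => χ z.1 * Φ (x - z.2)) z =
      deriv χ z.1 * Φ (x - z.2) := fun z => by
    simp only [timeDeriv, deriv_mul_const_field]
  have e2 : ∀ (z : ℝ × Plane) v, spaceDeriv (fun z => χ z.1 * Φ (x - z.2)) z v =
      -(χ z.1 * fderiv ℝ Φ (x - z.2) v) := fun z v => by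
    have hd : DifferentiableAt ℝ (fun y => Φ (x - y)) z.2 :=
      (hΦ.differentiable _).comp _ (by fun_prop)
    simp only [spaceDeriv]
    rw [fderiv_const_mul hd, hΦ.fderiv_comp_sub_left]
    simp only [_root_.smul_apply, _root_.neg_apply, smul_eq_mul, mul_neg]
  have i1 : Integrable (fun z : ℝ × Plane => ω z.1 z.2) (spaceTime T) :=
    integrable_spaceTime_of_lintegral_le T N.measurable.stronglyMeasurable ENNReal.coe_lt_top
      fun t => (hA t).1
  have i2 : Integrable (fun z : ℝ × Plane => vorticityFlux (ω z.1) z.2) (spaceTime T) :=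
    integrable_spaceTime_of_lintegral_le T N.measurable_vorticityFlux.stronglyMeasurable
      ENNReal.coe_lt_top fun t => (hA t).2.2
  have j1 : Integrable (fun z : ℝ × Plane => ω z.1 z.2 * (deriv χ z.1 * Φ (x - z.2)))
      (spaceTime T) := by
    have := i1.mul_bdd hc1.aestronglyMeasurable hC₁
    simpa only [e1] using this
  have j2 : Integrable (fun z : ℝ × Plane => -(χ z.1 * fderiv ℝ Φ (x - z.2)
      (vorticityFlux (ω z.1) z.2))) (spaceTime T) := by
    have : Integrable (fun z : ℝ × Plane => spaceDeriv (fun z => χ z.1 * Φ (x - z.2)) z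
        (vorticityFlux (ω z.1) z.2)) (spaceTime T) := by
      refine (i2.norm.const_mul (C₂ : ℝ)).mono' ((ContinuousLinearMap.id ℝ
        (Plane →L[ℝ] ℝ)).aestronglyMeasurable_comp₂ hc2.aestronglyMeasurable i2.1) ?_
      filter_upwards [hC₂] with z hz
      refine (ContinuousLinearMap.le_opNorm _ _).trans ?_
      gcongr
    simpa only [e2] using this
  simp only [e1, e2] at h
  change ∫ z, ω z.1 z.2 * (deriv χ z.1 * Φ (x - z.2)) +
    -(χ z.1 * fderiv ℝ Φ (x - z.2) (vorticityFlux (ω z.1) z.2)) ∂(spaceTime T) = 0 at h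
  rw [integral_add j1 j2, integral_neg, add_neg_eq_zero] at h
  rw [spaceTime_eq_prod] at h j1 j2
  have j2' := j2.neg
  simp only [Pi.neg_def, neg_neg] at j2'
  rw [integral_prod _ j1, integral_prod _ j2'] at h
  simp only [integral_const_mul] at h
  refine Eq.trans (integral_congr_ae (ae_of_all _ fun t => ?_)) h
  simp only [smooth, ← integral_const_mul, smul_eq_mul]
  exact integral_congr_ae (ae_of_all _ fun y => by ring)

include hh

/-- The space-time integral of the flux, with all derivatives moved to the test function. -/
theorem integral_kernelFlux_mul {T : ℝ} (hT : 0 < T) (hsol : IsWeakEuler T ω)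
    {ψ : ℝ × Plane → ℝ} (hψ : IsTest T ψ) :
    ∫ z, kernelFlux Φ h ω z * ψ z ∂(spaceTime T) =
      ∫ z, smoothPairing Φ h ω ψ z ∂(spaceTime T) := by
  have hh1 : ContDiff ℝ 1 h := hh.of_le (by norm_num)
  have hd : ContDiff ℝ 1 (deriv h) := ContDiff.deriv' hh
  obtain ⟨A, hA⟩ := N.exists_norm_le V hΦ
  obtain ⟨S, hS⟩ := N.exists_norm_stress_le V hΦ
  obtain ⟨C₀, hC₀⟩ := exists_norm_comp_le hh1.continuous A
  obtain ⟨C₁, hC₁⟩ := exists_norm_comp_le hd.continuous A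
  obtain ⟨D₀, hD₀⟩ := exists_norm_le_spaceTime T hψ.smooth.continuous
  have hc1 := continuous_timeDeriv hψ.contDiff_one
  have hc2 := continuous_spaceDeriv hψ.contDiff_one
  obtain ⟨D₁, hD₁⟩ := exists_norm_le_spaceTime T hc1
  obtain ⟨D₂, hD₂⟩ := exists_norm_le_spaceTime T hc2
  have mF := N.measurable_smooth hΦ
  have mv := N.measurable_velocity_smooth V hΦ
  have mD := N.measurable_smoothDiv_vorticityFlux hΦ
  have mS := N.measurable_stress V hΦ
  have mh : Measurable fun z : ℝ × Plane => h (smooth Φ (ω z.1) z.2) :=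
    hh1.continuous.measurable.comp mF
  have mh' : Measurable fun z : ℝ × Plane => deriv h (smooth Φ (ω z.1) z.2) :=
    hd.continuous.measurable.comp mF
  have mψ : Measurable ψ := hψ.smooth.continuous.measurable
  have ia : Integrable (fun z => kernelFlux Φ h ω z * ψ z) (spaceTime T) :=
    (N.integrable_kernelFlux V hΦ hh T).mul_bdd hψ.smooth.continuous.aestronglyMeasurable hD₀
  have ib : Integrable (fun z : ℝ × Plane => deriv h (smooth Φ (ω z.1) z.2) * ψ z *
      smoothDiv Φ (vorticityFlux (ω z.1)) z.2) (spaceTime T) := by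
    refine Integrable.of_bound (by fun_prop : Measurable _).aestronglyMeasurable (C₁ * D₀ * A) ?_
    filter_upwards [hD₀] with z hz
    rw [norm_mul, norm_mul]
    gcongr
    exacts [hC₁ _ (hA _ _).1, (hA _ _).2.2.2.2]
  have happ : ∀ {w : ℝ × Plane → Plane}, Measurable w →
      AEStronglyMeasurable (fun z => spaceDeriv ψ z (w z)) (spaceTime T) := fun {w} hw =>
    (ContinuousLinearMap.id ℝ (Plane →L[ℝ] ℝ)).aestronglyMeasurable_comp₂
      hc2.aestronglyMeasurable hw.aestronglyMeasurable
  have ic : Integrable (fun z : ℝ × Plane => deriv h (smooth Φ (ω z.1) z.2) *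
      spaceDeriv ψ z (stress Φ (ω z.1) z.2)) (spaceTime T) := by
    refine Integrable.of_bound (mh'.aestronglyMeasurable.mul (happ mS)) (C₁ * (D₂ * S)) ?_
    filter_upwards [hD₂] with z hz
    rw [norm_mul]
    gcongr
    · exact hC₁ _ (hA _ _).1
    · refine (ContinuousLinearMap.le_opNorm _ _).trans ?_
      gcongr
      exact hS _ _
  have id : Integrable (fun z : ℝ × Plane => h (smooth Φ (ω z.1) z.2) *
      spaceDeriv ψ z (velocity (smooth Φ (ω z.1)) z.2)) (spaceTime T) := by
    refine Integrable.of_bound (mh.aestronglyMeasurable.mul (happ mv)) (C₀ * (D₂ * A)) ?_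
    filter_upwards [hD₂] with z hz
    rw [norm_mul]
    gcongr
    · exact hC₀ _ (hA _ _).1
    · refine (ContinuousLinearMap.le_opNorm _ _).trans ?_
      gcongr
      exact (hA _ _).2.2.1
  have ie : Integrable (fun z : ℝ × Plane => timeDeriv ψ z * h (smooth Φ (ω z.1) z.2))
      (spaceTime T) := by
    refine Integrable.of_bound (hc1.measurable.mul mh).aestronglyMeasurable (D₁ * C₀) ?_
    filter_upwards [hD₁] with z hz
    rw [norm_mul]
    gcongr
    exact hC₀ _ (hA _ _).1
  have e1 : ∫ z, kernelFlux Φ h ω z * ψ z ∂(spaceTime T) =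
      ∫ z : ℝ × Plane, (deriv h (smooth Φ (ω z.1) z.2) * ψ z *
        smoothDiv Φ (vorticityFlux (ω z.1)) z.2 + deriv h (smooth Φ (ω z.1) z.2) *
      spaceDeriv ψ z (stress Φ (ω z.1) z.2) + h (smooth Φ (ω z.1) z.2) *
      spaceDeriv ψ z (velocity (smooth Φ (ω z.1)) z.2)) ∂(spaceTime T) := by
    have i3 := (ib.add ic).add id
    rw [spaceTime_eq_prod] at ia i3 ⊢
    rw [integral_prod _ ia]
    refine Eq.trans ?_ (integral_prod _ i3).symm
    refine integral_congr_ae (ae_of_all _ fun t => ?_)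
    exact integral_flux_mul hΦ hh (N.torusL1 V t) (N.integrable_vorticityFlux V t)
      (hψ.contDiff_space t) (hψ.periodic t)
  -- At each fixed `x` the chain rule in time trades the divergence term left by the integration by
  -- parts in space for `h(ω_ε) ∂_tψ`. Added to `e1`, it leaves a pairing without derivatives on the
  -- vorticity.
  have e2 : ∫ z : ℝ × Plane, (timeDeriv ψ z * h (smooth Φ (ω z.1) z.2) -
      deriv h (smooth Φ (ω z.1) z.2) * ψ z * smoothDiv Φ (vorticityFlux (ω z.1)) z.2)
      ∂(spaceTime T) = 0 := by
    have i3 := ie.sub ib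
    rw [spaceTime_eq_prod] at i3 ⊢
    refine (integral_prod_symm _ i3).trans
      (Eq.trans (integral_congr_ae (ae_of_all _ fun x => ?_)) (integral_zero _ _))
    have hx : Measurable fun t : ℝ => (t, x) := by fun_prop
    have key := (N.hasNegWeakDeriv V hΦ hsol x).integral_deriv_mul_comp hT
      (Integrable.of_bound (mF.comp hx).aestronglyMeasurable A (ae_of_all _ fun t => (hA t x).1))
      (mD.comp hx) (fun t => (hA t x).2.2.2.2) hh1 (hψ.isTimeTest x)
    refine Eq.trans (integral_congr_ae (ae_of_all _ fun t => ?_)) key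
    simp only [Pi.sub_apply, timeDeriv]
    ring
  have e3 := integral_sub ie ib
  rw [e2] at e3
  rw [e1, ← add_zero (∫ z, _ ∂_), ← e2]
  refine (integral_add ((ib.add ic).add id) (ie.sub ib)).symm.trans ?_
  refine integral_congr_ae (ae_of_all _ fun z => ?_)
  simp only [smoothPairing, map_smul, smul_eq_mul, Pi.add_apply, Pi.sub_apply]
  ring

end BoundedVorticity

/-! ### Removing the mollification. -/

/-- The integrand of the pairing of `∂_t h(ω) + ∇ ⬝ (u h(ω))` with a test function. -/
def balanceIntegrand (h : ℝ → ℝ) (ω : ℝ → Plane → ℝ) (ψ : ℝ × Plane → ℝ) (z : ℝ × Plane) : ℝ :=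
  h (ω z.1 z.2) * timeDeriv ψ z + spaceDeriv ψ z (h (ω z.1 z.2) • velocity (ω z.1) z.2)

/-- The distance of the mollified nonlinear quantities to their limits. -/
def mollifyError (Φ : Plane → ℝ) (h : ℝ → ℝ) (f : Plane → ℝ) (x : Plane) : ENNReal :=
  ‖h (smooth Φ f x) - h (f x)‖ₑ +
    ‖h (smooth Φ f x) • velocity (smooth Φ f) x - h (f x) • velocity f x‖ₑ +
    ‖deriv h (smooth Φ f x) • stress Φ f x‖ₑ

/-- All three errors are linear in the translation bound `δ`, because the trilinear estimate is
linear in two of its arguments. The constant depends on the norm bound only, not on the kernel or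
the time slice. -/
theorem VelocityBound.exists_lintegral_mollifyError_le {p m : ℝ} {B : ℝ≥0}
    (V : VelocityBound p m B) {h : ℝ → ℝ} {C : ℝ≥0} (H : PowerGrowth h m C) (M : ℝ≥0) :
    ∃ K : ℝ≥0, ∀ (Φ f : Plane → ℝ) (δ : ENNReal), UnitKernel Φ → Measurable f → Periodic2 f →
      torusNorm p f ≤ M → Integrable (vorticityFlux f) torusMeasure →
      (∀ y, Φ y ≠ 0 → torusNorm p (fun x => f (x - y) - f x) ≤ δ) →
      ∫⁻ x, mollifyError Φ h f x ∂torusMeasure ≤ K * δ := by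
  have hm := V.nonneg
  have f1 : ((1 + 2 * M : ENNReal)) ^ m < ⊤ := ENNReal.rpow_lt_top_of_nonneg hm (by finiteness)
  have f2 : ((1 + M : ENNReal)) ^ m < ⊤ := ENNReal.rpow_lt_top_of_nonneg hm (by finiteness)
  obtain ⟨K, hK⟩ : ∃ K : ℝ≥0, (K : ENNReal) = C * (1 + 2 * M) ^ m +
      (C * (B * (1 + 2 * M) ^ m * M) + C * (B * (1 + M) ^ m * (1 + M))) +
      C * (B * (1 + M) ^ m * 2 * M + B * (1 + M) ^ m * M * 2) :=
    ⟨_, ENNReal.coe_toNNReal (by finiteness)⟩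
  refine ⟨K, fun Φ f δ hΦ hf hfp hN hi hδ => ?_⟩
  have hp := V.one_lt.le
  have hf1 := V.torusL1 hf hfp (hN.trans_lt ENNReal.coe_lt_top)
  have hs := hf1.smooth hΦ.toSmooth
  have hsN := (hΦ.torusNorm_smooth_le hp hf1).trans hN
  have hsδ := hΦ.torusNorm_smooth_sub_le hp hf1 hδ
  have hsm := hs.measurable
  have hvm := hf1.stronglyMeasurable_velocity.measurable
  have hvsm := hs.stronglyMeasurable_velocity.measurable
  have hhm := H.continuous.measurable
  have hWm := (hΦ.toSmooth.continuous_smooth hi).measurable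
  have m1 : Measurable (stress Φ f) := hWm.sub (hsm.smul hvsm)
  have e1 := V.lintegral_comp_sub_le H hsm hf hsN hN hsδ
  have e2 := V.lintegral_comp_smul_velocity_sub_le H hsm hf hs.periodic hfp hsN hN hsδ
  have e3 : ∫⁻ x, ‖deriv h (smooth Φ f x) • stress Φ f x‖ₑ ∂torusMeasure ≤
      C * (B * (1 + M) ^ m * (2 * δ) * M + B * (1 + M) ^ m * M * (2 * δ)) := by
    refine le_trans ?_ (mul_le_mul_right
      (V.lintegral_weight_smooth_sub_le hΦ hsm hf hfp hsN hN hi hδ) _)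
    rw [← lintegral_const_mul _ (by
      have : Measurable fun x => ‖stress Φ f x‖ₑ := m1.enorm
      exact ((hsm.enorm.const_add 1).pow_const m).mul this)]
    refine lintegral_mono fun x => ?_
    rw [enorm_smul, ← mul_assoc]
    exact mul_le_mul_left (H.enorm_deriv_le _) _
  simp only [mollifyError]
  rw [lintegral_add_left (by fun_prop), lintegral_add_left (by fun_prop), hK]
  refine (add_le_add (add_le_add e1 e2) e3).trans_eq ?_
  ring

namespace BoundedVorticity

variable {p m : ℝ} {B M : ℝ≥0} {ω : ℝ → Plane → ℝ} (N : BoundedVorticity p M ω)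
  (V : VelocityBound p m B)
include N V

theorem measurable_mollifyError {Φ : Plane → ℝ} (hΦ : SmoothKernel Φ) {h : ℝ → ℝ}
    (hh : ContDiff ℝ 1 h) :
    Measurable fun z : ℝ × Plane => mollifyError Φ h (ω z.1) z.2 := by
  have m1 := N.measurable
  have m2 := N.measurable_velocity
  have m3 := N.measurable_smooth hΦ
  have m4 := N.measurable_velocity_smooth V hΦ
  have m5 := N.measurable_stress V hΦ
  have m6 := hh.continuous.measurable
  have m7 := (hh.continuous_deriv le_rfl).measurable
  unfold mollifyError
  fun_prop

omit V in
/-- Dominated convergence in time for errors that are controlled by the modulus of translations. -/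
theorem tendsto_lintegral_of_le_translationModulus (hp : 1 ≤ p) (T : ℝ)
    {e : ℝ → ℝ × Plane → ENNReal} (hm : ∀ ε > 0, Measurable (e ε)) (K : ℝ≥0) (R : ℝ)
    (hb : ∀ ε > 0, ∀ t, ∫⁻ x, e ε (t, x) ∂torusMeasure ≤ K * translationModulus p (ω t) (R * ε)) :
    Tendsto (fun ε => ∫⁻ z, e ε z ∂(spaceTime T)) (𝓝[>] 0) (𝓝 0) := by
  have h1 : Tendsto (fun ε => ∫⁻ t in Ioo 0 T,
      ∫⁻ x, e ε (t, x) ∂torusMeasure) (𝓝[>] 0)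
      (𝓝 (∫⁻ _ in Ioo 0 T, 0)) := by
    -- The modulus of `ω t` tends to zero for each `t` but not uniformly, so dominated convergence
    -- in time is needed; twice the norm bound dominates.
    refine tendsto_lintegral_filter_of_dominated_convergence (fun _ => K * (2 * M)) ?_ ?_ ?_ ?_
    · filter_upwards [self_mem_nhdsWithin] with ε hε
      exact (hm ε hε).lintegral_prod_right'
    · filter_upwards [self_mem_nhdsWithin] with ε hε
      refine ae_of_all _ fun t => (hb ε hε t).trans ?_
      gcongr
      refine (translationModulus_le hp (N.measurable_at t) (N.periodic t) _).trans ?_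
      gcongr
      exact N.norm_le t
    · rw [lintegral_const]
      finiteness
    · refine ae_of_all _ fun t => ?_
      have h2 := ENNReal.Tendsto.const_mul (a := K) (tendsto_translationModulus hp (N.measurable_at t)
        (N.periodic t) ((N.norm_le t).trans_lt ENNReal.coe_lt_top) R) (Or.inr (by simp))
      rw [mul_zero] at h2
      refine tendsto_of_tendsto_of_tendsto_of_le_of_le' tendsto_const_nhds h2
        (Eventually.of_forall fun _ => zero_le) ?_
      filter_upwards [self_mem_nhdsWithin] with ε hε using hb ε hε t
  rw [lintegral_zero] at h1
  refine h1.congr' ?_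
  filter_upwards [self_mem_nhdsWithin] with ε hε
  rw [spaceTime_eq_prod, lintegral_prod _ (hm ε hε).aemeasurable]

theorem tendsto_lintegral_mollifyError {h : ℝ → ℝ} {C : ℝ≥0} (H : PowerGrowth h m C) (T : ℝ)
    {φ : Plane → ℝ} (hφ : IsMollifier φ) :
    Tendsto (fun ε => ∫⁻ z : ℝ × Plane, mollifyError (mollKernel φ ε) h (ω z.1) z.2 ∂(spaceTime T))
      (𝓝[>] 0) (𝓝 0) := by
  obtain ⟨K, hK⟩ := V.exists_lintegral_mollifyError_le H M
  obtain ⟨R, hR⟩ := hφ.exists_radius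
  have hp := V.one_lt.le
  have hb : ∀ ε > 0, ∀ t, ∫⁻ x, mollifyError (mollKernel φ ε) h (ω t) x ∂torusMeasure ≤
      K * translationModulus p (ω t) (R * ε) := fun ε hε t =>
    hK _ _ _ (hφ.unitKernel hε) (N.measurable_at t) (N.periodic t) (N.norm_le t)
      (N.integrable_vorticityFlux V t)
      fun y hy => IsMollifier.torusNorm_translate_le hR hε (N.periodic t) p hy
  have hm : ∀ ε > 0, Measurable fun z : ℝ × Plane => mollifyError (mollKernel φ ε) h (ω z.1) z.2 :=
    fun ε hε => N.measurable_mollifyError V (hφ.smoothKernel hε) H.contDiff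
  exact N.tendsto_lintegral_of_le_translationModulus hp T hm K R hb

theorem integrable_comp {h : ℝ → ℝ} {C : ℝ≥0} (H : PowerGrowth h m C) (T : ℝ) :
    Integrable (fun z : ℝ × Plane => h (ω z.1 z.2)) (spaceTime T) ∧
    Integrable (fun z : ℝ × Plane => h (ω z.1 z.2) • velocity (ω z.1) z.2) (spaceTime T) := by
  have hm := V.nonneg
  have f2 : ((1 + M : ENNReal)) ^ m < ⊤ := ENNReal.rpow_lt_top_of_nonneg hm (by finiteness)
  have m1 : Measurable fun z : ℝ × Plane => h (ω z.1 z.2) :=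
    H.continuous.measurable.comp N.measurable
  exact ⟨integrable_spaceTime_of_lintegral_le T m1.stronglyMeasurable
      (by finiteness : (C * ((1 + M) ^ m * (1 + M)) : ENNReal) < ⊤)
      fun t => V.lintegral_comp_le H (N.measurable_at t) (N.norm_le t),
    integrable_spaceTime_of_lintegral_le T (m1.smul N.measurable_velocity).stronglyMeasurable
      (by finiteness : (C * (B * (1 + M) ^ m * (1 + M) * M) : ENNReal) < ⊤)
      fun t => V.lintegral_comp_smul_velocity_le H (N.measurable_at t) (N.periodic t) (N.norm_le t)⟩

omit N V in
theorem _root_.TorusEuler.aestronglyMeasurable_spaceDeriv_apply {T : ℝ} {ψ : ℝ × Plane → ℝ}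
    (hψ : IsTest T ψ) {w : ℝ × Plane → Plane} (hw : AEStronglyMeasurable w (spaceTime T)) :
    AEStronglyMeasurable (fun z => spaceDeriv ψ z (w z)) (spaceTime T) :=
  (ContinuousLinearMap.id ℝ (Plane →L[ℝ] ℝ)).aestronglyMeasurable_comp₂
    (continuous_spaceDeriv hψ.contDiff_one).aestronglyMeasurable hw

/-- The derivatives of the test function are bounded, so the integrands differ by at most a constant
times the mollification error, which tends to zero in `L¹`. -/
theorem tendsto_integral_smoothPairing {h : ℝ → ℝ} {C : ℝ≥0} (H : PowerGrowth h m C) {T : ℝ}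
    {φ : Plane → ℝ} (hφ : IsMollifier φ) {ψ : ℝ × Plane → ℝ} (hψ : IsTest T ψ) :
    Tendsto (fun ε => ∫ z, smoothPairing (mollKernel φ ε) h ω ψ z ∂(spaceTime T)) (𝓝[>] 0)
      (𝓝 (∫ z, balanceIntegrand h ω ψ z ∂(spaceTime T))) := by
  have hc1 := continuous_timeDeriv hψ.contDiff_one
  have hc2 := continuous_spaceDeriv hψ.contDiff_one
  obtain ⟨D₁, hD₁⟩ := exists_norm_le_spaceTime T hc1
  obtain ⟨D₂, hD₂⟩ := exists_norm_le_spaceTime T hc2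
  obtain ⟨i1, i2⟩ := N.integrable_comp V H T
  have hlim : Integrable (balanceIntegrand h ω ψ) (spaceTime T) := by
    refine (i1.mul_bdd hc1.aestronglyMeasurable hD₁).add ?_
    refine (i2.norm.const_mul (D₂ : ℝ)).mono' (aestronglyMeasurable_spaceDeriv_apply hψ i2.1) ?_
    filter_upwards [hD₂] with z hz
    exact (ContinuousLinearMap.le_opNorm _ _).trans (by gcongr)
  have herr : ∀ ε > 0, ∀ᵐ z ∂(spaceTime T),
      ‖smoothPairing (mollKernel φ ε) h ω ψ z - balanceIntegrand h ω ψ z‖ₑ ≤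
        (D₁ + D₂ : ℝ≥0) * mollifyError (mollKernel φ ε) h (ω z.1) z.2 := fun ε hε => by
    filter_upwards [hD₁, hD₂] with z h1 h2
    set F := smooth (mollKernel φ ε) (ω z.1)
    have e : smoothPairing (mollKernel φ ε) h ω ψ z - balanceIntegrand h ω ψ z =
        (h (F z.2) - h (ω z.1 z.2)) * timeDeriv ψ z +
        spaceDeriv ψ z (h (F z.2) • velocity F z.2 - h (ω z.1 z.2) • velocity (ω z.1) z.2) +
        spaceDeriv ψ z (deriv h (F z.2) • stress (mollKernel φ ε) (ω z.1) z.2) := by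
      simp only [smoothPairing, balanceIntegrand, map_sub, F]
      ring
    rw [e]
    have l1 : ‖timeDeriv ψ z‖ₑ ≤ (D₁ + D₂ : ℝ≥0) :=
      enorm_le_coe.2 (le_trans (b := D₁) h1 le_self_add)
    have l2 : ‖spaceDeriv ψ z‖ₑ ≤ (D₁ + D₂ : ℝ≥0) :=
      enorm_le_coe.2 (le_trans (b := D₂) h2 le_add_self)
    refine (enorm_add_le _ _).trans ((add_le_add (enorm_add_le _ _) le_rfl).trans ?_)
    rw [mollifyError, mul_add, mul_add]
    refine add_le_add (add_le_add ?_ ?_) ?_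
    · rw [enorm_mul, mul_comm]
      gcongr
    · exact ((spaceDeriv ψ z).le_opENorm _).trans (by gcongr)
    · exact ((spaceDeriv ψ z).le_opENorm _).trans (by gcongr)
  have hmeas : ∀ ε > 0, AEStronglyMeasurable (smoothPairing (mollKernel φ ε) h ω ψ) (spaceTime T) :=
    fun ε hε => by
    have hΦ := hφ.smoothKernel hε
    have m1 : Measurable fun z : ℝ × Plane => h (smooth (mollKernel φ ε) (ω z.1) z.2) :=
      H.continuous.measurable.comp (N.measurable_smooth hΦ)
    have m2 : Measurable fun z : ℝ × Plane => deriv h (smooth (mollKernel φ ε) (ω z.1) z.2) :=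
      H.continuous_deriv.measurable.comp (N.measurable_smooth hΦ)
    exact ((m1.mul hc1.measurable).aestronglyMeasurable.add
      (aestronglyMeasurable_spaceDeriv_apply hψ
        (m1.smul (N.measurable_velocity_smooth V hΦ)).aestronglyMeasurable)).add
      (aestronglyMeasurable_spaceDeriv_apply hψ
        (m2.smul (N.measurable_stress V hΦ)).aestronglyMeasurable)
  have ht := N.tendsto_lintegral_mollifyError V H T hφ
  have ht' : Tendsto (fun ε => ∫⁻ z, ‖smoothPairing (mollKernel φ ε) h ω ψ z -
      balanceIntegrand h ω ψ z‖ₑ ∂(spaceTime T)) (𝓝[>] 0) (𝓝 0) := by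
    have h2 := ENNReal.Tendsto.const_mul (a := ((D₁ + D₂ : ℝ≥0) : ENNReal)) ht (Or.inr (by simp))
    rw [mul_zero] at h2
    refine tendsto_of_tendsto_of_tendsto_of_le_of_le' tendsto_const_nhds h2
      (Eventually.of_forall fun _ => zero_le) ?_
    filter_upwards [self_mem_nhdsWithin] with ε hε
    rw [← lintegral_const_mul _ (N.measurable_mollifyError V (hφ.smoothKernel hε) H.contDiff)]
    exact lintegral_mono_ae (herr ε hε)
  refine tendsto_integral_of_L1 _ hlim.1 ?_ ht'
  filter_upwards [ht'.eventually (gt_mem_nhds ENNReal.zero_lt_top), self_mem_nhdsWithin] with ε h1 hε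
  have : Integrable (fun z => smoothPairing (mollKernel φ ε) h ω ψ z - balanceIntegrand h ω ψ z)
    (spaceTime T) := ⟨(hmeas ε hε).sub hlim.1, h1⟩
  exact (this.add hlim).congr (ae_of_all _ fun z => sub_add_cancel _ _)

end BoundedVorticity

/-! ### The defect as a distribution, and the choice of a representative. -/

/-- The distribution `∂_t h(ω) + ∇ ⬝ (u h(ω))`, with the sign changed. -/
def defect (T : ℝ) (h : ℝ → ℝ) (ω : ℝ → Plane → ℝ) (ψ : ℝ × Plane → ℝ) : ℝ :=
  ∫ z, balanceIntegrand h ω ψ z ∂(spaceTime T)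

theorem balancePairing_eq_neg_defect (T : ℝ) (h : ℝ → ℝ) (ω : ℝ → Plane → ℝ)
    (ψ : ℝ × Plane → ℝ) : balancePairing T (fun t x => h (ω t x))
      (fun t x => h (ω t x) • velocity (ω t) x) ψ = -defect T h ω ψ :=
  balancePairing_eq _ _ _ _

/-- Only first derivatives of the test function occur, so the order is at most one, and the `L¹`
norms give a constant that does not depend on the support in time. -/
theorem isDistribution_defect {T : ℝ} {h : ℝ → ℝ} {ω : ℝ → Plane → ℝ}
    (i1 : Integrable (fun z : ℝ × Plane => h (ω z.1 z.2)) (spaceTime T))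
    (i2 : Integrable (fun z : ℝ × Plane => h (ω z.1 z.2) • velocity (ω z.1) z.2) (spaceTime T)) :
    IsDistribution T (defect T h ω) := by
  have hint : ∀ ψ, IsTest T ψ → Integrable (balanceIntegrand h ω ψ) (spaceTime T) := fun ψ hψ => by
    have hc1 := continuous_timeDeriv hψ.contDiff_one
    have hc2 := continuous_spaceDeriv hψ.contDiff_one
    obtain ⟨D₁, hD₁⟩ := exists_norm_le_spaceTime T hc1
    obtain ⟨D₂, hD₂⟩ := exists_norm_le_spaceTime T hc2
    refine (i1.mul_bdd hc1.aestronglyMeasurable hD₁).add ?_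
    refine (i2.norm.const_mul (D₂ : ℝ)).mono' (aestronglyMeasurable_spaceDeriv_apply hψ i2.1) ?_
    filter_upwards [hD₂] with z hz
    exact (ContinuousLinearMap.le_opNorm _ _).trans (by gcongr)
  refine ⟨fun ψ₁ ψ₂ h₁ h₂ c₁ c₂ => ?_, fun a b _ _ => ⟨1,
    ∫ z : ℝ × Plane, (‖h (ω z.1 z.2)‖ + ‖h (ω z.1 z.2) • velocity (ω z.1) z.2‖) ∂(spaceTime T),
    fun ψ hψ _ A hA => ?_⟩⟩
  · unfold defect
    rw [← integral_const_mul, ← integral_const_mul,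
      ← integral_add ((hint _ h₁).const_mul _) ((hint _ h₂).const_mul _)]
    refine integral_congr_ae (ae_of_all _ fun z => ?_)
    have d1 := h₁.contDiff_one
    have d2 := h₂.contDiff_one
    have d3 : ContDiff ℝ 1 fun z => c₁ * ψ₁ z + c₂ * ψ₂ z :=
      (contDiff_const.mul d1).add (contDiff_const.mul d2)
    have e : fderiv ℝ (fun z => c₁ * ψ₁ z + c₂ * ψ₂ z) z =
        c₁ • fderiv ℝ ψ₁ z + c₂ • fderiv ℝ ψ₂ z := by
      have l1 := d1.differentiable one_ne_zero z
      have l2 := d2.differentiable one_ne_zero z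
      rw [fderiv_fun_add (l1.const_mul _) (l2.const_mul _), fderiv_const_mul l1, fderiv_const_mul l2]
    simp only [balanceIntegrand, timeDeriv_eq d1, timeDeriv_eq d2, timeDeriv_eq d3,
      spaceDeriv_eq d1, spaceDeriv_eq d2, spaceDeriv_eq d3, e, ContinuousLinearMap.comp_apply,
      _root_.add_apply, _root_.smul_apply, smul_eq_mul]
    ring
  · rw [← integral_mul_const, defect, ← Real.norm_eq_abs]
    refine norm_integral_le_of_norm_le ((i1.norm.add i2.norm).mul_const A) (ae_of_all _ fun z => ?_)
    have hb := hA 1 le_rfl z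
    rw [norm_iteratedFDeriv_one (𝕜 := ℝ)] at hb
    rw [balanceIntegrand, timeDeriv_eq hψ.contDiff_one, spaceDeriv_eq hψ.contDiff_one]
    refine (norm_add_le _ _).trans ?_
    rw [add_mul, norm_mul]
    refine add_le_add ?_ ?_
    · gcongr
      refine ((fderiv ℝ ψ z).le_opNorm _).trans ?_
      simpa [Prod.norm_def] using hb
    · rw [ContinuousLinearMap.comp_apply, mul_comm]
      refine ((fderiv ℝ ψ z).le_opNorm _).trans ?_
      simp only [ContinuousLinearMap.inr_apply, Prod.norm_def, norm_zero]
      rw [max_eq_right (norm_nonneg _)]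
      gcongr

/-- The representative of a point in the fundamental cell. -/
def toCell (x : Plane) : Plane := WithLp.toLp 2 fun i => Int.fract (x i)

theorem measurable_toCell : Measurable toCell := by
  refine (MeasurableEquiv.toLp 2 (Fin 2 → ℝ)).measurable.comp (measurable_pi_lambda _ fun i => ?_)
  exact measurable_fract.comp (by fun_prop : Measurable fun x : Plane => x i)

theorem periodic2_toCell : Periodic2 toCell := fun i x => by
  ext j
  by_cases h : j = i
  · subst h; simp [toCell]
  · simp [toCell, h]

theorem toCell_eq {x : Plane} (hx : x ∈ cell) : toCell x = x := by
  ext j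
  simpa [toCell] using Int.fract_eq_self.2 (hx j)

theorem ae_mem_cell (T : ℝ) : ∀ᵐ z ∂(spaceTime T), z.2 ∈ cell := by
  rw [spaceTime]
  exact (ae_restrict_iff' (measurableSet_Ioo.prod measurableSet_cell)).2 (ae_of_all _ fun z hz => hz.2)

theorem ae_spaceTime_of_ae_time {T : ℝ} {P : ℝ → Prop}
    (h : ∀ᵐ t ∂(volume.restrict (Ioo 0 T)), P t) : ∀ᵐ z ∂(spaceTime T), P z.1 := by
  rw [spaceTime_eq_prod]
  exact Measure.quasiMeasurePreserving_fst.ae h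

theorem ae_time_of_ae_spaceTime {T : ℝ} {P : ℝ × Plane → Prop} (h : ∀ᵐ z ∂(spaceTime T), P z) :
    ∀ᵐ t ∂(volume.restrict (Ioo 0 T)), ∀ᵐ x ∂torusMeasure, P (t, x) := by
  rw [spaceTime_eq_prod] at h
  exact Measure.ae_ae_of_ae_prod h

/-- A measurable modification on the cell is extended periodically through the fractional part, and
set to zero at the times where its norm exceeds the bound; inside `(0,T)` these form a null set.
Measurability, periodicity and the norm bound then hold without exceptional sets. -/
theorem MemLinftyLp.exists_boundedVorticity {T p : ℝ} (hp : 0 < p) {ω : ℝ → Plane → ℝ}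
    (hω : MemLinftyLp T p ω) : ∃ (M : ℝ≥0) (ω' : ℝ → Plane → ℝ), BoundedVorticity p M ω' ∧
      ∀ᵐ z ∂(spaceTime T), ω' z.1 z.2 = ω z.1 z.2 := by
  classical
  obtain ⟨M, hM⟩ := hω.bounded
  set g := hω.measurable.mk with hg
  have hgm : Measurable g := hω.measurable.stronglyMeasurable_mk.measurable
  have hae := hω.measurable.ae_eq_mk
  set G : ℝ → Plane → ℝ := fun t x => g (t, toCell x) with hG
  have hGm : Measurable fun z : ℝ × Plane => G z.1 z.2 :=
    hgm.comp (measurable_fst.prodMk (measurable_toCell.comp measurable_snd))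
  have hNm : Measurable fun t => torusNorm p (G t) := by
    simp only [torusNorm_eq hp]
    refine Measurable.pow_const ?_ _
    exact (hGm.enorm.pow_const p).lintegral_prod_right'
  have hS : MeasurableSet {t | torusNorm p (G t) ≤ M} := measurableSet_le hNm measurable_const
  have hGω : ∀ᵐ z ∂(spaceTime T), G z.1 z.2 = ω z.1 z.2 := by
    filter_upwards [hae, ae_mem_cell T] with z h1 h2
    rw [hG]
    simp only [toCell_eq h2]
    exact h1.symm
  have hGS : ∀ᵐ t ∂(volume.restrict (Ioo 0 T)), torusNorm p (G t) ≤ M := by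
    filter_upwards [hM, ae_time_of_ae_spaceTime hGω] with t h1 h2
    refine le_trans (le_of_eq ?_) h1
    exact eLpNorm_congr_ae h2
  refine ⟨M, fun t x => if torusNorm p (G t) ≤ M then G t x else 0, ⟨?_, fun t i x => ?_,
    fun t => ?_⟩, ?_⟩
  · exact Measurable.ite (hS.preimage measurable_fst) hGm measurable_const
  · simp only [hG, periodic2_toCell i x]
  · by_cases h : torusNorm p (G t) ≤ M
    · simp only [h, if_true]
    · simp only [h, if_false]
      exact (eLpNorm_zero (ε := ℝ)).trans_le zero_le
  · filter_upwards [hGω, ae_spaceTime_of_ae_time hGS] with z h1 h2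
    rw [if_pos h2, h1]

/-- Mollification over the plane unfolds to convolution with the periodized kernel and depends only
on the class modulo null sets. This links the given vorticity to its good representative. -/
theorem BoundedVorticity.turbulentTransport_eq {p m : ℝ} {B M : ℝ≥0} {ω : ℝ → Plane → ℝ}
    (N : BoundedVorticity p M ω) (V : VelocityBound p m B) {φ : Plane → ℝ} (hφ : IsMollifier φ)
    {ε : ℝ} (hε : 0 < ε) {t : ℝ} {f : Plane → ℝ} (hf : Periodic2 f) (h : ω t =ᵐ[torusMeasure] f) :
    mollify φ ε f = smooth (mollKernel φ ε) (ω t) ∧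
      turbulentTransport φ ε f = stress (mollKernel φ ε) (ω t) := by
  have hL := N.torusL1 V t
  have hv : velocity f = velocity (ω t) := velocity_congr hf hL.periodic h.symm
  have e1 : mollify φ ε f = smooth (mollKernel φ ε) (ω t) := by
    rw [mollify_congr φ ε hf hL.periodic h.symm]
    exact funext fun x => hφ.mollify_eq hε hL.measurable.stronglyMeasurable hL.periodic
      hL.integrable x
  refine ⟨e1, funext fun x => ?_⟩
  rw [turbulentTransport, stress, hv, e1, hL.velocity_smooth (hφ.smoothKernel hε),
    hφ.mollify_eq hε hL.stronglyMeasurable_velocity (periodic2_velocity hL.periodic)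
      hL.integrable_velocity,
    mollify_congr φ ε (f := fun y => f y • velocity (ω t) y) (g := vorticityFlux (ω t))
      (hf.comp₂ (periodic2_velocity hL.periodic) fun a b => a • b)
      (periodic2_vorticityFlux hL.periodic)
      (h.mono fun y hy => by simp only [vorticityFlux, hy]),
    hφ.mollify_eq hε (f := vorticityFlux (ω t))
      (hL.measurable.stronglyMeasurable.smul hL.stronglyMeasurable_velocity)
      (periodic2_vorticityFlux hL.periodic) (N.integrable_vorticityFlux V t)]

theorem IsWeakEuler.congr {T : ℝ} {ω ω' : ℝ → Plane → ℝ} (hsol : IsWeakEuler T ω)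
    (h : ∀ᵐ z ∂(spaceTime T), ω' z.1 z.2 = ω z.1 z.2 ∧ velocity (ω' z.1) = velocity (ω z.1)) :
    IsWeakEuler T ω' := fun ψ hψ => by
  rw [← hsol ψ hψ, balancePairing_eq, balancePairing_eq]
  congr 1
  refine integral_congr_ae (h.mono fun z hz => ?_)
  simp only [hz.1, hz.2]

/-- The local balance of `h(ω)`, for a nonlinearity `h` whose growth is controlled by the
integrability of the vorticity. -/
theorem isDefect_and_localBalance {T p m : ℝ} (hT : 0 < T) {B C : ℝ≥0} {h : ℝ → ℝ}
    (V : VelocityBound p m B) (H : PowerGrowth h m C) (hh : ContDiff ℝ 2 h)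
    {ω : ℝ → Plane → ℝ} (hω : MemLinftyLp T p ω) (hsol : IsWeakEuler T ω) :
    IsDefect T ω h (defect T h ω) ∧ LocalBalance T ω h (defect T h ω) := by
  obtain ⟨M, ω', N, hae⟩ := hω.exists_boundedVorticity (by linarith [V.one_lt])
  have hae' : ∀ᵐ z ∂(spaceTime T), ω' z.1 =ᵐ[torusMeasure] ω z.1 :=
    ae_spaceTime_of_ae_time (ae_time_of_ae_spaceTime hae)
  have hv : ∀ᵐ z ∂(spaceTime T), velocity (ω' z.1) = velocity (ω z.1) :=
    hae'.mono fun z hz => velocity_congr (N.periodic _) (hω.periodic _) hz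
  have hsol' : IsWeakEuler T ω' := hsol.congr (hae.and hv)
  obtain ⟨i1, i2⟩ := N.integrable_comp V H T
  have j1 : Integrable (fun z : ℝ × Plane => h (ω z.1 z.2)) (spaceTime T) :=
    i1.congr (hae.mono fun z hz => by simp only [hz])
  have j2 : Integrable (fun z : ℝ × Plane => h (ω z.1 z.2) • velocity (ω z.1) z.2)
      (spaceTime T) := i2.congr ((hae.and hv).mono fun z hz => by simp only [hz.1, hz.2])
  have hdef : ∀ ψ, defect T h ω ψ = ∫ z, balanceIntegrand h ω' ψ z ∂(spaceTime T) := fun ψ =>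
    integral_congr_ae ((hae.and hv).mono fun z hz => by
      simp only [balanceIntegrand, hz.1, hz.2])
  have hflux : ∀ {φ}, IsMollifier φ → ∀ ε > 0,
      kernelFlux (mollKernel φ ε) h ω' =ᵐ[spaceTime T] flux h ω φ ε := fun {φ} hφ ε hε => by
    filter_upwards [hae'] with z hz
    obtain ⟨e1, e2⟩ := N.turbulentTransport_eq V hφ hε (hω.periodic z.1) hz
    rw [kernelFlux, flux, e1, e2, inner_gradient]
  refine ⟨⟨isDistribution_defect j1 j2, fun φ hφ => ⟨fun ε hε => ?_, fun ψ hψ => ?_⟩⟩, j1, j2,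
    fun ψ hψ => balancePairing_eq_neg_defect T h ω ψ⟩
  · exact (N.integrable_kernelFlux V (hφ.smoothKernel hε) hh T).congr (hflux hφ ε hε)
  · rw [hdef]
    refine (N.tendsto_integral_smoothPairing V H hφ hψ).congr' ?_
    filter_upwards [self_mem_nhdsWithin] with ε hε
    rw [← N.integral_kernelFlux_mul V (hφ.smoothKernel hε) hh hT hsol' hψ]
    exact integral_congr_ae ((hflux hφ ε hε).mono fun z hz => by simp only [hz])

theorem GrowthClass.exists_powerGrowth {r m : ℝ} (hm : 0 ≤ m) (hr : r - 1 ≤ m) {h : ℝ → ℝ}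
    (hh : h ∈ GrowthClass r) : ∃ C, PowerGrowth h m C := by
  obtain ⟨hc, C, hC, hb⟩ := hh
  -- When `r < 1` the power `|s|^(r-1)` blows up at the origin, so for `|s| ≤ 1` the bound comes
  -- from continuity of `h'`; the growth condition is used only for `|s| ≥ 1`.
  obtain ⟨C₁, hC₁⟩ := exists_norm_comp_le (hc.continuous_deriv le_rfl) 1
  have h1 : ∀ s : ℝ, 1 ≤ (1 + |s|) ^ m := fun s => Real.one_le_rpow (by linarith [abs_nonneg s]) hm
  have hd : ∀ s, |deriv h s| ≤ (2 * C + C₁) * (1 + |s|) ^ m := fun s => by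
    rcases le_total |s| 1 with hs | hs
    · have := hC₁ s hs
      rw [Real.norm_eq_abs] at this
      have := h1 s
      nlinarith [C₁.2]
    · have h2 : |s| ^ (r - 1) ≤ (1 + |s|) ^ m :=
        (Real.rpow_le_rpow_of_exponent_le hs hr).trans
          (Real.rpow_le_rpow (abs_nonneg s) (by linarith) hm)
      have := hb s
      have := h1 s
      nlinarith [C₁.2]
  obtain ⟨K, hK⟩ : ∃ K : ℝ≥0, (K : ℝ) = 2 * C + C₁ :=
    ⟨(2 * C + C₁).toNNReal, Real.coe_toNNReal _ (by positivity)⟩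
  refine ⟨K + ‖h 0‖₊, hc, fun s => (hd s).trans ?_, fun s => ?_⟩
  · push_cast
    rw [hK]
    exact mul_le_mul_of_nonneg_right (le_add_of_nonneg_right (norm_nonneg _)) (by positivity)
  · have h3 : |h s - h 0| ≤ (2 * C + C₁) * (1 + |s|) ^ m * |s - 0| := by
      refine (convex_Icc (-|s|) |s|).norm_image_sub_le_of_norm_deriv_le (𝕜 := ℝ)
        (fun x _ => hc.differentiable one_ne_zero x) (fun x hx => (hd x).trans ?_) ?_ ?_
      · have : |x| ≤ |s| := abs_le.2 hx
        gcongr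
      · simp
      · exact abs_le.1 le_rfl
    have h4 : |h s| ≤ |h s - h 0| + |h 0| := by
      have := abs_add_le (h s - h 0) (h 0)
      rwa [sub_add_cancel] at this
    have h5 := h1 s
    have h6 : |h 0| ≤ |h 0| * ((1 + |s|) ^ m * (1 + |s|)) :=
      le_mul_of_one_le_right (abs_nonneg _)
        (one_le_mul_of_one_le_of_one_le h5 (by linarith [abs_nonneg s]))
    rw [sub_zero] at h3
    have h7 : (2 * C + C₁) * (1 + |s|) ^ m * |s| ≤ (2 * C + C₁) * (1 + |s|) ^ m * (1 + |s|) := by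
      gcongr
      linarith
    push_cast
    rw [hK, Real.norm_eq_abs]
    linarith

theorem MemLinftyLp.mono_exponent {T p q : ℝ} (hqp : q ≤ p) {ω : ℝ → Plane → ℝ}
    (hω : MemLinftyLp T p ω) : MemLinftyLp T q ω := by
  obtain ⟨M, hM⟩ := hω.bounded
  have hm : ∀ᵐ t ∂(volume.restrict (Ioo 0 T)), AEStronglyMeasurable (ω t) torusMeasure := by
    have := hω.measurable
    rw [spaceTime_eq_prod] at this
    exact this.prodMk_left
  refine ⟨hω.periodic, hω.measurable, M, ?_⟩
  filter_upwards [hM, hm] with t h1 h2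
  exact (eLpNorm_le_eLpNorm_of_exponent_le (ENNReal.ofReal_le_ofReal hqp) h2).trans h1

theorem isDefect_of_admissibleGrowth {T p r : ℝ} (hT : 0 < T) {h : ℝ → ℝ}
    (hr : AdmissibleGrowth p r) (hg : h ∈ GrowthClass r) (hh : ContDiff ℝ 2 h)
    {ω : ℝ → Plane → ℝ} (hω : MemLinftyLp T p ω) (hsol : IsWeakEuler T ω) :
    IsDefect T ω h (defect T h ω) ∧ LocalBalance T ω h (defect T h ω) := by
  rcases hr with ⟨h1, h2, rfl⟩ | ⟨rfl, h2⟩ | ⟨h1, rfl⟩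
  · obtain ⟨B, V⟩ := velocityBound_of_lt_two h1 h2
    obtain ⟨C, H⟩ := GrowthClass.exists_powerGrowth V.nonneg (by linarith) hg
    exact isDefect_and_localBalance hT V H hh hω hsol
  · obtain ⟨q, hq1, hq2, hq3⟩ : ∃ q : ℝ, 4 / 3 < q ∧ q < 2 ∧ r - 1 ≤ 3 / 2 * q - 2 := by
      refine ⟨max (2 / 3 * (r + 1)) (5 / 3), lt_max_of_lt_right (by norm_num),
        max_lt (by linarith) (by norm_num), ?_⟩
      linarith [le_max_left (2 / 3 * (r + 1)) (5 / 3)]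
    obtain ⟨B, V⟩ := velocityBound_of_lt_two hq1 hq2
    obtain ⟨C, H⟩ := GrowthClass.exists_powerGrowth V.nonneg hq3 hg
    exact isDefect_and_localBalance hT V H hh (hω.mono_exponent hq2.le) hsol
  · obtain ⟨B, V⟩ := velocityBound_of_two_lt h1
    obtain ⟨C, H⟩ := GrowthClass.exists_powerGrowth V.nonneg le_rfl hg
    exact isDefect_and_localBalance hT V H hh hω hsol

/-! ### Convergence of mollifications in `L¹` of space-time. -/

theorem torusNorm_one_eq {E : Type*} [NormedAddCommGroup E] (f : Plane → E) :
    torusNorm 1 f = ∫⁻ x, ‖f x‖ₑ ∂torusMeasure := by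
  rw [torusNorm_eq one_pos]
  simp

theorem BoundedVorticity.torusL1' {p : ℝ} (hp : 1 ≤ p) {M : ℝ≥0} {ω : ℝ → Plane → ℝ}
    (N : BoundedVorticity p M ω) (t : ℝ) : TorusL1 (ω t) :=
  ⟨N.measurable_at t, N.periodic t, integrable_of_torusNorm_lt_top hp (N.measurable_at t)
    ((N.norm_le t).trans_lt ENNReal.coe_lt_top)⟩

/-- Mollification converges in `L^p` in space, uniformly bounded in time. -/
theorem BoundedVorticity.tendsto_lintegral_smooth_sub {M : ℝ≥0} {g : ℝ → Plane → ℝ}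
    (N : BoundedVorticity 1 M g) (T : ℝ) {φ : Plane → ℝ} (hφ : IsMollifier φ) :
    Tendsto (fun ε => ∫⁻ z : ℝ × Plane, ‖smooth (mollKernel φ ε) (g z.1) z.2 - g z.1 z.2‖ₑ
      ∂(spaceTime T)) (𝓝[>] 0) (𝓝 0) := by
  obtain ⟨R, hR⟩ := hφ.exists_radius
  refine N.tendsto_lintegral_of_le_translationModulus le_rfl T (e := fun ε z =>
    ‖smooth (mollKernel φ ε) (g z.1) z.2 - g z.1 z.2‖ₑ) (fun ε hε => ?_) 1 R fun ε hε t => ?_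
  · exact ((N.measurable_smooth (hφ.smoothKernel hε)).sub N.measurable).enorm
  · rw [← torusNorm_one_eq (fun x => smooth (mollKernel φ ε) (g t) x - g t x), ENNReal.coe_one,
      one_mul]
    exact (hφ.unitKernel hε).torusNorm_smooth_sub_le le_rfl (N.torusL1' le_rfl t)
      fun y hy => IsMollifier.torusNorm_translate_le hR hε (N.periodic t) 1 hy

theorem enorm_le_sum_coord (v : Plane) : ‖v‖ₑ ≤ ‖v 0‖ₑ + ‖v 1‖ₑ := by
  have h : v = EuclideanSpace.single 0 (v 0) + EuclideanSpace.single 1 (v 1) := by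
    ext i
    fin_cases i <;> simp
  have h2 := enorm_add_le (EuclideanSpace.single 0 (v 0) : Plane) (EuclideanSpace.single 1 (v 1))
  rw [← h] at h2
  refine h2.trans_eq ?_
  simp only [← ofReal_norm, EuclideanSpace.single, PiLp.norm_single]

theorem enorm_coord_le (v : Plane) (i : Fin 2) : ‖v i‖ₑ ≤ ‖v‖ₑ :=
  enorm_le_iff_norm_le.2 (PiLp.norm_apply_le v i)

/-- Convolution acts on each coordinate separately, which reduces vector fields to the scalar
convergence result. -/
theorem smooth_coord {Φ : Plane → ℝ} (hΦ : SmoothKernel Φ) {W : Plane → Plane}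
    (hW : Integrable W torusMeasure) (x : Plane) (i : Fin 2) :
    smooth Φ W x i = smooth Φ (fun y => W y i) x := by
  have h := (EuclideanSpace.proj (𝕜 := ℝ) i : Plane →L[ℝ] ℝ).integral_comp_comm
    (hΦ.integrable_smooth_integrand hW x)
  simpa [smooth] using h.symm

/-- A time-dependent vector field that is bounded in `L^1`. -/
structure BoundedField (A : ℝ≥0) (W : ℝ → Plane → Plane) : Prop where
  measurable : Measurable fun z : ℝ × Plane => W z.1 z.2
  periodic : ∀ t, Periodic2 (W t)
  lintegral_le : ∀ t, ∫⁻ x, ‖W t x‖ₑ ∂torusMeasure ≤ A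

namespace BoundedField

variable {A : ℝ≥0} {W : ℝ → Plane → Plane} (N : BoundedField A W)
include N

theorem measurable_at (t : ℝ) : Measurable (W t) :=
  N.measurable.comp (by fun_prop : Measurable fun x : Plane => (t, x))

theorem integrable (t : ℝ) : Integrable (W t) torusMeasure :=
  ⟨(N.measurable_at t).aestronglyMeasurable, (N.lintegral_le t).trans_lt ENNReal.coe_lt_top⟩

theorem coord (i : Fin 2) : BoundedVorticity 1 A fun t x => W t x i :=
  ⟨by have := N.measurable; fun_prop, fun t => (N.periodic t).comp fun v => v i, fun t => by
    rw [torusNorm_one_eq]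
    exact (lintegral_mono fun x => enorm_coord_le _ i).trans (N.lintegral_le t)⟩

theorem tendsto_lintegral_smooth_sub (T : ℝ) {φ : Plane → ℝ} (hφ : IsMollifier φ) :
    Tendsto (fun ε => ∫⁻ z : ℝ × Plane, ‖smooth (mollKernel φ ε) (W z.1) z.2 - W z.1 z.2‖ₑ
      ∂(spaceTime T)) (𝓝[>] 0) (𝓝 0) := by
  have h := ((N.coord 0).tendsto_lintegral_smooth_sub T hφ).add
    ((N.coord 1).tendsto_lintegral_smooth_sub T hφ)
  rw [add_zero] at h
  refine tendsto_of_tendsto_of_tendsto_of_le_of_le' tendsto_const_nhds h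
    (Eventually.of_forall fun _ => zero_le) ?_
  filter_upwards [self_mem_nhdsWithin] with ε hε
  have hΦ := hφ.smoothKernel hε
  have hm : Measurable fun z : ℝ × Plane =>
      ‖smooth (mollKernel φ ε) (fun x => W z.1 x 0) z.2 - W z.1 z.2 0‖ₑ :=
    (((N.coord 0).measurable_smooth hΦ).sub (N.coord 0).measurable).enorm
  rw [← lintegral_add_left hm]
  refine lintegral_mono fun z => (enorm_le_sum_coord _).trans_eq ?_
  simp only [PiLp.sub_apply, smooth_coord hΦ (N.integrable z.1)]

theorem measurable_smooth {Φ : Plane → ℝ} (hΦ : SmoothKernel Φ) :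
    Measurable fun z : ℝ × Plane => smooth Φ (W z.1) z.2 :=
  (stronglyMeasurable_integral_bilinear (ContinuousLinearMap.lsmul ℝ ℝ) hΦ.continuous
    N.measurable.stronglyMeasurable).measurable

theorem measurable_smoothDiv {Φ : Plane → ℝ} (hΦ : SmoothKernel Φ) :
    Measurable fun z : ℝ × Plane => smoothDiv Φ (W z.1) z.2 :=
  (stronglyMeasurable_integral_bilinear (ContinuousLinearMap.id ℝ (Plane →L[ℝ] ℝ))
    hΦ.continuous_fderiv N.measurable.stronglyMeasurable).measurable

theorem exists_norm_le {Φ : Plane → ℝ} (hΦ : SmoothKernel Φ) :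
    ∃ C : ℝ≥0, ∀ t x, ‖smooth Φ (W t) x‖ ≤ C ∧ ‖smoothDiv Φ (W t) x‖ ≤ C := by
  obtain ⟨C₂, h₂⟩ := hΦ.exists_norm_smooth_le Plane
  obtain ⟨C₃, h₃⟩ := hΦ.exists_norm_smoothDiv_le
  refine ⟨(C₂ + C₃) * A, fun t x => ?_⟩
  obtain ⟨i₁, a₁⟩ := integral_norm_le_of_lintegral_le (N.integrable t).1 (N.lintegral_le t)
  push_cast
  constructor
  · refine (h₂ _ i₁ x).trans ?_
    gcongr
    exact le_add_of_nonneg_right C₃.2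
  · refine (h₃ _ i₁ x).trans ?_
    gcongr
    exact le_add_of_nonneg_left C₂.2

theorem integrable_spaceTime (T : ℝ) :
    Integrable (fun z : ℝ × Plane => W z.1 z.2) (spaceTime T) :=
  integrable_spaceTime_of_lintegral_le T N.measurable.stronglyMeasurable ENNReal.coe_lt_top
    N.lintegral_le

end BoundedField

theorem BoundedVorticity.exists_norm_le_of_one {M : ℝ≥0} {g : ℝ → Plane → ℝ}
    (N : BoundedVorticity 1 M g) {Φ : Plane → ℝ} (hΦ : SmoothKernel Φ) :
    ∃ C : ℝ≥0, ∀ t x, ‖smooth Φ (g t) x‖ ≤ C ∧ ‖fderiv ℝ (smooth Φ (g t)) x‖ ≤ C := by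
  obtain ⟨C₂, h₂⟩ := hΦ.exists_norm_smooth_le ℝ
  obtain ⟨C₃, h₃⟩ := hΦ.exists_norm_fderiv_smooth_le
  refine ⟨(C₂ + C₃) * M, fun t x => ?_⟩
  obtain ⟨i₁, a₁⟩ := integral_norm_le_of_lintegral_le (N.torusL1' le_rfl t).integrable.1
    ((torusNorm_one_eq (g t)).symm.trans_le (N.norm_le t))
  push_cast
  constructor
  · refine (h₂ _ i₁ x).trans ?_
    gcongr
    exact le_add_of_nonneg_right C₃.2
  · refine (h₃ _ i₁ x).trans ?_
    gcongr
    exact le_add_of_nonneg_left C₂.2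

theorem BoundedVorticity.integrable_spaceTime {M : ℝ≥0} {g : ℝ → Plane → ℝ}
    (N : BoundedVorticity 1 M g) (T : ℝ) :
    Integrable (fun z : ℝ × Plane => g z.1 z.2) (spaceTime T) :=
  integrable_spaceTime_of_lintegral_le T N.measurable.stronglyMeasurable ENNReal.coe_lt_top
    fun t => (torusNorm_one_eq (g t)).symm.trans_le (N.norm_le t)

/-- The mollification of a constant is constant, so its gradient vanishes. -/
theorem smoothDiv_const {Φ : Plane → ℝ} (hΦ : SmoothKernel Φ) (v x : Plane) :
    smoothDiv Φ (fun _ => v) x = 0 := by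
  have h := hΦ.fderiv_smooth (integrable_const (1 : ℝ)) x v
  have h2 : smooth Φ (fun _ => (1 : ℝ)) = fun _ => ∫ y, Φ y • (1 : ℝ) ∂torusMeasure :=
    funext fun x => smooth_eq hΦ.periodic (f := fun _ => (1 : ℝ)) (fun _ _ => rfl) x
  rw [h2] at h
  simpa using h.symm

/-! ### Algebra of the cubic increment. -/

/-- The flux in terms of increments, expanded into mollified quantities. -/
def expandedFlux (Φ : Plane → ℝ) (f : Plane → ℝ) (x : Plane) : ℝ :=
  -smoothDiv Φ (fun y => f y ^ 2 • velocity f y) x + 2 * f x * smoothDiv Φ (vorticityFlux f) x +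
    fderiv ℝ (smooth Φ fun y => f y ^ 2) x (velocity f x) -
    2 * f x * fderiv ℝ (smooth Φ f) x (velocity f x)

/-- Multiplying out the increments gives six terms. The two with the factor `f x ^ 2` vanish, one
because the velocity is divergence free and the other because the gradient of `Φ` has mean zero.
Evenness of `Φ` makes its gradient odd, which converts forward increments into convolutions. -/
theorem integral_increment_eq {Φ : Plane → ℝ} (hΦ : SmoothKernel Φ) (heven : ∀ x, Φ (-x) = Φ x)
    {f : Plane → ℝ} (hf : TorusL1 f) (hf2 : Integrable (fun x => f x ^ 2) torusMeasure)
    (hi1 : Integrable (vorticityFlux f) torusMeasure)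
    (hi2 : Integrable (fun x => f x ^ 2 • velocity f x) torusMeasure) (x : Plane) :
    ∫ y, fderiv ℝ Φ y ((f (x + y) - f x) ^ 2 • (velocity f (x + y) - velocity f x)) ∂torusMeasure =
      expandedFlux Φ f x := by
  have hodd : ∀ z, fderiv ℝ Φ (-z) = -fderiv ℝ Φ z := fun z => by
    have h := hΦ.fderiv_comp_sub_left 0 z
    simp only [zero_sub, heven] at h
    rw [h, neg_neg]
  have hvp := periodic2_velocity hf.periodic
  have hper : Periodic2 fun y => fderiv ℝ Φ y
      ((f (x + y) - f x) ^ 2 • (velocity f (x + y) - velocity f x)) := by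
    have h1 := (hf.periodic.comp_add x).comp₂ (hvp.comp_add x)
      fun a b => (a - f x) ^ 2 • (b - velocity f x)
    simp only [add_comm _ x] at h1
    exact hΦ.periodic.fderiv.comp₂ h1 fun a b => a b
  have e1 := integral_torus_sub hper x
  rw [← e1]
  have i1 := hΦ.integrable_smoothDiv_integrand hi2 x
  have i2 := (hΦ.integrable_smoothDiv_integrand hi1 x).const_mul (2 * f x)
  have i3 := (hΦ.integrable_smoothDiv_integrand hf.integrable_velocity x).const_mul (f x ^ 2)
  have i4 := hΦ.integrable_smoothDiv_integrand (hf2.smul_const (velocity f x)) x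
  have i5 := (hΦ.integrable_smoothDiv_integrand (hf.integrable.smul_const (velocity f x)) x).const_mul
    (2 * f x)
  have i6 := (hΦ.integrable_smoothDiv_integrand (integrable_const (velocity f x)) x).const_mul
    (f x ^ 2)
  have e2 : expandedFlux Φ f x = -∫ y, (fderiv ℝ Φ (x - y) (f y ^ 2 • velocity f y) -
      2 * f x * fderiv ℝ Φ (x - y) (vorticityFlux f y) +
      f x ^ 2 * fderiv ℝ Φ (x - y) (velocity f y) -
      fderiv ℝ Φ (x - y) (f y ^ 2 • velocity f x) +
      2 * f x * fderiv ℝ Φ (x - y) (f y • velocity f x) -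
      f x ^ 2 * fderiv ℝ Φ (x - y) (velocity f x)) ∂torusMeasure := by
    have k2 : Integrable (fun y => fderiv ℝ Φ (x - y) (f y ^ 2 • velocity f y) -
      2 * f x * fderiv ℝ Φ (x - y) (vorticityFlux f y)) torusMeasure := i1.sub i2
    have k3 : Integrable (fun y => fderiv ℝ Φ (x - y) (f y ^ 2 • velocity f y) -
      2 * f x * fderiv ℝ Φ (x - y) (vorticityFlux f y) +
      f x ^ 2 * fderiv ℝ Φ (x - y) (velocity f y)) torusMeasure := k2.add i3
    have k4 : Integrable (fun y => fderiv ℝ Φ (x - y) (f y ^ 2 • velocity f y) -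
      2 * f x * fderiv ℝ Φ (x - y) (vorticityFlux f y) +
      f x ^ 2 * fderiv ℝ Φ (x - y) (velocity f y) -
      fderiv ℝ Φ (x - y) (f y ^ 2 • velocity f x)) torusMeasure := k3.sub i4
    have k5 : Integrable (fun y => fderiv ℝ Φ (x - y) (f y ^ 2 • velocity f y) -
      2 * f x * fderiv ℝ Φ (x - y) (vorticityFlux f y) +
      f x ^ 2 * fderiv ℝ Φ (x - y) (velocity f y) -
      fderiv ℝ Φ (x - y) (f y ^ 2 • velocity f x) +
      2 * f x * fderiv ℝ Φ (x - y) (f y • velocity f x)) torusMeasure := k4.add i5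
    rw [integral_sub k5 i6, integral_add k4 i5, integral_sub k3 i4,
      integral_add k2 i3, integral_sub i1 i2, integral_const_mul, integral_const_mul,
      integral_const_mul, integral_const_mul]
    have z1 := hf.smoothDiv_velocity hΦ x
    have z2 := smoothDiv_const hΦ (velocity f x) x
    have z3 := hΦ.fderiv_smooth hf2 x (velocity f x)
    have z4 := hΦ.fderiv_smooth hf.integrable x (velocity f x)
    rw [expandedFlux, z3, z4]
    unfold smoothDiv at z1 z2 ⊢
    rw [z1, z2]
    ring
  rw [e2, ← integral_neg]
  refine integral_congr_ae (ae_of_all _ fun y => ?_)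
  simp only
  rw [show y - x = -(x - y) by abel, hodd, show x + -(x - y) = y by abel, _root_.neg_apply]
  congr 1
  simp only [vorticityFlux, map_smul, map_sub, smul_eq_mul]
  ring

/-- The space integral of the flux in terms of increments. -/
theorem integral_mul_expandedFlux {Φ : Plane → ℝ} (hΦ : SmoothKernel Φ)
    {f : Plane → ℝ} (hf : TorusL1 f) (hf2 : TorusL1 fun x => f x ^ 2) {U : ℝ≥0}
    (hU : ∀ x, ‖velocity f x‖ ≤ U)
    (hi1 : Integrable (vorticityFlux f) torusMeasure)
    (hi2 : Integrable (fun x => f x ^ 2 • velocity f x) torusMeasure)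
    {η : Plane → ℝ} (hη : ContDiff ℝ 1 η) (hηp : Periodic2 η) :
    ∫ x, η x * expandedFlux Φ f x ∂torusMeasure =
      ∫ x, (fderiv ℝ η x (smooth Φ (fun y => f y ^ 2 • velocity f y) x) -
        smooth Φ (fun y => f y ^ 2) x * fderiv ℝ η x (velocity f x) +
        2 * (η x * f x * (smoothDiv Φ (vorticityFlux f) x -
          fderiv ℝ (smooth Φ f) x (velocity f x)))) ∂torusMeasure := by
  have hη0 := hη.continuous
  have hη1 := hη.continuous_fderiv one_ne_zero
  have hS := hΦ.contDiff_smooth hf2.integrable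
  have hSp := periodic2_smooth hΦ.periodic (fun x => f x ^ 2)
  have hF := hΦ.contDiff_smooth hf.integrable
  have hFp := periodic2_smooth hΦ.periodic f
  have hS1 := hS.continuous_fderiv one_ne_zero
  have hF1 := hF.continuous_fderiv one_ne_zero
  have hW2 := hΦ.continuous_smooth hi2
  have hD2 := hΦ.continuous_smoothDiv hi2
  have hD1 := hΦ.continuous_smoothDiv hi1
  have hv := hf.stronglyMeasurable_velocity
  have hint : ∀ {g : Plane → ℝ}, Continuous g → Integrable g torusMeasure := fun {g} hg =>
    (hg.continuousOn.integrableOn_compact (isCompact_closedBall (0 : Plane) 2)).mono_set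
      fun x hx => by simpa using norm_le_two_of_mem_cell hx
  have happ : ∀ {c : Plane → Plane →L[ℝ] ℝ}, Continuous c → Periodic2 c →
      ∃ C : ℝ≥0, (∀ x, ‖c x (velocity f x)‖ ≤ C) ∧
        AEStronglyMeasurable (fun x => c x (velocity f x)) torusMeasure := fun {c} hc hp => by
    obtain ⟨C, hC⟩ := hp.exists_norm_le hc
    refine ⟨C * U, fun x => ?_, (ContinuousLinearMap.id ℝ (Plane →L[ℝ] ℝ)).aestronglyMeasurable_comp₂
      hc.aestronglyMeasurable hv.aestronglyMeasurable⟩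
    refine (ContinuousLinearMap.le_opNorm _ _).trans ?_
    push_cast
    gcongr
    exacts [hC x, hU x]
  obtain ⟨C₁, b1, m1⟩ := happ hη1 hηp.fderiv
  obtain ⟨C₂, b2, m2⟩ := happ hS1 hSp.fderiv
  obtain ⟨C₃, b3, m3⟩ := happ hF1 hFp.fderiv
  have hηf := hf.integrable.bdd_mul (c := (hηp.exists_norm_le hη0).choose) hη0.aestronglyMeasurable
    (ae_of_all _ (hηp.exists_norm_le hη0).choose_spec)
  have hD1p : Periodic2 (smoothDiv Φ (vorticityFlux f)) := fun i x => by
    unfold smoothDiv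
    congr 1 with y
    rw [add_sub_right_comm, hΦ.periodic.fderiv]
  obtain ⟨C₄, b4⟩ := hD1p.exists_norm_le hD1
  have j1 : Integrable (fun x => η x * f x * smoothDiv Φ (vorticityFlux f) x) torusMeasure :=
    hηf.mul_bdd hD1.aestronglyMeasurable (ae_of_all _ b4)
  have j2 : Integrable (fun x => η x * f x * fderiv ℝ (smooth Φ f) x (velocity f x)) torusMeasure :=
    hηf.mul_bdd m3 (ae_of_all _ b3)
  have j3 : Integrable (fun x => η x * fderiv ℝ (smooth Φ fun y => f y ^ 2) x (velocity f x))
      torusMeasure := (hint hη0).mul_bdd m2 (ae_of_all _ b2)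
  have j4 : Integrable (fun x => η x * smoothDiv Φ (fun y => f y ^ 2 • velocity f y) x)
      torusMeasure := hint (by fun_prop)
  have j5 : Integrable (fun x => fderiv ℝ η x (smooth Φ (fun y => f y ^ 2 • velocity f y) x))
      torusMeasure := hint (by fun_prop)
  have j6 : Integrable (fun x => smooth Φ (fun y => f y ^ 2) x * fderiv ℝ η x (velocity f x))
      torusMeasure := (hint hS.continuous).mul_bdd m1 (ae_of_all _ b1)
  have e1 := hΦ.integral_mul_smoothDiv hη hηp hi2
  -- The divergence-free condition, tested with the product of `η` and the mollified square, moves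
  -- the derivative from the square onto `η`.
  have e2 := hf.integral_fderiv_velocity (hη.mul hS) (hηp.comp₂ hSp fun a b => a * b)
  have e3 : ∀ x, fderiv ℝ (fun x => η x * smooth Φ (fun y => f y ^ 2) x) x (velocity f x) =
      η x * fderiv ℝ (smooth Φ fun y => f y ^ 2) x (velocity f x) +
      smooth Φ (fun y => f y ^ 2) x * fderiv ℝ η x (velocity f x) := fun x => by
    rw [fderiv_fun_mul (hη.differentiable one_ne_zero x) (hS.differentiable one_ne_zero x)]
    simp only [_root_.add_apply, _root_.smul_apply, smul_eq_mul]
  change ∫ x, fderiv ℝ (fun x => η x * smooth Φ (fun y => f y ^ 2) x) x (velocity f x)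
    ∂torusMeasure = 0 at e2
  simp only [e3] at e2
  rw [integral_add j3 j6] at e2
  calc _ = ∫ x, (-(η x * smoothDiv Φ (fun y => f y ^ 2 • velocity f y) x) +
        η x * fderiv ℝ (smooth Φ fun y => f y ^ 2) x (velocity f x) +
        2 * (η x * f x * smoothDiv Φ (vorticityFlux f) x -
          η x * f x * fderiv ℝ (smooth Φ f) x (velocity f x))) ∂torusMeasure := by
        refine integral_congr_ae (ae_of_all _ fun x => ?_)
        simp only [expandedFlux]
        ring
    _ = (∫ x, fderiv ℝ η x (smooth Φ (fun y => f y ^ 2 • velocity f y) x) ∂torusMeasure) -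
        (∫ x, smooth Φ (fun y => f y ^ 2) x * fderiv ℝ η x (velocity f x) ∂torusMeasure) +
        ∫ x, 2 * (η x * f x * smoothDiv Φ (vorticityFlux f) x -
          η x * f x * fderiv ℝ (smooth Φ f) x (velocity f x)) ∂torusMeasure := by
        have k4 : Integrable (fun x => -(η x * smoothDiv Φ (fun y => f y ^ 2 • velocity f y) x))
          torusMeasure := j4.neg
        have k43 : Integrable (fun x => -(η x * smoothDiv Φ (fun y => f y ^ 2 • velocity f y) x) +
          η x * fderiv ℝ (smooth Φ fun y => f y ^ 2) x (velocity f x)) torusMeasure := k4.add j3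
        have k12 : Integrable (fun x => 2 * (η x * f x * smoothDiv Φ (vorticityFlux f) x -
          η x * f x * fderiv ℝ (smooth Φ f) x (velocity f x))) torusMeasure :=
          (j1.sub j2).const_mul 2
        rw [integral_add k43 k12, integral_add k4 j3, integral_neg, e1]
        linarith
    _ = _ := by
        rw [← integral_sub j5 j6]
        refine (integral_add (j5.sub j6) ((j1.sub j2).const_mul 2)).symm.trans ?_
        refine integral_congr_ae (ae_of_all _ fun x => ?_)
        simp only [Pi.sub_apply]
        ring

/-- Convergence in `L^1` is preserved by bounded multipliers. -/
theorem tendsto_integral_clm_apply {α E : Type*} [MeasurableSpace α] {μ : Measure α}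
    [NormedAddCommGroup E] [NormedSpace ℝ E] {g : ℝ → α → E} {g₀ : α → E}
    (hg₀ : Integrable g₀ μ) (hm : ∀ δ > 0, AEStronglyMeasurable (g δ) μ)
    (h : Tendsto (fun δ => ∫⁻ z, ‖g δ z - g₀ z‖ₑ ∂μ) (𝓝[>] 0) (𝓝 0))
    {L : α → E →L[ℝ] ℝ} (hL : AEStronglyMeasurable L μ) {C : ℝ≥0} (hC : ∀ᵐ z ∂μ, ‖L z‖ ≤ C) :
    Tendsto (fun δ => ∫ z, L z (g δ z) ∂μ) (𝓝[>] 0) (𝓝 (∫ z, L z (g₀ z) ∂μ)) := by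
  have hb : ∀ {w : α → E}, Integrable w μ → Integrable (fun z => L z (w z)) μ := fun {w} hw => by
    refine (hw.norm.const_mul (C : ℝ)).mono' ((ContinuousLinearMap.id ℝ
      (E →L[ℝ] ℝ)).aestronglyMeasurable_comp₂ hL hw.1) ?_
    filter_upwards [hC] with z hz
    exact (ContinuousLinearMap.le_opNorm _ _).trans (by gcongr)
  refine tendsto_integral_of_L1 _ (hb hg₀).1 ?_ (?_ : Tendsto
    (fun δ => ∫⁻ z, ‖L z (g δ z) - L z (g₀ z)‖ₑ ∂μ) (𝓝[>] 0) (𝓝 0))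
  · filter_upwards [h.eventually (gt_mem_nhds ENNReal.zero_lt_top), self_mem_nhdsWithin] with δ h1 hδ
    have : Integrable (fun z => g δ z - g₀ z) μ := ⟨(hm δ hδ).sub hg₀.1, h1⟩
    exact hb ((this.add hg₀).congr (ae_of_all _ fun z => sub_add_cancel _ _))
  · have h2 := ENNReal.Tendsto.const_mul (a := (C : ENNReal)) h (Or.inr (by simp))
    rw [mul_zero] at h2
    refine tendsto_of_tendsto_of_tendsto_of_le_of_le tendsto_const_nhds h2
      (fun _ => zero_le) fun δ => ?_
    rw [← lintegral_const_mul' _ _ ENNReal.coe_ne_top]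
    refine lintegral_mono_ae ?_
    filter_upwards [hC] with z hz
    rw [← map_sub]
    have : ‖L z‖ₑ ≤ C := enorm_le_coe.2 hz
    exact ((L z).le_opENorm _).trans (by gcongr)

theorem tendsto_integral_mul {α : Type*} [MeasurableSpace α] {μ : Measure α} {g : ℝ → α → ℝ}
    {g₀ : α → ℝ} (hg₀ : Integrable g₀ μ) (hm : ∀ δ > 0, AEStronglyMeasurable (g δ) μ)
    (h : Tendsto (fun δ => ∫⁻ z, ‖g δ z - g₀ z‖ₑ ∂μ) (𝓝[>] 0) (𝓝 0))
    {c : α → ℝ} (hc : AEStronglyMeasurable c μ) {C : ℝ≥0} (hC : ∀ᵐ z ∂μ, ‖c z‖ ≤ C) :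
    Tendsto (fun δ => ∫ z, c z * g δ z ∂μ) (𝓝[>] 0) (𝓝 (∫ z, c z * g₀ z ∂μ)) :=
  tendsto_integral_clm_apply hg₀ hm h (L := fun z => ContinuousLinearMap.lsmul ℝ ℝ (c z))
    ((ContinuousLinearMap.lsmul ℝ ℝ).continuous.comp_aestronglyMeasurable hc)
    (hC.mono fun _ hz => (ContinuousLinearMap.opNorm_lsmul_apply_le _).trans hz)

/-- A flow with bounded velocity and square integrable vorticity. -/
structure BoundedFlow (U A : ℝ≥0) (ω : ℝ → Plane → ℝ) : Prop where
  velocity_le : ∀ t x, ‖velocity (ω t) x‖ ≤ U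
  vorticity : BoundedVorticity 1 A ω
  square : BoundedVorticity 1 A fun t x => ω t x ^ 2
  flux : BoundedField A fun t => vorticityFlux (ω t)
  squareFlux : BoundedField A fun t x => ω t x ^ 2 • velocity (ω t) x

/-- For `p > 2` the velocity is bounded and the vorticity is square integrable, so the quadratic
flux with two factors of vorticity makes sense. One common constant bounds all four densities. -/
theorem BoundedVorticity.exists_boundedFlow {p : ℝ} (hp : 2 < p) {M : ℝ≥0} {ω : ℝ → Plane → ℝ}
    (N : BoundedVorticity p M ω) : ∃ U A, BoundedFlow U A ω := by
  obtain ⟨C, hC⟩ := exists_potential_le hp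
  have hU : ∀ t x, ‖velocity (ω t) x‖ₑ ≤ (C * M : ℝ≥0) := fun t x => by
    refine (enorm_velocity_le _ x).trans ((hC _ (N.measurable_at t) (N.periodic t) x).trans ?_)
    push_cast
    gcongr
    exact N.norm_le t
  have h1 : ∀ t, ∫⁻ x, ‖ω t x‖ₑ ∂torusMeasure ≤ ((1 + M) * M : ℝ≥0) := fun t => by
    have h := lintegral_one_add_rpow_mul_le (p := p) (m := 0) (by linarith) le_rfl (by linarith)
      (N.measurable_at t) (N.measurable_at t)
    simp only [ENNReal.rpow_zero, one_mul] at h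
    refine h.trans ((N.norm_le t).trans ?_)
    exact_mod_cast le_mul_of_one_le_left zero_le le_self_add
  have h2 : ∀ t, ∫⁻ x, ‖ω t x ^ 2‖ₑ ∂torusMeasure ≤ ((1 + M) * M : ℝ≥0) := fun t => by
    have h := lintegral_one_add_rpow_mul_le (p := p) (m := 1) (by linarith) zero_le_one
      (by linarith) (N.measurable_at t) (N.measurable_at t)
    simp only [ENNReal.rpow_one] at h
    refine (lintegral_mono fun x => ?_).trans (h.trans ?_)
    · rw [pow_two, enorm_mul]
      gcongr
      exact le_add_self
    · have := N.norm_le t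
      push_cast
      gcongr
  have hs : ∀ (g : ℝ → Plane → ℝ) (t : ℝ), ∫⁻ x, ‖g t x‖ₑ ∂torusMeasure ≤ ((1 + M) * M : ℝ≥0) →
      ∫⁻ x, ‖g t x • velocity (ω t) x‖ₑ ∂torusMeasure ≤
        ((1 + C * M) * ((1 + M) * M) : ℝ≥0) := fun g t h => by
    refine (lintegral_mono fun x => (?_ : _ ≤ ((C * M : ℝ≥0) : ENNReal) * ‖g t x‖ₑ)).trans ?_
    · rw [enorm_smul, mul_comm]
      gcongr
      exact hU t x
    · rw [lintegral_const_mul' _ _ ENNReal.coe_ne_top]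
      exact (mul_le_mul' (ENNReal.coe_le_coe.2 le_add_self) h).trans_eq (ENNReal.coe_mul _ _).symm
  have hA : (1 + M) * M ≤ (1 + C * M) * ((1 + M) * M) :=
    le_mul_of_one_le_left zero_le le_self_add
  have m := N.measurable
  have mv := N.measurable_velocity
  have hA' : (((1 + M) * M : ℝ≥0) : ENNReal) ≤ ((1 + C * M) * ((1 + M) * M) : ℝ≥0) :=
    ENNReal.coe_le_coe.2 hA
  have n1 : BoundedVorticity 1 ((1 + C * M) * ((1 + M) * M)) ω :=
    ⟨m, N.periodic, fun t => (torusNorm_one_eq (ω t)).trans_le ((h1 t).trans hA')⟩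
  have n2 : BoundedVorticity 1 ((1 + C * M) * ((1 + M) * M)) fun t x => ω t x ^ 2 :=
    ⟨m.pow_const 2, fun t => (N.periodic t).comp fun a => a ^ 2,
      fun t => (torusNorm_one_eq fun x => ω t x ^ 2).trans_le ((h2 t).trans hA')⟩
  have n3 : BoundedField ((1 + C * M) * ((1 + M) * M)) fun t => vorticityFlux (ω t) :=
    ⟨N.measurable_vorticityFlux, fun t => periodic2_vorticityFlux (N.periodic t),
      fun t => hs ω t (h1 t)⟩
  have n4 : BoundedField ((1 + C * M) * ((1 + M) * M))
      fun t x => ω t x ^ 2 • velocity (ω t) x :=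
    ⟨(m.pow_const 2).smul mv, fun t => (N.periodic t).comp₂ (periodic2_velocity (N.periodic t))
      fun a b => a ^ 2 • b, fun t => hs (fun t x => ω t x ^ 2) t (h2 t)⟩
  exact ⟨C * M, _, fun t x => enorm_le_coe.1 (hU t x), n1, n2, n3, n4⟩

/-- The error is `ω` times the difference of `Φ * ω` and `ω`, both factors in `L^p`; `p ≥ 2` makes
the product integrable. -/
theorem BoundedVorticity.tendsto_lintegral_mul_smooth_sub {p : ℝ} (hp : 2 ≤ p) {M : ℝ≥0}
    {ω : ℝ → Plane → ℝ} (N : BoundedVorticity p M ω) (T : ℝ) {φ : Plane → ℝ}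
    (hφ : IsMollifier φ) :
    Tendsto (fun ε => ∫⁻ z : ℝ × Plane,
      ‖ω z.1 z.2 * smooth (mollKernel φ ε) (ω z.1) z.2 - ω z.1 z.2 ^ 2‖ₑ ∂(spaceTime T))
      (𝓝[>] 0) (𝓝 0) := by
  obtain ⟨R, hR⟩ := hφ.exists_radius
  have m := N.measurable
  refine N.tendsto_lintegral_of_le_translationModulus (by linarith) T (e := fun ε z =>
    ‖ω z.1 z.2 * smooth (mollKernel φ ε) (ω z.1) z.2 - ω z.1 z.2 ^ 2‖ₑ) (fun ε hε => ?_) (1 + M) R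
    fun ε hε t => ?_
  · have := N.measurable_smooth (hφ.smoothKernel hε)
    fun_prop
  · have h1 : TorusL1 (ω t) := N.torusL1' (by linarith) t
    have hs := (h1.smooth (hφ.smoothKernel hε)).measurable
    have h2 := (hφ.unitKernel hε).torusNorm_smooth_sub_le (by linarith) h1
      fun y hy => IsMollifier.torusNorm_translate_le hR hε (N.periodic t) p hy
    have h := lintegral_one_add_rpow_mul_le (p := p) (m := 1) (by linarith) zero_le_one
      (by linarith) (N.measurable_at t) (hs.sub (N.measurable_at t))
    simp only [ENNReal.rpow_one] at h
    refine (lintegral_mono fun x => ?_).trans (h.trans ?_)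
    · rw [pow_two, ← mul_sub, enorm_mul]
      exact mul_le_mul' le_add_self le_rfl
    · push_cast
      exact mul_le_mul' (add_le_add le_rfl (N.norm_le t)) h2

theorem BoundedFlow.integrable_commutator {p m : ℝ} {B M U A : ℝ≥0} {ω : ℝ → Plane → ℝ}
    (F : BoundedFlow U A ω) (N : BoundedVorticity p M ω) (V : VelocityBound p m B)
    {Φ : Plane → ℝ} (hΦ : SmoothKernel Φ) (T : ℝ) :
    Integrable (fun z : ℝ × Plane => ω z.1 z.2 * (smoothDiv Φ (vorticityFlux (ω z.1)) z.2 -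
      fderiv ℝ (smooth Φ (ω z.1)) z.2 (velocity (ω z.1) z.2))) (spaceTime T) := by
  obtain ⟨K, hK⟩ := N.exists_norm_le V hΦ
  have mD := N.measurable_smoothDiv_vorticityFlux hΦ
  refine (F.vorticity.integrable_spaceTime T).mul_bdd (c := K + K * U)
    (mD.aestronglyMeasurable.sub ((ContinuousLinearMap.id ℝ
      (Plane →L[ℝ] ℝ)).aestronglyMeasurable_comp₂ (stronglyMeasurable_fderiv_smooth N.measurable
        (fun t => (N.torusL1 V t).integrable) hΦ).aestronglyMeasurable
      N.measurable_velocity.aestronglyMeasurable)) (ae_of_all _ fun z => ?_)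
  refine (norm_sub_le _ _).trans (add_le_add (hK _ _).2.2.2.2 ?_)
  refine (ContinuousLinearMap.le_opNorm _ _).trans ?_
  gcongr
  exacts [(hK _ _).2.1, F.velocity_le _ _]

/-! ### Point splitting: the equation tested with products of mollifications. -/

section pairing

variable {p m : ℝ} {B M U A : ℝ≥0} {ω : ℝ → Plane → ℝ} (N : BoundedVorticity p M ω)
  (V : VelocityBound p m B) {T : ℝ} {ψ : ℝ × Plane → ℝ} (hψ : IsTest T ψ)
  {Φ Ψ : Plane → ℝ} (hΦ : SmoothKernel Φ)
include N V hψ hΦ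

/-- The multiplier of the vorticity in the time derivative of a product of mollifications. -/
theorem exists_norm_vorticityMultiplier_le : ∃ C : ℝ≥0, Measurable (fun z : ℝ × Plane =>
      timeDeriv ψ z * smooth Φ (ω z.1) z.2 - ψ z * smoothDiv Φ (vorticityFlux (ω z.1)) z.2) ∧
    ∀ᵐ z ∂(spaceTime T), ‖timeDeriv ψ z * smooth Φ (ω z.1) z.2 -
      ψ z * smoothDiv Φ (vorticityFlux (ω z.1)) z.2‖ ≤ C := by
  have hc1 := continuous_timeDeriv hψ.contDiff_one
  obtain ⟨D₀, hD₀⟩ := exists_norm_le_spaceTime T hψ.smooth.continuous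
  obtain ⟨D₁, hD₁⟩ := exists_norm_le_spaceTime T hc1
  obtain ⟨K, hK⟩ := N.exists_norm_le V hΦ
  have m1 := N.measurable_smooth hΦ
  have m2 := N.measurable_smoothDiv_vorticityFlux hΦ
  refine ⟨D₁ * K + D₀ * K, (hc1.measurable.mul m1).sub (hψ.smooth.continuous.measurable.mul m2), ?_⟩
  filter_upwards [hD₀, hD₁] with z h0 h1
  refine (norm_sub_le _ _).trans ?_
  rw [norm_mul, norm_mul]
  push_cast
  gcongr
  exacts [(hK _ _).1, (hK _ _).2.2.2.2]

/-- The multiplier of the flux in the time derivative of a product of mollifications. -/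
theorem exists_norm_fluxMultiplier_le : ∃ C : ℝ≥0, AEStronglyMeasurable (fun z : ℝ × Plane =>
      smooth Φ (ω z.1) z.2 • spaceDeriv ψ z + ψ z • fderiv ℝ (smooth Φ (ω z.1)) z.2) (spaceTime T) ∧
    ∀ᵐ z ∂(spaceTime T), ‖smooth Φ (ω z.1) z.2 • spaceDeriv ψ z +
      ψ z • fderiv ℝ (smooth Φ (ω z.1)) z.2‖ ≤ C := by
  have hc2 := continuous_spaceDeriv hψ.contDiff_one
  obtain ⟨D₀, hD₀⟩ := exists_norm_le_spaceTime T hψ.smooth.continuous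
  obtain ⟨D₂, hD₂⟩ := exists_norm_le_spaceTime T hc2
  obtain ⟨K, hK⟩ := N.exists_norm_le V hΦ
  have m1 := N.measurable_smooth hΦ
  have m2 := stronglyMeasurable_fderiv_smooth N.measurable (fun t => (N.torusL1 V t).integrable) hΦ
  refine ⟨K * D₂ + D₀ * K, (m1.aestronglyMeasurable.smul hc2.aestronglyMeasurable).add
    (hψ.smooth.continuous.aestronglyMeasurable.smul m2.aestronglyMeasurable), ?_⟩
  filter_upwards [hD₀, hD₂] with z h0 h2
  refine (norm_add_le _ _).trans ?_
  rw [norm_smul, norm_smul]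
  push_cast
  gcongr
  exacts [(hK _ _).1, (hK _ _).2.1]

/-- The product of two mollifications of the vorticity, tested against `ψ`. -/
theorem integral_smooth_mul_smooth (hT : 0 < T) (hsol : IsWeakEuler T ω) (hΨ : SmoothKernel Ψ) :
    (∫ z : ℝ × Plane, (timeDeriv ψ z * smooth Φ (ω z.1) z.2 -
        ψ z * smoothDiv Φ (vorticityFlux (ω z.1)) z.2) * smooth Ψ (ω z.1) z.2 ∂(spaceTime T)) +
      ∫ z : ℝ × Plane, (smooth Φ (ω z.1) z.2 • spaceDeriv ψ z +
        ψ z • fderiv ℝ (smooth Φ (ω z.1)) z.2) (smooth Ψ (vorticityFlux (ω z.1)) z.2)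
        ∂(spaceTime T) = 0 := by
  obtain ⟨C₁, mc, hC₁⟩ := exists_norm_vorticityMultiplier_le N V hψ hΦ
  obtain ⟨C₂, mL, hC₂⟩ := exists_norm_fluxMultiplier_le N V hψ hΦ
  obtain ⟨D₀, hD₀⟩ := exists_norm_le_spaceTime T hψ.smooth.continuous
  obtain ⟨K, hK⟩ := N.exists_norm_le V hΦ
  obtain ⟨J, hJ⟩ := N.exists_norm_le V hΨ
  have mψ := hψ.smooth.continuous.measurable
  have m1 := N.measurable_smooth hΦ
  have m2 := N.measurable_smooth hΨ
  have d1 := N.measurable_smoothDiv_vorticityFlux hΦ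
  have d2 := N.measurable_smoothDiv_vorticityFlux hΨ
  have w2 := N.measurable_smooth_vorticityFlux hΨ
  have ia : Integrable (fun z : ℝ × Plane => (timeDeriv ψ z * smooth Φ (ω z.1) z.2 -
      ψ z * smoothDiv Φ (vorticityFlux (ω z.1)) z.2) * smooth Ψ (ω z.1) z.2) (spaceTime T) := by
    refine Integrable.of_bound (mc.mul m2).aestronglyMeasurable (C₁ * J) ?_
    filter_upwards [hC₁] with z hz
    rw [norm_mul]
    gcongr
    exact (hJ _ _).1
  have ib : Integrable (fun z : ℝ × Plane => ψ z * smooth Φ (ω z.1) z.2 *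
      smoothDiv Ψ (vorticityFlux (ω z.1)) z.2) (spaceTime T) := by
    refine Integrable.of_bound ((mψ.mul m1).mul d2).aestronglyMeasurable (D₀ * K * J) ?_
    filter_upwards [hD₀] with z hz
    rw [norm_mul, norm_mul]
    gcongr
    exacts [(hK _ _).1, (hJ _ _).2.2.2.2]
  have ic : Integrable (fun z : ℝ × Plane => (smooth Φ (ω z.1) z.2 • spaceDeriv ψ z +
        ψ z • fderiv ℝ (smooth Φ (ω z.1)) z.2) (smooth Ψ (vorticityFlux (ω z.1)) z.2))
        (spaceTime T) := by
    refine Integrable.of_bound ((ContinuousLinearMap.id ℝ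
      (Plane →L[ℝ] ℝ)).aestronglyMeasurable_comp₂ mL w2.aestronglyMeasurable) (C₂ * J) ?_
    filter_upwards [hC₂] with z hz
    refine (ContinuousLinearMap.le_opNorm _ _).trans ?_
    gcongr
    exact (hJ _ _).2.2.2.1
  -- At each fixed `x` this is the product rule for two functions that are Lipschitz in time.
  have e1 : ∫ z : ℝ × Plane, ((timeDeriv ψ z * smooth Φ (ω z.1) z.2 -
      ψ z * smoothDiv Φ (vorticityFlux (ω z.1)) z.2) * smooth Ψ (ω z.1) z.2 -
      ψ z * smooth Φ (ω z.1) z.2 * smoothDiv Ψ (vorticityFlux (ω z.1)) z.2) ∂(spaceTime T) = 0 := by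
    have i3 := ia.sub ib
    rw [spaceTime_eq_prod] at i3 ⊢
    refine (integral_prod_symm _ i3).trans
      (Eq.trans (integral_congr_ae (ae_of_all _ fun x => ?_)) (integral_zero _ _))
    have hx : Measurable fun t : ℝ => (t, x) := by fun_prop
    have key := (N.hasNegWeakDeriv V hΦ hsol x).integral_deriv_mul_mul hT
      (Integrable.of_bound (m1.comp hx).aestronglyMeasurable K (ae_of_all _ fun t => (hK t x).1))
      (d1.comp hx) (fun t => (hK t x).2.2.2.2) (N.hasNegWeakDeriv V hΨ hsol x)
      (Integrable.of_bound (m2.comp hx).aestronglyMeasurable J (ae_of_all _ fun t => (hJ t x).1))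
      (d2.comp hx) (fun t => (hJ t x).2.2.2.2) (hψ.isTimeTest x)
    refine Eq.trans (integral_congr_ae (ae_of_all _ fun t => ?_)) key
    simp only [Pi.sub_apply, timeDeriv]
    ring
  have e2 : ∫ z : ℝ × Plane, ψ z * smooth Φ (ω z.1) z.2 *
      smoothDiv Ψ (vorticityFlux (ω z.1)) z.2 ∂(spaceTime T) =
      -∫ z : ℝ × Plane, (smooth Φ (ω z.1) z.2 • spaceDeriv ψ z +
        ψ z • fderiv ℝ (smooth Φ (ω z.1)) z.2) (smooth Ψ (vorticityFlux (ω z.1)) z.2)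
        ∂(spaceTime T) := by
    rw [spaceTime_eq_prod] at ib ic ⊢
    rw [integral_prod _ ib, integral_prod _ ic, ← integral_neg]
    refine integral_congr_ae (ae_of_all _ fun t => ?_)
    have hL := N.torusL1 V t
    have hη := hψ.contDiff_space t
    have hF := hΦ.contDiff_smooth hL.integrable
    refine (hΨ.integral_mul_smoothDiv (hη.mul hF) ((hψ.periodic t).comp₂
      (periodic2_smooth hΦ.periodic (ω t)) fun a b => a * b)
      (N.integrable_vorticityFlux V t)).trans ?_
    congr 1
    refine integral_congr_ae (ae_of_all _ fun x => ?_)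
    have e : fderiv ℝ (fun x => ψ (t, x) * smooth Φ (ω t) x) x =
        ψ (t, x) • fderiv ℝ (smooth Φ (ω t)) x + smooth Φ (ω t) x • spaceDeriv ψ (t, x) :=
      fderiv_fun_mul (hη.differentiable one_ne_zero x) (hF.differentiable one_ne_zero x)
    change fderiv ℝ (fun x => ψ (t, x) * smooth Φ (ω t) x) x _ = _
    rw [e, add_comm]
  rw [integral_sub ia ib, e2, sub_neg_eq_add] at e1
  exact e1

/-- The commutator of the mollification with the transport by the velocity, tested against the
vorticity. -/
theorem integral_mul_commutator (hT : 0 < T) (hsol : IsWeakEuler T ω) (F : BoundedFlow U A ω)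
    {χ : Plane → ℝ} (hχ : IsMollifier χ) :
    ∫ z : ℝ × Plane, ψ z * (ω z.1 z.2 * (smoothDiv Φ (vorticityFlux (ω z.1)) z.2 -
        fderiv ℝ (smooth Φ (ω z.1)) z.2 (velocity (ω z.1) z.2))) ∂(spaceTime T) =
      ∫ z : ℝ × Plane, (timeDeriv ψ z + spaceDeriv ψ z (velocity (ω z.1) z.2)) *
        (ω z.1 z.2 * smooth Φ (ω z.1) z.2) ∂(spaceTime T) := by
  obtain ⟨C₁, mc, hC₁⟩ := exists_norm_vorticityMultiplier_le N V hψ hΦ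
  obtain ⟨C₂, mL, hC₂⟩ := exists_norm_fluxMultiplier_le N V hψ hΦ
  obtain ⟨D₀, hD₀⟩ := exists_norm_le_spaceTime T hψ.smooth.continuous
  have i0 := F.vorticity.integrable_spaceTime T
  have i1 := F.flux.integrable_spaceTime T
  have t1 := tendsto_integral_mul i0
    (fun δ hδ => (F.vorticity.measurable_smooth (hχ.smoothKernel hδ)).aestronglyMeasurable)
    (F.vorticity.tendsto_lintegral_smooth_sub T hχ) mc.aestronglyMeasurable hC₁
  have t2 := tendsto_integral_clm_apply i1
    (fun δ hδ => (F.flux.measurable_smooth (hχ.smoothKernel hδ)).aestronglyMeasurable)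
    (F.flux.tendsto_lintegral_smooth_sub T hχ) mL hC₂
  -- The second kernel shrinks to a point while `Φ` stays fixed. The multipliers contain derivatives
  -- of `Φ * ω` only and are bounded, so convergence in `L¹` of the mollified vorticity and of its
  -- flux suffices.
  have h0 := tendsto_nhds_unique (tendsto_const_nhds.congr' (by
    filter_upwards [self_mem_nhdsWithin] with δ hδ
    exact (integral_smooth_mul_smooth N V hψ hΦ hT hsol (hχ.smoothKernel hδ)).symm)) (t1.add t2)
  have j0 := i0.bdd_mul mc.aestronglyMeasurable hC₁
  have j1 : Integrable (fun z : ℝ × Plane => (smooth Φ (ω z.1) z.2 • spaceDeriv ψ z +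
      ψ z • fderiv ℝ (smooth Φ (ω z.1)) z.2) (vorticityFlux (ω z.1) z.2)) (spaceTime T) := by
    refine (i1.norm.const_mul (C₂ : ℝ)).mono' ((ContinuousLinearMap.id ℝ
      (Plane →L[ℝ] ℝ)).aestronglyMeasurable_comp₂ mL i1.1) ?_
    filter_upwards [hC₂] with z hz
    exact (ContinuousLinearMap.le_opNorm _ _).trans (by gcongr)
  have j2 : Integrable (fun z : ℝ × Plane => ψ z * (ω z.1 z.2 *
      (smoothDiv Φ (vorticityFlux (ω z.1)) z.2 -
        fderiv ℝ (smooth Φ (ω z.1)) z.2 (velocity (ω z.1) z.2)))) (spaceTime T) :=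
    (F.integrable_commutator N V hΦ T).bdd_mul hψ.smooth.continuous.aestronglyMeasurable hD₀
  have h1 := integral_add (j0.add j1) j2
  have h2 := integral_add j0 j1
  refine (zero_add _).symm.trans ?_
  rw [h0, ← h2]
  refine h1.symm.trans (integral_congr_ae (ae_of_all _ fun z => ?_))
  simp only [Pi.add_apply, vorticityFlux, _root_.add_apply, _root_.smul_apply, map_smul,
    smul_eq_mul]
  ring

end pairing

/-! ### The limit of the expanded flux. -/

section expanded

variable {p m : ℝ} {B M U A : ℝ≥0} {ω : ℝ → Plane → ℝ} (F : BoundedFlow U A ω)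
  (N : BoundedVorticity p M ω) (V : VelocityBound p m B) {Φ : Plane → ℝ}
include F N V

theorem BoundedFlow.integrable_expandedFlux (hΦ : SmoothKernel Φ) (T : ℝ) :
    Integrable (fun z : ℝ × Plane => expandedFlux Φ (ω z.1) z.2) (spaceTime T) := by
  obtain ⟨C₁, h₁⟩ := F.squareFlux.exists_norm_le hΦ
  obtain ⟨C₂, h₂⟩ := F.square.exists_norm_le_of_one hΦ
  have i1 : Integrable (fun z : ℝ × Plane => smoothDiv Φ
      (fun y => ω z.1 y ^ 2 • velocity (ω z.1) y) z.2) (spaceTime T) :=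
    Integrable.of_bound (F.squareFlux.measurable_smoothDiv hΦ).aestronglyMeasurable C₁
      (ae_of_all _ fun z => (h₁ _ _).2)
  have i2 : Integrable (fun z : ℝ × Plane => fderiv ℝ (smooth Φ fun y => ω z.1 y ^ 2) z.2
      (velocity (ω z.1) z.2)) (spaceTime T) := by
    refine Integrable.of_bound ((ContinuousLinearMap.id ℝ
      (Plane →L[ℝ] ℝ)).aestronglyMeasurable_comp₂ (stronglyMeasurable_fderiv_smooth
        F.square.measurable (fun t => (F.square.torusL1' le_rfl t).integrable)
        hΦ).aestronglyMeasurable N.measurable_velocity.aestronglyMeasurable) (C₂ * U)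
      (ae_of_all _ fun z => (ContinuousLinearMap.le_opNorm _ _).trans ?_)
    gcongr
    exacts [(h₂ _ _).2, F.velocity_le _ _]
  refine ((i2.sub i1).add ((F.integrable_commutator N V hΦ T).const_mul 2)).congr
    (ae_of_all _ fun z => ?_)
  simp only [Pi.add_apply, Pi.sub_apply, expandedFlux]
  ring

/-- The pairing of the expanded flux with a test function. -/
theorem BoundedFlow.integral_expandedFlux_mul (hΦ : SmoothKernel Φ) {T : ℝ} (hT : 0 < T)
    (hsol : IsWeakEuler T ω) {ψ : ℝ × Plane → ℝ} (hψ : IsTest T ψ) {χ : Plane → ℝ}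
    (hχ : IsMollifier χ) :
    ∫ z : ℝ × Plane, expandedFlux Φ (ω z.1) z.2 * ψ z ∂(spaceTime T) =
      (∫ z : ℝ × Plane, spaceDeriv ψ z (smooth Φ (fun y => ω z.1 y ^ 2 • velocity (ω z.1) y) z.2)
        ∂(spaceTime T)) -
      (∫ z : ℝ × Plane, spaceDeriv ψ z (velocity (ω z.1) z.2) *
        smooth Φ (fun y => ω z.1 y ^ 2) z.2 ∂(spaceTime T)) +
      2 * ∫ z : ℝ × Plane, (timeDeriv ψ z + spaceDeriv ψ z (velocity (ω z.1) z.2)) *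
        (ω z.1 z.2 * smooth Φ (ω z.1) z.2) ∂(spaceTime T) := by
  obtain ⟨C₁, h₁⟩ := F.squareFlux.exists_norm_le hΦ
  obtain ⟨C₂, h₂⟩ := F.square.exists_norm_le_of_one hΦ
  obtain ⟨D₀, hD₀⟩ := exists_norm_le_spaceTime T hψ.smooth.continuous
  obtain ⟨D₂, hD₂⟩ := exists_norm_le_spaceTime T (continuous_spaceDeriv hψ.contDiff_one)
  have i0 : Integrable (fun z : ℝ × Plane => expandedFlux Φ (ω z.1) z.2 * ψ z) (spaceTime T) :=
    (F.integrable_expandedFlux N V hΦ T).mul_bdd hψ.smooth.continuous.aestronglyMeasurable hD₀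
  have i1 : Integrable (fun z : ℝ × Plane => spaceDeriv ψ z
      (smooth Φ (fun y => ω z.1 y ^ 2 • velocity (ω z.1) y) z.2)) (spaceTime T) := by
    refine Integrable.of_bound (aestronglyMeasurable_spaceDeriv_apply hψ
      (F.squareFlux.measurable_smooth hΦ).aestronglyMeasurable) (D₂ * C₁) ?_
    filter_upwards [hD₂] with z hz
    refine (ContinuousLinearMap.le_opNorm _ _).trans ?_
    gcongr
    exact (h₁ _ _).1
  have i2 : Integrable (fun z : ℝ × Plane => spaceDeriv ψ z (velocity (ω z.1) z.2) *
      smooth Φ (fun y => ω z.1 y ^ 2) z.2) (spaceTime T) := by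
    refine Integrable.of_bound ((aestronglyMeasurable_spaceDeriv_apply hψ
      N.measurable_velocity.aestronglyMeasurable).mul
      (F.square.measurable_smooth hΦ).aestronglyMeasurable) (D₂ * U * C₂) ?_
    filter_upwards [hD₂] with z hz
    rw [norm_mul]
    refine mul_le_mul ((ContinuousLinearMap.le_opNorm _ _).trans ?_) (h₂ _ _).1 (norm_nonneg _)
      (by positivity)
    gcongr
    exact F.velocity_le _ _
  have i3 : Integrable (fun z : ℝ × Plane => ψ z * (ω z.1 z.2 *
      (smoothDiv Φ (vorticityFlux (ω z.1)) z.2 -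
        fderiv ℝ (smooth Φ (ω z.1)) z.2 (velocity (ω z.1) z.2)))) (spaceTime T) :=
    (F.integrable_commutator N V hΦ T).bdd_mul hψ.smooth.continuous.aestronglyMeasurable hD₀
  rw [← integral_mul_commutator N V hψ hΦ hT hsol F hχ, ← integral_sub i1 i2,
    ← integral_const_mul]
  refine Eq.trans ?_ (integral_add (i1.sub i2) (i3.const_mul 2))
  have i4 := (i1.sub i2).add (i3.const_mul 2)
  rw [spaceTime_eq_prod] at i0 i4 ⊢
  refine (integral_prod _ i0).trans (Eq.trans ?_ (integral_prod _ i4).symm)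
  refine integral_congr_ae (ae_of_all _ fun t => ?_)
  have h := integral_mul_expandedFlux hΦ (N.torusL1 V t) (F.square.torusL1' le_rfl t)
    (F.velocity_le t) (N.integrable_vorticityFlux V t) (F.squareFlux.integrable t)
    (hψ.contDiff_space t) (hψ.periodic t)
  refine Eq.trans (integral_congr_ae (ae_of_all _ fun x => mul_comm _ _)) (h.trans ?_)
  refine integral_congr_ae (ae_of_all _ fun x => ?_)
  simp only [Pi.add_apply, Pi.sub_apply, spaceDeriv]
  ring

/-- The first two terms of the pairing have the common limit of `ω² u·∇ψ` integrated, and cancel.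
The commutator term tends to twice the integral of `(∂_tψ + u·∇ψ) ω²`, and the prefactor `1/4` turns
this into the pairing with `ω²/2`. -/
theorem BoundedFlow.tendsto_integral_expandedFlux_mul (hp : 2 ≤ p) {T : ℝ} (hT : 0 < T)
    (hsol : IsWeakEuler T ω) {ψ : ℝ × Plane → ℝ} (hψ : IsTest T ψ) {φ : Plane → ℝ}
    (hφ : IsMollifier φ) :
    Tendsto (fun ε => ∫ z : ℝ × Plane, 1 / 4 * expandedFlux (mollKernel φ ε) (ω z.1) z.2 * ψ z
      ∂(spaceTime T)) (𝓝[>] 0) (𝓝 (defect T (fun s => s ^ 2 / 2) ω ψ)) := by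
  have hc1 := continuous_timeDeriv hψ.contDiff_one
  have hc2 := continuous_spaceDeriv hψ.contDiff_one
  obtain ⟨D₁, hD₁⟩ := exists_norm_le_spaceTime T hc1
  obtain ⟨D₂, hD₂⟩ := exists_norm_le_spaceTime T hc2
  have mv := aestronglyMeasurable_spaceDeriv_apply hψ
    (N.measurable_velocity.aestronglyMeasurable (μ := spaceTime T))
  have hv : ∀ᵐ z ∂(spaceTime T), ‖spaceDeriv ψ z (velocity (ω z.1) z.2)‖ ≤ (D₂ * U : ℝ≥0) := by
    filter_upwards [hD₂] with z hz
    refine (ContinuousLinearMap.le_opNorm _ _).trans ?_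
    push_cast
    gcongr
    exact F.velocity_le _ _
  have hw : ∀ᵐ z ∂(spaceTime T), ‖timeDeriv ψ z + spaceDeriv ψ z (velocity (ω z.1) z.2)‖ ≤
      (D₁ + D₂ * U : ℝ≥0) := by
    filter_upwards [hD₁, hv] with z h1 h2
    exact (norm_add_le _ _).trans (add_le_add h1 h2)
  have i2 := F.square.integrable_spaceTime T
  have i3 := F.squareFlux.integrable_spaceTime T
  have t1 := tendsto_integral_clm_apply i3
    (fun δ hδ => (F.squareFlux.measurable_smooth (hφ.smoothKernel hδ)).aestronglyMeasurable)
    (F.squareFlux.tendsto_lintegral_smooth_sub T hφ) hc2.aestronglyMeasurable hD₂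
  have t2 := tendsto_integral_mul i2
    (fun δ hδ => (F.square.measurable_smooth (hφ.smoothKernel hδ)).aestronglyMeasurable)
    (F.square.tendsto_lintegral_smooth_sub T hφ) mv hv
  have t3 : Tendsto (fun ε => ∫ z : ℝ × Plane, (timeDeriv ψ z +
      spaceDeriv ψ z (velocity (ω z.1) z.2)) * (ω z.1 z.2 * smooth (mollKernel φ ε) (ω z.1) z.2)
      ∂(spaceTime T)) (𝓝[>] 0) (𝓝 (∫ z : ℝ × Plane, (timeDeriv ψ z +
      spaceDeriv ψ z (velocity (ω z.1) z.2)) * ω z.1 z.2 ^ 2 ∂(spaceTime T))) :=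
    tendsto_integral_mul i2
    (fun δ hδ => (N.measurable.mul (N.measurable_smooth
      (hφ.smoothKernel hδ))).aestronglyMeasurable)
    (N.tendsto_lintegral_mul_smooth_sub hp T hφ) (hc1.aestronglyMeasurable.add mv) hw
  have t4 := ((t1.sub t2).add (t3.const_mul 2)).const_mul (1 / 4)
  have e1 : ∀ ε > 0, (∫ z : ℝ × Plane, 1 / 4 * expandedFlux (mollKernel φ ε) (ω z.1) z.2 * ψ z
      ∂(spaceTime T)) = 1 / 4 * ∫ z : ℝ × Plane, expandedFlux (mollKernel φ ε) (ω z.1) z.2 * ψ z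
      ∂(spaceTime T) := fun ε _ => by
    rw [← integral_const_mul]
    simp only [mul_assoc]
  have e2 : (∫ z : ℝ × Plane, spaceDeriv ψ z (ω z.1 z.2 ^ 2 • velocity (ω z.1) z.2)
      ∂(spaceTime T)) = ∫ z : ℝ × Plane, spaceDeriv ψ z (velocity (ω z.1) z.2) * ω z.1 z.2 ^ 2
      ∂(spaceTime T) := integral_congr_ae (ae_of_all _ fun z => by
    simp only [map_smul, smul_eq_mul, mul_comm])
  have e3 : defect T (fun s => s ^ 2 / 2) ω ψ = 1 / 2 * ∫ z : ℝ × Plane,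
      (timeDeriv ψ z + spaceDeriv ψ z (velocity (ω z.1) z.2)) * ω z.1 z.2 ^ 2 ∂(spaceTime T) := by
    rw [← integral_const_mul]
    refine integral_congr_ae (ae_of_all _ fun z => ?_)
    simp only [balanceIntegrand, map_smul, smul_eq_mul]
    ring
  rw [e2, sub_self, zero_add, ← mul_assoc, show (1 / 4 * 2 : ℝ) = 1 / 2 by norm_num, ← e3] at t4
  refine t4.congr' ?_
  filter_upwards [self_mem_nhdsWithin] with ε hε
  rw [e1 ε hε, F.integral_expandedFlux_mul N V (hφ.smoothKernel hε) hT hsol hψ hφ]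

end expanded

/-! ### The flux in terms of increments -/

theorem mollKernel_neg {φ : Plane → ℝ} (h : ∀ x, φ (-x) = φ x) (ε : ℝ) (x : Plane) :
    mollKernel φ ε (-x) = mollKernel φ ε x := by
  unfold mollKernel periodize
  rw [← finsum_comp_equiv (Equiv.neg lattice)]
  refine finsum_congr fun v => ?_
  simp only [rescale, Equiv.neg_apply, NegMemClass.coe_neg, ← neg_add, smul_neg, h]

theorem incrementIntegrand_eq (ω : ℝ → Plane → ℝ) (φ : Plane → ℝ) (ε t : ℝ) (x l : Plane) :
    incrementIntegrand ω φ ε (t, x) l = fderiv ℝ (rescale φ ε) l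
      ((ω t (x + l) - ω t x) ^ 2 • (velocity (ω t) (x + l) - velocity (ω t) x)) := by
  rw [incrementIntegrand, inner_gradient, map_smul, smul_eq_mul, sq_abs, mul_comm]

/-- The increments are periodic in the displacement, so the integral over the plane unfolds to the
torus with the gradient of the periodized kernel. For a good representative this holds at every
point, since the squared increment is integrable and the velocity is bounded. -/
theorem BoundedFlow.incrementFlux_eq {U A : ℝ≥0} {ω : ℝ → Plane → ℝ} (F : BoundedFlow U A ω)
    {φ : Plane → ℝ} (hφ : IsMollifier φ) (heven : ∀ x, φ (-x) = φ x) {ε : ℝ} (hε : 0 < ε)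
    (z : ℝ × Plane) : Integrable (incrementIntegrand ω φ ε z) ∧
      incrementFlux ω φ ε z = 1 / 4 * expandedFlux (mollKernel φ ε) (ω z.1) z.2 := by
  obtain ⟨t, x⟩ := z
  have hc := (hφ.contDiff_rescale ε).of_le (m := 1) (by simp)
  have hs := hφ.hasCompactSupport_rescale hε
  have hf := F.vorticity.torusL1' le_rfl t
  have hf2 := F.square.torusL1' le_rfl t
  have hvp := periodic2_velocity hf.periodic
  have hG : Periodic2 fun y => (ω t (x + y) - ω t x) ^ 2 •
      (velocity (ω t) (x + y) - velocity (ω t) x) := by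
    have h1 := (hf.periodic.comp_add x).comp₂ (hvp.comp_add x)
      fun a b => (a - ω t x) ^ 2 • (b - velocity (ω t) x)
    simpa only [add_comm _ x] using h1
  have hm : StronglyMeasurable fun y => (ω t y - ω t x) ^ 2 •
      (velocity (ω t) y - velocity (ω t) x) :=
    ((hf.measurable.sub_const _).pow_const 2).stronglyMeasurable.smul
      (hf.stronglyMeasurable_velocity.sub stronglyMeasurable_const)
  have hi : Integrable (fun y => (ω t y - ω t x) ^ 2 •
      (velocity (ω t) y - velocity (ω t) x)) torusMeasure := by
    have h1 : Integrable (fun y => (ω t y - ω t x) ^ 2) torusMeasure := by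
      refine ((hf2.integrable.sub (hf.integrable.const_mul (2 * ω t x))).add
        (integrable_const (ω t x ^ 2))).congr (ae_of_all _ fun y => ?_)
      simp only [Pi.add_apply, Pi.sub_apply]
      ring
    refine (h1.norm.mul_const (U + U : ℝ)).mono' hm.aestronglyMeasurable (ae_of_all _ fun y => ?_)
    rw [norm_smul]
    gcongr
    exact (norm_sub_le _ _).trans (add_le_add (F.velocity_le _ _) (F.velocity_le _ _))
  have hm' : StronglyMeasurable fun y => (ω t (x + y) - ω t x) ^ 2 •
      (velocity (ω t) (x + y) - velocity (ω t) x) :=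
    hm.comp_measurable (by fun_prop : Measurable fun y : Plane => x + y)
  have hi' : Integrable (fun y => (ω t (x + y) - ω t x) ^ 2 •
      (velocity (ω t) (x + y) - velocity (ω t) x)) torusMeasure := by
    have h1 : Periodic2 fun y => (ω t y - ω t x) ^ 2 • (velocity (ω t) y - velocity (ω t) x) :=
      hf.periodic.comp₂ hvp fun a b => (a - ω t x) ^ 2 • (b - velocity (ω t) x)
    simpa only [add_comm _ x] using (integrable_torus_add_iff h1 x).2 hi
  have e : incrementIntegrand ω φ ε (t, x) = fun l => ContinuousLinearMap.id ℝ (Plane →L[ℝ] ℝ)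
      (fderiv ℝ (rescale φ ε) l) ((ω t (x + l) - ω t x) ^ 2 •
      (velocity (ω t) (x + l) - velocity (ω t) x)) := funext (incrementIntegrand_eq ω φ ε t x)
  have hc1 := hc.continuous_fderiv one_ne_zero
  refine ⟨e ▸ integrable_of_periodic _ (hs.fderiv (𝕜 := ℝ)) hc1 hG hm' hi', ?_⟩
  rw [incrementFlux, e, integral_periodize _ (hs.fderiv (𝕜 := ℝ)) hc1 hG hm' hi',
    ← integral_increment_eq (hφ.smoothKernel hε) (mollKernel_neg heven ε) hf hf2.integrable
      (F.flux.integrable t) (F.squareFlux.integrable t)]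
  simp only [ContinuousLinearMap.id_apply, mollKernel, fderiv_periodize hs hc]

theorem incrementIntegrand_ae_eq {ω ω' : ℝ → Plane → ℝ} {z : ℝ × Plane}
    (hp : Periodic2 (ω z.1)) (hp' : Periodic2 (ω' z.1)) (h : ω' z.1 =ᵐ[torusMeasure] ω z.1)
    (hz : ω' z.1 z.2 = ω z.1 z.2) (φ : Plane → ℝ) (ε : ℝ) :
    incrementIntegrand ω' φ ε z =ᵐ[volume] incrementIntegrand ω φ ε z := by
  have h1 : ∀ᵐ y, ω' z.1 y = ω z.1 y := ae_plane_of_ae_torus (hp'.comp₂ hp fun a b => a = b) h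
  have h2 : ∀ᵐ l, ω' z.1 (z.2 + l) = ω z.1 (z.2 + l) :=
    (measurePreserving_add_left volume z.2).quasiMeasurePreserving.ae h1
  filter_upwards [h2] with l hl
  simp only [incrementIntegrand, velocity_congr hp' hp h, hl, hz]

theorem distribTendsto_incrementFlux {T p : ℝ} (hT : 0 < T) (hp : 2 < p) {ω : ℝ → Plane → ℝ}
    (hω : MemLinftyLp T p ω) (hsol : IsWeakEuler T ω) {φ : Plane → ℝ} (hφ : IsMollifier φ)
    (heven : ∀ x, φ (-x) = φ x) :
    (∀ ε > 0, ∀ᵐ z ∂(spaceTime T), Integrable (incrementIntegrand ω φ ε z)) ∧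
      DistribTendsto T (incrementFlux ω φ) (defect T (fun s => s ^ 2 / 2) ω) := by
  obtain ⟨M, ω', N, hae⟩ := hω.exists_boundedVorticity (by linarith)
  obtain ⟨B, V⟩ := velocityBound_of_two_lt hp
  obtain ⟨U, A, F⟩ := N.exists_boundedFlow hp
  have hae' : ∀ᵐ z ∂(spaceTime T), ω' z.1 =ᵐ[torusMeasure] ω z.1 :=
    ae_spaceTime_of_ae_time (ae_time_of_ae_spaceTime hae)
  have hv : ∀ᵐ z ∂(spaceTime T), velocity (ω' z.1) = velocity (ω z.1) :=
    hae'.mono fun z hz => velocity_congr (N.periodic _) (hω.periodic _) hz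
  have hsol' : IsWeakEuler T ω' := hsol.congr (hae.and hv)
  -- The exceptional set does not depend on `ε`: it only records where the two representatives
  -- differ.
  have hinc : ∀ᵐ z ∂(spaceTime T), ∀ ε,
      incrementIntegrand ω' φ ε z =ᵐ[volume] incrementIntegrand ω φ ε z := by
    filter_upwards [hae, hae'] with z h1 h2 ε
    exact incrementIntegrand_ae_eq (hω.periodic _) (N.periodic _) h2 h1 φ ε
  have hflux : ∀ ε > 0, (fun z : ℝ × Plane => 1 / 4 * expandedFlux (mollKernel φ ε) (ω' z.1) z.2)
      =ᵐ[spaceTime T] incrementFlux ω φ ε := fun ε hε => by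
    filter_upwards [hinc] with z hz
    rw [← (F.incrementFlux_eq hφ heven hε z).2, incrementFlux, incrementFlux,
      integral_congr_ae (hz ε)]
  refine ⟨fun ε hε => ?_, fun ε hε => ?_, fun ψ hψ => ?_⟩
  · filter_upwards [hinc] with z hz
    exact (F.incrementFlux_eq hφ heven hε z).1.congr (hz ε)
  · exact ((F.integrable_expandedFlux N V (hφ.smoothKernel hε) T).const_mul (1 / 4)).congr
      (hflux ε hε)
  · have hdef : defect T (fun s => s ^ 2 / 2) ω ψ = defect T (fun s => s ^ 2 / 2) ω' ψ :=
      integral_congr_ae ((hae.and hv).mono fun z hz => by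
        simp only [balanceIntegrand, hz.1, hz.2])
    rw [hdef]
    refine (F.tendsto_integral_expandedFlux_mul N V hp.le hT hsol' hψ hφ).congr' ?_
    filter_upwards [self_mem_nhdsWithin] with ε hε
    exact integral_congr_ae ((hflux ε hε).mono fun z hz => by simp only [← hz])

theorem half_sq_mem_growthClass {p : ℝ} (hp : 2 ≤ p) : (fun s : ℝ => s ^ 2 / 2) ∈ GrowthClass p := by
  refine ⟨by fun_prop, 1, one_pos, fun s => ?_⟩
  have h : deriv (fun s : ℝ => s ^ 2 / 2) s = s := by
    rw [deriv_div_const, deriv_pow_field]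
    norm_num
  rw [h, one_mul]
  rcases le_total |s| 1 with hs | hs
  · linarith [Real.rpow_nonneg (abs_nonneg s) (p - 1)]
  · have := Real.rpow_le_rpow_of_exponent_le hs (by linarith : 1 ≤ p - 1)
    rw [Real.rpow_one] at this
    linarith

end

end TorusEuler

theorem theorem1 (T p : ℝ) (hT : 0 < T) (hp : 4 / 3 < p) (ω : ℝ → TorusEuler.Plane → ℝ)
    (hω : TorusEuler.MemLinftyLp T p ω) (hsol : TorusEuler.IsWeakEuler T ω) :
    (∀ r : ℝ, TorusEuler.AdmissibleGrowth p r →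
      ∀ h ∈ TorusEuler.GrowthClass r, ContDiff ℝ 2 h →
        ∃ Z : (ℝ × TorusEuler.Plane → ℝ) → ℝ,
          TorusEuler.IsDefect T ω h Z ∧ TorusEuler.LocalBalance T ω h Z) ∧
    (2 < p →
      ∃ Z : (ℝ × TorusEuler.Plane → ℝ) → ℝ,
        TorusEuler.IsDefect T ω (fun s => s ^ 2 / 2) Z ∧
        TorusEuler.LocalBalance T ω (fun s => s ^ 2 / 2) Z ∧
        ∀ φ, TorusEuler.IsMollifier φ → (∀ x, φ (-x) = φ x) →
          (∀ ε > 0, ∀ᵐ z ∂(TorusEuler.spaceTime T),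
            MeasureTheory.Integrable (TorusEuler.incrementIntegrand ω φ ε z)) ∧
          TorusEuler.DistribTendsto T (TorusEuler.incrementFlux ω φ) Z) := by
  refine ⟨fun r hr h hh hh2 =>
    ⟨_, TorusEuler.isDefect_of_admissibleGrowth hT hr hh hh2 hω hsol⟩, fun hp2 => ?_⟩
  obtain ⟨h1, h2⟩ := TorusEuler.isDefect_of_admissibleGrowth hT (Or.inr (Or.inr ⟨hp2, rfl⟩))
    (TorusEuler.half_sq_mem_growthClass hp2.le) (by fun_prop) hω hsol
  exact ⟨_, h1, h2, fun φ hφ heven =>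
    TorusEuler.distribTendsto_incrementFlux hT hp2 hω hsol hφ heven⟩
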